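/- **Setting.** Write $\mathbb R_+=(0,\infty)$. Let $f,\gamma:\mathbb R\to[0,\infty)$ be symmetric, locally integrable and non-negative definite (i.e. $\int\!\!\int k(x-y)\varphi(x)\varphi(y)\,dx\,dy\ge 0$ for every $\varphi\in C_c^\infty(\mathbb R)$, for $k=f$ and $k=\gamma$; a singularity at $0$ is allowed). Let $H$ be the Hilbert space completion of $C_c^\infty(\mathbb R_+^2)$ for $$\langle\varphi,\psi\rangle_H=\int_{\mathbb R_+^4} f(x-y)\,\gamma(r-s)\,\varphi(x,r)\,\psi(y,s)\,dx\,dy\,dr\,ds ,$$ and let $W=\{W(h):h\in H\}$ be an isonormal Gaussian process over $H$ (a centred Gaussian family with $\mathbb E[W(h_1)W(h_2)]=\langle h_1,h_2\rangle_H$) on a probability space $(\Omega,\mathcal F,\mathbb P)$ whose $\sigma$-algebra is, up to null sets, generated by $W$. Let $D$ be the Malliavin derivative with domain $\mathbb D^{1,2}$, and let the Skorohod integral $\delta(v)=\int v(w,\tau)\,W(dw,d\tau)$ be the adjoint of $D$. A random field $v$ on $\mathbb R_+^2$ is regarded as an element of $L^2(\Omega;H)$ when it is jointly measurable and $\mathbb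 E\int f(x-y)\gamma(r-s)|v(x,r)||v(y,s)|\,dx\,dy\,dr\,ds<\infty$. Let $\mathcal I_n$ denote the $n$-fold iterated Skorohod integral ($\mathcal I_0(c)=c$). With $I_\nu$ the modified Bessel functions of the first kind, put $$q_0(z,w,t)=\sqrt{\tfrac zw}\,\frac{e^{-(z+w)/t}}{t}\,I_1\!\Big(\frac{2\sqrt{zw}}t\Big),\qquad U(x)=e^{-x}I_0(x)-\tfrac12e^{-2x},$$ $$F_\varepsilon=\int_{-\varepsilon}^{\varepsilon}f(x)\,dx,\qquad \Gamma_t=\int_{-t}^{t}\gamma(\tau)\,d\tau .$$ Let $u_0\in C_b(\mathbb R_+)$ have supremum norm $\|u_0\|$, and put $u_0(z,t)=\int_0^\infty q_0(z,w,t)u_0(w)\,dw$. Define $f_0(z,t)=u_0(z,t)$ and, for $n\ge1$, $$f_n(z_1,t_1,\dots,z_n,t_n;z,t)=\mathbf 1_{(0,t)}(t_n)\,q_0(z,z_n,t-t_n)\,f_{n-1}(z_1,t_1,\dots,z_{n-1},t_{n-1};z_n,t_n).$$ A *mild solution* of the stochastic Kimura equation $\partial_tu=z\,\partial_z^2u+u\,\dot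 W$ on $\mathbb R_+^2$ with $u(z,0)=u_0(z)$ for $z>0$ and $u(0,t)=0$ for $t>0$ is a random field $\{u(z,t):z,t\ge0\}$ with these initial and boundary values, with $\mathbb E[u(z,t)^2]<\infty$ for all $z,t\ge0$, and with a jointly measurable modification (again denoted $u$), such that for all $z,t>0$ the process $(w,\tau)\mapsto\mathbf 1_{(0,t)}(\tau)q_0(z,w,t-\tau)u(w,\tau)$ is Skorohod integrable and $$u(z,t)=u_0(z,t)+\int_0^t\!\!\int_0^\infty q_0(z,w,t-\tau)\,u(w,\tau)\,W(dw,d\tau)\quad\text{a.s.}$$ **Theorem.** Suppose that $f$ is non-increasing on $\mathbb R_+$ and that $F_\varepsilon<\infty$ for all $\varepsilon>0$, with $\lim_{\varepsilon\searrow0}F_\varepsilon=0$. Then: 1. For all $z,t>0$ the multiple integrals $\mathcal I_n(f_n(\cdot;z,t))$, $n\ge0$, are well-defined elements of $L^2(\Omega)$, and the series $u(z,t)=\sum_{n=0}^\infty\mathcal I_n(f_n(\cdot;z,t))$ converges in $L^2(\Omega)$. 2. For every $t>0$ there is $\varepsilon_0=\varepsilon_0(t)>0$ such that for all $\varepsilon\in(0,\varepsilon_0)$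 and all $z>0$, $$\mathbb E[u(z,t)^2]\le u_0(z,t)^2+\|u_0\|^2\left(U\!\Big(\frac zt\Big)\frac{2\,\Gamma_tF_\varepsilon}{2-\Gamma_tF_\varepsilon}+\frac{\sqrt2\,\Gamma_tf(\varepsilon)t}{\sqrt2-\sqrt{\Gamma_tF_\varepsilon}}\exp\left\{\frac{2f(\varepsilon)t\sqrt{\Gamma_tF_\varepsilon}}{F_\varepsilon\,(\sqrt2-\sqrt{\Gamma_tF_\varepsilon})}\right\}\right).$$ (If $F_\varepsilon=0$, then $f(\varepsilon)=0$ and the last summand is read as $0$.) For $u_0\equiv1$ one has $\|u_0\|=1$. 3. $u$, extended by the initial and boundary values, is a mild solution, and it is the unique one up to modification: every mild solution $v$ satisfies $v(z,t)=u(z,t)$ a.s. for all $z,t\ge0$ with $(z,t)\ne(0,0)$. -/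

import Mathlib

open MeasureTheory Set Filter Topology
open scoped Distributions

/-- Non-negative definiteness of a locally integrable kernel, tested on smooth compactly
supported functions. -/
def IsNonnegDef (k : ℝ → ℝ) : Prop :=
  ∀ φ : ℝ → ℝ, ContDiff ℝ (⊤ : ℕ∞) φ → HasCompactSupport φ →
    0 ≤ ∫ p : ℝ × ℝ, k (p.1 - p.2) * φ p.1 * φ p.2

/-- Admissible covariance kernels: non-negative, symmetric, locally integrable and non-negative
definite functions on `ℝ`. A singularity at the origin (as for `|x|^{-1/2}`) is allowed: the value at
the single point `0` plays no role. -/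
structure IsCovarianceKernel (k : ℝ → ℝ) : Prop where
  nonneg : ∀ x, 0 ≤ k x
  symm : ∀ x, k (-x) = k x
  locallyIntegrable : LocallyIntegrable k
  nonnegDef : IsNonnegDef k

/-- The open quadrant `ℝ₊²`. -/
def quadrant : Set (ℝ × ℝ) := Ioi 0 ×ˢ Ioi 0

/-- `∫ f(x - y) γ(r - s) g(x, r) h(y, s) dx dy dr ds` over `ℝ₊⁴`; the integration variable is
`p = ((x, y), (r, s))`. -/
noncomputable def covForm (f γ : ℝ → ℝ) (g h : ℝ × ℝ → ℝ) : ℝ :=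
  ∫ p in quadrant ×ˢ quadrant,
    f (p.1.1 - p.1.2) * γ (p.2.1 - p.2.2) * g (p.1.1, p.2.1) * h (p.1.2, p.2.2)

theorem covForm_box_integrable {k : ℝ → ℝ} (hk : LocallyIntegrable k) (M : ℝ) :
    Integrable (fun p : ℝ × ℝ => (Icc (-(2 * M)) (2 * M)).indicator k (p.1 - p.2) *
      (Icc (-M) M).indicator (fun _ => (1 : ℝ)) p.2) := by
  have h1 : Integrable ((Icc (-(2 * M)) (2 * M)).indicator k) :=
    (hk.integrableOn_isCompact isCompact_Icc).integrable_indicator measurableSet_Icc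
  have h2 : Integrable ((Icc (-M) M).indicator (fun _ => (1 : ℝ))) :=
    IntegrableOn.integrable_indicator (by simp) measurableSet_Icc
  have h3 := h1.mul_prod h2
  exact (measurePreserving_sub_prod (volume : Measure ℝ) (volume : Measure ℝ)).integrable_comp_of_integrable h3

theorem covForm_integrable {f γ : ℝ → ℝ} (hf : LocallyIntegrable f) (hγ : LocallyIntegrable γ)
    {g h : ℝ × ℝ → ℝ} {M C : ℝ} (hg : Measurable g) (hh : Measurable h)
    (hgC : ∀ p, |g p| ≤ C) (hhC : ∀ p, |h p| ≤ C)
    (hgM : ∀ p, g p ≠ 0 → |p.1| ≤ M ∧ |p.2| ≤ M) (hhM : ∀ p, h p ≠ 0 → |p.1| ≤ M ∧ |p.2| ≤ M) :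
    Integrable (fun p : (ℝ × ℝ) × (ℝ × ℝ) =>
      f (p.1.1 - p.1.2) * γ (p.2.1 - p.2.2) * g (p.1.1, p.2.1) * h (p.1.2, p.2.2)) := by
  have h3 := (covForm_box_integrable hf M).mul_prod (covForm_box_integrable hγ M)
  have h4 : Measurable (fun p : (ℝ × ℝ) × (ℝ × ℝ) => g (p.1.1, p.2.1) * h (p.1.2, p.2.2)) :=
    (hg.comp (by fun_prop)).mul (hh.comp (by fun_prop))
  have h5 := h3.mul_bdd (c := C * C) h4.aestronglyMeasurable (ae_of_all _ fun p => by
    rw [Real.norm_eq_abs, abs_mul]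
    exact mul_le_mul (hgC _) (hhC _) (abs_nonneg _) ((abs_nonneg _).trans (hgC (0, 0))))
  refine h5.congr (ae_of_all _ fun p => ?_)
  by_cases hg0 : g (p.1.1, p.2.1) = 0
  · simp [hg0]
  by_cases hh0 : h (p.1.2, p.2.2) = 0
  · simp [hh0]
  obtain ⟨a1, a2⟩ := hgM _ hg0
  obtain ⟨b1, b2⟩ := hhM _ hh0
  simp only [abs_le] at a1 a2 b1 b2
  have e1 : p.1.1 - p.1.2 ∈ Icc (-(2 * M)) (2 * M) := ⟨by linarith, by linarith⟩
  have e2 : p.2.1 - p.2.2 ∈ Icc (-(2 * M)) (2 * M) := ⟨by linarith, by linarith⟩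
  have e3 : p.1.2 ∈ Icc (-M) M := b1
  have e4 : p.2.2 ∈ Icc (-M) M := b2
  simp only [indicator_of_mem e1, indicator_of_mem e2, indicator_of_mem e3, indicator_of_mem e4]
  ring

/-- A smooth partition of unity on a grid of mesh `1 / (N + 1)`. It serves, up to
`full_form_nonneg`, only to prove that the bilinear form `covForm` is non-negative. -/
noncomputable def smoothHat (N : ℕ) (i : ℕ) (x : ℝ) : ℝ :=
  Real.smoothTransition ((N + 1) * x - (i - ((N : ℝ) + 1) ^ 2)) -
    Real.smoothTransition ((N + 1) * x - ((i + 1 : ℕ) - ((N : ℝ) + 1) ^ 2))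

/-- The nodes of the grid. -/
noncomputable def hatNode (N i : ℕ) : ℝ := (i - ((N : ℝ) + 1) ^ 2) / (N + 1)

theorem smoothHat_nonneg (N i : ℕ) (x : ℝ) : 0 ≤ smoothHat N i x := by
  unfold smoothHat
  rw [sub_nonneg]
  apply Real.smoothTransition.monotone
  push_cast
  linarith

theorem smoothHat_ne_zero {N i : ℕ} {x : ℝ} (h : smoothHat N i x ≠ 0) :
    |x - hatNode N i| ≤ 2 / (N + 1) := by
  have hN : (0 : ℝ) < N + 1 := by positivity
  have hx : x - hatNode N i = ((N + 1) * x - (i - ((N : ℝ) + 1) ^ 2)) / (N + 1) := by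
    unfold hatNode; field_simp
  rw [hx, abs_div, abs_of_pos hN]
  gcongr
  rw [abs_le]
  by_contra hcon
  apply h
  unfold smoothHat
  rcases not_and_or.mp hcon with h1 | h1
  · rw [Real.smoothTransition.zero_of_nonpos (by linarith),
      Real.smoothTransition.zero_of_nonpos (by push_cast; linarith), sub_zero]
  · rw [Real.smoothTransition.one_of_one_le (by linarith),
      Real.smoothTransition.one_of_one_le (by push_cast; linarith), sub_self]

theorem smoothHat_contDiff (N i : ℕ) : ContDiff ℝ (⊤ : ℕ∞) (smoothHat N i) := by
  unfold smoothHat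
  exact (Real.smoothTransition.contDiff (n := ⊤)).comp (by fun_prop) |>.sub
    ((Real.smoothTransition.contDiff (n := ⊤)).comp (by fun_prop))

theorem smoothHat_abs_le {N i : ℕ} {x : ℝ} (h : smoothHat N i x ≠ 0) :
    |x| ≤ |hatNode N i| + 2 := by
  have h1 := smoothHat_ne_zero h
  have h2 : (2 : ℝ) / (N + 1) ≤ 2 := by
    rw [div_le_iff₀ (by positivity)]; nlinarith [Nat.cast_nonneg (α := ℝ) N]
  have h3 := abs_sub_abs_le_abs_sub x (hatNode N i)
  linarith

theorem smoothHat_hasCompactSupport (N i : ℕ) : HasCompactSupport (smoothHat N i) := by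
  refine HasCompactSupport.intro (isCompact_Icc (a := -(|hatNode N i| + 2))
    (b := |hatNode N i| + 2)) fun x hx => ?_
  by_contra h
  exact hx (abs_le.mp (smoothHat_abs_le h))

theorem sum_smoothHat (N n : ℕ) (x : ℝ) :
    ∑ i ∈ Finset.range n, smoothHat N i x =
      Real.smoothTransition ((N + 1) * x + ((N : ℝ) + 1) ^ 2) -
        Real.smoothTransition ((N + 1) * x - (n - ((N : ℝ) + 1) ^ 2)) := by
  unfold smoothHat
  rw [Finset.sum_range_sub']
  simp

theorem sum_smoothHat_le (N n : ℕ) (x : ℝ) :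
    ∑ i ∈ Finset.range n, smoothHat N i x ≤ 1 := by
  rw [sum_smoothHat]
  linarith [Real.smoothTransition.le_one ((N + 1) * x + ((N : ℝ) + 1) ^ 2),
    Real.smoothTransition.nonneg ((N + 1) * x - (n - ((N : ℝ) + 1) ^ 2))]

theorem sum_smoothHat_eq {N : ℕ} {x : ℝ} (hx : |x| ≤ N) :
    ∑ i ∈ Finset.range (2 * (N + 1) ^ 2), smoothHat N i x = 1 := by
  have hN : (0 : ℝ) ≤ N := Nat.cast_nonneg N
  obtain ⟨h1, h2⟩ := abs_le.mp hx
  rw [sum_smoothHat, Real.smoothTransition.one_of_one_le (by nlinarith),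
    Real.smoothTransition.zero_of_nonpos (by push_cast; nlinarith), sub_zero]

/-- Quasi-interpolation of `g` on a grid of mesh `1 / (N + 1)`. -/
noncomputable def hatApprox (g : ℝ × ℝ → ℝ) (N : ℕ) (p : ℝ × ℝ) : ℝ :=
  ∑ i ∈ Finset.range (2 * (N + 1) ^ 2), ∑ j ∈ Finset.range (2 * (N + 1) ^ 2),
    g (hatNode N i, hatNode N j) * smoothHat N i p.1 * smoothHat N j p.2

theorem hatApprox_measurable (g : ℝ × ℝ → ℝ) (N : ℕ) : Measurable (hatApprox g N) := by
  have h : ∀ i, Measurable (smoothHat N i) := fun i => (smoothHat_contDiff N i).continuous.measurable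
  unfold hatApprox
  refine Finset.measurable_fun_sum _ fun i _ => Finset.measurable_fun_sum _ fun j _ => ?_
  exact (measurable_const.mul ((h i).comp measurable_fst)).mul ((h j).comp measurable_snd)

theorem hatSum_mul (N : ℕ) (c : ℝ) (p : ℝ × ℝ) :
    ∑ i ∈ Finset.range (2 * (N + 1) ^ 2), ∑ j ∈ Finset.range (2 * (N + 1) ^ 2),
      c * smoothHat N i p.1 * smoothHat N j p.2 =
    c * (∑ i ∈ Finset.range (2 * (N + 1) ^ 2), smoothHat N i p.1) *
      (∑ j ∈ Finset.range (2 * (N + 1) ^ 2), smoothHat N j p.2) := by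
  rw [mul_assoc, Finset.sum_mul_sum, Finset.mul_sum]
  refine Finset.sum_congr rfl fun i _ => ?_
  rw [Finset.mul_sum]
  exact Finset.sum_congr rfl fun j _ => by ring

theorem hatApprox_bound {g : ℝ × ℝ → ℝ} {C : ℝ} (hC : ∀ p, |g p| ≤ C) (N : ℕ) (p : ℝ × ℝ) :
    |hatApprox g N p| ≤ C := by
  have hC0 : 0 ≤ C := (abs_nonneg _).trans (hC (0, 0))
  calc |hatApprox g N p|
      ≤ ∑ i ∈ Finset.range (2 * (N + 1) ^ 2), ∑ j ∈ Finset.range (2 * (N + 1) ^ 2),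
        C * smoothHat N i p.1 * smoothHat N j p.2 := by
        unfold hatApprox
        refine (Finset.abs_sum_le_sum_abs _ _).trans (Finset.sum_le_sum fun i _ => ?_)
        refine (Finset.abs_sum_le_sum_abs _ _).trans (Finset.sum_le_sum fun j _ => ?_)
        rw [abs_mul, abs_mul, abs_of_nonneg (smoothHat_nonneg N i _),
          abs_of_nonneg (smoothHat_nonneg N j _)]
        have := smoothHat_nonneg N i p.1
        have := smoothHat_nonneg N j p.2
        gcongr
        exact hC _
    _ ≤ C * 1 * 1 := by
        rw [hatSum_mul]
        have h1 := sum_smoothHat_le N (2 * (N + 1) ^ 2) p.1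
        have h2 := sum_smoothHat_le N (2 * (N + 1) ^ 2) p.2
        have h3 : 0 ≤ ∑ j ∈ Finset.range (2 * (N + 1) ^ 2), smoothHat N j p.2 :=
          Finset.sum_nonneg fun j _ => smoothHat_nonneg N j _
        gcongr
    _ = C := by ring

theorem hatApprox_support {g : ℝ × ℝ → ℝ} {M : ℝ} (hM : ∀ p, g p ≠ 0 → |p.1| ≤ M ∧ |p.2| ≤ M)
    (N : ℕ) (p : ℝ × ℝ) (h : hatApprox g N p ≠ 0) : |p.1| ≤ M + 2 ∧ |p.2| ≤ M + 2 := by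
  unfold hatApprox at h
  obtain ⟨i, _, hi⟩ := Finset.exists_ne_zero_of_sum_ne_zero h
  obtain ⟨j, _, hj⟩ := Finset.exists_ne_zero_of_sum_ne_zero hi
  have h1 := hM _ (left_ne_zero_of_mul (left_ne_zero_of_mul hj))
  have h2 := smoothHat_abs_le (right_ne_zero_of_mul (left_ne_zero_of_mul hj))
  have h3 := smoothHat_abs_le (right_ne_zero_of_mul hj)
  exact ⟨by linarith [h1.1], by linarith [h1.2]⟩

theorem hatApprox_tendsto {g : ℝ × ℝ → ℝ} (hg : Continuous g) (p : ℝ × ℝ) :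
    Tendsto (fun N => hatApprox g N p) atTop (𝓝 (g p)) := by
  rw [Metric.tendsto_atTop]
  intro ε hε
  obtain ⟨δ, hδ, hgδ⟩ := Metric.continuous_iff.mp hg p (ε / 2) (by positivity)
  obtain ⟨N₀, hN₀⟩ := exists_nat_gt (max (max |p.1| |p.2|) (2 / δ))
  refine ⟨N₀, fun N hN => ?_⟩
  have hNN : (N₀ : ℝ) ≤ N := Nat.cast_le.mpr hN
  have hp1 : |p.1| ≤ N := ((le_max_left _ _).trans (le_max_left _ _)).trans (hN₀.le.trans hNN)
  have hp2 : |p.2| ≤ N := ((le_max_right _ _).trans (le_max_left _ _)).trans (hN₀.le.trans hNN)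
  have hd : 2 / ((N : ℝ) + 1) < δ := by
    have : 2 / δ < N + 1 := ((le_max_right _ _).trans_lt hN₀).trans_le (by linarith)
    rw [div_lt_iff₀ hδ] at this
    rw [div_lt_iff₀ (by positivity)]
    linarith
  have hgp : g p = ∑ i ∈ Finset.range (2 * (N + 1) ^ 2), ∑ j ∈ Finset.range (2 * (N + 1) ^ 2),
      g p * smoothHat N i p.1 * smoothHat N j p.2 := by
    rw [hatSum_mul, sum_smoothHat_eq hp1, sum_smoothHat_eq hp2]; ring
  have hε2 : ε / 2 = ∑ i ∈ Finset.range (2 * (N + 1) ^ 2), ∑ j ∈ Finset.range (2 * (N + 1) ^ 2),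
      (ε / 2) * smoothHat N i p.1 * smoothHat N j p.2 := by
    rw [hatSum_mul, sum_smoothHat_eq hp1, sum_smoothHat_eq hp2]; ring
  rw [Real.dist_eq]
  refine lt_of_le_of_lt ?_ (half_lt_self hε)
  rw [hgp, hε2]
  unfold hatApprox
  rw [← Finset.sum_sub_distrib]
  refine (Finset.abs_sum_le_sum_abs _ _).trans (Finset.sum_le_sum fun i _ => ?_)
  rw [← Finset.sum_sub_distrib]
  refine (Finset.abs_sum_le_sum_abs _ _).trans (Finset.sum_le_sum fun j _ => ?_)
  have n1 := smoothHat_nonneg N i p.1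
  have n2 := smoothHat_nonneg N j p.2
  rw [← sub_mul, ← sub_mul, abs_mul, abs_mul, abs_of_nonneg n1, abs_of_nonneg n2]
  by_cases hi : smoothHat N i p.1 = 0
  · simp [hi]
  by_cases hj : smoothHat N j p.2 = 0
  · simp [hj]
  have d1 := smoothHat_ne_zero hi
  have d2 := smoothHat_ne_zero hj
  have := hgδ (hatNode N i, hatNode N j) (by
    rw [dist_comm, Prod.dist_eq, Real.dist_eq, Real.dist_eq]
    exact max_lt (d1.trans_lt hd) (d2.trans_lt hd))
  rw [Real.dist_eq] at this
  gcongr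

/-- Gram matrix of the bumps under a kernel. -/
noncomputable def hatGram (k : ℝ → ℝ) (N : ℕ) (i i' : ℕ) : ℝ :=
  ∫ p : ℝ × ℝ, k (p.1 - p.2) * smoothHat N i p.1 * smoothHat N i' p.2

theorem hatGram_integrable {k : ℝ → ℝ} (hk : LocallyIntegrable k) (N i i' : ℕ) :
    Integrable (fun p : ℝ × ℝ => k (p.1 - p.2) * smoothHat N i p.1 * smoothHat N i' p.2) := by
  obtain ⟨M, hM⟩ : ∃ M, M = max (|hatNode N i| + 2) (|hatNode N i'| + 2) := ⟨_, rfl⟩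
  have hc : ∀ i x, |smoothHat N i x| ≤ 1 := fun i x => by
    rw [abs_of_nonneg (smoothHat_nonneg N i x)]
    unfold smoothHat
    linarith [Real.smoothTransition.le_one ((N + 1) * x - (i - ((N : ℝ) + 1) ^ 2)),
      Real.smoothTransition.nonneg ((N + 1) * x - ((i + 1 : ℕ) - ((N : ℝ) + 1) ^ 2))]
  have hm : ∀ i, Measurable (smoothHat N i) := fun i => (smoothHat_contDiff N i).continuous.measurable
  have h4 : Measurable (fun p : ℝ × ℝ => smoothHat N i p.1 * smoothHat N i' p.2) :=
    ((hm i).comp measurable_fst).mul ((hm i').comp measurable_snd)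
  have h5 := (covForm_box_integrable hk M).mul_bdd (c := 1 * 1) h4.aestronglyMeasurable (ae_of_all _ fun p => by
      rw [Real.norm_eq_abs, abs_mul]
      exact mul_le_mul (hc _ _) (hc _ _) (abs_nonneg _) zero_le_one)
  refine h5.congr (ae_of_all _ fun p => ?_)
  by_cases hg0 : smoothHat N i p.1 = 0
  · simp [hg0]
  by_cases hh0 : smoothHat N i' p.2 = 0
  · simp [hh0]
  obtain ⟨a1, a2⟩ := abs_le.mp ((smoothHat_abs_le hg0).trans (hM ▸ le_max_left _ _) : |p.1| ≤ M)
  obtain ⟨b1, b2⟩ := abs_le.mp ((smoothHat_abs_le hh0).trans (hM ▸ le_max_right _ _) : |p.2| ≤ M)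
  have e1 : p.1 - p.2 ∈ Icc (-(2 * M)) (2 * M) := ⟨by linarith, by linarith⟩
  have e3 : p.2 ∈ Icc (-M) M := ⟨b1, b2⟩
  simp only [indicator_of_mem e1, indicator_of_mem e3]
  ring

theorem hatGram_posSemidef {k : ℝ → ℝ} (hk : IsCovarianceKernel k) (N n : ℕ) :
    (Matrix.of fun i i' : Fin n => hatGram k N i i').PosSemidef := by
  refine Matrix.PosSemidef.of_dotProduct_mulVec_nonneg ?_ fun a => ?_
  · ext i i'
    simp only [Matrix.conjTranspose_apply, Matrix.of_apply, star_trivial]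
    unfold hatGram
    rw [Measure.volume_eq_prod, ← integral_prod_swap]
    refine integral_congr_ae (ae_of_all _ fun p => ?_)
    have := hk.symm (p.1 - p.2)
    rw [neg_sub] at this
    simp [this]; ring
  · have h := hk.nonnegDef (fun x => ∑ i : Fin n, a i * smoothHat N i x)
      (ContDiff.sum fun i _ => contDiff_const.mul (smoothHat_contDiff N i))
      (by
        have : ∀ s : Finset (Fin n), HasCompactSupport (fun x => ∑ i ∈ s, a i * smoothHat N i x) := by
          intro s
          classical
          induction s using Finset.induction_on with
          | empty =>
            simp only [Finset.sum_empty]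
            exact HasCompactSupport.zero
          | insert i s hi ih =>
            simp only [Finset.sum_insert hi]
            exact ((smoothHat_hasCompactSupport N i).mul_left).add ih
        exact this _)
    suffices hs : ∫ p : ℝ × ℝ, k (p.1 - p.2) * (∑ i : Fin n, a i * smoothHat N i p.1) *
        (∑ i : Fin n, a i * smoothHat N i p.2) =
        dotProduct (star a) ((Matrix.of fun i i' : Fin n => hatGram k N i i').mulVec a) from hs ▸ h
    have e : ∀ p : ℝ × ℝ, k (p.1 - p.2) * (∑ i : Fin n, a i * smoothHat N i p.1) *
        (∑ i : Fin n, a i * smoothHat N i p.2) = ∑ i : Fin n, ∑ i' : Fin n,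
          (a i * a i') * (k (p.1 - p.2) * smoothHat N i p.1 * smoothHat N i' p.2) := fun p => by
      rw [mul_assoc, Finset.sum_mul_sum, Finset.mul_sum]
      refine Finset.sum_congr rfl fun i _ => ?_
      rw [Finset.mul_sum]
      exact Finset.sum_congr rfl fun j _ => by ring
    refine (integral_congr_ae (ae_of_all _ e)).trans ?_
    have hi := fun i j : Fin n =>
      (hatGram_integrable hk.locallyIntegrable N i j).const_mul (a i * a j)
    rw [integral_finsetSum _ fun i _ => integrable_finsetSum _ fun j _ => hi i j]
    simp only [dotProduct, Matrix.mulVec, Pi.star_apply, star_trivial, Matrix.of_apply]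
    refine Finset.sum_congr rfl fun i _ => ?_
    rw [integral_finsetSum _ fun j _ => hi i j, Finset.mul_sum]
    refine Finset.sum_congr rfl fun j _ => ?_
    rw [integral_const_mul]
    unfold hatGram
    ring

theorem hatApprox_form_nonneg {f γ : ℝ → ℝ} (hf : IsCovarianceKernel f)
    (hγ : IsCovarianceKernel γ) (g : ℝ × ℝ → ℝ) (N : ℕ) :
    0 ≤ ∫ p : (ℝ × ℝ) × (ℝ × ℝ), f (p.1.1 - p.1.2) * γ (p.2.1 - p.2.2) *
      hatApprox g N (p.1.1, p.2.1) * hatApprox g N (p.1.2, p.2.2) := by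
  set n := 2 * (N + 1) ^ 2 with hn
  have hA : ∀ p : ℝ × ℝ, hatApprox g N p = ∑ ij : Fin n × Fin n,
      g (hatNode N ij.1, hatNode N ij.2) * smoothHat N ij.1 p.1 * smoothHat N ij.2 p.2 := by
    intro p
    rw [Fintype.sum_prod_type]
    unfold hatApprox
    rw [Finset.sum_range]
    exact Finset.sum_congr rfl fun i _ => by rw [Finset.sum_range]
  have hps := ((hatGram_posSemidef hf N n).submatrix (Prod.fst : Fin n × Fin n → Fin n)).hadamard
    ((hatGram_posSemidef hγ N n).submatrix (Prod.snd : Fin n × Fin n → Fin n))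
  have h := hps.dotProduct_mulVec_nonneg (fun ij => g (hatNode N ij.1, hatNode N ij.2))
  refine h.trans_eq (Eq.symm ?_)
  have e : ∀ p : (ℝ × ℝ) × (ℝ × ℝ), f (p.1.1 - p.1.2) * γ (p.2.1 - p.2.2) *
      hatApprox g N (p.1.1, p.2.1) * hatApprox g N (p.1.2, p.2.2) =
      ∑ a : Fin n × Fin n, ∑ b : Fin n × Fin n,
        (g (hatNode N a.1, hatNode N a.2) * g (hatNode N b.1, hatNode N b.2)) *
        ((f (p.1.1 - p.1.2) * smoothHat N a.1 p.1.1 * smoothHat N b.1 p.1.2) *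
        (γ (p.2.1 - p.2.2) * smoothHat N a.2 p.2.1 * smoothHat N b.2 p.2.2)) := fun p => by
    rw [hA, hA, mul_assoc, Finset.sum_mul_sum, Finset.mul_sum]
    refine Finset.sum_congr rfl fun i _ => ?_
    rw [Finset.mul_sum]
    exact Finset.sum_congr rfl fun j _ => by ring
  rw [integral_congr_ae (ae_of_all _ e)]
  have hi := fun a b : Fin n × Fin n => ((hatGram_integrable hf.locallyIntegrable N a.1 b.1).mul_prod
    (hatGram_integrable hγ.locallyIntegrable N a.2 b.2)).const_mul
      (g (hatNode N a.1, hatNode N a.2) * g (hatNode N b.1, hatNode N b.2))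
  rw [Measure.volume_eq_prod (ℝ × ℝ) (ℝ × ℝ), integral_finsetSum _ fun a _ => integrable_finsetSum _ fun b _ => hi a b]
  simp only [dotProduct, Matrix.mulVec, Pi.star_apply, star_trivial, Matrix.hadamard_apply,
    Matrix.submatrix_apply, Matrix.of_apply]
  refine Finset.sum_congr rfl fun a _ => ?_
  rw [integral_finsetSum _ fun b _ => hi a b, Finset.mul_sum]
  refine Finset.sum_congr rfl fun b _ => ?_
  rw [integral_const_mul]
  have := integral_prod_mul (μ := (volume : Measure (ℝ × ℝ))) (ν := (volume : Measure (ℝ × ℝ)))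
    (fun p : ℝ × ℝ => f (p.1 - p.2) * smoothHat N a.1 p.1 * smoothHat N b.1 p.2)
    (fun p : ℝ × ℝ => γ (p.1 - p.2) * smoothHat N a.2 p.1 * smoothHat N b.2 p.2)
  rw [this]
  unfold hatGram
  ring

theorem full_form_nonneg {f γ : ℝ → ℝ} (hf : IsCovarianceKernel f) (hγ : IsCovarianceKernel γ)
    {g : ℝ × ℝ → ℝ} {M C : ℝ} (hg : Continuous g) (hgC : ∀ p, |g p| ≤ C)
    (hgM : ∀ p, g p ≠ 0 → |p.1| ≤ M ∧ |p.2| ≤ M) :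
    0 ≤ ∫ p : (ℝ × ℝ) × (ℝ × ℝ), f (p.1.1 - p.1.2) * γ (p.2.1 - p.2.2) *
      g (p.1.1, p.2.1) * g (p.1.2, p.2.2) := by
  have hC0 : 0 ≤ C := (abs_nonneg _).trans (hgC (0, 0))
  set box : ℝ × ℝ → ℝ := (Icc (-(M + 2)) (M + 2) ×ˢ Icc (-(M + 2)) (M + 2)).indicator fun _ => C
  have hboxm : Measurable box :=
    measurable_const.indicator (measurableSet_Icc.prod measurableSet_Icc)
  have hboxC : ∀ p, |box p| ≤ C := fun p => by
    by_cases hp : p ∈ Icc (-(M + 2)) (M + 2) ×ˢ Icc (-(M + 2)) (M + 2)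
    · simp only [box, indicator_of_mem hp, abs_of_nonneg hC0, le_refl]
    · simp only [box, indicator_of_notMem hp, abs_zero, hC0]
  have hbox0 : ∀ p, box p ≠ 0 → |p.1| ≤ M + 2 ∧ |p.2| ≤ M + 2 := fun p hp => by
    have := mem_of_indicator_ne_zero hp
    exact ⟨abs_le.mpr this.1, abs_le.mpr this.2⟩
  have happ : ∀ N p, |hatApprox g N p| ≤ box p := fun N p => by
    by_cases h0 : hatApprox g N p = 0
    · rw [h0, abs_zero]
      exact indicator_nonneg (fun _ _ => hC0) _
    · have := hatApprox_support hgM N p h0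
      have hp : p ∈ Icc (-(M + 2)) (M + 2) ×ˢ Icc (-(M + 2)) (M + 2) :=
        ⟨abs_le.mp this.1, abs_le.mp this.2⟩
      simp only [box, indicator_of_mem hp]
      exact hatApprox_bound hgC N p
  have hint := covForm_integrable hf.locallyIntegrable hγ.locallyIntegrable hboxm hboxm hboxC hboxC
    hbox0 hbox0
  refine ge_of_tendsto' (tendsto_integral_of_dominated_convergence (F := fun N p =>
    f (p.1.1 - p.1.2) * γ (p.2.1 - p.2.2) *
      hatApprox g N (p.1.1, p.2.1) * hatApprox g N (p.1.2, p.2.2)) _ (fun N => ?_) hint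
    (fun N => ae_of_all _ fun p => ?_) (ae_of_all _ fun p => ?_))
    fun N => hatApprox_form_nonneg hf hγ g N
  · exact (covForm_integrable hf.locallyIntegrable hγ.locallyIntegrable (hatApprox_measurable g N)
      (hatApprox_measurable g N) (hatApprox_bound hgC N) (hatApprox_bound hgC N)
      (hatApprox_support hgM N) (hatApprox_support hgM N)).aestronglyMeasurable
  · rw [Real.norm_eq_abs, abs_mul, abs_mul, abs_mul, abs_of_nonneg (hf.nonneg _),
      abs_of_nonneg (hγ.nonneg _)]
    have a1 := hf.nonneg (p.1.1 - p.1.2)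
    have a2 := hγ.nonneg (p.2.1 - p.2.2)
    have b1 := happ N (p.1.1, p.2.1)
    have b2 := happ N (p.1.2, p.2.2)
    have b3 := (abs_nonneg _).trans b1
    gcongr
  · exact ((hatApprox_tendsto hg _).const_mul _).mul (hatApprox_tendsto hg _)

/-- The open quadrant as an open set of the plane. -/
def openQuadrant : TopologicalSpace.Opens (ℝ × ℝ) :=
  ⟨quadrant, isOpen_Ioi.prod isOpen_Ioi⟩

theorem testFunction_bounds (φ : 𝓓(openQuadrant, ℝ)) :
    ∃ M C : ℝ, (∀ p, |φ p| ≤ C) ∧ ∀ p, φ p ≠ 0 → |p.1| ≤ M ∧ |p.2| ≤ M := by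
  obtain ⟨C, hC⟩ := φ.hasCompactSupport.exists_bound_of_continuous φ.continuous
  obtain ⟨M, hM⟩ := φ.hasCompactSupport.isCompact.isBounded.exists_norm_le
  refine ⟨M, C, hC, fun p hp => ?_⟩
  have := hM p (subset_tsupport _ hp)
  rw [Prod.norm_def, Real.norm_eq_abs, Real.norm_eq_abs] at this
  exact max_le_iff.mp this

theorem testFunction_eq_zero (φ : 𝓓(openQuadrant, ℝ)) {p : ℝ × ℝ} (hp : p ∉ quadrant) :
    φ p = 0 := by
  by_contra h
  exact hp (φ.tsupport_subset (subset_tsupport _ h))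

theorem covForm_integrand_testFunction {f γ : ℝ → ℝ} (hf : IsCovarianceKernel f)
    (hγ : IsCovarianceKernel γ) (φ ψ : 𝓓(openQuadrant, ℝ)) :
    Integrable (fun p : (ℝ × ℝ) × (ℝ × ℝ) =>
      f (p.1.1 - p.1.2) * γ (p.2.1 - p.2.2) * φ (p.1.1, p.2.1) * ψ (p.1.2, p.2.2)) := by
  obtain ⟨M, C, h1, h2⟩ := testFunction_bounds φ
  obtain ⟨M', C', h1', h2'⟩ := testFunction_bounds ψ
  exact covForm_integrable hf.locallyIntegrable hγ.locallyIntegrable (M := max M M')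
    (C := max C C') φ.continuous.measurable ψ.continuous.measurable
    (fun p => (h1 p).trans (le_max_left _ _)) (fun p => (h1' p).trans (le_max_right _ _))
    (fun p hp => ⟨(h2 p hp).1.trans (le_max_left _ _), (h2 p hp).2.trans (le_max_left _ _)⟩)
    (fun p hp => ⟨(h2' p hp).1.trans (le_max_right _ _), (h2' p hp).2.trans (le_max_right _ _)⟩)

theorem covForm_testFunction (f γ : ℝ → ℝ) (φ ψ : 𝓓(openQuadrant, ℝ)) :
    covForm f γ φ ψ = ∫ p : (ℝ × ℝ) × (ℝ × ℝ),
      f (p.1.1 - p.1.2) * γ (p.2.1 - p.2.2) * φ (p.1.1, p.2.1) * ψ (p.1.2, p.2.2) := by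
  unfold covForm
  refine setIntegral_eq_integral_of_forall_compl_eq_zero fun p hp => ?_
  by_cases h1 : (p.1.1, p.2.1) ∈ quadrant
  · have h2 : (p.1.2, p.2.2) ∉ quadrant := fun h2 => hp ⟨⟨h1.1, h2.1⟩, ⟨h1.2, h2.2⟩⟩
    rw [testFunction_eq_zero ψ h2, mul_zero]
  · rw [testFunction_eq_zero φ h1, mul_zero, zero_mul]

theorem covForm_nonneg {f γ : ℝ → ℝ} (hf : IsCovarianceKernel f) (hγ : IsCovarianceKernel γ)
    (φ : 𝓓(openQuadrant, ℝ)) : 0 ≤ covForm f γ φ φ := by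
  obtain ⟨M, C, h1, h2⟩ := testFunction_bounds φ
  rw [covForm_testFunction]
  exact full_form_nonneg hf hγ φ.continuous h1 h2

theorem covForm_symm {f γ : ℝ → ℝ} (hf : IsCovarianceKernel f) (hγ : IsCovarianceKernel γ)
    (φ ψ : 𝓓(openQuadrant, ℝ)) : covForm f γ φ ψ = covForm f γ ψ φ := by
  rw [covForm_testFunction, covForm_testFunction]
  have hs : MeasurePreserving (Prod.map (MeasurableEquiv.prodComm (α := ℝ) (β := ℝ))
      (MeasurableEquiv.prodComm (α := ℝ) (β := ℝ))) volume volume :=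
    (Measure.measurePreserving_swap (μ := (volume : Measure ℝ))
      (ν := (volume : Measure ℝ))).prod Measure.measurePreserving_swap
  rw [← hs.integral_comp
    (MeasurableEquiv.prodCongr MeasurableEquiv.prodComm MeasurableEquiv.prodComm).measurableEmbedding]
  refine integral_congr_ae (ae_of_all _ fun p => ?_)
  have e1 := hf.symm (p.1.1 - p.1.2)
  have e2 := hγ.symm (p.2.1 - p.2.2)
  rw [neg_sub] at e1 e2
  change f (p.1.2 - p.1.1) * γ (p.2.2 - p.2.1) * φ (p.1.2, p.2.2) * ψ (p.1.1, p.2.1) =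
    f (p.1.1 - p.1.2) * γ (p.2.1 - p.2.2) * ψ (p.1.1, p.2.1) * φ (p.1.2, p.2.2)
  rw [e1, e2]
  ring

theorem covForm_add_left {f γ : ℝ → ℝ} (hf : IsCovarianceKernel f) (hγ : IsCovarianceKernel γ)
    (φ ψ χ : 𝓓(openQuadrant, ℝ)) :
    covForm f γ (φ + ψ : 𝓓(openQuadrant, ℝ)) χ = covForm f γ φ χ + covForm f γ ψ χ := by
  rw [covForm_testFunction, covForm_testFunction, covForm_testFunction, ← integral_add
    (covForm_integrand_testFunction hf hγ φ χ) (covForm_integrand_testFunction hf hγ ψ χ)]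
  refine integral_congr_ae (ae_of_all _ fun p => ?_)
  have h : (φ + ψ : 𝓓(openQuadrant, ℝ)) (p.1.1, p.2.1) = φ (p.1.1, p.2.1) + ψ (p.1.1, p.2.1) := rfl
  simp only [h]
  ring

theorem covForm_smul_left (f γ : ℝ → ℝ) (r : ℝ) (φ ψ : 𝓓(openQuadrant, ℝ)) :
    covForm f γ (r • φ : 𝓓(openQuadrant, ℝ)) ψ = r * covForm f γ φ ψ := by
  rw [covForm_testFunction, covForm_testFunction, ← integral_const_mul]
  refine integral_congr_ae (ae_of_all _ fun p => ?_)
  have h : (r • φ : 𝓓(openQuadrant, ℝ)) (p.1.1, p.2.1) = r * φ (p.1.1, p.2.1) := rfl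
  simp only [h]
  ring

/-- The two kernels of the noise: `f` in space and `γ` in time. -/
structure NoiseKernel where
  f : ℝ → ℝ
  γ : ℝ → ℝ
  hf : IsCovarianceKernel f
  hγ : IsCovarianceKernel γ

namespace NoiseKernel

/-- Test functions on the open quadrant, with the inner product `⟨φ, ψ⟩_H`. -/
def TestSpace (_K : NoiseKernel) : Type := 𝓓(openQuadrant, ℝ)

noncomputable instance (K : NoiseKernel) : AddCommGroup K.TestSpace :=
  inferInstanceAs (AddCommGroup 𝓓(openQuadrant, ℝ))

noncomputable instance (K : NoiseKernel) : Module ℝ K.TestSpace :=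
  inferInstanceAs (Module ℝ 𝓓(openQuadrant, ℝ))

/-- The inner product `⟨φ, ψ⟩_H` on test functions. -/
@[reducible]
noncomputable def core (K : NoiseKernel) : PreInnerProductSpace.Core ℝ K.TestSpace where
  inner φ ψ := covForm K.f K.γ (TestFunction.toFun φ) (TestFunction.toFun ψ)
  conj_inner_symm φ ψ := covForm_symm K.hf K.hγ ψ φ
  re_inner_nonneg φ := covForm_nonneg K.hf K.hγ φ
  add_left φ ψ χ := covForm_add_left K.hf K.hγ φ ψ χ
  smul_left φ ψ r := covForm_smul_left K.f K.γ r φ ψ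

noncomputable instance (K : NoiseKernel) : SeminormedAddCommGroup K.TestSpace :=
  @InnerProductSpace.Core.toSeminormedAddCommGroup ℝ _ _ _ _ K.core

noncomputable instance (K : NoiseKernel) : InnerProductSpace ℝ K.TestSpace :=
  InnerProductSpace.ofCore K.core

/-- A test function, as an element of the pre-Hilbert space. -/
def ofTest (K : NoiseKernel) (φ : 𝓓(openQuadrant, ℝ)) : K.TestSpace := φ

/-- The Hilbert space `H`: the completion of the test functions for `⟨·, ·⟩_H`. -/
abbrev H (K : NoiseKernel) : Type := UniformSpace.Completion K.TestSpace

/-- The canonical map from test functions to `H`. -/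
noncomputable def toH (K : NoiseKernel) (φ : 𝓓(openQuadrant, ℝ)) : K.H :=
  UniformSpace.Completion.coe' (K.ofTest φ)

theorem inner_toH (K : NoiseKernel) (φ ψ : 𝓓(openQuadrant, ℝ)) :
    inner ℝ (K.toH φ) (K.toH ψ) = covForm K.f K.γ φ ψ :=
  UniformSpace.Completion.inner_coe (𝕜 := ℝ) (K.ofTest φ) (K.ofTest ψ)

theorem denseRange_toH (K : NoiseKernel) : DenseRange K.toH := by
  have h : DenseRange (UniformSpace.Completion.coe' : K.TestSpace → K.H) :=
    UniformSpace.Completion.denseRange_coe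
  exact h

end NoiseKernel

/-- The modified Bessel function of the first kind of integer order `n`. -/
noncomputable def besselI (n : ℕ) (x : ℝ) : ℝ :=
  ∑' m : ℕ, (x / 2) ^ (2 * m + n) / ((m.factorial : ℝ) * ((m + n).factorial : ℝ))

/-- The fundamental solution of the Kimura equation `∂ₜ u = z ∂_z² u` on `ℝ₊`. -/
noncomputable def kimuraKernel (z w t : ℝ) : ℝ :=
  √(z / w) * (Real.exp (-(z + w) / t) / t) * besselI 1 (2 * √(z * w) / t)

/-- The solution of the deterministic Kimura equation with initial condition `u₀ ∈ C_b(ℝ₊)`. -/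
noncomputable def detSolution (u₀ : BoundedContinuousFunction (Ioi (0 : ℝ)) ℝ) (z t : ℝ) : ℝ :=
  ∫ w : Ioi (0 : ℝ), kimuraKernel z w t * u₀ w ∂(volume.comap Subtype.val)

/-- `U(x) = e^{-x} I₀(x) - e^{-2x} / 2`. -/
noncomputable def kimuraU (x : ℝ) : ℝ :=
  Real.exp (-x) * besselI 0 x - Real.exp (-2 * x) / 2

/-- `∫_{-a}^{a} k`; this is `F_ε` for `k = f`, `a = ε` and `Γ_t` for `k = γ`, `a = t`. -/
noncomputable def symmIntegral (k : ℝ → ℝ) (a : ℝ) : ℝ := ∫ x in (-a)..a, k x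

/-- The Duhamel kernels `fₙ(z₁, t₁, …, zₙ, tₙ; z, t)`: `f₀ = u₀(z, t)` is the deterministic
solution and `fₙ₊₁(…, z', t'; z, t) = 1_{(0,t)}(t') q₀(z, z', t - t') fₙ(…; z', t')`. -/
noncomputable def chaosKernel (u₀ : BoundedContinuousFunction (Ioi (0 : ℝ)) ℝ) :
    (n : ℕ) → (Fin n → ℝ × ℝ) → ℝ → ℝ → ℝ
  | 0, _, z, t => detSolution u₀ z t
  | n + 1, p, z, t =>
      (Ioo 0 t).indicator (fun τ => kimuraKernel z (p (Fin.last n)).1 (t - τ)) (p (Fin.last n)).2 *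
        chaosKernel u₀ n (fun i => p i.castSucc) (p (Fin.last n)).1 (p (Fin.last n)).2

section Malliavin

variable {Ω : Type*} [MeasurableSpace Ω] (K : NoiseKernel) (P : Measure Ω) (W : K.H → Ω → ℝ)

/-- `W` is an isonormal Gaussian process over `H`, and the `σ`-algebra of the probability space
is generated by `W` up to `P`-null sets. -/
structure IsIsonormal : Prop where
  measurable : ∀ h, Measurable (W h)
  gaussian : ProbabilityTheory.IsGaussianProcess W P
  mean : ∀ h, ∫ ω, W h ω ∂P = 0
  covariance : ∀ h₁ h₂, ∫ ω, W h₁ ω * W h₂ ω ∂P = inner ℝ h₁ h₂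
  generates : ∀ s, MeasurableSet s → ∃ s',
    MeasurableSet[⨆ h, MeasurableSpace.comap (W h) inferInstance] s' ∧ s =ᵐ[P] s'

/-- The graph of the Malliavin derivative on smooth random variables: pairs `(X, DX)` with
`X = F(W(h₁), …, W(h_N))` and `DX = ∑ⱼ ∂ⱼF(W(h₁), …, W(h_N)) hⱼ`, where `F` is smooth and has,
together with all its derivatives, at most polynomial growth. -/
def smoothMalliavinGraph : Set (Lp ℝ 2 P × Lp K.H 2 P) :=
  {XU | ∃ (N : ℕ) (F : (Fin N → ℝ) → ℝ) (h : Fin N → K.H), F.HasTemperateGrowth ∧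
    (XU.1 =ᵐ[P] fun ω => F fun i => W (h i) ω) ∧
    (XU.2 =ᵐ[P] fun ω => ∑ j, fderiv ℝ F (fun i => W (h i) ω) (Pi.single j 1) • h j)}

/-- The graph of the Malliavin derivative `D` on `𝔻^{1,2}`: the closure of the graph on smooth
random variables in the graph norm, i.e. in `L²(Ω) × L²(Ω; H)`. -/
def malliavinGraph : Set (Lp ℝ 2 P × Lp K.H 2 P) := closure (smoothMalliavinGraph K P W)

/-- `V ∈ Dom δ` and `δ(V) = Y`, where the divergence `δ` is the adjoint of `D`. -/
def IsDivergence (V : Lp K.H 2 P) (Y : Ω → ℝ) : Prop :=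
  MemLp Y 2 P ∧ ∀ XU ∈ malliavinGraph K P W,
    ∫ ω, Y ω * XU.1 ω ∂P = ∫ ω, (inner ℝ (XU.2 ω) (V ω) : ℝ) ∂P

/-- The random field `v` on `ℝ₊²` is, as a process in `L²(Ω; H)`, the random element `V`:
it is jointly measurable, `E ∫ f(x-y) γ(r-s) |v(x,r)| |v(y,s)| < ∞`, and almost surely the function
`v(·, ω)` is the element `V(ω)` of `H`, which is determined by its inner products
`∫ f(x-y) γ(r-s) v(x,r,ω) φ(y,s)` with all test functions `φ`. -/
structure IsFieldElement (v : ℝ → ℝ → Ω → ℝ) (V : Lp K.H 2 P) : Prop where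
  measurable : AEStronglyMeasurable (fun p : (ℝ × ℝ) × Ω => v p.1.1 p.1.2 p.2)
    ((volume.restrict quadrant).prod P)
  integrable : Integrable (fun p : ((ℝ × ℝ) × (ℝ × ℝ)) × Ω =>
      K.f (p.1.1.1 - p.1.1.2) * K.γ (p.1.2.1 - p.1.2.2) * v p.1.1.1 p.1.2.1 p.2 *
        v p.1.1.2 p.1.2.2 p.2)
    ((volume.restrict (quadrant ×ˢ quadrant)).prod P)
  inner_eq : ∀ᵐ ω ∂P, ∀ φ : 𝓓(openQuadrant, ℝ),
    inner ℝ (V ω) (K.toH φ) = covForm K.f K.γ (fun p => v p.1 p.2 ω) φ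

/-- The random field `v` is Skorohod integrable and `∫ v(w, τ) W(dw, dτ) = Y`. -/
def IsSkorohodIntegral (v : ℝ → ℝ → Ω → ℝ) (Y : Ω → ℝ) : Prop :=
  ∃ V : Lp K.H 2 P, IsFieldElement K P v V ∧ IsDivergence K P W V Y

/-- `Y` is the multiple Skorohod integral `𝓘ₙ(g)` of `g : (ℝ₊²)ⁿ → ℝ`, that is, the iterated
Skorohod integral `∫ ⋯ ∫ g(z₁, t₁, …, zₙ, tₙ) W(dz₁, dt₁) ⋯ W(dzₙ, dtₙ)`, with `𝓘₀(g) = g`. -/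
def IsMultipleIntegral : (n : ℕ) → ((Fin n → ℝ × ℝ) → ℝ) → (Ω → ℝ) → Prop
  | 0, g, Y => Y =ᵐ[P] fun _ => g fun i => i.elim0
  | n + 1, g, Y => ∃ v : ℝ → ℝ → Ω → ℝ,
      (∀ᵐ p ∂(volume.restrict quadrant : Measure (ℝ × ℝ)),
        IsMultipleIntegral n (fun x => g (Fin.snoc (α := fun _ => ℝ × ℝ) x p)) (v p.1 p.2)) ∧
      IsSkorohodIntegral K P W v Y

/-- Mild solutions of the stochastic Kimura equation `∂ₜ u = z ∂_z² u + u Ẇ` with `u(z, 0) = u₀(z)`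
and `u(0, t) = 0`: square-integrable random fields on `[0, ∞)²` with a jointly measurable
modification `ũ` such that, for `z, t > 0`, the process `1_{(0,t)}(τ) q₀(z, w, t - τ) ũ(w, τ)` is
Skorohod integrable and the mild equation holds almost surely. -/
def IsMildSolution (u₀ : BoundedContinuousFunction (Ioi (0 : ℝ)) ℝ) (u : ℝ → ℝ → Ω → ℝ) : Prop :=
  (∀ z t, 0 ≤ z → 0 ≤ t → MemLp (u z t) 2 P) ∧
  (∀ z : Ioi (0 : ℝ), u z 0 =ᵐ[P] fun _ => u₀ z) ∧
  (∀ t, 0 < t → u 0 t =ᵐ[P] fun _ => 0) ∧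
  ∃ ũ : ℝ → ℝ → Ω → ℝ, Measurable (fun p : (ℝ × ℝ) × Ω => ũ p.1.1 p.1.2 p.2) ∧
    (∀ z t, 0 ≤ z → 0 ≤ t → ũ z t =ᵐ[P] u z t) ∧
    ∀ z t, 0 < z → 0 < t → ∃ I : Ω → ℝ,
      IsSkorohodIntegral K P W
        (fun w τ ω => (Ioo 0 t).indicator (fun τ' => kimuraKernel z w (t - τ') * ũ w τ' ω) τ) I ∧
      u z t =ᵐ[P] fun ω => detSolution u₀ z t + I ω

end Malliavin

/-!
The chaos expansion is handled through its pairings with the trigonometric exponentials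
`X(h, a) = exp(‖h‖² / 2) cos(W(h) + a)`, where `h` runs over test functions. These are total in
`L²(Ω)` (`ae_eq_zero_of_test`), and the `n`-th chaos component `Jₙ(z, t)` has to pair with `X(h, a)`
to `φₙ(h; z, t) cos(a + nπ/2)`, where `φₙ(h; z, t)` is the integral of the kernel `fₙ` against the
`n`-th tensor power of the potential of `h`. The numbers `φₙ` satisfy the Duhamel recursion
`φₙ₊₁ = ∫ q₀ φₙ (k * h)` over space-time, with `k` the covariance of the noise, so that neither
multiple integrals nor tensor powers of `H` are needed.

*Existence.* By the Riesz representation theorem, `Jₙ(z, t)` exists once the quadratic form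
`(∑ᵢ cᵢ φₙ(hᵢ; z, t))²` is bounded by the Gram form `∑ᵢⱼ cᵢ cⱼ ⟨hᵢ, hⱼ⟩ⁿ / n!`. The key bound
`sum_chaosPairing_sq_le` gives this with the constant `Γ_tⁿ Aₙ(z, t)`, where `Aₙ` (`chaosBound`) is
the variance recursion for noise which is white in time. It is proved by induction on `n`: the
coefficients `cᵢ (k * hᵢ)(p)` are absorbed at each point `p` of space-time, the vector-valued
Cauchy–Schwarz inequality `lintegral_mul_sqrt_le` is applied in space and the scalar one in time,
and the accumulated covariances are compared with `Γ_t` times the inner product of `H` by the Schur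
product theorem (`sum_sliceIntegral_pow_le`). Different orders are orthogonal, so the bounds add up
along finite sums (`exists_chaosSum`).

*Convergence and second moments.* As `f` is non-increasing on `(0, ∞)`, it is dominated by its part
near the diagonal, of mass `F_ε`, and the constant `f(ε)`. With `∫ q₀ dw ≤ 1` and
`∫₀ᵗ ∫ q₀² dw ds ≤ U(z/t) ≤ 1/2`, which follow from the power series, this turns the variance
recursion into a linear inequality with an explicit supersolution (`sum_chaosBound_le`). This gives
summability in `L²(Ω)` and, after an elementary comparison (`supersolution_le`), the stated bound.

*The equation.* Gaussian integration by parts against `cos(W(h) + a)` for test functions `h`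
implies, by Fourier inversion, cut-off and closure, the divergence identity on the whole domain of
the Malliavin derivative (`isDivergence_of_cos`). Hence the Skorohod integral of `q₀ y` is
identified by its pairings with the `X(h, a)` alone (`isSkorohodIntegral_duhamel`), and both the
identification of `Jₙ` with the iterated integral of `fₙ` and the mild equation for the sum reduce
to the recursion for the `φₙ`.

*Uniqueness.* Testing the mild equation with `W(h)ⁿ` expresses `E[v(z, t) W(h)ⁿ]` by the moments of
order `n - 1`. By induction all these moments agree for two mild solutions, and polynomials in the
noise are total (`ae_eq_zero_of_integral_mul_pow`).
-/

open scoped ENNReal NNReal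
set_option linter.unusedSectionVars false

/-! ### Positive definite translation-invariant forms -/

section Forms

variable {E : Type*} [NormedAddCommGroup E] [NormedSpace ℝ E] [FiniteDimensional ℝ E]
  [MeasureSpace E] [BorelSpace E] [(volume : Measure E).IsAddHaarMeasure]

/-- A non-negative, even, locally integrable function on `E` which is non-negative definite when
tested on smooth compactly supported functions. -/
structure IsPDKernel (k : E → ℝ) : Prop where
  nonneg : ∀ x, 0 ≤ k x
  symm : ∀ x, k (-x) = k x
  locallyIntegrable : LocallyIntegrable k
  nonnegDef : ∀ φ : E → ℝ, ContDiff ℝ (⊤ : ℕ∞) φ → HasCompactSupport φ →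
    0 ≤ ∫ p : E × E, k (p.1 - p.2) * φ p.1 * φ p.2

/-- The energy `∫∫ k(x - y) a(x) b(y) dx dy` of functions with values in `[0, ∞]`. -/
noncomputable def energy (k : E → ℝ) (a b : E → ℝ≥0∞) : ℝ≥0∞ :=
  ∫⁻ p : E × E, ENNReal.ofReal (k (p.1 - p.2)) * a p.1 * b p.2

/-- The bilinear form `∫∫ k(x - y) g(x) h(y) dx dy`. -/
noncomputable def bilin (k : E → ℝ) (g h : E → ℝ) : ℝ :=
  ∫ p : E × E, k (p.1 - p.2) * g p.1 * h p.2

variable {k : E → ℝ}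

theorem aestronglyMeasurable_comp_sub (hk : LocallyIntegrable k) :
    AEStronglyMeasurable (fun p : E × E => k (p.1 - p.2)) volume := by
  have h := quasiMeasurePreserving_sub (μ := (volume : Measure E)) (ν := (volume : Measure E))
  exact hk.aestronglyMeasurable.comp_quasiMeasurePreserving h

theorem bilin_box_integrable (hk : LocallyIntegrable k) (M : ℝ) :
    Integrable (fun p : E × E => (Metric.closedBall 0 (2 * M)).indicator k (p.1 - p.2) *
      (Metric.closedBall 0 M).indicator (fun _ => (1 : ℝ)) p.2) := by
  have h1 : Integrable ((Metric.closedBall 0 (2 * M)).indicator k) :=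
    (hk.integrableOn_isCompact (isCompact_closedBall _ _)).integrable_indicator
      measurableSet_closedBall
  have h2 : Integrable ((Metric.closedBall (0 : E) M).indicator (fun _ => (1 : ℝ))) :=
    IntegrableOn.integrable_indicator
      (integrableOn_const (measure_closedBall_lt_top.ne)) measurableSet_closedBall
  have h3 := h1.mul_prod h2
  exact (measurePreserving_sub_prod (volume : Measure E)
    (volume : Measure E)).integrable_comp_of_integrable h3

theorem bilin_integrable_of_bounded (hk : LocallyIntegrable k) {g h : E → ℝ} {M C : ℝ}
    (hg : Measurable g) (hh : Measurable h) (hgC : ∀ p, |g p| ≤ C) (hhC : ∀ p, |h p| ≤ C)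
    (hgM : ∀ p, g p ≠ 0 → ‖p‖ ≤ M) (hhM : ∀ p, h p ≠ 0 → ‖p‖ ≤ M) :
    Integrable (fun p : E × E => k (p.1 - p.2) * g p.1 * h p.2) := by
  have h4 : Measurable (fun p : E × E => g p.1 * h p.2) :=
    (hg.comp measurable_fst).mul (hh.comp measurable_snd)
  have h5 := (bilin_box_integrable hk M).mul_bdd (c := C * C) h4.aestronglyMeasurable
    (ae_of_all _ fun p => by
      rw [Real.norm_eq_abs, abs_mul]
      exact mul_le_mul (hgC _) (hhC _) (abs_nonneg _) ((abs_nonneg _).trans (hgC 0)))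
  refine h5.congr (ae_of_all _ fun p => ?_)
  by_cases hg0 : g p.1 = 0
  · simp [hg0]
  by_cases hh0 : h p.2 = 0
  · simp [hh0]
  have a := hgM _ hg0
  have b := hhM _ hh0
  have e1 : p.1 - p.2 ∈ Metric.closedBall (0 : E) (2 * M) := by
    rw [mem_closedBall_zero_iff]
    exact (norm_sub_le _ _).trans (by linarith)
  have e2 : p.2 ∈ Metric.closedBall (0 : E) M := by rwa [mem_closedBall_zero_iff]
  simp only [indicator_of_mem e1, indicator_of_mem e2]
  ring

/-- Positivity for bounded functions with bounded support, by mollification. -/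
theorem bilin_nonneg_of_bounded (hk : IsPDKernel k) {g : E → ℝ} {M C : ℝ}
    (hg : Measurable g) (hgC : ∀ p, |g p| ≤ C) (hgM : ∀ p, g p ≠ 0 → ‖p‖ ≤ M) :
    0 ≤ bilin k g g := by
  have hC : 0 ≤ C := (abs_nonneg _).trans (hgC 0)
  have hgcs : HasCompactSupport g := HasCompactSupport.intro (isCompact_closedBall (0 : E) M)
    fun x hx => by
      by_contra h
      exact hx (mem_closedBall_zero_iff.2 (hgM x h))
  have hgint : Integrable g := by
    refine (integrableOn_iff_integrable_of_support_subset (s := Metric.closedBall (0 : E) M)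
      fun x hx => mem_closedBall_zero_iff.2 (hgM x hx)).1 ?_
    exact Measure.integrableOn_of_bounded (M := C) measure_closedBall_lt_top.ne
      hg.aestronglyMeasurable (ae_of_all _ hgC)
  -- The outer radius of the bumps tends to zero and is at most twice the inner one, which gives
  -- almost everywhere convergence of the mollified functions.
  let φ : ℕ → ContDiffBump (0 : E) := fun n =>
    ⟨1 / (2 * ((n : ℝ) + 1)), 1 / ((n : ℝ) + 1), by positivity, by
      apply one_div_lt_one_div_of_lt <;> linarith [Nat.cast_nonneg (α := ℝ) n]⟩
  have hφ1 : ∀ n, (φ n).rOut ≤ 1 := fun n => by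
    change 1 / ((n : ℝ) + 1) ≤ 1
    rw [div_le_one (by positivity)]
    linarith [Nat.cast_nonneg (α := ℝ) n]
  let G : ℕ → E → ℝ := fun n =>
    convolution ((φ n).normed volume) g (ContinuousLinearMap.lsmul ℝ ℝ) volume
  have hconv : ∀ᵐ x, Tendsto (fun n => G n x) atTop (𝓝 (g x)) := by
    refine ContDiffBump.ae_convolution_tendsto_right_of_locallyIntegrable (K := 2)
      (tendsto_one_div_add_atTop_nhds_zero_nat) (Eventually.of_forall fun n => ?_)
      hgint.locallyIntegrable
    change 1 / ((n : ℝ) + 1) ≤ 2 * (1 / (2 * ((n : ℝ) + 1)))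
    apply le_of_eq
    field_simp
  have hsm : ∀ n, ContDiff ℝ (⊤ : ℕ∞) (G n) := fun n =>
    (φ n).hasCompactSupport_normed.contDiff_convolution_left _ (φ n).contDiff_normed
      hgint.locallyIntegrable
  have hcs : ∀ n, HasCompactSupport (G n) := fun n =>
    (φ n).hasCompactSupport_normed.convolution _ hgcs
  have hGC : ∀ n x, |G n x| ≤ C := fun n x => by
    have h1 : |G n x| ≤ ∫ t, (φ n).normed volume t * C := by
      rw [← Real.norm_eq_abs]
      refine norm_integral_le_of_norm_le ((φ n).integrable_normed.mul_const C)
        (ae_of_all _ fun t => ?_)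
      simp only [ContinuousLinearMap.lsmul_apply, smul_eq_mul, norm_mul, Real.norm_eq_abs]
      rw [abs_of_nonneg ((φ n).nonneg_normed t)]
      exact mul_le_mul_of_nonneg_left (hgC _) ((φ n).nonneg_normed t)
    rwa [integral_mul_const, (φ n).integral_normed, one_mul] at h1
  have hGM : ∀ n x, G n x ≠ 0 → ‖x‖ ≤ M + 1 := fun n x hx => by
    have h1 := support_convolution_subset _ hx
    obtain ⟨a, ha, b, hb, hab⟩ := h1
    rw [(φ n).support_normed_eq, mem_ball_zero_iff] at ha
    have := hgM b hb
    rw [← hab]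
    exact (norm_add_le a b).trans (by linarith [hφ1 n])
  -- The mollified functions are dominated by a multiple of the indicator of one fixed ball.
  let box : E → ℝ := (Metric.closedBall (0 : E) (M + 1)).indicator fun _ => C
  have hbm : Measurable box := measurable_const.indicator measurableSet_closedBall
  have hbC : ∀ p, |box p| ≤ C := fun p => by
    by_cases hp : p ∈ Metric.closedBall (0 : E) (M + 1)
    · simp only [box, indicator_of_mem hp, abs_of_nonneg hC, le_refl]
    · simp only [box, indicator_of_notMem hp, abs_zero, hC]
  have hbM : ∀ p, box p ≠ 0 → ‖p‖ ≤ M + 1 := fun p hp =>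
    mem_closedBall_zero_iff.1 (mem_of_indicator_ne_zero hp)
  have hGbox : ∀ n p, |G n p| ≤ box p := fun n p => by
    by_cases h0 : G n p = 0
    · rw [h0, abs_zero]; exact indicator_nonneg (fun _ _ => hC) _
    · simp only [box, indicator_of_mem (mem_closedBall_zero_iff.2 (hGM n p h0))]
      exact hGC n p
  have hae : ∀ᵐ p : E × E, Tendsto (fun n => k (p.1 - p.2) * G n p.1 * G n p.2) atTop
      (𝓝 (k (p.1 - p.2) * g p.1 * g p.2)) := by
    have a1 : ∀ᵐ p : E × E, Tendsto (fun n => G n p.1) atTop (𝓝 (g p.1)) :=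
      Measure.quasiMeasurePreserving_fst.ae hconv
    have a2 : ∀ᵐ p : E × E, Tendsto (fun n => G n p.2) atTop (𝓝 (g p.2)) :=
      Measure.quasiMeasurePreserving_snd.ae hconv
    filter_upwards [a1, a2] with p h1 h2
    exact (h1.const_mul _).mul h2
  refine ge_of_tendsto' (tendsto_integral_of_dominated_convergence _ (fun n => ?_)
    (bilin_integrable_of_bounded hk.locallyIntegrable hbm hbm hbC hbC hbM hbM)
    (fun n => ae_of_all _ fun p => ?_) hae) fun n => hk.nonnegDef (G n) (hsm n) (hcs n)
  · exact (bilin_integrable_of_bounded hk.locallyIntegrable (hsm n).continuous.measurable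
      (hsm n).continuous.measurable (hGC n) (hGC n) (hGM n) (hGM n)).aestronglyMeasurable
  · rw [Real.norm_eq_abs, abs_mul, abs_mul, abs_of_nonneg (hk.nonneg _)]
    have a1 := hk.nonneg (p.1 - p.2)
    have b1 := hGbox n p.1
    have b2 := hGbox n p.2
    have b3 := (abs_nonneg _).trans b1
    gcongr

theorem bilin_nonneg (hk : IsPDKernel k) {g : E → ℝ} (hg : Measurable g)
    (hint : Integrable (fun p : E × E => k (p.1 - p.2) * g p.1 * g p.2)) :
    0 ≤ bilin k g g := by
  let s : ℕ → Set E := fun n => {x | ‖x‖ ≤ n ∧ |g x| ≤ n}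
  have hs : ∀ n, MeasurableSet (s n) := fun n =>
    (measurableSet_le measurable_norm measurable_const).inter
      (measurableSet_le hg.abs measurable_const)
  let G : ℕ → E → ℝ := fun n => (s n).indicator g
  have hGm : ∀ n, Measurable (G n) := fun n => hg.indicator (hs n)
  have hGC : ∀ n x, |G n x| ≤ n := fun n x => by
    by_cases hx : x ∈ s n
    · simp only [G, indicator_of_mem hx]; exact hx.2
    · simp only [G, indicator_of_notMem hx, abs_zero]; positivity
  have hGM : ∀ n x, G n x ≠ 0 → ‖x‖ ≤ n := fun n x hx => (mem_of_indicator_ne_zero hx).1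
  have hGg : ∀ n x, |G n x| ≤ |g x| := fun n x => by
    by_cases hx : x ∈ s n
    · simp only [G, indicator_of_mem hx, le_refl]
    · simp only [G, indicator_of_notMem hx, abs_zero]; positivity
  have hlim : ∀ x, Tendsto (fun n => G n x) atTop (𝓝 (g x)) := fun x => by
    obtain ⟨N, hN⟩ := exists_nat_ge (max ‖x‖ |g x|)
    refine tendsto_const_nhds.congr' ?_
    filter_upwards [eventually_ge_atTop N] with n hn
    have hn' : (N : ℝ) ≤ n := Nat.cast_le.2 hn
    have : x ∈ s n := ⟨(le_max_left _ _).trans (hN.trans hn'),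
      (le_max_right _ _).trans (hN.trans hn')⟩
    simp only [G, indicator_of_mem this]
  refine ge_of_tendsto' (tendsto_integral_of_dominated_convergence _ (fun n => ?_)
    hint.norm (fun n => ae_of_all _ fun p => ?_) (ae_of_all _ fun p => ?_))
    fun n => bilin_nonneg_of_bounded hk (hGm n) (hGC n) (hGM n)
  · exact (bilin_integrable_of_bounded hk.locallyIntegrable (hGm n) (hGm n) (hGC n) (hGC n)
      (hGM n) (hGM n)).aestronglyMeasurable
  · simp only [Real.norm_eq_abs, abs_mul]
    exact mul_le_mul (mul_le_mul_of_nonneg_left (hGg n _) (abs_nonneg _)) (hGg n _)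
      (abs_nonneg _) (by positivity)
  · exact ((hlim _).const_mul _).mul (hlim _)

theorem bilin_swap (hk : IsPDKernel k) (g h : E → ℝ) : bilin k g h = bilin k h g := by
  unfold bilin
  rw [Measure.volume_eq_prod, ← integral_prod_swap]
  refine integral_congr_ae (ae_of_all _ fun p => ?_)
  have := hk.symm (p.1 - p.2)
  rw [neg_sub] at this
  simp only [Prod.fst_swap, Prod.snd_swap, this]
  ring

theorem bilin_integrable_swap (hk : IsPDKernel k) {g h : E → ℝ}
    (hi : Integrable (fun p : E × E => k (p.1 - p.2) * g p.1 * h p.2)) :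
    Integrable (fun p : E × E => k (p.1 - p.2) * h p.1 * g p.2) := by
  rw [Measure.volume_eq_prod] at hi ⊢
  refine hi.swap.congr (ae_of_all _ fun p => ?_)
  have := hk.symm (p.1 - p.2)
  rw [neg_sub] at this
  simp only [Function.comp, Prod.fst_swap, Prod.snd_swap, this]
  ring

theorem bilin_sq_le_aux (hk : IsPDKernel k) {g h : E → ℝ} (hg : Measurable g) (hh : Measurable h)
    (hgg : Integrable (fun p : E × E => k (p.1 - p.2) * g p.1 * g p.2))
    (hgh : Integrable (fun p : E × E => k (p.1 - p.2) * g p.1 * h p.2))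
    (hhh : Integrable (fun p : E × E => k (p.1 - p.2) * h p.1 * h p.2)) :
    bilin k g h ^ 2 ≤ bilin k g g * bilin k h h := by
  have hhg := bilin_integrable_swap hk hgh
  -- The quadratic polynomial `c ↦ ⟨c g + h, c g + h⟩` is non-negative.
  have key : ∀ c : ℝ, 0 ≤ bilin k g g * (c * c) + (2 * bilin k g h) * c + bilin k h h := by
    intro c
    have e : ∀ p : E × E, k (p.1 - p.2) * (c * g p.1 + h p.1) * (c * g p.2 + h p.2) =
        (c * c) * (k (p.1 - p.2) * g p.1 * g p.2) + c * (k (p.1 - p.2) * g p.1 * h p.2) +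
        c * (k (p.1 - p.2) * h p.1 * g p.2) + k (p.1 - p.2) * h p.1 * h p.2 := fun p => by ring
    have i1 := hgg.const_mul (c * c)
    have i2 := hgh.const_mul c
    have i3 := hhg.const_mul c
    have hint := ((i1.add i2).add i3).add hhh
    have h0 := bilin_nonneg hk (g := fun x => c * g x + h x) ((hg.const_mul c).add hh)
      (hint.congr (ae_of_all _ fun p => (e p).symm))
    have h1 : bilin k (fun x => c * g x + h x) (fun x => c * g x + h x) =
        (c * c) * bilin k g g + c * bilin k g h + c * bilin k h g + bilin k h h := by
      unfold bilin
      rw [integral_congr_ae (ae_of_all _ e), integral_add (by exact (i1.add i2).add i3) hhh,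
        integral_add (by exact i1.add i2) i3, integral_add i1 i2, integral_const_mul,
        integral_const_mul, integral_const_mul]
    rw [h1, bilin_swap hk h g] at h0
    linarith
  have := discrim_le_zero key
  unfold discrim at this
  nlinarith

theorem aemeasurable_ofReal_comp_sub (hk : LocallyIntegrable k) :
    AEMeasurable (fun p : E × E => ENNReal.ofReal (k (p.1 - p.2))) volume :=
  (aestronglyMeasurable_comp_sub hk).aemeasurable.ennreal_ofReal

theorem energy_mono {a b a' b' : E → ℝ≥0∞} (ha : ∀ x, a x ≤ a' x) (hb : ∀ x, b x ≤ b' x) :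
    energy k a b ≤ energy k a' b' :=
  lintegral_mono fun p => by
    have h1 := ha p.1
    have h2 := hb p.2
    gcongr

theorem energy_eq_lintegral_enorm (hk : IsPDKernel k) (g h : E → ℝ) :
    energy k (fun x => ‖g x‖ₑ) (fun x => ‖h x‖ₑ) =
      ∫⁻ p : E × E, ‖k (p.1 - p.2) * g p.1 * h p.2‖ₑ := by
  refine lintegral_congr fun p => ?_
  rw [enorm_mul, enorm_mul, Real.enorm_of_nonneg (hk.nonneg _)]

theorem bilin_integrable_iff (hk : IsPDKernel k) {g h : E → ℝ} (hg : Measurable g)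
    (hh : Measurable h) :
    Integrable (fun p : E × E => k (p.1 - p.2) * g p.1 * h p.2) ↔
      energy k (fun x => ‖g x‖ₑ) (fun x => ‖h x‖ₑ) < ∞ := by
  rw [energy_eq_lintegral_enorm hk]
  refine ⟨fun h => h.2, fun h => ⟨?_, h⟩⟩
  exact ((aestronglyMeasurable_comp_sub hk.locallyIntegrable).mul
    (hg.comp measurable_fst).aestronglyMeasurable).mul
    (hh.comp measurable_snd).aestronglyMeasurable

theorem energy_ofReal (hk : IsPDKernel k) {g h : E → ℝ} (hg : ∀ x, 0 ≤ g x) (hh : ∀ x, 0 ≤ h x)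
    (hi : Integrable (fun p : E × E => k (p.1 - p.2) * g p.1 * h p.2)) :
    energy k (fun x => ENNReal.ofReal (g x)) (fun x => ENNReal.ofReal (h x)) =
      ENNReal.ofReal (bilin k g h) := by
  unfold bilin
  rw [ofReal_integral_eq_lintegral_ofReal hi
    (ae_of_all _ fun p => mul_nonneg (mul_nonneg (hk.nonneg _) (hg _)) (hh _))]
  refine lintegral_congr fun p => ?_
  rw [ENNReal.ofReal_mul (mul_nonneg (hk.nonneg _) (hg _)), ENNReal.ofReal_mul (hk.nonneg _)]

/-- The Cauchy–Schwarz inequality for the energy. -/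
theorem energy_le_sqrt (hk : IsPDKernel k) {a b : E → ℝ≥0∞} (ha : Measurable a)
    (hb : Measurable b) :
    energy k a b ≤ (energy k a a) ^ (1 / 2 : ℝ) * (energy k b b) ^ (1 / 2 : ℝ) := by
  -- Truncation in size and in space reduces to bounded functions with bounded support, and the
  -- truncations increase to the function.
  let tr : (E → ℝ≥0∞) → ℕ → E → ℝ≥0∞ := fun a n =>
    (Metric.closedBall (0 : E) n).indicator fun x => min (a x) n
  have htm : ∀ {a : E → ℝ≥0∞}, Measurable a → ∀ n, Measurable (tr a n) := fun ha n =>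
    (ha.min measurable_const).indicator measurableSet_closedBall
  have htle : ∀ (a : E → ℝ≥0∞) n x, tr a n x ≤ a x := fun a n x => by
    by_cases hx : x ∈ Metric.closedBall (0 : E) n
    · simp only [tr, indicator_of_mem hx]; exact min_le_left _ _
    · simp only [tr, indicator_of_notMem hx]; exact zero_le
  have htn : ∀ (a : E → ℝ≥0∞) n x, tr a n x ≤ n := fun a n x => by
    by_cases hx : x ∈ Metric.closedBall (0 : E) n
    · simp only [tr, indicator_of_mem hx]; exact min_le_right _ _
    · simp only [tr, indicator_of_notMem hx]; exact zero_le
  have htmono : ∀ (a : E → ℝ≥0∞) x, Monotone fun n => tr a n x := fun a x m n hmn => by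
    have hc : (m : ℝ≥0∞) ≤ n := by exact_mod_cast hmn
    have hc' : (m : ℝ) ≤ n := by exact_mod_cast hmn
    by_cases hx : x ∈ Metric.closedBall (0 : E) m
    · have hx' : x ∈ Metric.closedBall (0 : E) n := Metric.closedBall_subset_closedBall hc' hx
      simp only [tr, indicator_of_mem hx, indicator_of_mem hx']
      exact min_le_min le_rfl hc
    · simp only [tr, indicator_of_notMem hx]; exact zero_le
  have htsup : ∀ (a : E → ℝ≥0∞) x, Tendsto (fun n => tr a n x) atTop (𝓝 (a x)) := fun a x => by
    obtain ⟨N, hN⟩ := exists_nat_ge ‖x‖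
    have h1 : Tendsto (fun n : ℕ => min (a x) (n : ℝ≥0∞)) atTop (𝓝 (a x)) := by
      have : Tendsto (fun n : ℕ => min (a x) (n : ℝ≥0∞)) atTop (𝓝 (min (a x) ⊤)) :=
        tendsto_const_nhds.min ENNReal.tendsto_nat_nhds_top
      simpa using this
    refine h1.congr' ?_
    filter_upwards [eventually_ge_atTop N] with n hn
    have hn' : (N : ℝ) ≤ n := Nat.cast_le.2 hn
    have : x ∈ Metric.closedBall (0 : E) n := mem_closedBall_zero_iff.2 (hN.trans hn')
    simp only [tr, indicator_of_mem this]
  have hfin : ∀ (a : E → ℝ≥0∞) n x, tr a n x ≠ ∞ := fun a n x =>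
    ((htn a n x).trans_lt (ENNReal.natCast_lt_top n)).ne
  have hbound : ∀ n, energy k (tr a n) (tr b n) ≤
      (energy k a a) ^ (1 / 2 : ℝ) * (energy k b b) ^ (1 / 2 : ℝ) := by
    intro n
    let A : E → ℝ := fun x => (tr a n x).toReal
    let B : E → ℝ := fun x => (tr b n x).toReal
    have hA : tr a n = fun x => ENNReal.ofReal (A x) := by
      funext x; exact (ENNReal.ofReal_toReal (hfin a n x)).symm
    have hB : tr b n = fun x => ENNReal.ofReal (B x) := by
      funext x; exact (ENNReal.ofReal_toReal (hfin b n x)).symm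
    have hA0 : ∀ x, 0 ≤ A x := fun x => ENNReal.toReal_nonneg
    have hB0 : ∀ x, 0 ≤ B x := fun x => ENNReal.toReal_nonneg
    have hAC : ∀ x, |A x| ≤ n := fun x => by
      rw [abs_of_nonneg (hA0 x)]
      exact ENNReal.toReal_le_of_le_ofReal (by positivity) (by simpa using htn a n x)
    have hBC : ∀ x, |B x| ≤ n := fun x => by
      rw [abs_of_nonneg (hB0 x)]
      exact ENNReal.toReal_le_of_le_ofReal (by positivity) (by simpa using htn b n x)
    have hAM : ∀ x, A x ≠ 0 → ‖x‖ ≤ n := fun x hx => by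
      by_contra hcon
      apply hx
      have : x ∉ Metric.closedBall (0 : E) n := fun h => hcon (mem_closedBall_zero_iff.1 h)
      simp only [A, tr, indicator_of_notMem this, ENNReal.toReal_zero]
    have hBM : ∀ x, B x ≠ 0 → ‖x‖ ≤ n := fun x hx => by
      by_contra hcon
      apply hx
      have : x ∉ Metric.closedBall (0 : E) n := fun h => hcon (mem_closedBall_zero_iff.1 h)
      simp only [B, tr, indicator_of_notMem this, ENNReal.toReal_zero]
    have hAm : Measurable A := (htm ha n).ennreal_toReal
    have hBm : Measurable B := (htm hb n).ennreal_toReal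
    have iAA := bilin_integrable_of_bounded hk.locallyIntegrable hAm hAm hAC hAC hAM hAM
    have iAB := bilin_integrable_of_bounded hk.locallyIntegrable hAm hBm hAC hBC hAM hBM
    have iBB := bilin_integrable_of_bounded hk.locallyIntegrable hBm hBm hBC hBC hBM hBM
    have hcs := bilin_sq_le_aux hk hAm hBm iAA iAB iBB
    have nAA := bilin_nonneg hk hAm iAA
    have nBB := bilin_nonneg hk hBm iBB
    calc energy k (tr a n) (tr b n) = ENNReal.ofReal (bilin k A B) := by
          rw [hA, hB]; exact energy_ofReal hk hA0 hB0 iAB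
      _ ≤ ENNReal.ofReal ((bilin k A A) ^ (1 / 2 : ℝ) * (bilin k B B) ^ (1 / 2 : ℝ)) := by
          apply ENNReal.ofReal_le_ofReal
          rw [← Real.sqrt_eq_rpow, ← Real.sqrt_eq_rpow, ← Real.sqrt_mul nAA]
          exact Real.le_sqrt_of_sq_le hcs
      _ = (energy k (tr a n) (tr a n)) ^ (1 / 2 : ℝ) *
          (energy k (tr b n) (tr b n)) ^ (1 / 2 : ℝ) := by
          rw [ENNReal.ofReal_mul (by positivity), hA, hB, energy_ofReal hk hA0 hA0 iAA,
            energy_ofReal hk hB0 hB0 iBB, ENNReal.ofReal_rpow_of_nonneg nAA (by norm_num),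
            ENNReal.ofReal_rpow_of_nonneg nBB (by norm_num)]
      _ ≤ _ := by
          have h1 : energy k (tr a n) (tr a n) ≤ energy k a a := energy_mono (htle a n) (htle a n)
          have h2 : energy k (tr b n) (tr b n) ≤ energy k b b := energy_mono (htle b n) (htle b n)
          gcongr
  refine le_of_tendsto' (lintegral_tendsto_of_tendsto_of_monotone (fun n => ?_)
    (ae_of_all _ fun p => ?_) (ae_of_all _ fun p => ?_)) hbound
  · exact ((aemeasurable_ofReal_comp_sub hk.locallyIntegrable).mul
      ((htm ha n).comp measurable_fst).aemeasurable).mul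
      ((htm hb n).comp measurable_snd).aemeasurable
  · intro m n hmn
    have h1 := htmono a p.1 hmn
    have h2 := htmono b p.2 hmn
    dsimp only at h1 h2 ⊢
    gcongr
  · have h1 : Tendsto (fun n => tr a n p.1 * tr b n p.2) atTop (𝓝 (a p.1 * b p.2)) := by
      by_cases ha0 : a p.1 = 0
      · have : ∀ n, tr a n p.1 = 0 := fun n => le_antisymm ((htle a n _).trans ha0.le) zero_le
        simp [this, ha0]
      by_cases hb0 : b p.2 = 0
      · have : ∀ n, tr b n p.2 = 0 := fun n => le_antisymm ((htle b n _).trans hb0.le) zero_le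
        simp [this, hb0]
      exact ENNReal.Tendsto.mul (htsup a _) (Or.inl ha0) (htsup b _) (Or.inl hb0)
    have h2 := ENNReal.Tendsto.const_mul (a := ENNReal.ofReal (k (p.1 - p.2))) h1
      (Or.inr ENNReal.ofReal_ne_top)
    simpa only [mul_assoc] using h2

theorem bilin_integrable_cross (hk : IsPDKernel k) {g h : E → ℝ} (hg : Measurable g)
    (hh : Measurable h)
    (hgg : Integrable (fun p : E × E => k (p.1 - p.2) * g p.1 * g p.2))
    (hhh : Integrable (fun p : E × E => k (p.1 - p.2) * h p.1 * h p.2)) :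
    Integrable (fun p : E × E => k (p.1 - p.2) * g p.1 * h p.2) := by
  rw [bilin_integrable_iff hk hg hg] at hgg
  rw [bilin_integrable_iff hk hh hh] at hhh
  rw [bilin_integrable_iff hk hg hh]
  refine (energy_le_sqrt hk hg.enorm hh.enorm).trans_lt (ENNReal.mul_lt_top ?_ ?_)
  · exact ENNReal.rpow_lt_top_of_nonneg (by norm_num) hgg.ne
  · exact ENNReal.rpow_lt_top_of_nonneg (by norm_num) hhh.ne

/-- The Cauchy–Schwarz inequality for signed functions of finite absolute energy. -/
theorem bilin_sq_le (hk : IsPDKernel k) {g h : E → ℝ} (hg : Measurable g) (hh : Measurable h)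
    (hgg : Integrable (fun p : E × E => k (p.1 - p.2) * g p.1 * g p.2))
    (hhh : Integrable (fun p : E × E => k (p.1 - p.2) * h p.1 * h p.2)) :
    bilin k g h ^ 2 ≤ bilin k g g * bilin k h h :=
  bilin_sq_le_aux hk hg hh hgg (bilin_integrable_cross hk hg hh hgg hhh) hhh

end Forms

theorem IsCovarianceKernel.isPDKernel {f : ℝ → ℝ} (hf : IsCovarianceKernel f) : IsPDKernel f :=
  ⟨hf.nonneg, hf.symm, hf.locallyIntegrable, hf.nonnegDef⟩

/-- The exchange `((x, y), (r, s)) ↦ ((x, r), (y, s))` of the two middle variables. -/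
def middleSwap : (ℝ × ℝ) × (ℝ × ℝ) ≃ᵐ (ℝ × ℝ) × (ℝ × ℝ) where
  toEquiv := Equiv.prodProdProdComm ℝ ℝ ℝ ℝ
  measurable_toFun := by
    change Measurable fun p : (ℝ × ℝ) × (ℝ × ℝ) => ((p.1.1, p.2.1), (p.1.2, p.2.2))
    fun_prop
  measurable_invFun := by
    change Measurable fun p : (ℝ × ℝ) × (ℝ × ℝ) => ((p.1.1, p.2.1), (p.1.2, p.2.2))
    fun_prop

theorem middleSwap_apply (p : (ℝ × ℝ) × (ℝ × ℝ)) :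
    middleSwap p = ((p.1.1, p.2.1), (p.1.2, p.2.2)) := rfl

theorem measurePreserving_middleSwap : MeasurePreserving middleSwap volume volume := by
  let ν : Measure ℝ := volume
  have a1 := measurePreserving_prodAssoc ν ν (ν.prod ν)
  have a2 := (measurePreserving_prodAssoc ν ν ν).symm
  have a3 := (Measure.measurePreserving_swap (μ := ν) (ν := ν)).prod (MeasurePreserving.id ν)
  have a4 := measurePreserving_prodAssoc ν ν ν
  have a5 := (MeasurePreserving.id ν).prod (a4.comp (a3.comp a2))
  have a6 := (measurePreserving_prodAssoc ν ν (ν.prod ν)).symm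
  exact a6.comp (a5.comp a1)

/-- The space-time kernel `(x, r) ↦ f(x) γ(r)`. -/
def tensorKernel (f γ : ℝ → ℝ) (p : ℝ × ℝ) : ℝ := f p.1 * γ p.2

theorem tensorKernel_locallyIntegrable {f γ : ℝ → ℝ} (hf : LocallyIntegrable f)
    (hγ : LocallyIntegrable γ) : LocallyIntegrable (tensorKernel f γ) := by
  rw [locallyIntegrable_iff]
  intro S hS
  obtain ⟨R, hR⟩ := hS.isBounded.exists_norm_le
  have h1 := hf.integrableOn_isCompact (isCompact_Icc (a := -R) (b := R))
  have h2 := hγ.integrableOn_isCompact (isCompact_Icc (a := -R) (b := R))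
  have h3 := Integrable.mul_prod h1 h2
  rw [Measure.prod_restrict] at h3
  refine IntegrableOn.mono_set (t := Icc (-R) R ×ˢ Icc (-R) R) h3 fun p hp => ?_
  have := hR p hp
  rw [Prod.norm_def, max_le_iff] at this
  exact ⟨abs_le.1 this.1, abs_le.1 this.2⟩

theorem integral_tensorKernel (f γ : ℝ → ℝ) (g h : ℝ × ℝ → ℝ) :
    bilin (tensorKernel f γ) g h = ∫ p : (ℝ × ℝ) × (ℝ × ℝ),
      f (p.1.1 - p.1.2) * γ (p.2.1 - p.2.2) * g (p.1.1, p.2.1) * h (p.1.2, p.2.2) := by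
  unfold bilin
  rw [← measurePreserving_middleSwap.integral_comp middleSwap.measurableEmbedding]
  rfl

theorem isPDKernel_tensorKernel {f γ : ℝ → ℝ} (hf : IsCovarianceKernel f)
    (hγ : IsCovarianceKernel γ) : IsPDKernel (tensorKernel f γ) where
  nonneg p := mul_nonneg (hf.nonneg _) (hγ.nonneg _)
  symm p := by simp only [tensorKernel, Prod.fst_neg, Prod.snd_neg, hf.symm, hγ.symm]
  locallyIntegrable := tensorKernel_locallyIntegrable hf.locallyIntegrable hγ.locallyIntegrable
  nonnegDef φ hφ hc := by
    obtain ⟨C, hC⟩ := hc.exists_bound_of_continuous hφ.continuous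
    obtain ⟨M, hM⟩ := hc.isCompact.isBounded.exists_norm_le
    have := full_form_nonneg (M := M) hf hγ hφ.continuous hC fun p hp => by
      have := hM p (subset_tsupport _ hp)
      rw [Prod.norm_def, Real.norm_eq_abs, Real.norm_eq_abs] at this
      exact max_le_iff.mp this
    rw [← integral_tensorKernel] at this
    exact this

section VectorCS

variable {E : Type*} [NormedAddCommGroup E] [NormedSpace ℝ E] [FiniteDimensional ℝ E]
  [MeasureSpace E] [BorelSpace E] [(volume : Measure E).IsAddHaarMeasure] {k : E → ℝ}

theorem integrable_kernel_mul (hk : LocallyIntegrable k) {g : E → ℝ} (hg : Continuous g)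
    (hgc : HasCompactSupport g) (w : E) : Integrable fun y => k (w - y) * g y := by
  have h := hgc.convolutionExists_right (ContinuousLinearMap.mul ℝ ℝ) hk hg w
  have h2 := h.integrable_swap
  simpa using h2

theorem continuous_kernel_integral (hk : LocallyIntegrable k) {g : E → ℝ} (hg : Continuous g)
    (hgc : HasCompactSupport g) : Continuous fun w => ∫ y, k (w - y) * g y := by
  have h := hgc.continuous_convolution_right (ContinuousLinearMap.mul ℝ ℝ) hk hg
  refine h.congr fun w => ?_
  rw [convolution_eq_swap]
  rfl

theorem bilin_eq_integral {g h : E → ℝ}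
    (hi : Integrable (fun p : E × E => k (p.1 - p.2) * g p.1 * h p.2)) :
    bilin k g h = ∫ w, g w * ∫ y, k (w - y) * h y := by
  unfold bilin
  rw [Measure.volume_eq_prod, integral_prod _ hi]
  refine integral_congr_ae (ae_of_all _ fun w => ?_)
  dsimp only
  rw [← integral_const_mul]
  exact integral_congr_ae (ae_of_all _ fun y => by dsimp only; ring)

theorem integrable_mul_kernel_integral {g h : E → ℝ}
    (hi : Integrable (fun p : E × E => k (p.1 - p.2) * g p.1 * h p.2)) :
    Integrable fun w => g w * ∫ y, k (w - y) * h y := by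
  rw [Measure.volume_eq_prod] at hi
  refine hi.integral_prod_left.congr (ae_of_all _ fun w => ?_)
  dsimp only
  rw [← integral_const_mul]
  exact integral_congr_ae (ae_of_all _ fun y => by dsimp only; ring)

theorem bilin_integrable_of_continuous (hk : LocallyIntegrable k) {g h : E → ℝ}
    (hg : Continuous g) (hgc : HasCompactSupport g) (hh : Continuous h)
    (hhc : HasCompactSupport h) :
    Integrable (fun p : E × E => k (p.1 - p.2) * g p.1 * h p.2) := by
  obtain ⟨C, hC⟩ := hgc.exists_bound_of_continuous hg
  obtain ⟨M, hM⟩ := hgc.isCompact.isBounded.exists_norm_le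
  obtain ⟨C', hC'⟩ := hhc.exists_bound_of_continuous hh
  obtain ⟨M', hM'⟩ := hhc.isCompact.isBounded.exists_norm_le
  exact bilin_integrable_of_bounded hk (M := max M M') (C := max C C') hg.measurable hh.measurable
    (fun p => (hC p).trans (le_max_left _ _)) (fun p => (hC' p).trans (le_max_right _ _))
    (fun p hp => (hM p (subset_tsupport _ hp)).trans (le_max_left _ _))
    (fun p hp => (hM' p (subset_tsupport _ hp)).trans (le_max_right _ _))

/-- A factorisation of a positive semidefinite form as a sum of squares of linear forms. -/
theorem Matrix.PosSemidef.exists_factor {ι : Type*} [Fintype ι] {P : Matrix ι ι ℝ}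
    (hP : P.PosSemidef) : ∃ B : Matrix ι ι ℝ, ∀ i j, P i j = ∑ l, B l i * B l j := by
  classical
  open scoped MatrixOrder in
  obtain ⟨B, hB⟩ := CStarAlgebra.nonneg_iff_eq_star_mul_self.mp hP.nonneg
  refine ⟨B, fun i j => ?_⟩
  rw [hB, Matrix.mul_apply]
  rfl

/-- A Cauchy–Schwarz inequality for vector-valued functions: with `Gᵢ = k * gᵢ` and `P` positive
semidefinite, `∫ a (∑ᵢⱼ Pᵢⱼ Gᵢ Gⱼ)^{1/2}` is at most the product of the energy norms of `a` and of
`(gᵢ)`, the latter taken with respect to `P`. It is the scalar inequality for the functions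
`a eₗ`, where `e` is the unit vector in the direction of the vector `B G`, and `P = Bᵀ B`. -/
theorem lintegral_mul_sqrt_le (hk : IsPDKernel k) {ι : Type*} [Fintype ι] {P : Matrix ι ι ℝ}
    (hP : P.PosSemidef) {g : ι → E → ℝ} (hg : ∀ i, Continuous (g i))
    (hgc : ∀ i, HasCompactSupport (g i)) {a : E → ℝ} (ha : Measurable a) (ha0 : ∀ x, 0 ≤ a x)
    (hfin : energy k (fun x => ENNReal.ofReal (a x)) (fun x => ENNReal.ofReal (a x)) ≠ ∞) :
    ∫⁻ w, ENNReal.ofReal (a w * √(∑ i, ∑ j, P i j * (∫ y, k (w - y) * g i y) *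
        (∫ y, k (w - y) * g j y))) ≤
      (energy k (fun x => ENNReal.ofReal (a x)) (fun x => ENNReal.ofReal (a x))) ^ (1 / 2 : ℝ) *
        ENNReal.ofReal (√(∑ i, ∑ j, P i j * bilin k (g i) (g j))) := by
  obtain ⟨B, hB⟩ := hP.exists_factor
  let G : ι → E → ℝ := fun i w => ∫ y, k (w - y) * g i y
  let g' : ι → E → ℝ := fun l y => ∑ i, B l i * g i y
  let G' : ι → E → ℝ := fun l w => ∑ i, B l i * G i w
  have hkl := hk.locallyIntegrable
  have hg'c : ∀ l, Continuous (g' l) := fun l =>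
    continuous_finsetSum _ fun i _ => (hg i).const_mul _
  have hg's : ∀ l, HasCompactSupport (g' l) := fun l => by
    have : ∀ s : Finset ι, HasCompactSupport fun y => ∑ i ∈ s, B l i * g i y := by
      classical
      intro s
      induction s using Finset.induction_on with
      | empty => simp only [Finset.sum_empty]; exact HasCompactSupport.zero
      | insert i s hi ih =>
        simp only [Finset.sum_insert hi]
        exact ((hgc i).mul_left).add ih
    exact this _
  have hG' : ∀ l w, ∫ y, k (w - y) * g' l y = G' l w := fun l w => by
    have e : ∀ y, k (w - y) * g' l y = ∑ i, B l i * (k (w - y) * g i y) := fun y => by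
      simp only [g', Finset.mul_sum]
      exact Finset.sum_congr rfl fun i _ => by ring
    rw [integral_congr_ae (ae_of_all _ e), integral_finsetSum _ fun i _ =>
      (integrable_kernel_mul hkl (hg i) (hgc i) w).const_mul _]
    exact Finset.sum_congr rfl fun i _ => integral_const_mul _ _
  have hG'm : ∀ l, Measurable (G' l) := fun l =>
    Finset.measurable_fun_sum _ fun i _ =>
      ((continuous_kernel_integral hkl (hg i) (hgc i)).measurable).const_mul _
  have hPG : ∀ w, ∑ i, ∑ j, P i j * G i w * G j w = ∑ l, G' l w ^ 2 := fun w => by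
    simp only [hB, G', pow_two, Finset.sum_mul, Finset.mul_sum]
    rw [Finset.sum_congr rfl fun i _ => Finset.sum_comm, Finset.sum_comm]
    exact Finset.sum_congr rfl fun l _ => Finset.sum_congr rfl fun i _ =>
      Finset.sum_congr rfl fun j _ => by ring
  -- `s` is the length of the vector `B G`, and `e = B G / s` is its direction; it is zero where
  -- `s = 0`.
  let s : E → ℝ := fun w => √(∑ l, G' l w ^ 2)
  let e : ι → E → ℝ := fun l w => G' l w / s w
  have hsm : Measurable s := (Finset.measurable_fun_sum _ fun l _ => (hG'm l).pow_const 2).sqrt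
  have hem : ∀ l, Measurable (e l) := fun l => (hG'm l).div hsm
  have hs2 : ∀ w, s w ^ 2 = ∑ l, G' l w ^ 2 := fun w =>
    Real.sq_sqrt (Finset.sum_nonneg fun l _ => sq_nonneg _)
  have hee : ∀ w, ∑ l, e l w ^ 2 ≤ 1 := fun w => by
    simp only [e, div_pow, ← Finset.sum_div, ← hs2]
    exact div_self_le_one _
  have hes : ∀ w, s w = ∑ l, e l w * G' l w := fun w => by
    have : ∑ l, e l w * G' l w = s w ^ 2 / s w := by
      rw [hs2, Finset.sum_div]
      exact Finset.sum_congr rfl fun l _ => by simp only [e]; ring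
    rw [this, pow_two]
    by_cases h : s w = 0
    · simp [h]
    · rw [mul_div_assoc, div_self h, mul_one]
  have he1 : ∀ l w, |e l w| ≤ 1 := fun l w => by
    rw [← sq_le_one_iff_abs_le_one]
    exact (Finset.single_le_sum (f := fun l => e l w ^ 2) (fun _ _ => sq_nonneg _)
      (Finset.mem_univ l)).trans (hee w)
  have iaa : Integrable (fun p : E × E => k (p.1 - p.2) * a p.1 * a p.2) := by
    rw [bilin_integrable_iff hk ha ha]
    have : (fun x => ‖a x‖ₑ) = fun x => ENNReal.ofReal (a x) :=
      funext fun x => Real.enorm_of_nonneg (ha0 x)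
    rw [this]
    exact lt_top_iff_ne_top.2 hfin
  let ae : ι → E → ℝ := fun l w => a w * e l w
  have haem : ∀ l, Measurable (ae l) := fun l => ha.mul (hem l)
  have iae : ∀ l, Integrable (fun p : E × E => k (p.1 - p.2) * ae l p.1 * ae l p.2) := fun l => by
    refine iaa.mono (((aestronglyMeasurable_comp_sub hkl).mul
      ((haem l).comp measurable_fst).aestronglyMeasurable).mul
      ((haem l).comp measurable_snd).aestronglyMeasurable) (ae_of_all _ fun p => ?_)
    simp only [Real.norm_eq_abs, abs_mul, ae]
    have h1 : |a p.1| * |e l p.1| ≤ |a p.1| := mul_le_of_le_one_right (abs_nonneg _) (he1 l _)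
    have h2 : |a p.2| * |e l p.2| ≤ |a p.2| := mul_le_of_le_one_right (abs_nonneg _) (he1 l _)
    exact mul_le_mul (mul_le_mul_of_nonneg_left h1 (abs_nonneg _)) h2 (by positivity)
      (by positivity)
  have igg : ∀ i j, Integrable (fun p : E × E => k (p.1 - p.2) * g i p.1 * g j p.2) := fun i j =>
    bilin_integrable_of_continuous hkl (hg i) (hgc i) (hg j) (hgc j)
  have ig' : ∀ l, Integrable (fun p : E × E => k (p.1 - p.2) * g' l p.1 * g' l p.2) := fun l =>
    bilin_integrable_of_continuous hkl (hg'c l) (hg's l) (hg'c l) (hg's l)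
  have iag : ∀ l, Integrable (fun p : E × E => k (p.1 - p.2) * ae l p.1 * g' l p.2) := fun l =>
    bilin_integrable_cross hk (haem l) (hg'c l).measurable (iae l) (ig' l)
  have hint : ∀ l, Integrable fun w => ae l w * G' l w := fun l => by
    have := integrable_mul_kernel_integral (iag l)
    simpa only [hG'] using this
  have has : ∀ w, a w * s w = ∑ l, ae l w * G' l w := fun w => by
    rw [hes, Finset.mul_sum]
    exact Finset.sum_congr rfl fun l _ => by simp only [ae]; ring
  -- `∑ₗ eₗ(x) eₗ(y) ≤ 1`, so the energies of the functions `a eₗ` add up to at most that of `a`.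
  have hsum1 : ∑ l, bilin k (ae l) (ae l) ≤ bilin k a a := by
    unfold bilin
    rw [← integral_finsetSum _ fun l _ => iae l]
    refine integral_mono (integrable_finsetSum _ fun l _ => iae l) iaa fun p => ?_
    have h1 : ∑ l, e l p.1 * e l p.2 ≤ 1 := by
      have h2 : ∀ l, e l p.1 * e l p.2 ≤ (e l p.1 ^ 2 + e l p.2 ^ 2) / 2 := fun l => by
        nlinarith [sq_nonneg (e l p.1 - e l p.2)]
      refine (Finset.sum_le_sum fun l _ => h2 l).trans ?_
      rw [← Finset.sum_div, Finset.sum_add_distrib]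
      linarith [hee p.1, hee p.2]
    have h3 : ∑ l, k (p.1 - p.2) * ae l p.1 * ae l p.2 =
        (k (p.1 - p.2) * a p.1 * a p.2) * ∑ l, e l p.1 * e l p.2 := by
      rw [Finset.mul_sum]
      exact Finset.sum_congr rfl fun l _ => by simp only [ae]; ring
    dsimp only
    rw [h3]
    exact mul_le_of_le_one_right (mul_nonneg (mul_nonneg (hk.nonneg _) (ha0 _)) (ha0 _)) h1
  have hsum2 : ∑ l, bilin k (g' l) (g' l) = ∑ i, ∑ j, P i j * bilin k (g i) (g j) := by
    have h1 : ∀ l, bilin k (g' l) (g' l) =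
        ∑ i, ∑ j, B l i * B l j * bilin k (g i) (g j) := fun l => by
      have e1 : ∀ p : E × E, k (p.1 - p.2) * g' l p.1 * g' l p.2 =
          ∑ i, ∑ j, B l i * B l j * (k (p.1 - p.2) * g i p.1 * g j p.2) := fun p => by
        simp only [g']
        rw [mul_assoc, Finset.sum_mul_sum, Finset.mul_sum]
        refine Finset.sum_congr rfl fun i _ => ?_
        rw [Finset.mul_sum]
        exact Finset.sum_congr rfl fun j _ => by ring
      unfold bilin
      rw [integral_congr_ae (ae_of_all _ e1), integral_finsetSum _ fun i _ =>
        integrable_finsetSum _ fun j _ => (igg i j).const_mul _]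
      refine Finset.sum_congr rfl fun i _ => ?_
      rw [integral_finsetSum _ fun j _ => (igg i j).const_mul _]
      exact Finset.sum_congr rfl fun j _ => integral_const_mul _ _
    simp only [h1, hB, Finset.sum_mul]
    rw [Finset.sum_comm]
    exact Finset.sum_congr rfl fun i _ => Finset.sum_comm
  have n1 : ∀ l, 0 ≤ bilin k (ae l) (ae l) := fun l => bilin_nonneg hk (haem l) (iae l)
  have n2 : ∀ l, 0 ≤ bilin k (g' l) (g' l) := fun l => bilin_nonneg hk (hg'c l).measurable (ig' l)
  have hmain : ∫ w, a w * s w ≤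
      √(bilin k a a) * √(∑ i, ∑ j, P i j * bilin k (g i) (g j)) := by
    calc ∫ w, a w * s w = ∑ l, bilin k (ae l) (g' l) := by
          simp only [has]
          rw [integral_finsetSum _ fun l _ => hint l]
          refine Finset.sum_congr rfl fun l _ => ?_
          rw [bilin_eq_integral (iag l)]
          simp only [hG']
      _ ≤ ∑ l, √(bilin k (ae l) (ae l)) * √(bilin k (g' l) (g' l)) := by
          refine Finset.sum_le_sum fun l _ => ?_
          rw [← Real.sqrt_mul (n1 l)]
          exact Real.le_sqrt_of_sq_le
            (bilin_sq_le hk (haem l) (hg'c l).measurable (iae l) (ig' l))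
      _ ≤ √(∑ l, bilin k (ae l) (ae l)) * √(∑ l, bilin k (g' l) (g' l)) :=
          Real.sum_sqrt_mul_sqrt_le _ n1 n2
      _ ≤ _ := by
          rw [hsum2]
          gcongr
  have has_int : Integrable fun w => a w * s w := by
    simp only [has]
    exact integrable_finsetSum _ fun l _ => hint l
  have hL : ∫⁻ w, ENNReal.ofReal (a w * √(∑ i, ∑ j, P i j * (∫ y, k (w - y) * g i y) *
        (∫ y, k (w - y) * g j y))) = ENNReal.ofReal (∫ w, a w * s w) := by
    rw [ofReal_integral_eq_lintegral_ofReal has_int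
      (ae_of_all _ fun w => mul_nonneg (ha0 w) (Real.sqrt_nonneg _))]
    refine lintegral_congr fun w => ?_
    change ENNReal.ofReal (a w * √(∑ i, ∑ j, P i j * G i w * G j w)) = _
    rw [hPG]
  rw [hL, energy_ofReal hk ha0 ha0 iaa, ENNReal.ofReal_rpow_of_nonneg (bilin_nonneg hk ha iaa)
    (by norm_num), ← Real.sqrt_eq_rpow, ← ENNReal.ofReal_mul (Real.sqrt_nonneg _)]
  exact ENNReal.ofReal_le_ofReal hmain

end VectorCS

/-! ### The Kimura kernel -/

theorem besselI_summable (n : ℕ) (x : ℝ) : Summable fun m : ℕ =>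
    (x / 2) ^ (2 * m + n) / ((m.factorial : ℝ) * ((m + n).factorial : ℝ)) := by
  have h := (Real.summable_pow_div_factorial ((x / 2) ^ 2)).mul_left (|x / 2| ^ n)
  refine Summable.of_norm_bounded h fun m => ?_
  have h1 : (1 : ℝ) ≤ (m + n).factorial := by exact_mod_cast Nat.succ_le_of_lt (Nat.factorial_pos _)
  have h2 : (0 : ℝ) < m.factorial := by exact_mod_cast Nat.factorial_pos _
  rw [norm_div, norm_mul, Real.norm_natCast, Real.norm_natCast, norm_pow, pow_add, pow_mul,
    Real.norm_eq_abs, sq_abs, mul_comm, mul_div_assoc]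
  gcongr
  exact le_mul_of_one_le_right h2.le h1

theorem besselI_measurable (n : ℕ) : Measurable (besselI n) := by
  refine measurable_of_tendsto_metrizable (f := fun N x => ∑ m ∈ Finset.range N,
    (x / 2) ^ (2 * m + n) / ((m.factorial : ℝ) * ((m + n).factorial : ℝ))) (fun N => ?_) ?_
  · fun_prop
  · rw [tendsto_pi_nhds]
    exact fun x => (besselI_summable n x).hasSum.tendsto_sum_nat

theorem kimuraKernel_measurable :
    Measurable fun p : ℝ × ℝ × ℝ => kimuraKernel p.1 p.2.1 p.2.2 := by
  unfold kimuraKernel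
  have h := besselI_measurable 1
  fun_prop

theorem besselI_nonneg (n : ℕ) {x : ℝ} (hx : 0 ≤ x) : 0 ≤ besselI n x :=
  tsum_nonneg fun m => by positivity

theorem kimuraKernel_nonneg (z w : ℝ) {t : ℝ} (ht : 0 < t) : 0 ≤ kimuraKernel z w t := by
  unfold kimuraKernel
  have := besselI_nonneg 1 (x := 2 * √(z * w) / t) (by positivity)
  positivity

/-- The kernel `q₀(z, ·, t)` is a mixture of Gamma densities with Poisson weights. -/
theorem kimuraKernel_hasSum {z w t : ℝ} (hz : 0 < z) (hw : 0 < w) (ht : 0 < t) :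
    HasSum (fun m : ℕ => Real.exp (-(z / t)) * (z / t) ^ (m + 1) / (m + 1).factorial *
      (1 / (m.factorial * t ^ (m + 1))) * (w ^ m * Real.exp (-(1 / t * w))))
      (kimuraKernel z w t) := by
  have h := ((besselI_summable 1 (2 * √(z * w) / t)).hasSum).mul_left
    (√(z / w) * (Real.exp (-(z + w) / t) / t))
  change HasSum _ (kimuraKernel z w t) at h
  refine h.congr_fun ?_
  intro m
  have e1 : 2 * √(z * w) / t / 2 = √(z * w) / t := by ring
  have e2 : Real.exp (-(z + w) / t) = Real.exp (-(z / t)) * Real.exp (-(1 / t * w)) := by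
    rw [← Real.exp_add]; congr 1; ring
  have e3 : √(z / w) * √(z * w) = z := by
    rw [← Real.sqrt_mul (by positivity)]
    rw [show z / w * (z * w) = z ^ 2 by field_simp, Real.sqrt_sq hz.le]
  have e4 : √(z * w) ^ (2 * m) = (z * w) ^ m := by
    rw [pow_mul, Real.sq_sqrt (by positivity)]
  rw [e1, e2, div_pow √(z * w), pow_succ √(z * w), e4]
  have e5 : √(z / w) * (Real.exp (-(z / t)) * Real.exp (-(1 / t * w)) / t) *
      ((z * w) ^ m * √(z * w) / t ^ (2 * m + 1) / (m.factorial * (m + 1).factorial)) =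
      (√(z / w) * √(z * w)) * (Real.exp (-(z / t)) * Real.exp (-(1 / t * w)) / t) *
      ((z * w) ^ m / t ^ (2 * m + 1) / (m.factorial * (m + 1).factorial)) := by ring
  rw [e5, e3, mul_pow, div_pow]
  have := Nat.factorial_ne_zero m
  have := Nat.factorial_ne_zero (m + 1)
  field_simp
  ring

theorem lintegral_pow_mul_exp (m : ℕ) {c : ℝ} (hc : 0 < c) :
    ∫⁻ w in Ioi (0 : ℝ), ENNReal.ofReal (w ^ m * Real.exp (-(c * w))) =
      ENNReal.ofReal (m.factorial / c ^ (m + 1)) := by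
  have h := Real.integral_rpow_mul_exp_neg_mul_Ioi (a := m + 1) (r := c) (by positivity) hc
  rw [add_sub_cancel_right, Real.Gamma_nat_eq_factorial] at h
  have e : (1 / c) ^ ((m : ℝ) + 1) * (m.factorial : ℝ) = m.factorial / c ^ (m + 1) := by
    rw [show (m : ℝ) + 1 = ((m + 1 : ℕ) : ℝ) by push_cast; ring, Real.rpow_natCast]
    rw [div_pow, one_pow]; ring
  rw [e] at h
  simp only [Real.rpow_natCast] at h
  have hpos : (0 : ℝ) < m.factorial / c ^ (m + 1) := by
    have : (0 : ℝ) < m.factorial := by exact_mod_cast Nat.factorial_pos _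
    positivity
  have hi : IntegrableOn (fun w : ℝ => w ^ m * Real.exp (-(c * w))) (Ioi 0) := by
    by_contra hcon
    rw [integral_undef hcon] at h
    exact hpos.ne h
  rw [← h, ofReal_integral_eq_lintegral_ofReal hi]
  filter_upwards [ae_restrict_mem measurableSet_Ioi] with w hw
  have : (0 : ℝ) < w := hw
  simp only [Pi.zero_apply]
  positivity

theorem ofReal_kimuraKernel {z w t : ℝ} (hz : 0 < z) (hw : 0 < w) (ht : 0 < t) :
    ENNReal.ofReal (kimuraKernel z w t) = ∑' m : ℕ,
      ENNReal.ofReal (Real.exp (-(z / t)) * (z / t) ^ (m + 1) / (m + 1).factorial *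
      (1 / (m.factorial * t ^ (m + 1)))) * ENNReal.ofReal (w ^ m * Real.exp (-(1 / t * w))) := by
  have h := kimuraKernel_hasSum hz hw ht
  rw [← h.tsum_eq, ENNReal.ofReal_tsum_of_nonneg (fun m => by positivity) h.summable]
  exact tsum_congr fun m => ENNReal.ofReal_mul (by positivity)

/-- The total mass is `1 - e^{-z/t}`, the probability that the Poisson variable is positive; the
diffusion is absorbed at `0`. -/
theorem lintegral_kimuraKernel_le {z t : ℝ} (hz : 0 < z) (ht : 0 < t) :
    ∫⁻ w in Ioi (0 : ℝ), ENNReal.ofReal (kimuraKernel z w t) ≤ 1 := by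
  have h1 : ∫⁻ w in Ioi (0 : ℝ), ENNReal.ofReal (kimuraKernel z w t) =
      ∑' m : ℕ, ENNReal.ofReal (Real.exp (-(z / t)) * (z / t) ^ (m + 1) / (m + 1).factorial) := by
    rw [setLIntegral_congr_fun measurableSet_Ioi fun w hw => ofReal_kimuraKernel hz hw ht,
      lintegral_tsum fun m => by fun_prop]
    refine tsum_congr fun m => ?_
    rw [lintegral_const_mul _ (by fun_prop), lintegral_pow_mul_exp m (by positivity),
      ← ENNReal.ofReal_mul (by positivity)]
    congr 1
    have := Nat.factorial_ne_zero m
    rw [mul_assoc, one_div, one_div, inv_pow, div_inv_eq_mul, inv_mul_cancel₀ (by positivity),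
      mul_one]
  have h2 : Summable fun m : ℕ => (z / t) ^ (m + 1) / ((m + 1).factorial : ℝ) :=
    (summable_nat_add_iff 1).2 (Real.summable_pow_div_factorial (z / t))
  have h3 : ∑' m : ℕ, (z / t) ^ (m + 1) / ((m + 1).factorial : ℝ) ≤ Real.exp (z / t) := by
    rw [Real.exp_eq_exp_ℝ, NormedSpace.exp_eq_tsum_div]
    have := (Real.summable_pow_div_factorial (z / t)).sum_add_tsum_nat_add 1
    simp only [Finset.range_one, Finset.sum_singleton, pow_zero, Nat.factorial_zero,
      Nat.cast_one, div_one] at this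
    linarith
  rw [h1]
  simp only [mul_div_assoc]
  rw [← ENNReal.ofReal_tsum_of_nonneg (fun m => by positivity) (h2.mul_left _), tsum_mul_left,
    ← ENNReal.ofReal_one]
  apply ENNReal.ofReal_le_ofReal
  calc Real.exp (-(z / t)) * _ ≤ Real.exp (-(z / t)) * Real.exp (z / t) := by gcongr
    _ = 1 := by rw [← Real.exp_add]; simp

/-- The coefficients of `e^y I₀(y)`. -/
noncomputable def expBesselCoeff (n : ℕ) : ℝ := n.centralBinom / (n.factorial * 2 ^ n)

theorem expBesselCoeff_nonneg (n : ℕ) : 0 ≤ expBesselCoeff n := by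
  unfold expBesselCoeff; positivity

theorem expBesselCoeff_le (n : ℕ) : expBesselCoeff n ≤ 2 ^ n / n.factorial := by
  unfold expBesselCoeff
  have h : (n.centralBinom : ℝ) ≤ 4 ^ n := by
    have := Nat.choose_le_two_pow (2 * n) n
    rw [pow_mul] at this
    norm_num at this
    exact_mod_cast this
  have h2 : (0 : ℝ) < n.factorial := by exact_mod_cast Nat.factorial_pos _
  rw [div_le_div_iff₀ (by positivity) h2]
  have h4 : (4 : ℝ) ^ n = 2 ^ n * 2 ^ n := by rw [← mul_pow]; norm_num
  rw [h4] at h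
  nlinarith

theorem expBesselCoeff_summable (y : ℝ) : Summable fun n => expBesselCoeff n * y ^ n := by
  refine Summable.of_norm_bounded (Real.summable_pow_div_factorial (2 * |y|)) fun n => ?_
  rw [norm_mul, norm_pow, Real.norm_of_nonneg (expBesselCoeff_nonneg n), Real.norm_eq_abs, mul_pow,
    mul_div_right_comm]
  gcongr
  exact expBesselCoeff_le n

/-- The coefficient of `X ^ n` in `(1 + X)^{2n} = (2X + (1 + X²))^n`. -/
theorem centralBinom_eq_sum (n : ℕ) : (n.centralBinom : ℝ) =
    ∑ p ∈ Finset.HasAntidiagonal.antidiagonal n,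
    (n.choose p.1 : ℝ) * 2 ^ p.1 * (if 2 ∣ p.2 then (p.2.choose (p.2 / 2) : ℝ) else 0) := by
  have h : ((1 + Polynomial.X : Polynomial ℝ) ^ (2 * n)) =
      (2 * Polynomial.X + (1 + Polynomial.X ^ 2)) ^ n := by
    rw [pow_mul]; congr 1; ring
  have h1 := congrArg (fun p => Polynomial.coeff p n) h
  simp only [Polynomial.coeff_one_add_X_pow] at h1
  rw [Nat.centralBinom_eq_two_mul_choose, h1, (Commute.all _ _).add_pow',
    Polynomial.finsetSum_coeff]
  refine Finset.sum_congr rfl fun p hp => ?_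
  have hp' : p.1 + p.2 = n := Finset.HasAntidiagonal.mem_antidiagonal.1 hp
  have e : (2 * Polynomial.X : Polynomial ℝ) ^ p.1 * (1 + Polynomial.X ^ 2) ^ p.2 =
      Polynomial.C ((2 : ℝ) ^ p.1) *
        (Polynomial.expand ℝ 2 ((1 + Polynomial.X) ^ p.2) * Polynomial.X ^ p.1) := by
    simp only [map_pow, map_add, map_one, Polynomial.expand_X, mul_pow, Polynomial.C_ofNat]
    ring
  have e2 : (Polynomial.expand ℝ 2 ((1 + Polynomial.X) ^ p.2) * Polynomial.X ^ p.1).coeff n =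
      (if 2 ∣ p.2 then (p.2.choose (p.2 / 2) : ℝ) else 0) := by
    conv_lhs => rw [← hp', add_comm p.1, Polynomial.coeff_mul_X_pow]
    rw [Polynomial.coeff_expand (by norm_num)]
    simp only [Polynomial.coeff_one_add_X_pow]
  rw [Polynomial.coeff_smul, e, Polynomial.coeff_C_mul, e2, nsmul_eq_mul, mul_assoc]

/-- The power series of `e^y I₀(y)`, by the Cauchy product and the expansion of `(2X + (1 +
X²))^n`. -/
theorem exp_mul_besselI_zero (y : ℝ) :
    Real.exp y * besselI 0 y = ∑' n, expBesselCoeff n * y ^ n := by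
  -- `b j` is the coefficient sequence of `I₀`, indexed by all exponents with zeros at the odd
  -- ones, so that the Cauchy product with the exponential series applies.
  let b : ℕ → ℝ := fun j => if 2 ∣ j then (y / 2) ^ j / ((j / 2).factorial : ℝ) ^ 2 else 0
  have hinj : Function.Injective fun m : ℕ => 2 * m := fun a b h => by simpa using h
  have hsupp : Function.support b ⊆ range fun m : ℕ => 2 * m := fun j hj => by
    by_contra h
    apply hj
    have : ¬ 2 ∣ j := fun ⟨c, hc⟩ => h ⟨c, hc.symm⟩
    simp only [b, if_neg this]
  have hb2 : ∀ m : ℕ, b (2 * m) =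
      (y / 2) ^ (2 * m + 0) / ((m.factorial : ℝ) * ((m + 0).factorial : ℝ)) := fun m => by
    simp only [b, dvd_mul_right, if_true, Nat.mul_div_cancel_left m (by norm_num : 0 < 2),
      add_zero, pow_two]
  have hbs : Summable b := by
    rw [← hinj.summable_iff fun x hx => by
      by_contra h
      exact hx (hsupp h)]
    exact (besselI_summable 0 y).congr fun m => (hb2 m).symm
  have hbI : besselI 0 y = ∑' j, b j := by
    rw [← hinj.tsum_eq hsupp]
    exact tsum_congr fun m => (hb2 m).symm
  have hE := Real.summable_pow_div_factorial y
  rw [hbI, Real.exp_eq_exp_ℝ, NormedSpace.exp_eq_tsum_div,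
    tsum_mul_tsum_eq_tsum_sum_antidiagonal_of_summable_norm hE.norm hbs.norm]
  refine tsum_congr fun n => ?_
  unfold expBesselCoeff
  have hn : (n.factorial : ℝ) ≠ 0 := by exact_mod_cast Nat.factorial_ne_zero n
  rw [centralBinom_eq_sum, div_mul_eq_mul_div, eq_div_iff (by positivity), Finset.sum_mul,
    Finset.sum_mul]
  refine Finset.sum_congr rfl fun p hp => ?_
  have hp' : p.1 + p.2 = n := Finset.HasAntidiagonal.mem_antidiagonal.1 hp
  have h1 : (p.1.factorial : ℝ) ≠ 0 := by exact_mod_cast Nat.factorial_ne_zero _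
  simp only [b]
  split_ifs with hd
  · obtain ⟨c, hc⟩ := hd
    have hc2 : p.2 / 2 = c := by omega
    have h2 : (c.factorial : ℝ) ≠ 0 := by exact_mod_cast Nat.factorial_ne_zero _
    have e1 : (n.choose p.1 : ℝ) * (p.1.factorial * p.2.factorial) = n.factorial := by
      rw [← hp', ← mul_assoc, Nat.choose_symm_add]
      exact_mod_cast Nat.add_choose_mul_factorial_mul_factorial p.1 p.2
    have e2 : (p.2.choose c : ℝ) * (c.factorial * c.factorial) = p.2.factorial := by
      have := Nat.add_choose_mul_factorial_mul_factorial c c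
      rw [← two_mul, ← hc, mul_assoc] at this
      exact_mod_cast this
    rw [hc2, ← e1, ← e2, ← hp', pow_add, pow_add, div_pow]
    field_simp
  · simp

theorem kimuraU_eq (y : ℝ) :
    kimuraU y = Real.exp (-2 * y) * ((∑' n, expBesselCoeff n * y ^ n) - 1 / 2) := by
  rw [← exp_mul_besselI_zero]
  unfold kimuraU
  have : Real.exp (-2 * y) * Real.exp y = Real.exp (-y) := by rw [← Real.exp_add]; congr 1; ring
  rw [mul_sub, ← mul_assoc, this]; ring

/-- `-U'(y)`, which is also `∫ q₀(z, w, t)² dw` up to the factor `z / t²`, with `y = z / t`. -/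
noncomputable def kimuraUDeriv (y : ℝ) : ℝ :=
  Real.exp (-2 * y) * ∑' n : ℕ, (n + 1).centralBinom / (n + 2).factorial * (y / 2) ^ (n + 1)

theorem expBesselDeriv_summable (y : ℝ) :
    Summable fun n : ℕ => ((n : ℝ) + 1) * expBesselCoeff (n + 1) * y ^ n := by
  refine Summable.of_norm_bounded ((Real.summable_pow_div_factorial (2 * |y|)).mul_left 2)
    fun n => ?_
  have h := expBesselCoeff_le (n + 1)
  have h2 : (0 : ℝ) < n.factorial := by exact_mod_cast Nat.factorial_pos _
  rw [norm_mul, norm_pow, norm_mul, Real.norm_of_nonneg (expBesselCoeff_nonneg _),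
    Real.norm_eq_abs y, mul_pow, Real.norm_of_nonneg (by positivity)]
  calc ((n : ℝ) + 1) * expBesselCoeff (n + 1) * |y| ^ n
      ≤ ((n : ℝ) + 1) * (2 ^ (n + 1) / (n + 1).factorial) * |y| ^ n := by gcongr
    _ = 2 * (2 ^ n * |y| ^ n / n.factorial) := by
      rw [Nat.factorial_succ]; push_cast; field_simp; ring

theorem hasDerivAt_expBessel (y : ℝ) : HasDerivAt (fun y => ∑' n, expBesselCoeff n * y ^ n)
    (∑' n : ℕ, ((n : ℝ) + 1) * expBesselCoeff (n + 1) * y ^ n) y := by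
  have h0 : (∑' n : ℕ, ((n : ℝ) + 1) * expBesselCoeff (n + 1) * y ^ n) =
      ∑' n : ℕ, expBesselCoeff n * ((n : ℝ) * y ^ (n - 1)) := by
    have hs : Summable fun n : ℕ => expBesselCoeff n * ((n : ℝ) * y ^ (n - 1)) := by
      rw [← summable_nat_add_iff 1]
      refine (expBesselDeriv_summable y).congr fun n => ?_
      simp only [Nat.add_sub_cancel]; push_cast; ring
    rw [hs.tsum_eq_zero_add]
    simp only [Nat.cast_zero, zero_mul, mul_zero, zero_add, Nat.add_sub_cancel]
    refine tsum_congr fun n => ?_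
    push_cast; ring
  rw [h0]
  refine hasDerivAt_tsum_of_isPreconnected
    (u := fun n : ℕ => expBesselCoeff n * ((n : ℝ) * (|y| + 1) ^ (n - 1)))
    (t := Ioo (-(|y| + 1)) (|y| + 1)) (y₀ := y) ?_ isOpen_Ioo isPreconnected_Ioo
    (fun n x _ => (hasDerivAt_pow n x).const_mul _) (fun n x hx => ?_) ?_
    (expBesselCoeff_summable y) ?_
  · rw [← summable_nat_add_iff 1]
    refine (expBesselDeriv_summable (|y| + 1)).congr fun n => ?_
    simp only [Nat.add_sub_cancel]; push_cast; ring
  · rw [norm_mul, norm_mul, norm_pow, Real.norm_of_nonneg (expBesselCoeff_nonneg n),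
      Real.norm_natCast, Real.norm_eq_abs]
    have := expBesselCoeff_nonneg n
    have : |x| ≤ |y| + 1 := abs_le.2 ⟨hx.1.le, hx.2.le⟩
    gcongr
  all_goals
    constructor
    · linarith [neg_abs_le y]
    · linarith [le_abs_self y]

theorem hasDerivAt_kimuraU (y : ℝ) : HasDerivAt kimuraU (-kimuraUDeriv y) y := by
  have h1 : HasDerivAt (fun y : ℝ => Real.exp (-2 * y)) (Real.exp (-2 * y) * (-2)) y := by
    have := ((hasDerivAt_id y).const_mul (-2)).exp
    simpa using this
  have h2 := h1.mul ((hasDerivAt_expBessel y).sub_const (1 / 2))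
  have h3 : kimuraU = fun y => Real.exp (-2 * y) * ((∑' n, expBesselCoeff n * y ^ n) - 1 / 2) :=
    funext kimuraU_eq
  rw [h3]
  refine h2.congr_deriv ?_
  unfold kimuraUDeriv
  have hco : ∀ n : ℕ, 2 * (expBesselCoeff n * y ^ n) -
      ((n : ℝ) + 1) * expBesselCoeff (n + 1) * y ^ n =
      (n.centralBinom : ℝ) / (n + 1).factorial * (y / 2) ^ n := fun n => by
    have h : ((n : ℝ) + 1) * (n + 1).centralBinom = 2 * (2 * n + 1) * n.centralBinom := by
      exact_mod_cast Nat.succ_mul_centralBinom_succ n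
    have hn : (n.factorial : ℝ) ≠ 0 := by exact_mod_cast Nat.factorial_ne_zero n
    unfold expBesselCoeff
    rw [Nat.factorial_succ, div_pow]
    push_cast
    have h' : ((n + 1).centralBinom : ℝ) = 2 * (2 * n + 1) * n.centralBinom / (n + 1) := by
      rw [eq_div_iff (by positivity), ← h]; ring
    rw [h']
    field_simp
    ring
  have hs : Summable fun n : ℕ => (n.centralBinom : ℝ) / (n + 1).factorial * (y / 2) ^ n :=
    (((expBesselCoeff_summable y).mul_left 2).sub (expBesselDeriv_summable y)).congr hco
  have hsub : (2 * ∑' n, expBesselCoeff n * y ^ n) -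
      ∑' n : ℕ, ((n : ℝ) + 1) * expBesselCoeff (n + 1) * y ^ n =
      ∑' n : ℕ, (n.centralBinom : ℝ) / (n + 1).factorial * (y / 2) ^ n := by
    rw [← tsum_mul_left, ← ((expBesselCoeff_summable y).mul_left 2).tsum_sub
      (expBesselDeriv_summable y)]
    exact tsum_congr hco
  rw [hs.tsum_eq_zero_add] at hsub
  simp only [Nat.centralBinom_zero, zero_add, Nat.factorial_one, pow_zero, Nat.cast_one, div_one,
    mul_one] at hsub
  have e : ∀ n : ℕ, ((n + 1).centralBinom : ℝ) / (n + 1 + 1).factorial * (y / 2) ^ (n + 1) =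
    (n + 1).centralBinom / (n + 2).factorial * (y / 2) ^ (n + 1) := fun n => rfl
  simp only [e] at hsub
  linear_combination -Real.exp (-2 * y) * hsub

theorem kimuraUDeriv_nonneg {y : ℝ} (hy : 0 ≤ y) : 0 ≤ kimuraUDeriv y :=
  mul_nonneg (Real.exp_nonneg _) (tsum_nonneg fun n => by positivity)

theorem kimuraU_nonneg {y : ℝ} (hy : 0 ≤ y) : 0 ≤ kimuraU y := by
  rw [kimuraU_eq]
  refine mul_nonneg (Real.exp_nonneg _) ?_
  have := (expBesselCoeff_summable y).le_tsum 0 fun n _ =>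
    mul_nonneg (expBesselCoeff_nonneg n) (pow_nonneg hy n)
  simp only [expBesselCoeff, Nat.centralBinom_zero, Nat.factorial_zero, pow_zero, Nat.cast_one,
    mul_one, div_one] at this
  simp only [expBesselCoeff]
  linarith

theorem kimuraU_le_half {y : ℝ} (hy : 0 ≤ y) : kimuraU y ≤ 1 / 2 := by
  have hd : Differentiable ℝ kimuraU := fun y => (hasDerivAt_kimuraU y).differentiableAt
  have h : AntitoneOn kimuraU (Ici 0) := by
    refine antitoneOn_of_deriv_nonpos (convex_Ici 0) hd.continuous.continuousOn
      hd.differentiableOn fun x hx => ?_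
    rw [interior_Ici] at hx
    rw [(hasDerivAt_kimuraU x).deriv]
    linarith [kimuraUDeriv_nonneg (le_of_lt (show (0 : ℝ) < x from hx))]
  have h0 : kimuraU 0 = 1 / 2 := by
    rw [kimuraU_eq, (expBesselCoeff_summable 0).tsum_eq_zero_add]
    simp [expBesselCoeff]
    norm_num
  rw [← h0]
  exact h self_mem_Ici hy hy

/-- The Vandermonde identity, with factorials in place of binomial coefficients. -/
theorem sum_antidiagonal_factorial (n : ℕ) :
    ∑ p ∈ Finset.HasAntidiagonal.antidiagonal n, ((p.1 + p.2).factorial : ℝ) /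
      ((p.1 + 1).factorial * (p.2 + 1).factorial * (p.1.factorial * p.2.factorial)) =
      (n + 1).centralBinom / (n + 2).factorial := by
  have h := Nat.add_choose_eq n (n + 2) (n + 1)
  rw [Finset.Nat.sum_antidiagonal_succ', Nat.choose_succ_self, zero_mul, zero_add,
    show n + (n + 2) = 2 * (n + 1) by ring, ← Nat.centralBinom_eq_two_mul_choose] at h
  rw [h, eq_div_iff (by exact_mod_cast Nat.factorial_ne_zero _), Finset.sum_mul]
  push_cast
  refine Finset.sum_congr rfl fun p hp => ?_
  have hp' : p.1 + p.2 = n := Finset.HasAntidiagonal.mem_antidiagonal.1 hp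
  have f0 : ∀ m : ℕ, (m.factorial : ℝ) ≠ 0 := fun m => by exact_mod_cast Nat.factorial_ne_zero m
  have e1 : (n.choose p.1 : ℝ) * (p.1.factorial * p.2.factorial) = n.factorial := by
    rw [← hp', ← mul_assoc, Nat.choose_symm_add]
    exact_mod_cast Nat.add_choose_mul_factorial_mul_factorial p.1 p.2
  have e2 : ((n + 2).choose (p.2 + 1) : ℝ) * ((p.1 + 1).factorial * (p.2 + 1).factorial) =
      (n + 2).factorial := by
    rw [show n + 2 = (p.1 + 1) + (p.2 + 1) by omega, ← mul_assoc]
    exact_mod_cast Nat.add_choose_mul_factorial_mul_factorial (p.1 + 1) (p.2 + 1)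
  rw [hp', ← e1, ← e2]
  have := f0 p.1
  have := f0 p.2
  have := f0 (p.1 + 1)
  have := f0 (p.2 + 1)
  field_simp

/-- The double sum over the Poisson weights is regrouped along antidiagonals, where the
Vandermonde identity evaluates it. -/
theorem lintegral_kimuraKernel_sq {z t : ℝ} (hz : 0 < z) (ht : 0 < t) :
    ∫⁻ w in Ioi (0 : ℝ), ENNReal.ofReal (kimuraKernel z w t ^ 2) =
      ENNReal.ofReal (z / t ^ 2 * kimuraUDeriv (z / t)) := by
  set y := z / t with hy
  have hy0 : 0 < y := by positivity
  let c : ℕ → ℝ := fun m => Real.exp (-y) * y ^ (m + 1) / (m + 1).factorial *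
      (1 / (m.factorial * t ^ (m + 1)))
  have hc : ∀ m, 0 ≤ c m := fun m => by positivity
  have h1 : ∀ w ∈ Ioi (0 : ℝ), ENNReal.ofReal (kimuraKernel z w t ^ 2) =
      ∑' p : ℕ × ℕ, ENNReal.ofReal (c p.1 * c p.2) *
        ENNReal.ofReal (w ^ (p.1 + p.2) * Real.exp (-(2 / t * w))) := fun w hw => by
    have hw0 : (0 : ℝ) < w := hw
    rw [ENNReal.ofReal_pow (kimuraKernel_nonneg z w ht), ofReal_kimuraKernel hz hw ht, pow_two,
      ← ENNReal.tsum_mul_right, ENNReal.tsum_prod']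
    refine tsum_congr fun i => ?_
    rw [← ENNReal.tsum_mul_left]
    refine tsum_congr fun j => ?_
    rw [← ENNReal.ofReal_mul (hc i), ← ENNReal.ofReal_mul (hc j),
      ← ENNReal.ofReal_mul (by have := hc i; positivity),
      ← ENNReal.ofReal_mul (mul_nonneg (hc i) (hc j))]
    congr 1
    have : Real.exp (-(2 / t * w)) = Real.exp (-(1 / t * w)) * Real.exp (-(1 / t * w)) := by
      rw [← Real.exp_add]; congr 1; ring
    rw [this, pow_add]
    ring
  rw [setLIntegral_congr_fun measurableSet_Ioi h1, lintegral_tsum fun p => by fun_prop]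
  have h2 : ∀ p : ℕ × ℕ, ∫⁻ w in Ioi (0 : ℝ), ENNReal.ofReal (c p.1 * c p.2) *
        ENNReal.ofReal (w ^ (p.1 + p.2) * Real.exp (-(2 / t * w))) =
      ENNReal.ofReal (z / t ^ 2 * Real.exp (-2 * y) * (y / 2) ^ (p.1 + p.2 + 1) *
        (((p.1 + p.2).factorial : ℝ) / ((p.1 + 1).factorial * (p.2 + 1).factorial *
          (p.1.factorial * p.2.factorial)))) := fun p => by
    rw [lintegral_const_mul _ (by fun_prop), lintegral_pow_mul_exp _ (by positivity),
      ← ENNReal.ofReal_mul (mul_nonneg (hc _) (hc _))]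
    congr 1
    have : Real.exp (-2 * y) = Real.exp (-y) * Real.exp (-y) := by
      rw [← Real.exp_add]; congr 1; ring
    have hzt : z / t ^ 2 = y / t := by rw [hy]; field_simp
    rw [this, hzt]
    simp only [c, div_pow]
    have f0 : ∀ m : ℕ, (m.factorial : ℝ) ≠ 0 := fun m => by exact_mod_cast Nat.factorial_ne_zero m
    have := f0 p.1
    have := f0 p.2
    have := f0 (p.1 + 1)
    have := f0 (p.2 + 1)
    field_simp
    ring
  rw [tsum_congr h2, ← Finset.HasAntidiagonal.sigmaAntidiagonalEquivProd.tsum_eq,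
    ENNReal.tsum_sigma']
  unfold kimuraUDeriv
  have hs : Summable fun n : ℕ => ((n + 1).centralBinom : ℝ) / (n + 2).factorial *
      (y / 2) ^ (n + 1) := by
    have h3 := (summable_nat_add_iff 1).2 (expBesselCoeff_summable y)
    refine Summable.of_nonneg_of_le (fun n => by positivity) (fun n => ?_) h3
    have f1 : (0 : ℝ) < (n + 1).factorial := by exact_mod_cast Nat.factorial_pos _
    have f2 : ((n + 1).factorial : ℝ) ≤ (n + 2).factorial := by
      exact_mod_cast Nat.factorial_le (by omega)
    unfold expBesselCoeff
    rw [div_pow]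
    calc ((n + 1).centralBinom : ℝ) / (n + 2).factorial * (y ^ (n + 1) / 2 ^ (n + 1))
        ≤ ((n + 1).centralBinom : ℝ) / (n + 1).factorial * (y ^ (n + 1) / 2 ^ (n + 1)) := by
          gcongr
      _ = _ := by field_simp
  rw [← mul_assoc, ← tsum_mul_left, ENNReal.ofReal_tsum_of_nonneg (fun n => by positivity)
    (hs.mul_left _)]
  refine tsum_congr fun n => ?_
  rw [tsum_fintype]
  have h4 := Finset.sum_coe_sort (Finset.HasAntidiagonal.antidiagonal n) (fun p : ℕ × ℕ =>
    ENNReal.ofReal (z / t ^ 2 * Real.exp (-2 * y) * (y / 2) ^ (p.1 + p.2 + 1) *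
        (((p.1 + p.2).factorial : ℝ) / ((p.1 + 1).factorial * (p.2 + 1).factorial *
          (p.1.factorial * p.2.factorial)))))
  refine h4.trans ?_
  rw [← ENNReal.ofReal_sum_of_nonneg fun p _ => by positivity]
  congr 1
  rw [← sum_antidiagonal_factorial, Finset.sum_mul, Finset.mul_sum]
  refine Finset.sum_congr rfl fun p hp => ?_
  have hp' : p.1 + p.2 = n := Finset.HasAntidiagonal.mem_antidiagonal.1 hp
  rw [hp']
  ring

/-- The space-time integral of the squared kernel, by the fundamental theorem of calculus for `s ↦
U(z / s)`. -/
theorem lintegral_kimuraKernel_sq_time {z t : ℝ} (hz : 0 < z) (ht : 0 < t) :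
    ∫⁻ s in Ioo (0 : ℝ) t, ∫⁻ w in Ioi (0 : ℝ), ENNReal.ofReal (kimuraKernel z w s ^ 2) ≤
      ENNReal.ofReal (kimuraU (z / t)) := by
  -- `q₀(z, ·, s)` has squared `L²` norm `∂ₛ U(z / s)`, so that the time integral telescopes. It
  -- is taken over `(t / (n + 2), t)` first, since `z / s` is singular at `s = 0`.
  let g' : ℝ → ℝ := fun s => z / s ^ 2 * kimuraUDeriv (z / s)
  have hd : ∀ s, 0 < s → HasDerivAt (fun s => kimuraU (z / s)) (g' s) s := fun s hs => by
    have h1 : HasDerivAt (fun s : ℝ => z / s) (-z / s ^ 2) s := by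
      have := (hasDerivAt_inv hs.ne').const_mul z
      refine (this.congr_deriv ?_)
      ring
    have h2 := (hasDerivAt_kimuraU (z / s)).comp s h1
    refine h2.congr_deriv ?_
    simp only [g']; ring
  have hg'0 : ∀ s, 0 < s → 0 ≤ g' s := fun s hs =>
    mul_nonneg (by positivity) (kimuraUDeriv_nonneg (by positivity))
  rw [setLIntegral_congr_fun measurableSet_Ioo fun s hs => lintegral_kimuraKernel_sq hz hs.1]
  have hU : Ioo (0 : ℝ) t ⊆ ⋃ n : ℕ, Ioc (t / ((n : ℝ) + 2)) t := fun s hs => by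
    obtain ⟨n, hn⟩ := exists_nat_gt (t / s)
    refine mem_iUnion.2 ⟨n, ?_, hs.2.le⟩
    rw [div_lt_iff₀ hs.1] at hn
    rw [div_lt_iff₀ (by positivity)]
    nlinarith [hs.1]
  refine (lintegral_mono_set hU).trans ?_
  rw [setLIntegral_iUnion_of_directed]
  · refine iSup_le fun n => ?_
    have hn0 : (0 : ℝ) < t / ((n : ℝ) + 2) := by positivity
    have hnt : t / ((n : ℝ) + 2) ≤ t := div_le_self ht.le (by linarith [Nat.cast_nonneg (α := ℝ) n])
    have hcont : ContinuousOn (fun s => kimuraU (z / s)) (Icc (t / ((n : ℝ) + 2)) t) :=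
      fun s hs => (hd s (hn0.trans_le hs.1)).continuousAt.continuousWithinAt
    have hi : IntegrableOn g' (Ioc (t / ((n : ℝ) + 2)) t) :=
      intervalIntegral.integrableOn_deriv_of_nonneg hcont (fun s hs => hd s (hn0.trans hs.1))
        fun s hs => hg'0 s (hn0.trans hs.1)
    have hFTC := intervalIntegral.integral_eq_sub_of_hasDerivAt_of_le hnt hcont
      (fun s hs => hd s (hn0.trans hs.1)) ((intervalIntegrable_iff_integrableOn_Ioc_of_le hnt).2 hi)
    rw [intervalIntegral.integral_of_le hnt] at hFTC
    rw [← ofReal_integral_eq_lintegral_ofReal hi, hFTC]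
    · apply ENNReal.ofReal_le_ofReal
      have := kimuraU_nonneg (y := z / (t / ((n : ℝ) + 2))) (by positivity)
      linarith
    · filter_upwards [ae_restrict_mem measurableSet_Ioc] with s hs
      exact hg'0 s (hn0.trans hs.1)
  · refine directed_of_isDirected_le fun m n hmn => Ioc_subset_Ioc_left ?_
    have : (m : ℝ) ≤ n := by exact_mod_cast hmn
    gcongr

/-! ### The deterministic solution and the Duhamel kernel -/

/-- The extension by zero of a bounded continuous function on the half-line. -/
noncomputable def extendZero (u₀ : BoundedContinuousFunction (Ioi (0 : ℝ)) ℝ) (w : ℝ) : ℝ :=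
  if h : 0 < w then u₀ ⟨w, h⟩ else 0

theorem extendZero_measurable (u₀ : BoundedContinuousFunction (Ioi (0 : ℝ)) ℝ) :
    Measurable (extendZero u₀) := by
  unfold extendZero
  refine Measurable.dite (s := {w : ℝ | 0 < w}) (f := fun w => u₀ ⟨w.1, w.2⟩)
    (g := fun _ => 0) ?_ measurable_const measurableSet_Ioi
  exact u₀.continuous.measurable

theorem abs_extendZero_le (u₀ : BoundedContinuousFunction (Ioi (0 : ℝ)) ℝ) (w : ℝ) :
    |extendZero u₀ w| ≤ ‖u₀‖ := by
  unfold extendZero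
  split_ifs with h
  · exact u₀.norm_coe_le_norm _
  · simp

theorem detSolution_eq (u₀ : BoundedContinuousFunction (Ioi (0 : ℝ)) ℝ) (z t : ℝ) :
    detSolution u₀ z t = ∫ w in Ioi (0 : ℝ), kimuraKernel z w t * extendZero u₀ w := by
  unfold detSolution
  rw [← integral_subtype_comap measurableSet_Ioi]
  refine integral_congr_ae (ae_of_all _ fun w => ?_)
  have : 0 < w.1 := w.2
  simp only [extendZero, this, dif_pos]

theorem detSolution_measurable (u₀ : BoundedContinuousFunction (Ioi (0 : ℝ)) ℝ) :
    Measurable fun p : ℝ × ℝ => detSolution u₀ p.1 p.2 := by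
  simp only [detSolution_eq]
  have h : Measurable fun q : (ℝ × ℝ) × ℝ => kimuraKernel q.1.1 q.2 q.1.2 * extendZero u₀ q.2 :=
    (kimuraKernel_measurable.comp (f := fun q : (ℝ × ℝ) × ℝ => (q.1.1, q.2, q.1.2))
      (by fun_prop)).mul ((extendZero_measurable u₀).comp measurable_snd)
  exact (h.stronglyMeasurable.integral_prod_right'
    (ν := (volume : Measure ℝ).restrict (Ioi 0))).measurable

theorem abs_detSolution_le (u₀ : BoundedContinuousFunction (Ioi (0 : ℝ)) ℝ) {z t : ℝ}
    (hz : 0 < z) (ht : 0 < t) : |detSolution u₀ z t| ≤ ‖u₀‖ := by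
  rw [detSolution_eq]
  have h := enorm_integral_le_lintegral_enorm (μ := (volume : Measure ℝ).restrict (Ioi 0))
    fun w => kimuraKernel z w t * extendZero u₀ w
  have h2 : ∫⁻ w in Ioi (0 : ℝ), ‖kimuraKernel z w t * extendZero u₀ w‖ₑ ≤
      ENNReal.ofReal ‖u₀‖ := by
    calc ∫⁻ w in Ioi (0 : ℝ), ‖kimuraKernel z w t * extendZero u₀ w‖ₑ
        ≤ ∫⁻ w in Ioi (0 : ℝ), ENNReal.ofReal (kimuraKernel z w t) * ENNReal.ofReal ‖u₀‖ := by
          refine lintegral_mono fun w => ?_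
          rw [enorm_mul, Real.enorm_of_nonneg (kimuraKernel_nonneg z w ht),
            Real.enorm_eq_ofReal_abs]
          gcongr
          exact abs_extendZero_le u₀ w
      _ = (∫⁻ w in Ioi (0 : ℝ), ENNReal.ofReal (kimuraKernel z w t)) * ENNReal.ofReal ‖u₀‖ :=
          lintegral_mul_const' _ _ ENNReal.ofReal_ne_top
      _ ≤ 1 * ENNReal.ofReal ‖u₀‖ := by
          have := lintegral_kimuraKernel_le hz ht
          gcongr
      _ = _ := one_mul _
  have h3 := h.trans h2
  rw [Real.enorm_eq_ofReal_abs] at h3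
  exact (ENNReal.ofReal_le_ofReal_iff (norm_nonneg _)).1 h3

/-- The Duhamel kernel `1_{(0,t)}(τ) q₀(z, w, t - τ)` as a function of `p = (w, τ)`, cut off to the
quadrant. -/
noncomputable def duhamel (z t : ℝ) (p : ℝ × ℝ) : ℝ :=
  (Ioi (0 : ℝ) ×ˢ Ioo 0 t).indicator (fun p => kimuraKernel z p.1 (t - p.2)) p

theorem duhamel_nonneg (z t : ℝ) (p : ℝ × ℝ) : 0 ≤ duhamel z t p :=
  indicator_nonneg (fun _ hp => kimuraKernel_nonneg _ _ (sub_pos.2 hp.2.2)) p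

theorem duhamel_measurable : Measurable fun q : (ℝ × ℝ) × (ℝ × ℝ) => duhamel q.1.1 q.1.2 q.2 := by
  have h1 : Measurable fun q : (ℝ × ℝ) × (ℝ × ℝ) => kimuraKernel q.1.1 q.2.1 (q.1.2 - q.2.2) :=
    kimuraKernel_measurable.comp (f := fun q : (ℝ × ℝ) × (ℝ × ℝ) => (q.1.1, q.2.1, q.1.2 - q.2.2))
      (by fun_prop)
  have h2 : MeasurableSet {q : (ℝ × ℝ) × (ℝ × ℝ) | q.2 ∈ Ioi (0 : ℝ) ×ˢ Ioo 0 q.1.2} := by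
    have m1 : Measurable fun q : (ℝ × ℝ) × (ℝ × ℝ) => q.2.1 := by fun_prop
    have m2 : Measurable fun q : (ℝ × ℝ) × (ℝ × ℝ) => q.2.2 := by fun_prop
    have m3 : Measurable fun q : (ℝ × ℝ) × (ℝ × ℝ) => q.1.2 := by fun_prop
    exact (measurableSet_lt measurable_const m1).inter
      ((measurableSet_lt measurable_const m2).inter (measurableSet_lt m2 m3))
  exact h1.indicator h2

theorem duhamel_measurable' (z t : ℝ) : Measurable (duhamel z t) :=
  duhamel_measurable.comp (f := fun p : ℝ × ℝ => ((z, t), p))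
    (measurable_const.prodMk measurable_id)

theorem duhamel_eq {z t w τ : ℝ} (hw : 0 < w) (hτ : τ ∈ Ioo 0 t) :
    duhamel z t (w, τ) = kimuraKernel z w (t - τ) :=
  indicator_of_mem (show (w, τ) ∈ Ioi (0 : ℝ) ×ˢ Ioo 0 t from ⟨hw, hτ⟩) _

theorem duhamel_eq_zero {z t : ℝ} {p : ℝ × ℝ} (h : ¬ (0 < p.1 ∧ p.2 ∈ Ioo 0 t)) :
    duhamel z t p = 0 :=
  indicator_of_notMem (fun hp => h ⟨hp.1, hp.2⟩) _

theorem lintegral_duhamel_le {z t : ℝ} (hz : 0 < z) (τ : ℝ) :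
    ∫⁻ w, ENNReal.ofReal (duhamel z t (w, τ)) ≤ (Ioo 0 t).indicator 1 τ := by
  by_cases hτ : τ ∈ Ioo 0 t
  · rw [indicator_of_mem hτ]
    refine le_trans ?_ (lintegral_kimuraKernel_le hz (sub_pos.2 hτ.2))
    rw [← lintegral_indicator measurableSet_Ioi]
    refine lintegral_mono fun w => ?_
    by_cases hw : w ∈ Ioi (0 : ℝ)
    · rw [indicator_of_mem hw, duhamel_eq hw hτ]
    · rw [duhamel_eq_zero fun h : 0 < w ∧ τ ∈ Ioo 0 t => hw h.1]; simp
  · refine le_of_eq_of_le ?_ zero_le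
    rw [lintegral_congr fun w => by rw [duhamel_eq_zero fun h => hτ h.2]]
    simp

theorem lintegral_duhamel_sq_le {z t : ℝ} (hz : 0 < z) (ht : 0 < t) :
    ∫⁻ τ, ∫⁻ w, ENNReal.ofReal (duhamel z t (w, τ)) ^ 2 ≤ ENNReal.ofReal (kimuraU (z / t)) := by
  let G : ℝ → ℝ≥0∞ := (Ioo 0 t).indicator fun s =>
    ∫⁻ w in Ioi (0 : ℝ), ENNReal.ofReal (kimuraKernel z w s ^ 2)
  have h1 : ∀ τ, ∫⁻ w, ENNReal.ofReal (duhamel z t (w, τ)) ^ 2 ≤ G (t - τ) := fun τ => by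
    by_cases hτ : τ ∈ Ioo 0 t
    · have : t - τ ∈ Ioo 0 t := ⟨sub_pos.2 hτ.2, by linarith [hτ.1]⟩
      simp only [G, indicator_of_mem this]
      rw [← lintegral_indicator measurableSet_Ioi]
      refine lintegral_mono fun w => ?_
      by_cases hw : w ∈ Ioi (0 : ℝ)
      · rw [indicator_of_mem hw, duhamel_eq hw hτ,
          ENNReal.ofReal_pow (kimuraKernel_nonneg _ _ this.1)]
      · rw [duhamel_eq_zero fun h : 0 < w ∧ τ ∈ Ioo 0 t => hw h.1]; simp
    · refine le_of_eq_of_le ?_ zero_le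
      rw [lintegral_congr fun w => by rw [duhamel_eq_zero fun h => hτ h.2]]
      simp
  calc _ ≤ ∫⁻ τ, G (t - τ) := lintegral_mono h1
    _ = ∫⁻ s, G s := lintegral_sub_left_eq_self G t
    _ = _ := lintegral_indicator measurableSet_Ioo _
    _ ≤ _ := lintegral_kimuraKernel_sq_time hz ht

/-! ### Splitting the spatial covariance into a near and a far part -/

theorem symmIntegral_nonneg {k : ℝ → ℝ} (hk : IsCovarianceKernel k) {a : ℝ} (ha : 0 ≤ a) :
    0 ≤ symmIntegral k a :=
  intervalIntegral.integral_nonneg (by linarith) fun x _ => hk.nonneg x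

theorem lintegral_symmIntegral {k : ℝ → ℝ} (hk : IsCovarianceKernel k) {a : ℝ} (ha : 0 ≤ a) :
    ∫⁻ x in Ioo (-a) a, ENNReal.ofReal (k x) = ENNReal.ofReal (symmIntegral k a) := by
  unfold symmIntegral
  rw [intervalIntegral.integral_of_le (by linarith), integral_Ioc_eq_integral_Ioo,
    ofReal_integral_eq_lintegral_ofReal _ (ae_of_all _ hk.nonneg)]
  exact (hk.locallyIntegrable.integrableOn_isCompact (isCompact_Icc (a := -a) (b := a))).mono_set
    Ioo_subset_Icc_self

/-- The Young inequality for a kernel supported near the diagonal. -/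
theorem lintegral_young {φ : ℝ → ℝ≥0∞} (hφ : AEMeasurable φ)
    {a b : ℝ → ℝ≥0∞} (ha : Measurable a) (hb : Measurable b) :
    ∫⁻ p : ℝ × ℝ, φ (p.1 - p.2) * a p.1 * b p.2 ≤
      (∫⁻ x, φ x) * (((∫⁻ x, a x ^ 2) + ∫⁻ x, b x ^ 2) / 2) := by
  have hφ2 : AEMeasurable (fun p : ℝ × ℝ => φ (p.1 - p.2)) volume :=
    hφ.comp_quasiMeasurePreserving
      (quasiMeasurePreserving_sub (μ := (volume : Measure ℝ)) (ν := (volume : Measure ℝ)))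
  have amgm : ∀ x y : ℝ≥0∞, x * y ≤ x ^ 2 / 2 + y ^ 2 / 2 := fun x y => by
    by_cases hx : x = ∞
    · subst hx; simp [ENNReal.top_div]
    by_cases hy : y = ∞
    · subst hy; simp [ENNReal.top_div]
    lift x to ℝ≥0 using hx
    lift y to ℝ≥0 using hy
    have h : x * y ≤ x ^ 2 / 2 + y ^ 2 / 2 := by
      rw [← NNReal.coe_le_coe]
      push_cast
      nlinarith [sq_nonneg ((x : ℝ) - y)]
    have h2 : ((x * y : ℝ≥0) : ℝ≥0∞) ≤ ((x ^ 2 / 2 + y ^ 2 / 2 : ℝ≥0) : ℝ≥0∞) := by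
      exact_mod_cast h
    simpa [ENNReal.coe_div] using h2
  calc ∫⁻ p : ℝ × ℝ, φ (p.1 - p.2) * a p.1 * b p.2
      ≤ ∫⁻ p : ℝ × ℝ, (φ (p.1 - p.2) * (a p.1 ^ 2 / 2) + φ (p.1 - p.2) * (b p.2 ^ 2 / 2)) := by
        refine lintegral_mono fun p => ?_
        rw [← mul_add, mul_assoc]
        gcongr
        exact amgm _ _
    _ = (∫⁻ p : ℝ × ℝ, φ (p.1 - p.2) * (a p.1 ^ 2 / 2)) +
        ∫⁻ p : ℝ × ℝ, φ (p.1 - p.2) * (b p.2 ^ 2 / 2) :=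
        lintegral_add_left' (hφ2.mul
          (((ha.comp measurable_fst).pow_const 2).div_const 2).aemeasurable) _
    _ = (∫⁻ x, φ x) * (∫⁻ x, a x ^ 2 / 2) + (∫⁻ x, φ x) * (∫⁻ x, b x ^ 2 / 2) := by
        congr 1
        · have hm : AEMeasurable (fun p : ℝ × ℝ => φ (p.1 - p.2) * (a p.1 ^ 2 / 2))
              ((volume : Measure ℝ).prod volume) :=
            hφ2.mul (((ha.comp measurable_fst).pow_const 2).div_const 2).aemeasurable
          rw [Measure.volume_eq_prod, lintegral_prod _ hm]
          dsimp only
          have : ∀ x, ∫⁻ y, φ (x - y) * (a x ^ 2 / 2) = (∫⁻ y, φ y) * (a x ^ 2 / 2) := fun x => by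
            have hx : AEMeasurable (fun y => φ (x - y)) := hφ.comp_quasiMeasurePreserving
              (quasiMeasurePreserving_sub_left volume x)
            rw [lintegral_mul_const'' _ hx, lintegral_sub_left_eq_self φ x]
          rw [lintegral_congr this, lintegral_const_mul _ ((ha.pow_const 2).div_const 2)]
        · have hm : AEMeasurable (fun p : ℝ × ℝ => φ (p.1 - p.2) * (b p.2 ^ 2 / 2))
              ((volume : Measure ℝ).prod volume) :=
            hφ2.mul (((hb.comp measurable_snd).pow_const 2).div_const 2).aemeasurable
          rw [Measure.volume_eq_prod, lintegral_prod_symm _ hm]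
          dsimp only
          have : ∀ y, ∫⁻ x, φ (x - y) * (b y ^ 2 / 2) = (∫⁻ y, φ y) * (b y ^ 2 / 2) := fun y => by
            have hy : AEMeasurable (fun x => φ (x - y)) := hφ.comp_quasiMeasurePreserving
              (measurePreserving_sub_right volume y).quasiMeasurePreserving
            rw [lintegral_mul_const'' _ hy, lintegral_sub_right_eq_self φ y]
          rw [lintegral_congr this, lintegral_const_mul _ ((hb.pow_const 2).div_const 2)]
    _ = _ := by
        rw [← mul_add]
        simp only [div_eq_mul_inv]
        rw [lintegral_mul_const' _ _ (by simp), lintegral_mul_const' _ _ (by simp), add_mul]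

/-- `f(x - y) ≤ f(x - y) 1_{|x - y| < ε} + f(ε)`, integrated against `a(x) b(y)`. -/
theorem energy_le_near_far {f : ℝ → ℝ} (hf : IsCovarianceKernel f)
    (hanti : AntitoneOn f (Ioi 0)) {ε : ℝ} (hε : 0 < ε) {a b : ℝ → ℝ≥0∞} (ha : Measurable a)
    (hb : Measurable b) :
    energy f a b ≤ ENNReal.ofReal (symmIntegral f ε) *
        (((∫⁻ x, a x ^ 2) + ∫⁻ x, b x ^ 2) / 2) +
      ENNReal.ofReal (f ε) * ((∫⁻ x, a x) * ∫⁻ x, b x) := by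
  let φ : ℝ → ℝ≥0∞ := (Ioo (-ε) ε).indicator fun x => ENNReal.ofReal (f x)
  have hφm : AEMeasurable φ :=
    (hf.locallyIntegrable.aestronglyMeasurable.aemeasurable.ennreal_ofReal).indicator
      measurableSet_Ioo
  have hφ : ∀ x, ENNReal.ofReal (f x) ≤ φ x + ENNReal.ofReal (f ε) := fun x => by
    by_cases hx : x ∈ Ioo (-ε) ε
    · simp only [φ, indicator_of_mem hx]
      exact le_self_add
    · refine le_trans (ENNReal.ofReal_le_ofReal ?_) le_add_self
      have hx' : ε ≤ |x| := by
        by_contra h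
        exact hx (abs_lt.1 (not_le.1 h))
      have : f x = f |x| := by
        rcases abs_choice x with h | h <;> rw [h]
        rw [hf.symm]
      rw [this]
      exact hanti hε (hε.trans_le hx') hx'
  have hφ2 : AEMeasurable (fun p : ℝ × ℝ => φ (p.1 - p.2)) volume :=
    hφm.comp_quasiMeasurePreserving
      (quasiMeasurePreserving_sub (μ := (volume : Measure ℝ)) (ν := (volume : Measure ℝ)))
  calc energy f a b
      ≤ ∫⁻ p : ℝ × ℝ, (φ (p.1 - p.2) * a p.1 * b p.2 +
          ENNReal.ofReal (f ε) * (a p.1 * b p.2)) := by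
        refine lintegral_mono fun p => ?_
        rw [← mul_assoc, ← add_mul, ← add_mul]
        gcongr
        exact hφ _
    _ = (∫⁻ p : ℝ × ℝ, φ (p.1 - p.2) * a p.1 * b p.2) +
          ∫⁻ p : ℝ × ℝ, ENNReal.ofReal (f ε) * (a p.1 * b p.2) :=
        lintegral_add_left' ((hφ2.mul (ha.comp measurable_fst).aemeasurable).mul
          (hb.comp measurable_snd).aemeasurable) _
    _ ≤ _ := by
        refine add_le_add ?_ ?_
        · refine (lintegral_young hφm ha hb).trans_eq ?_
          rw [lintegral_indicator measurableSet_Ioo, lintegral_symmIntegral hf hε.le]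
        · rw [lintegral_const_mul' _ _ ENNReal.ofReal_ne_top, Measure.volume_eq_prod,
            lintegral_prod_mul ha.aemeasurable hb.aemeasurable]

/-! ### Deterministic bounds for the variances of the chaos components -/

theorem energy_measurable {E : Type*} [NormedAddCommGroup E] [NormedSpace ℝ E]
    [FiniteDimensional ℝ E] [MeasureSpace E] [BorelSpace E] [(volume : Measure E).IsAddHaarMeasure]
    {k : E → ℝ} (hk : LocallyIntegrable k) {X : Type*} [MeasurableSpace X] {a b : X → E → ℝ≥0∞}
    (ha : Measurable fun q : X × E => a q.1 q.2) (hb : Measurable fun q : X × E => b q.1 q.2) :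
    Measurable fun x => energy k (a x) (b x) := by
  have hκ := aemeasurable_ofReal_comp_sub hk
  have h : ∀ x, energy k (a x) (b x) = ∫⁻ p : E × E, hκ.mk _ p * a x p.1 * b x p.2 := fun x => by
    refine lintegral_congr_ae ?_
    filter_upwards [hκ.ae_eq_mk] with p hp
    rw [hp]
  simp only [h]
  refine Measurable.lintegral_prod_right' (f := fun q : X × (E × E) =>
    hκ.mk _ q.2 * a q.1 q.2.1 * b q.1 q.2.2) ?_
  have h1 : Measurable fun q : X × (E × E) => a q.1 q.2.1 :=
    ha.comp (f := fun q : X × (E × E) => (q.1, q.2.1)) (by fun_prop)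
  have h2 : Measurable fun q : X × (E × E) => b q.1 q.2.2 :=
    hb.comp (f := fun q : X × (E × E) => (q.1, q.2.2)) (by fun_prop)
  exact ((hκ.measurable_mk.comp measurable_snd).mul h1).mul h2

/-- The variances of the chaos components of the equation driven by noise which is white in time
and has spatial covariance `f`, with the off-diagonal covariances replaced by their
Cauchy–Schwarz bounds. -/
noncomputable def chaosBound (u₀ : BoundedContinuousFunction (Ioi (0 : ℝ)) ℝ) (f : ℝ → ℝ) :
    ℕ → ℝ → ℝ → ℝ≥0∞
  | 0, z, t => ENNReal.ofReal (detSolution u₀ z t ^ 2)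
  | n + 1, z, t => ∫⁻ τ, energy f
      (fun w => ENNReal.ofReal (duhamel z t (w, τ)) * chaosBound u₀ f n w τ ^ (1 / 2 : ℝ))
      (fun w => ENNReal.ofReal (duhamel z t (w, τ)) * chaosBound u₀ f n w τ ^ (1 / 2 : ℝ))

variable {f : ℝ → ℝ} (u₀ : BoundedContinuousFunction (Ioi (0 : ℝ)) ℝ)

theorem chaosBound_measurable (hf : LocallyIntegrable f) (n : ℕ) :
    Measurable fun p : ℝ × ℝ => chaosBound u₀ f n p.1 p.2 := by
  induction n with
  | zero => exact ((detSolution_measurable u₀).pow_const 2).ennreal_ofReal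
  | succ n ih =>
    have h1 : Measurable fun q : ((ℝ × ℝ) × ℝ) × ℝ =>
        ENNReal.ofReal (duhamel q.1.1.1 q.1.1.2 (q.2, q.1.2)) *
          chaosBound u₀ f n q.2 q.1.2 ^ (1 / 2 : ℝ) := by
      have a1 : Measurable fun q : ((ℝ × ℝ) × ℝ) × ℝ => duhamel q.1.1.1 q.1.1.2 (q.2, q.1.2) :=
        duhamel_measurable.comp (f := fun q : ((ℝ × ℝ) × ℝ) × ℝ => (q.1.1, (q.2, q.1.2)))
          (by fun_prop)
      have a2 : Measurable fun q : ((ℝ × ℝ) × ℝ) × ℝ => chaosBound u₀ f n q.2 q.1.2 :=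
        ih.comp (f := fun q : ((ℝ × ℝ) × ℝ) × ℝ => (q.2, q.1.2)) (by fun_prop)
      exact a1.ennreal_ofReal.mul (a2.pow_const _)
    let a : (ℝ × ℝ) × ℝ → ℝ → ℝ≥0∞ := fun q w =>
      ENNReal.ofReal (duhamel q.1.1 q.1.2 (w, q.2)) * chaosBound u₀ f n w q.2 ^ (1 / 2 : ℝ)
    have h2 : Measurable fun x => energy f (a x) (a x) := energy_measurable hf h1 h1
    exact h2.lintegral_prod_right'

/-- The Cauchy–Schwarz inequality with respect to the measure `q dμ`. -/
theorem lintegral_mul_sqrt_sq_le {X : Type*} [MeasurableSpace X] {μ : Measure X} {q A : X → ℝ≥0∞}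
    (hq : Measurable q) (hA : Measurable A) :
    (∫⁻ x, q x * A x ^ (1 / 2 : ℝ) ∂μ) * (∫⁻ x, q x * A x ^ (1 / 2 : ℝ) ∂μ) ≤
      (∫⁻ x, q x ∂μ) * ∫⁻ x, q x * A x ∂μ := by
  have h := ENNReal.lintegral_mul_le_Lp_mul_Lq μ Real.HolderConjugate.two_two
    (f := fun x => q x ^ (1 / 2 : ℝ)) (g := fun x => (q x * A x) ^ (1 / 2 : ℝ))
    (hq.pow_const _).aemeasurable ((hq.mul hA).pow_const _).aemeasurable
  have h2 : ∀ x : ℝ≥0∞, (x ^ (1 / 2 : ℝ)) ^ (2 : ℝ) = x := fun x => by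
    rw [← ENNReal.rpow_mul]; norm_num
  have h3 : ∀ x : ℝ≥0∞, x ^ (1 / 2 : ℝ) * x ^ (1 / 2 : ℝ) = x := fun x => by
    rw [← ENNReal.rpow_add_of_nonneg _ _ (by norm_num) (by norm_num)]; norm_num
  have h4 : ∀ x, ((fun x => q x ^ (1 / 2 : ℝ)) * fun x => (q x * A x) ^ (1 / 2 : ℝ)) x =
      q x * A x ^ (1 / 2 : ℝ) := fun x => by
    simp only [Pi.mul_apply]
    rw [ENNReal.mul_rpow_of_nonneg _ _ (by norm_num), ← mul_assoc, h3]
  simp only [h2] at h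
  rw [lintegral_congr h4] at h
  calc _ ≤ _ := mul_le_mul' h h
    _ = ((∫⁻ x, q x ∂μ) ^ (1 / 2 : ℝ) * (∫⁻ x, q x ∂μ) ^ (1 / 2 : ℝ)) *
      ((∫⁻ x, q x * A x ∂μ) ^ (1 / 2 : ℝ) * (∫⁻ x, q x * A x ∂μ) ^ (1 / 2 : ℝ)) := by ring
    _ = _ := by rw [h3, h3]

theorem lintegral_lintegral_sum {G : ℝ → ℝ → ℝ≥0∞} (hG : Measurable fun p : ℝ × ℝ => G p.1 p.2)
    {A : ℕ → ℝ → ℝ → ℝ≥0∞} (hA : ∀ n, Measurable fun p : ℝ × ℝ => A n p.1 p.2) (c : ℕ → ℝ≥0∞)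
    (s : Finset ℕ) :
    ∫⁻ τ, ∫⁻ w, G w τ * ∑ n ∈ s, c n * A n w τ =
      ∑ n ∈ s, c n * ∫⁻ τ, ∫⁻ w, G w τ * A n w τ := by
  have m1 : ∀ n, Measurable fun p : ℝ × ℝ => G p.2 p.1 * A n p.2 p.1 := fun n =>
    (hG.comp measurable_swap).mul ((hA n).comp measurable_swap)
  have m2 : ∀ n τ, Measurable fun w => G w τ * A n w τ := fun n τ =>
    (m1 n).comp (f := fun w => (τ, w)) (by fun_prop)
  have e : ∀ τ w, G w τ * ∑ n ∈ s, c n * A n w τ = ∑ n ∈ s, c n * (G w τ * A n w τ) :=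
    fun τ w => by
      rw [Finset.mul_sum]
      exact Finset.sum_congr rfl fun n _ => by ring
  have e2 : ∀ τ, ∫⁻ w, G w τ * ∑ n ∈ s, c n * A n w τ =
      ∑ n ∈ s, c n * ∫⁻ w, G w τ * A n w τ := fun τ => by
    simp only [e]
    rw [lintegral_finsetSum _ fun n _ => (m2 n τ).const_mul _]
    exact Finset.sum_congr rfl fun n _ => lintegral_const_mul _ (m2 n τ)
  simp only [e2]
  rw [lintegral_finsetSum _ fun n _ => ((m1 n).lintegral_prod_right').const_mul _]
  exact Finset.sum_congr rfl fun n _ => lintegral_const_mul _ ((m1 n).lintegral_prod_right')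

/-- One step of the recursion for the variances: the near part of the covariance costs `F_ε` and
the square of the kernel, the far part `f(ε)` and the kernel itself. -/
theorem chaosBound_succ_le (hf : IsCovarianceKernel f) (hanti : AntitoneOn f (Ioi 0)) {ε : ℝ}
    (hε : 0 < ε) (n : ℕ) {z t : ℝ} (hz : 0 < z) :
    chaosBound u₀ f (n + 1) z t ≤
      ENNReal.ofReal (symmIntegral f ε) * (∫⁻ τ, ∫⁻ w, ENNReal.ofReal (duhamel z t (w, τ)) ^ 2 *
        chaosBound u₀ f n w τ) +
      ENNReal.ofReal (f ε) * ∫⁻ τ, ∫⁻ w, ENNReal.ofReal (duhamel z t (w, τ)) *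
        chaosBound u₀ f n w τ := by
  have mA := chaosBound_measurable u₀ hf.locallyIntegrable n
  have mq : Measurable fun p : ℝ × ℝ => ENNReal.ofReal (duhamel z t (p.2, p.1)) :=
    ((duhamel_measurable' z t).comp measurable_swap).ennreal_ofReal
  have mq' : ∀ τ, Measurable fun w => ENNReal.ofReal (duhamel z t (w, τ)) := fun τ =>
    mq.comp (f := fun w => (τ, w)) (by fun_prop)
  have mA' : ∀ τ, Measurable fun w => chaosBound u₀ f n w τ := fun τ =>
    mA.comp (f := fun w => (w, τ)) (by fun_prop)
  have h : ∀ τ, energy f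
      (fun w => ENNReal.ofReal (duhamel z t (w, τ)) * chaosBound u₀ f n w τ ^ (1 / 2 : ℝ))
      (fun w => ENNReal.ofReal (duhamel z t (w, τ)) * chaosBound u₀ f n w τ ^ (1 / 2 : ℝ)) ≤
      ENNReal.ofReal (symmIntegral f ε) * (∫⁻ w, ENNReal.ofReal (duhamel z t (w, τ)) ^ 2 *
        chaosBound u₀ f n w τ) +
      ENNReal.ofReal (f ε) * ∫⁻ w, ENNReal.ofReal (duhamel z t (w, τ)) *
        chaosBound u₀ f n w τ := fun τ => by
    refine (energy_le_near_far hf hanti hε ((mq' τ).mul ((mA' τ).pow_const _))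
      ((mq' τ).mul ((mA' τ).pow_const _))).trans ?_
    have h2 : ∀ x : ℝ≥0∞, (x ^ (1 / 2 : ℝ)) ^ 2 = x := fun x => by
      rw [← ENNReal.rpow_natCast, ← ENNReal.rpow_mul]; norm_num
    refine add_le_add ?_ ?_
    · rw [ENNReal.add_div, ENNReal.add_halves]
      refine le_of_eq (congrArg _ (lintegral_congr fun w => ?_))
      rw [Pi.mul_apply, mul_pow, h2]
    · gcongr
      refine (lintegral_mul_sqrt_sq_le (mq' τ) (mA' τ)).trans ?_
      refine mul_le_of_le_one_left' ((lintegral_duhamel_le hz τ).trans ?_)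
      exact indicator_le' (fun _ _ => le_rfl) (fun _ _ => zero_le) τ
  refine (lintegral_mono h).trans_eq ?_
  have m1 : Measurable fun τ => ∫⁻ w, ENNReal.ofReal (duhamel z t (w, τ)) ^ 2 *
      chaosBound u₀ f n w τ :=
    ((mq.pow_const 2).mul (mA.comp measurable_swap)).lintegral_prod_right'
  rw [lintegral_add_left (m1.const_mul _), lintegral_const_mul' _ _ ENNReal.ofReal_ne_top,
    lintegral_const_mul' _ _ ENNReal.ofReal_ne_top]

/-- The function `(e^{λt} - 1) / (1 - θ) + 2θ U(z/t) / (1 - θ)`, with `θ = G F / 2` and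
`λ = G f(ε) / (1 - θ)`, is a supersolution of the recursion for the sums of the variances; this
uses only `U ≤ 1/2`. -/
theorem sum_chaosBound_le (hf : IsCovarianceKernel f) (hanti : AntitoneOn f (Ioi 0)) {ε : ℝ}
    (hε : 0 < ε) {G θ lam : ℝ} (hG : 0 ≤ G) (hθ : θ = G * symmIntegral f ε / 2) (hθ1 : θ < 1)
    (hlam : lam = G * f ε / (1 - θ)) (N : ℕ) : ∀ {z t : ℝ}, 0 < z → 0 < t →
    ∑ n ∈ Finset.range N, ENNReal.ofReal G ^ (n + 1) * chaosBound u₀ f (n + 1) z t ≤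
      ENNReal.ofReal (‖u₀‖ ^ 2 * (kimuraU (z / t) * (2 * θ / (1 - θ)) +
        (Real.exp (lam * t) - 1) / (1 - θ))) := by
  have hF := symmIntegral_nonneg hf hε.le
  have hθ0 : 0 ≤ θ := by rw [hθ]; positivity
  have hfε := hf.nonneg ε
  have h1θ : 0 < 1 - θ := by linarith
  have hlam0 : 0 ≤ lam := by rw [hlam]; positivity
  induction N with
  | zero => intro z t hz ht; simp
  | succ N ih =>
    intro z t hz ht
    -- `K e^{λτ}` bounds the partial sum, including the term `n = 0`, at all earlier times `τ`.
    set K : ℝ := ‖u₀‖ ^ 2 / (1 - θ) with hK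
    have hK0 : 0 ≤ K := by positivity
    have hU := kimuraU_nonneg (y := z / t) (by positivity)
    have hU2 := kimuraU_le_half (y := z / t) (by positivity)
    have hexp : 1 ≤ Real.exp (lam * t) := Real.one_le_exp (by positivity)
    have hS : ∀ w τ, 0 < w → 0 < τ → ∑ n ∈ Finset.range (N + 1),
        ENNReal.ofReal G ^ n * chaosBound u₀ f n w τ ≤
        ENNReal.ofReal (K * Real.exp (lam * τ)) := fun w τ hw hτ => by
      have hUw := kimuraU_le_half (y := w / τ) (by positivity)
      have hexp' : 1 ≤ Real.exp (lam * τ) := Real.one_le_exp (by positivity)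
      rw [Finset.sum_range_succ', pow_zero, one_mul]
      refine (add_le_add (ih hw hτ) (ENNReal.ofReal_le_ofReal
        (q := ‖u₀‖ ^ 2) ?_)).trans ?_
      · rw [← sq_abs]
        exact pow_le_pow_left₀ (abs_nonneg _) (abs_detSolution_le u₀ hw hτ) 2
      · rw [← ENNReal.ofReal_add _ (by positivity)]
        · apply ENNReal.ofReal_le_ofReal
          have : kimuraU (w / τ) * (2 * θ / (1 - θ)) ≤ 1 / 2 * (2 * θ / (1 - θ)) := by gcongr
          calc _ ≤ ‖u₀‖ ^ 2 * (1 / 2 * (2 * θ / (1 - θ)) + (Real.exp (lam * τ) - 1) / (1 - θ)) +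
                ‖u₀‖ ^ 2 := by gcongr
            _ = K * Real.exp (lam * τ) := by rw [hK]; field_simp; ring
        · have := kimuraU_nonneg (y := w / τ) (by positivity)
          have h3 : 0 ≤ (Real.exp (lam * τ) - 1) / (1 - θ) := div_nonneg (by linarith) h1θ.le
          positivity
    have mq : Measurable fun p : ℝ × ℝ => ENNReal.ofReal (duhamel z t p) :=
      (duhamel_measurable' z t).ennreal_ofReal
    have mq1 : Measurable fun p : ℝ × ℝ => ENNReal.ofReal (duhamel z t (p.1, p.2)) := mq
    have mq2 : Measurable fun p : ℝ × ℝ => ENNReal.ofReal (duhamel z t (p.1, p.2)) ^ 2 :=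
      mq1.pow_const 2
    have mA := chaosBound_measurable u₀ hf.locallyIntegrable
    have hpt : ∀ τ w, ENNReal.ofReal (duhamel z t (w, τ)) * ∑ n ∈ Finset.range (N + 1),
        ENNReal.ofReal G ^ n * chaosBound u₀ f n w τ ≤
        ENNReal.ofReal (duhamel z t (w, τ)) * ENNReal.ofReal (K * Real.exp (lam * τ)) :=
      fun τ w => by
        by_cases h : 0 < w ∧ τ ∈ Ioo 0 t
        · have := hS w τ h.1 h.2.1
          gcongr
        · rw [duhamel_eq_zero h]; simp
    have hpt2 : ∀ τ w, ENNReal.ofReal (duhamel z t (w, τ)) ^ 2 * ∑ n ∈ Finset.range (N + 1),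
        ENNReal.ofReal G ^ n * chaosBound u₀ f n w τ ≤
        ENNReal.ofReal (duhamel z t (w, τ)) ^ 2 * ENNReal.ofReal (K * Real.exp (lam * t)) :=
      fun τ w => by
        by_cases h : 0 < w ∧ τ ∈ Ioo 0 t
        · have := hS w τ h.1 h.2.1
          have h2 : Real.exp (lam * τ) ≤ Real.exp (lam * t) :=
            Real.exp_le_exp.2 (mul_le_mul_of_nonneg_left h.2.2.le hlam0)
          refine mul_le_mul' le_rfl (this.trans (ENNReal.ofReal_le_ofReal ?_))
          gcongr
        · rw [duhamel_eq_zero h]; simp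
    -- The near-diagonal part: the time integral of the squared kernel is `U(z / t)`.
    have I1 : ∫⁻ τ, ∫⁻ w, ENNReal.ofReal (duhamel z t (w, τ)) ^ 2 * ∑ n ∈ Finset.range (N + 1),
        ENNReal.ofReal G ^ n * chaosBound u₀ f n w τ ≤
        ENNReal.ofReal (kimuraU (z / t)) * ENNReal.ofReal (K * Real.exp (lam * t)) := by
      refine (lintegral_mono fun τ => lintegral_mono fun w => hpt2 τ w).trans ?_
      simp only [lintegral_mul_const' _ _ ENNReal.ofReal_ne_top]
      have := lintegral_duhamel_sq_le hz ht
      gcongr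
    -- The off-diagonal part: the kernel has mass at most one in space, and `K G f(ε) = ‖u₀‖² λ`.
    have I2 : ENNReal.ofReal (G * f ε) * ∫⁻ τ, ∫⁻ w, ENNReal.ofReal (duhamel z t (w, τ)) *
        ∑ n ∈ Finset.range (N + 1), ENNReal.ofReal G ^ n * chaosBound u₀ f n w τ ≤
        ENNReal.ofReal (‖u₀‖ ^ 2 * (Real.exp (lam * t) - 1)) := by
      calc _ ≤ ENNReal.ofReal (G * f ε) * ∫⁻ τ in Ioo 0 t,
            ENNReal.ofReal (K * Real.exp (lam * τ)) := by
            refine mul_le_mul' le_rfl ?_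
            rw [← lintegral_indicator measurableSet_Ioo]
            refine lintegral_mono fun τ => ?_
            refine (lintegral_mono fun w => hpt τ w).trans ?_
            rw [lintegral_mul_const' _ _ ENNReal.ofReal_ne_top]
            refine (mul_le_mul' (lintegral_duhamel_le hz τ) le_rfl).trans ?_
            by_cases hτ : τ ∈ Ioo 0 t
            · simp only [indicator_of_mem hτ, Pi.one_apply, one_mul, le_refl]
            · simp only [indicator_of_notMem hτ, zero_mul, le_refl]
        _ = ∫⁻ τ in Ioo 0 t, ENNReal.ofReal (‖u₀‖ ^ 2 * (Real.exp (lam * τ) * lam)) := by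
            rw [← lintegral_const_mul' _ _ ENNReal.ofReal_ne_top]
            refine lintegral_congr fun τ => ?_
            rw [← ENNReal.ofReal_mul (by positivity)]
            congr 1
            rw [hK, hlam]; field_simp
        _ = ENNReal.ofReal (∫ τ in Ioo 0 t, ‖u₀‖ ^ 2 * (Real.exp (lam * τ) * lam)) := by
            rw [ofReal_integral_eq_lintegral_ofReal _ (ae_of_all _ fun τ => by
              simp only [Pi.zero_apply]; positivity)]
            have hc : Continuous fun τ : ℝ => ‖u₀‖ ^ 2 * (Real.exp (lam * τ) * lam) := by fun_prop
            exact (hc.integrableOn_Icc (a := 0) (b := t)).mono_set Ioo_subset_Icc_self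
        _ = _ := by
            congr 1
            have hder : ∀ τ ∈ uIcc 0 t, HasDerivAt (fun τ => ‖u₀‖ ^ 2 * Real.exp (lam * τ))
                (‖u₀‖ ^ 2 * (Real.exp (lam * τ) * lam)) τ := fun τ _ => by
              have h1 : HasDerivAt (fun τ : ℝ => lam * τ) lam τ := by
                simpa using (hasDerivAt_id τ).const_mul lam
              exact h1.exp.const_mul _
            have hc : Continuous fun τ : ℝ => ‖u₀‖ ^ 2 * (Real.exp (lam * τ) * lam) := by fun_prop
            rw [← integral_Ioc_eq_integral_Ioo, ← intervalIntegral.integral_of_le ht.le,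
              intervalIntegral.integral_eq_sub_of_hasDerivAt hder (hc.intervalIntegrable _ _)]
            simp only [mul_zero, Real.exp_zero, mul_one]
            ring
    calc _ ≤ ∑ n ∈ Finset.range (N + 1), ENNReal.ofReal G ^ (n + 1) *
          (ENNReal.ofReal (symmIntegral f ε) *
            (∫⁻ τ, ∫⁻ w, ENNReal.ofReal (duhamel z t (w, τ)) ^ 2 * chaosBound u₀ f n w τ) +
          ENNReal.ofReal (f ε) * ∫⁻ τ, ∫⁻ w, ENNReal.ofReal (duhamel z t (w, τ)) *
            chaosBound u₀ f n w τ) := by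
          gcongr with n _
          exact chaosBound_succ_le u₀ hf hanti hε n hz
      _ = ENNReal.ofReal (G * symmIntegral f ε) *
            (∫⁻ τ, ∫⁻ w, ENNReal.ofReal (duhamel z t (w, τ)) ^ 2 * ∑ n ∈ Finset.range (N + 1),
              ENNReal.ofReal G ^ n * chaosBound u₀ f n w τ) +
          ENNReal.ofReal (G * f ε) * ∫⁻ τ, ∫⁻ w, ENNReal.ofReal (duhamel z t (w, τ)) *
            ∑ n ∈ Finset.range (N + 1), ENNReal.ofReal G ^ n * chaosBound u₀ f n w τ := by
          rw [lintegral_lintegral_sum (G := fun w τ => ENNReal.ofReal (duhamel z t (w, τ)) ^ 2)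
            mq2 mA, lintegral_lintegral_sum (G := fun w τ => ENNReal.ofReal (duhamel z t (w, τ)))
            mq1 mA, ENNReal.ofReal_mul hG, ENNReal.ofReal_mul hG, Finset.mul_sum, Finset.mul_sum,
            ← Finset.sum_add_distrib]
          refine Finset.sum_congr rfl fun n _ => ?_
          ring
      _ ≤ ENNReal.ofReal (G * symmIntegral f ε) *
            (ENNReal.ofReal (kimuraU (z / t)) * ENNReal.ofReal (K * Real.exp (lam * t))) +
          ENNReal.ofReal (‖u₀‖ ^ 2 * (Real.exp (lam * t) - 1)) := by
          refine add_le_add ?_ I2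
          gcongr
      _ ≤ _ := by
          rw [← ENNReal.ofReal_mul hU, ← ENNReal.ofReal_mul (by positivity),
            ← ENNReal.ofReal_add (by positivity)
              (mul_nonneg (by positivity) (by linarith))]
          apply ENNReal.ofReal_le_ofReal
          have hGF : G * symmIntegral f ε = 2 * θ := by rw [hθ]; ring
          rw [hGF, hK]
          -- The slack is a product of non-negative factors because `U ≤ 1/2`.
          have e : ‖u₀‖ ^ 2 * (kimuraU (z / t) * (2 * θ / (1 - θ)) +
              (Real.exp (lam * t) - 1) / (1 - θ)) -
              (2 * θ * (kimuraU (z / t) * (‖u₀‖ ^ 2 / (1 - θ) * Real.exp (lam * t))) +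
              ‖u₀‖ ^ 2 * (Real.exp (lam * t) - 1)) =
              2 * ‖u₀‖ ^ 2 * θ / (1 - θ) * (Real.exp (lam * t) - 1) *
                (1 / 2 - kimuraU (z / t)) := by
            field_simp; ring
          have h4 : 0 ≤ 2 * ‖u₀‖ ^ 2 * θ / (1 - θ) * (Real.exp (lam * t) - 1) *
              (1 / 2 - kimuraU (z / t)) :=
            mul_nonneg (mul_nonneg (by positivity) (by linarith)) (by linarith)
          linarith

/-! ### Potentials of test functions -/

section Potential

/-- The average `∫ γ(τ - s) h(y, s) ds` of `h` in time. -/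
noncomputable def timeAverage (γ : ℝ → ℝ) (h : ℝ × ℝ → ℝ) (τ y : ℝ) : ℝ :=
  ∫ s, γ (τ - s) * h (y, s)

/-- The potential `∫ f(w - y) γ(τ - s) h(y, s) dy ds` of `h` at `(w, τ)`. -/
noncomputable def potential (f γ : ℝ → ℝ) (h : ℝ × ℝ → ℝ) (p : ℝ × ℝ) : ℝ :=
  ∫ q, tensorKernel f γ (p - q) * h q

variable {f γ : ℝ → ℝ} {h g : ℝ × ℝ → ℝ}

theorem continuous_slice (hc : Continuous h) (y : ℝ) : Continuous fun s => h (y, s) :=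
  hc.comp (by fun_prop)

theorem eq_zero_of_notMem_fst {y : ℝ} (hy : y ∉ Prod.fst '' tsupport h) (s : ℝ) : h (y, s) = 0 := by
  by_contra h0
  exact hy ⟨(y, s), subset_tsupport _ h0, rfl⟩

theorem eq_zero_of_notMem_snd {s : ℝ} (hs : s ∉ Prod.snd '' tsupport h) (y : ℝ) : h (y, s) = 0 := by
  by_contra h0
  exact hs ⟨(y, s), subset_tsupport _ h0, rfl⟩

theorem HasCompactSupport.slice (hs : HasCompactSupport h) (y : ℝ) :
    HasCompactSupport fun s => h (y, s) :=
  HasCompactSupport.intro (hs.isCompact.image continuous_snd) fun _ hx =>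
    eq_zero_of_notMem_snd hx y

theorem timeAverage_eq_zero {y : ℝ} (hy : y ∉ Prod.fst '' tsupport h) (τ : ℝ) :
    timeAverage γ h τ y = 0 := by
  simp [timeAverage, eq_zero_of_notMem_fst hy]

theorem continuous_timeAverage_uncurry (hγ : LocallyIntegrable γ) (hc : Continuous h)
    (hs : HasCompactSupport h) : Continuous fun q : ℝ × ℝ => timeAverage γ h q.2 q.1 := by
  have h1 := continuousOn_convolution_right_with_param (ContinuousLinearMap.mul ℝ ℝ) (f := γ)
    (μ := (volume : Measure ℝ)) (g := fun y s => h (y, s)) (s := univ)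
    (k := Prod.snd '' tsupport h) (hs.isCompact.image continuous_snd)
    (fun p x _ hx => eq_zero_of_notMem_snd hx p) hγ hc.continuousOn
  rw [univ_prod_univ, continuousOn_univ] at h1
  refine h1.congr fun q => ?_
  rw [convolution_eq_swap]
  rfl

theorem continuous_timeAverage (hγ : LocallyIntegrable γ) (hc : Continuous h)
    (hs : HasCompactSupport h) (τ : ℝ) : Continuous (timeAverage γ h τ) :=
  (continuous_timeAverage_uncurry hγ hc hs).comp (f := fun y => (y, τ)) (by fun_prop)

theorem hasCompactSupport_timeAverage (hs : HasCompactSupport h) (τ : ℝ) :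
    HasCompactSupport (timeAverage γ h τ) :=
  HasCompactSupport.intro (hs.isCompact.image continuous_fst) fun _ hx => timeAverage_eq_zero hx τ

theorem continuous_potential (hf : LocallyIntegrable f) (hγ : LocallyIntegrable γ)
    (hc : Continuous h) (hs : HasCompactSupport h) : Continuous (potential f γ h) :=
  continuous_kernel_integral (tensorKernel_locallyIntegrable hf hγ) hc hs

theorem potential_eq (hf : LocallyIntegrable f) (hγ : LocallyIntegrable γ)
    (hc : Continuous h) (hs : HasCompactSupport h) (p : ℝ × ℝ) :
    potential f γ h p = ∫ y, f (p.1 - y) * timeAverage γ h p.2 y := by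
  have hi := integrable_kernel_mul (tensorKernel_locallyIntegrable hf hγ) hc hs p
  unfold potential
  rw [Measure.volume_eq_prod] at hi ⊢
  rw [integral_prod _ hi]
  refine integral_congr_ae (ae_of_all _ fun y => ?_)
  simp only [timeAverage, tensorKernel]
  rw [← integral_const_mul]
  exact integral_congr_ae (ae_of_all _ fun s => by simp only [Prod.fst_sub, Prod.snd_sub]; ring)

theorem bilin_timeAverage_integrable (hf : LocallyIntegrable f) (hγ : LocallyIntegrable γ)
    (hg : Continuous g) (hgs : HasCompactSupport g) (hc : Continuous h)
    (hs : HasCompactSupport h) (τ τ' : ℝ) : Integrable fun p : ℝ × ℝ =>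
      f (p.1 - p.2) * timeAverage γ g τ p.1 * timeAverage γ h τ' p.2 :=
  bilin_integrable_of_continuous hf (continuous_timeAverage hγ hg hgs τ)
    (hasCompactSupport_timeAverage hgs τ) (continuous_timeAverage hγ hc hs τ')
    (hasCompactSupport_timeAverage hs τ')

/-- The covariance `∫∫ f(x - y) ĝ(x, τ) ĥ(y, τ) dx dy` of the time averages at time `τ`. -/
noncomputable def sliceForm (f γ : ℝ → ℝ) (g h : ℝ × ℝ → ℝ) (τ : ℝ) : ℝ :=
  bilin f (timeAverage γ g τ) (timeAverage γ h τ)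

theorem sliceForm_eq (hf : LocallyIntegrable f) (hγ : LocallyIntegrable γ)
    (hg : Continuous g) (hgs : HasCompactSupport g) (hc : Continuous h)
    (hs : HasCompactSupport h) (τ : ℝ) :
    sliceForm f γ g h τ = ∫ w, timeAverage γ g τ w * potential f γ h (w, τ) := by
  unfold sliceForm
  rw [bilin_eq_integral (bilin_timeAverage_integrable hf hγ hg hgs hc hs τ τ)]
  simp only [potential_eq hf hγ hc hs]

theorem continuous_sliceForm (hf : LocallyIntegrable f) (hγ : LocallyIntegrable γ)
    (hg : Continuous g) (hgs : HasCompactSupport g) (hc : Continuous h)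
    (hs : HasCompactSupport h) : Continuous (sliceForm f γ g h) := by
  have h1 : Continuous (fun τ => ∫ w in Prod.fst '' tsupport g,
      timeAverage γ g τ w * potential f γ h (w, τ)) := by
    refine continuous_parametric_integral_of_continuous
      (f := fun τ w => timeAverage γ g τ w * potential f γ h (w, τ)) ?_
      (hgs.isCompact.image continuous_fst)
    refine Continuous.mul ?_ ?_
    · exact (continuous_timeAverage_uncurry hγ hg hgs).comp continuous_swap
    · exact (continuous_potential hf hγ hc hs).comp continuous_swap
  refine h1.congr fun τ => ?_
  rw [sliceForm_eq hf hγ hg hgs hc hs]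
  exact setIntegral_eq_integral_of_forall_compl_eq_zero fun w hw => by
    rw [timeAverage_eq_zero hw, zero_mul]

theorem sliceForm_comm (hf : IsCovarianceKernel f) (τ : ℝ) :
    sliceForm f γ g h τ = sliceForm f γ h g τ := bilin_swap hf.isPDKernel _ _

/-- The integral over `(0, t)` of the covariances of the time averages. -/
noncomputable def sliceIntegral (f γ : ℝ → ℝ) (g h : ℝ × ℝ → ℝ) (t : ℝ) : ℝ :=
  ∫ τ in (0 : ℝ)..t, sliceForm f γ g h τ

section Family

variable {ι : Type*} [Fintype ι] {H : ι → ℝ × ℝ → ℝ}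

theorem continuous_linComb (hc : ∀ i, Continuous (H i)) (c : ι → ℝ) :
    Continuous fun p => ∑ i, c i * H i p := by fun_prop

theorem hasCompactSupport_linComb (hs : ∀ i, HasCompactSupport (H i)) (c : ι → ℝ) :
    HasCompactSupport fun p => ∑ i, c i * H i p := by
  refine HasCompactSupport.intro (K := ⋃ i, tsupport (H i))
    (isCompact_iUnion fun i => (hs i).isCompact) fun x hx => ?_
  refine Finset.sum_eq_zero fun i _ => ?_
  rw [image_eq_zero_of_notMem_tsupport (fun h => hx (mem_iUnion.2 ⟨i, h⟩)), mul_zero]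

theorem timeAverage_linComb (hγ : LocallyIntegrable γ) (hc : ∀ i, Continuous (H i))
    (hs : ∀ i, HasCompactSupport (H i)) (c : ι → ℝ) (τ y : ℝ) :
    timeAverage γ (fun p => ∑ i, c i * H i p) τ y = ∑ i, c i * timeAverage γ (H i) τ y := by
  unfold timeAverage
  simp only [← integral_const_mul]
  rw [← integral_finsetSum _ fun i _ =>
    (integrable_kernel_mul hγ (continuous_slice (hc i) y) ((hs i).slice y) τ).const_mul (c i)]
  refine integral_congr_ae (ae_of_all _ fun s => ?_)
  dsimp only
  rw [Finset.mul_sum]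
  exact Finset.sum_congr rfl fun i _ => by ring

theorem bilin_linComb {E : Type*} [NormedAddCommGroup E] [NormedSpace ℝ E]
    [FiniteDimensional ℝ E] [MeasureSpace E] [BorelSpace E] [(volume : Measure E).IsAddHaarMeasure]
    {k : E → ℝ} {G : ι → E → ℝ}
    (hi : ∀ i j, Integrable fun p : E × E => k (p.1 - p.2) * G i p.1 * G j p.2) (c : ι → ℝ) :
    bilin k (fun x => ∑ i, c i * G i x) (fun x => ∑ i, c i * G i x) =
      ∑ i, ∑ j, c i * c j * bilin k (G i) (G j) := by
  unfold bilin
  simp only [← integral_const_mul]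
  simp_rw [← integral_finsetSum _ fun j _ => (hi _ j).const_mul _]
  rw [← integral_finsetSum _ fun i _ => integrable_finsetSum _ fun j _ => (hi i j).const_mul _]
  refine integral_congr_ae (ae_of_all _ fun p => ?_)
  dsimp only
  rw [mul_assoc, Finset.sum_mul_sum, Finset.mul_sum]
  refine Finset.sum_congr rfl fun i _ => ?_
  rw [Finset.mul_sum]
  exact Finset.sum_congr rfl fun j _ => by ring

theorem bilin_linComb_integrable {E : Type*} [NormedAddCommGroup E] [NormedSpace ℝ E]
    [FiniteDimensional ℝ E] [MeasureSpace E] [BorelSpace E] [(volume : Measure E).IsAddHaarMeasure]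
    {k : E → ℝ} {G : ι → E → ℝ}
    (hi : ∀ i j, Integrable fun p : E × E => k (p.1 - p.2) * G i p.1 * G j p.2) (c : ι → ℝ) :
    Integrable fun p : E × E => k (p.1 - p.2) * (∑ i, c i * G i p.1) * ∑ i, c i * G i p.2 := by
  refine (integrable_finsetSum Finset.univ fun i _ => integrable_finsetSum Finset.univ fun j _ =>
    (hi i j).const_mul (c i * c j)).congr (ae_of_all _ fun p => ?_)
  dsimp only
  rw [mul_assoc, Finset.sum_mul_sum, Finset.mul_sum]
  refine Finset.sum_congr rfl fun i _ => ?_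
  rw [Finset.mul_sum]
  exact Finset.sum_congr rfl fun j _ => by ring

theorem sliceForm_linComb (hf : LocallyIntegrable f) (hγ : LocallyIntegrable γ)
    (hc : ∀ i, Continuous (H i)) (hs : ∀ i, HasCompactSupport (H i)) (c : ι → ℝ) (τ : ℝ) :
    sliceForm f γ (fun p => ∑ i, c i * H i p) (fun p => ∑ i, c i * H i p) τ =
      ∑ i, ∑ j, c i * c j * sliceForm f γ (H i) (H j) τ := by
  unfold sliceForm
  rw [← bilin_linComb fun i j =>
    bilin_timeAverage_integrable hf hγ (hc i) (hs i) (hc j) (hs j) τ τ]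
  congr 1 <;> exact funext fun y => timeAverage_linComb hγ hc hs c τ y

theorem sliceForm_self_nonneg (hf : IsCovarianceKernel f) (hγ : LocallyIntegrable γ)
    (hc : Continuous h) (hs : HasCompactSupport h) (τ : ℝ) : 0 ≤ sliceForm f γ h h τ :=
  bilin_nonneg hf.isPDKernel (continuous_timeAverage hγ hc hs τ).measurable
    (bilin_timeAverage_integrable hf.locallyIntegrable hγ hc hs hc hs τ τ)

theorem sliceIntegral_linComb (hf : LocallyIntegrable f) (hγ : LocallyIntegrable γ)
    (hc : ∀ i, Continuous (H i)) (hs : ∀ i, HasCompactSupport (H i)) (c : ι → ℝ) (t : ℝ) :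
    sliceIntegral f γ (fun p => ∑ i, c i * H i p) (fun p => ∑ i, c i * H i p) t =
      ∑ i, ∑ j, c i * c j * sliceIntegral f γ (H i) (H j) t := by
  have hi : ∀ i j, IntervalIntegrable (fun τ => c i * c j * sliceForm f γ (H i) (H j) τ)
      volume 0 t := fun i j =>
    ((continuous_sliceForm hf hγ (hc i) (hs i) (hc j) (hs j)).intervalIntegrable _ _).const_mul _
  unfold sliceIntegral
  simp only [sliceForm_linComb hf hγ hc hs c, ← intervalIntegral.integral_const_mul]
  rw [intervalIntegral.integral_finsetSum fun i _ => ?_]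
  · refine Finset.sum_congr rfl fun i _ => ?_
    rw [intervalIntegral.integral_finsetSum fun j _ => hi i j]
  · have := IntervalIntegrable.sum Finset.univ fun j _ => hi i j
    rwa [Finset.sum_fn] at this

theorem sliceIntegral_comm (hf : IsCovarianceKernel f) (t : ℝ) :
    sliceIntegral f γ g h t = sliceIntegral f γ h g t := by
  unfold sliceIntegral
  simp only [sliceForm_comm hf (g := g)]

theorem sliceIntegral_self_nonneg (hf : IsCovarianceKernel f) (hγ : LocallyIntegrable γ)
    (hc : Continuous h) (hs : HasCompactSupport h) {t : ℝ} (ht : 0 ≤ t) :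
    0 ≤ sliceIntegral f γ h h t :=
  intervalIntegral.integral_nonneg ht fun τ _ => sliceForm_self_nonneg hf hγ hc hs τ

theorem Matrix.posSemidef_of_sum_nonneg {A : Matrix ι ι ℝ} (hsymm : ∀ i j, A i j = A j i)
    (h : ∀ c : ι → ℝ, 0 ≤ ∑ i, ∑ j, c i * c j * A i j) : A.PosSemidef := by
  refine Matrix.PosSemidef.of_dotProduct_mulVec_nonneg ?_ fun c => ?_
  · ext i j
    simp [hsymm i j]
  · refine (h c).trans_eq ?_
    simp only [dotProduct, Matrix.mulVec, Pi.star_apply, star_trivial, Finset.mul_sum]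
    exact Finset.sum_congr rfl fun i _ => Finset.sum_congr rfl fun j _ => by ring

theorem Matrix.PosSemidef.sum_nonneg {A : Matrix ι ι ℝ} (hA : A.PosSemidef) (c : ι → ℝ) :
    0 ≤ ∑ i, ∑ j, c i * c j * A i j := by
  refine (hA.dotProduct_mulVec_nonneg c).trans_eq ?_
  simp only [dotProduct, Matrix.mulVec, Pi.star_apply, star_trivial, Finset.mul_sum]
  exact Finset.sum_congr rfl fun i _ => Finset.sum_congr rfl fun j _ => by ring

/-- Entrywise powers of positive semidefinite matrices are positive semidefinite. -/
theorem Matrix.PosSemidef.entry_pow {A : Matrix ι ι ℝ} (hA : A.PosSemidef) (n : ℕ) :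
    (Matrix.of fun i j => A i j ^ n).PosSemidef := by
  induction n with
  | zero =>
    have := Matrix.posSemidef_vecMulVec_self_star (fun _ : ι => (1 : ℝ))
    convert this using 1
    ext i j
    simp [Matrix.vecMulVec_apply]
  | succ n ih =>
    have e : (Matrix.of fun i j => A i j ^ (n + 1)) =
        Matrix.hadamard (Matrix.of fun i j => A i j ^ n) A := by
      ext i j
      simp [pow_succ]
    rw [e]
    exact ih.hadamard hA

/-- Entrywise powers are monotone on positive semidefinite matrices. -/
theorem Matrix.PosSemidef.entry_pow_sub {A B : Matrix ι ι ℝ} (hA : A.PosSemidef)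
    (hB : B.PosSemidef) (hAB : (B - A).PosSemidef) (n : ℕ) :
    (Matrix.of fun i j => B i j ^ n - A i j ^ n).PosSemidef := by
  induction n with
  | zero =>
    convert Matrix.PosSemidef.zero (n := ι) (R := ℝ) using 1
    ext i j
    simp
  | succ n ih =>
    have e : (Matrix.of fun i j => B i j ^ (n + 1) - A i j ^ (n + 1)) =
        Matrix.hadamard (Matrix.of fun i j => B i j ^ n) (B - A) +
          Matrix.hadamard (Matrix.of fun i j => B i j ^ n - A i j ^ n) A := by
      ext i j
      simp only [Matrix.of_apply, Matrix.add_apply, Matrix.hadamard_apply, Matrix.sub_apply]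
      ring
    rw [e]
    exact ((hB.entry_pow n).hadamard hAB).add (ih.hadamard hA)

theorem sliceIntegral_posSemidef (hf : IsCovarianceKernel f) (hγ : LocallyIntegrable γ)
    (hc : ∀ i, Continuous (H i)) (hs : ∀ i, HasCompactSupport (H i)) {t : ℝ} (ht : 0 ≤ t) :
    (Matrix.of fun i j => sliceIntegral f γ (H i) (H j) t).PosSemidef := by
  refine Matrix.posSemidef_of_sum_nonneg (fun i j => sliceIntegral_comm hf t) fun c => ?_
  simp only [Matrix.of_apply]
  rw [← sliceIntegral_linComb hf.locallyIntegrable hγ hc hs c]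
  exact sliceIntegral_self_nonneg hf hγ (continuous_linComb hc c)
    (hasCompactSupport_linComb hs c) ht

end Family

end Potential

/-! ### Comparison of the covariances up to time `t` with the covariances in `H` -/

section Comparison

variable {f γ : ℝ → ℝ} {h : ℝ × ℝ → ℝ}

/-- The time average of `h`, cut off to the time interval `(0, t)`. -/
noncomputable def cutAverage (γ : ℝ → ℝ) (h : ℝ × ℝ → ℝ) (t : ℝ) (p : ℝ × ℝ) : ℝ :=
  (Ioo 0 t).indicator (fun τ => timeAverage γ h τ p.1) p.2

theorem cutAverage_measurable (hγ : LocallyIntegrable γ) (hc : Continuous h)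
    (hs : HasCompactSupport h) (t : ℝ) : Measurable (cutAverage γ h t) := by
  have h1 : cutAverage γ h t = (Prod.snd ⁻¹' Ioo 0 t).indicator
      fun q : ℝ × ℝ => timeAverage γ h q.2 q.1 := by
    ext q
    simp only [cutAverage, indicator, mem_preimage]
  rw [h1]
  exact (continuous_timeAverage_uncurry hγ hc hs).measurable.indicator
    (measurable_snd measurableSet_Ioo)

theorem cutAverage_bounds (hγ : LocallyIntegrable γ) (hc : Continuous h)
    (hs : HasCompactSupport h) (t : ℝ) :
    ∃ M C : ℝ, (∀ p, |cutAverage γ h t p| ≤ C) ∧ ∀ p, cutAverage γ h t p ≠ 0 → ‖p‖ ≤ M := by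
  have hK : IsCompact ((Prod.fst '' tsupport h) ×ˢ Icc 0 t) :=
    (hs.isCompact.image continuous_fst).prod isCompact_Icc
  have hmem : ∀ p, cutAverage γ h t p ≠ 0 →
      p ∈ (Prod.fst '' tsupport h) ×ˢ Icc 0 t := fun p hp => by
    by_contra hcon
    apply hp
    unfold cutAverage
    by_cases h2 : p.2 ∈ Ioo 0 t
    · rw [indicator_of_mem h2]
      exact timeAverage_eq_zero (fun h1 => hcon ⟨h1, Ioo_subset_Icc_self h2⟩) _
    · exact indicator_of_notMem h2 _
  obtain ⟨C, hC⟩ := hK.exists_bound_of_continuousOn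
    (continuous_timeAverage_uncurry hγ hc hs).continuousOn
  obtain ⟨M, hM⟩ := hK.isBounded.exists_norm_le
  refine ⟨M, max C 0, fun p => ?_, fun p hp => hM p (hmem p hp)⟩
  by_cases hp : cutAverage γ h t p = 0
  · rw [hp, abs_zero]; exact le_max_right _ _
  · refine le_trans ?_ ((hC p (hmem p hp)).trans (le_max_left _ _))
    rw [Real.norm_eq_abs]
    unfold cutAverage
    by_cases h2 : p.2 ∈ Ioo 0 t
    · rw [indicator_of_mem h2]
    · rw [indicator_of_notMem h2, abs_zero]; positivity

theorem sliceForm_ofReal_integral (hf : IsCovarianceKernel f) (hγ : LocallyIntegrable γ)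
    (hc : Continuous h) (hs : HasCompactSupport h) {t : ℝ} (ht : 0 ≤ t) :
    ∫⁻ τ in Ioo 0 t, ENNReal.ofReal (sliceForm f γ h h τ) =
      ENNReal.ofReal (sliceIntegral f γ h h t) := by
  unfold sliceIntegral
  rw [intervalIntegral.integral_of_le ht, integral_Ioc_eq_integral_Ioo,
    ofReal_integral_eq_lintegral_ofReal _ (ae_of_all _ fun τ =>
      sliceForm_self_nonneg hf hγ hc hs τ)]
  exact ((continuous_sliceForm hf.locallyIntegrable hγ hc hs hc hs).integrableOn_Icc
    (a := 0) (b := t)).mono_set Ioo_subset_Icc_self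

theorem abs_bilin_timeAverage_le (hf : IsCovarianceKernel f) (hγ : LocallyIntegrable γ)
    (hc : Continuous h) (hs : HasCompactSupport h) (r s : ℝ) :
    |bilin f (timeAverage γ h r) (timeAverage γ h s)| ≤
      √(sliceForm f γ h h r) * √(sliceForm f γ h h s) := by
  rw [← Real.sqrt_mul (sliceForm_self_nonneg hf hγ hc hs r)]
  refine Real.abs_le_sqrt ?_
  exact bilin_sq_le hf.isPDKernel (continuous_timeAverage hγ hc hs r).measurable
    (continuous_timeAverage hγ hc hs s).measurable
    (bilin_timeAverage_integrable hf.locallyIntegrable hγ hc hs hc hs r r)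
    (bilin_timeAverage_integrable hf.locallyIntegrable hγ hc hs hc hs s s)

/-- The norm in `H` of the cut-off average, by the Young inequality in time. -/
theorem bilin_cutAverage_self_le (hf : IsCovarianceKernel f) (hγ : IsCovarianceKernel γ)
    (hc : Continuous h) (hs : HasCompactSupport h) {t : ℝ} (ht : 0 ≤ t) :
    bilin (tensorKernel f γ) (cutAverage γ h t) (cutAverage γ h t) ≤
      symmIntegral γ t * sliceIntegral f γ h h t := by
  have hγ' := hγ.locallyIntegrable
  have hK := isPDKernel_tensorKernel hf hγ
  obtain ⟨M, C, hb1, hb2⟩ := cutAverage_bounds hγ' hc hs t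
  have hm := cutAverage_measurable hγ' hc hs t
  have hi := bilin_integrable_of_bounded hK.locallyIntegrable hm hm hb1 hb1 hb2 hb2
  have hi2 : Integrable fun p : (ℝ × ℝ) × (ℝ × ℝ) => f (p.1.1 - p.1.2) * γ (p.2.1 - p.2.2) *
      cutAverage γ h t (p.1.1, p.2.1) * cutAverage γ h t (p.1.2, p.2.2) :=
    measurePreserving_middleSwap.integrable_comp_of_integrable hi
  rw [Measure.volume_eq_prod] at hi2
  -- For times in `(0, t)`, the spatial integrals are bounded by the Cauchy–Schwarz inequality,
  -- and the time integral by the Young inequality with `γ` restricted to `(-t, t)`.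
  let a : ℝ → ℝ≥0∞ := (Ioo 0 t).indicator fun τ => ENNReal.ofReal √(sliceForm f γ h h τ)
  let φ : ℝ → ℝ≥0∞ := (Ioo (-t) t).indicator fun x => ENNReal.ofReal (γ x)
  have hcont := continuous_sliceForm hf.locallyIntegrable hγ' hc hs hc hs
  have ha : Measurable a := (hcont.measurable.sqrt.ennreal_ofReal).indicator measurableSet_Ioo
  have hφ : AEMeasurable φ :=
    (hγ'.aestronglyMeasurable.aemeasurable.ennreal_ofReal).indicator measurableSet_Ioo
  have hpt : ∀ q : ℝ × ℝ, ‖∫ p : ℝ × ℝ, f (p.1 - p.2) * γ (q.1 - q.2) *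
      cutAverage γ h t (p.1, q.1) * cutAverage γ h t (p.2, q.2)‖ₑ ≤
      φ (q.1 - q.2) * a q.1 * a q.2 := fun q => by
    by_cases h1 : q.1 ∈ Ioo 0 t
    · by_cases h2 : q.2 ∈ Ioo 0 t
      · have h3 : q.1 - q.2 ∈ Ioo (-t) t := ⟨by linarith [h1.1, h2.2], by linarith [h1.2, h2.1]⟩
        simp only [a, φ, cutAverage, indicator_of_mem h1, indicator_of_mem h2, indicator_of_mem h3]
        have e : ∀ p : ℝ × ℝ, f (p.1 - p.2) * γ (q.1 - q.2) * timeAverage γ h q.1 p.1 *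
            timeAverage γ h q.2 p.2 = γ (q.1 - q.2) *
            (f (p.1 - p.2) * timeAverage γ h q.1 p.1 * timeAverage γ h q.2 p.2) := fun p => by ring
        simp only [e]
        rw [integral_const_mul, ← ENNReal.ofReal_mul (hγ.nonneg _),
          ← ENNReal.ofReal_mul (mul_nonneg (hγ.nonneg _) (Real.sqrt_nonneg _)),
          Real.enorm_eq_ofReal_abs, abs_mul, abs_of_nonneg (hγ.nonneg _), mul_assoc]
        exact ENNReal.ofReal_le_ofReal (mul_le_mul_of_nonneg_left
          (abs_bilin_timeAverage_le hf hγ' hc hs _ _) (hγ.nonneg _))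
      · simp [cutAverage, indicator_of_notMem h2]
    · simp [cutAverage, indicator_of_notMem h1]
  have hm0 := sliceIntegral_self_nonneg hf hγ' hc hs ht
  have hΓ := symmIntegral_nonneg hγ ht
  have ha2 : ∫⁻ x, a x ^ 2 = ENNReal.ofReal (sliceIntegral f γ h h t) := by
    rw [← sliceForm_ofReal_integral hf hγ' hc hs ht, ← lintegral_indicator measurableSet_Ioo]
    refine lintegral_congr fun τ => ?_
    by_cases hτ : τ ∈ Ioo 0 t
    · simp only [a, indicator_of_mem hτ]
      rw [← ENNReal.ofReal_pow (Real.sqrt_nonneg _),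
        Real.sq_sqrt (sliceForm_self_nonneg hf hγ' hc hs τ)]
    · simp only [a, indicator_of_notMem hτ]; norm_num
  have hφ1 : ∫⁻ x, φ x = ENNReal.ofReal (symmIntegral γ t) := by
    rw [← lintegral_symmIntegral hγ ht, lintegral_indicator measurableSet_Ioo]
  have hmain : ENNReal.ofReal (bilin (tensorKernel f γ) (cutAverage γ h t) (cutAverage γ h t)) ≤
      ENNReal.ofReal (symmIntegral γ t * sliceIntegral f γ h h t) := by
    refine Real.ofReal_le_enorm _ |>.trans ?_
    rw [integral_tensorKernel, Measure.volume_eq_prod, integral_prod_symm _ hi2]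
    refine (enorm_integral_le_lintegral_enorm _).trans ((lintegral_mono hpt).trans ?_)
    refine (lintegral_young hφ ha ha).trans ?_
    rw [ha2, hφ1, ENNReal.add_div, ENNReal.add_halves, ENNReal.ofReal_mul hΓ]
  exact (ENNReal.ofReal_le_ofReal_iff (by positivity)).1 hmain

/-- The potential of `h` at time `τ`, paired with the time average of `h`, is the covariance of
the time averages at time `τ`. -/
theorem bilin_cutAverage (hf : IsCovarianceKernel f) (hγ : IsCovarianceKernel γ)
    (hc : Continuous h) (hs : HasCompactSupport h) {t : ℝ} (ht : 0 ≤ t) :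
    bilin (tensorKernel f γ) (cutAverage γ h t) h = sliceIntegral f γ h h t := by
  have hγ' := hγ.locallyIntegrable
  have hK := isPDKernel_tensorKernel hf hγ
  obtain ⟨M, C, hb1, hb2⟩ := cutAverage_bounds hγ' hc hs t
  obtain ⟨C', hC'⟩ := hs.exists_bound_of_continuous hc
  obtain ⟨M', hM'⟩ := hs.isCompact.isBounded.exists_norm_le
  have hi := bilin_integrable_of_bounded hK.locallyIntegrable (M := max M M') (C := max C C')
    (cutAverage_measurable hγ' hc hs t) hc.measurable
    (fun p => (hb1 p).trans (le_max_left _ _)) (fun p => (hC' p).trans (le_max_right _ _))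
    (fun p hp => (hb2 p hp).trans (le_max_left _ _))
    (fun p hp => (hM' p (subset_tsupport _ hp)).trans (le_max_right _ _))
  have hi2 : Integrable fun p => cutAverage γ h t p * potential f γ h p :=
    integrable_mul_kernel_integral hi
  have e : bilin (tensorKernel f γ) (cutAverage γ h t) h =
      ∫ p, cutAverage γ h t p * potential f γ h p := bilin_eq_integral hi
  rw [e]
  rw [Measure.volume_eq_prod] at hi2
  rw [Measure.volume_eq_prod, integral_prod_symm _ hi2]
  unfold sliceIntegral
  rw [intervalIntegral.integral_of_le ht, integral_Ioc_eq_integral_Ioo,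
    ← integral_indicator measurableSet_Ioo]
  refine integral_congr_ae (ae_of_all _ fun τ => ?_)
  by_cases hτ : τ ∈ Ioo 0 t
  · simp only [cutAverage, indicator_of_mem hτ]
    rw [sliceForm_eq hf.locallyIntegrable hγ' hc hs hc hs]
  · simp only [cutAverage, indicator_of_notMem hτ, zero_mul, integral_zero]

/-- The covariance which the noise accumulates up to time `t` when `γ` is replaced by white
noise is at most `Γ_t` times the norm in `H`. -/
theorem sliceIntegral_self_le (hf : IsCovarianceKernel f) (hγ : IsCovarianceKernel γ)
    (hc : Continuous h) (hs : HasCompactSupport h) {t : ℝ} (ht : 0 ≤ t) :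
    sliceIntegral f γ h h t ≤ symmIntegral γ t * bilin (tensorKernel f γ) h h := by
  have hγ' := hγ.locallyIntegrable
  have hK := isPDKernel_tensorKernel hf hγ
  obtain ⟨M, C, hb1, hb2⟩ := cutAverage_bounds hγ' hc hs t
  have hm := cutAverage_measurable hγ' hc hs t
  have hih := bilin_integrable_of_continuous hK.locallyIntegrable hc hs hc hs
  have h1 := bilin_sq_le hK hm hc.measurable
    (bilin_integrable_of_bounded hK.locallyIntegrable hm hm hb1 hb1 hb2 hb2) hih
  rw [bilin_cutAverage hf hγ hc hs ht] at h1
  have h2 := bilin_cutAverage_self_le hf hγ hc hs ht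
  have h3 := bilin_nonneg hK hc.measurable hih
  have h4 := sliceIntegral_self_nonneg hf hγ' hc hs ht
  have h5 := symmIntegral_nonneg hγ ht
  -- With `m` the accumulated covariance, `m² = ⟨ψ, h⟩² ≤ ⟨ψ, ψ⟩ ⟨h, h⟩ ≤ Γ_t m ⟨h, h⟩` for the
  -- cut-off average `ψ`; one factor `m` cancels unless `m = 0`.
  rcases h4.eq_or_lt with h6 | h6
  · rw [← h6]; positivity
  · have h7 := h1.trans (mul_le_mul_of_nonneg_right h2 h3)
    have h8 : sliceIntegral f γ h h t * sliceIntegral f γ h h t ≤ sliceIntegral f γ h h t *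
      (symmIntegral γ t * bilin (tensorKernel f γ) h h) := by linarith
    exact le_of_mul_le_mul_left h8 h6

/-- The comparison of `sliceIntegral_self_le` for Gram matrices and their entrywise powers. -/
theorem sum_sliceIntegral_pow_le (hf : IsCovarianceKernel f) (hγ : IsCovarianceKernel γ)
    {ι : Type*} [Fintype ι] {H : ι → ℝ × ℝ → ℝ}
    (hc : ∀ i, Continuous (H i)) (hs : ∀ i, HasCompactSupport (H i)) {t : ℝ} (ht : 0 ≤ t) (n : ℕ)
    (c : ι → ℝ) :
    ∑ i, ∑ j, c i * c j * sliceIntegral f γ (H i) (H j) t ^ n ≤ symmIntegral γ t ^ n *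
      ∑ i, ∑ j, c i * c j * bilin (tensorKernel f γ) (H i) (H j) ^ n := by
  have hK := isPDKernel_tensorKernel hf hγ
  have hΓ := symmIntegral_nonneg hγ ht
  have hi := fun i j => bilin_integrable_of_continuous hK.locallyIntegrable (hc i) (hs i) (hc j)
    (hs j)
  have key : ∀ c : ι → ℝ, ∑ i, ∑ j, c i * c j * sliceIntegral f γ (H i) (H j) t ≤
      ∑ i, ∑ j, c i * c j * (symmIntegral γ t * bilin (tensorKernel f γ) (H i) (H j)) := fun c => by
    rw [← sliceIntegral_linComb hf.locallyIntegrable hγ.locallyIntegrable hc hs c]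
    refine (sliceIntegral_self_le hf hγ (continuous_linComb hc c)
      (hasCompactSupport_linComb hs c) ht).trans_eq ?_
    rw [bilin_linComb hi c, Finset.mul_sum]
    refine Finset.sum_congr rfl fun i _ => ?_
    rw [Finset.mul_sum]
    exact Finset.sum_congr rfl fun j _ => by ring
  have hA := sliceIntegral_posSemidef hf hγ.locallyIntegrable hc hs ht
  have hBA : ((Matrix.of fun i j => symmIntegral γ t * bilin (tensorKernel f γ) (H i) (H j)) -
      Matrix.of fun i j => sliceIntegral f γ (H i) (H j) t).PosSemidef := by
    refine Matrix.posSemidef_of_sum_nonneg (fun i j => ?_) fun c => ?_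
    · simp only [Matrix.sub_apply, Matrix.of_apply]
      rw [sliceIntegral_comm hf, bilin_swap hK]
    · simp only [Matrix.sub_apply, Matrix.of_apply, mul_sub, Finset.sum_sub_distrib]
      have := key c
      linarith
  have hB : (Matrix.of fun i j =>
      symmIntegral γ t * bilin (tensorKernel f γ) (H i) (H j)).PosSemidef := by
    have := hBA.add hA
    rwa [sub_add_cancel] at this
  have h := (hA.entry_pow_sub hB hBA n).sum_nonneg c
  simp only [Matrix.of_apply, mul_sub, Finset.sum_sub_distrib, sub_nonneg] at h
  refine h.trans_eq ?_
  rw [Finset.mul_sum]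
  refine Finset.sum_congr rfl fun i _ => ?_
  rw [Finset.mul_sum]
  exact Finset.sum_congr rfl fun j _ => by rw [mul_pow]; ring

end Comparison

/-! ### Pairings of the chaos components with exponentials -/

section Pairing

variable (u₀ : BoundedContinuousFunction (Ioi (0 : ℝ)) ℝ) {f γ : ℝ → ℝ} {h : ℝ × ℝ → ℝ}

/-- The pairing `∫ fₙ(p; z, t) h̃(p₁) ⋯ h̃(pₙ) dp` of the Duhamel kernel with the `n`-th tensor
power of the potential `h̃` of `h`, which is the expectation of the product of the `n`-th multiple
integral and the exponential `exp(W(h) - ‖h‖² / 2)`. -/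
noncomputable def chaosPairing (f γ : ℝ → ℝ) (h : ℝ × ℝ → ℝ) : ℕ → ℝ → ℝ → ℝ
  | 0, z, t => detSolution u₀ z t
  | n + 1, z, t => ∫ p, duhamel z t p * (chaosPairing f γ h n p.1 p.2 * potential f γ h p)

theorem chaosPairing_measurable (hf : LocallyIntegrable f) (hγ : LocallyIntegrable γ)
    (hc : Continuous h) (hs : HasCompactSupport h) (n : ℕ) :
    Measurable fun p : ℝ × ℝ => chaosPairing u₀ f γ h n p.1 p.2 := by
  induction n with
  | zero => exact detSolution_measurable u₀
  | succ n ih =>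
    have h1 : Measurable fun q : (ℝ × ℝ) × (ℝ × ℝ) => duhamel q.1.1 q.1.2 q.2 *
        (chaosPairing u₀ f γ h n q.2.1 q.2.2 * potential f γ h q.2) :=
      duhamel_measurable.mul ((ih.comp measurable_snd).mul
        ((continuous_potential hf hγ hc hs).measurable.comp measurable_snd))
    exact h1.stronglyMeasurable.integral_prod_right'.measurable

theorem exists_chaosBound_le (hf : IsCovarianceKernel f) (hanti : AntitoneOn f (Ioi 0))
    (hlim : Tendsto (fun ε => symmIntegral f ε) (𝓝[>] 0) (𝓝 0)) (n : ℕ) (T : ℝ) :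
    ∃ C : ℝ, 0 ≤ C ∧ ∀ z t, 0 < z → 0 < t → t ≤ T → chaosBound u₀ f n z t ≤ ENNReal.ofReal C := by
  cases n with
  | zero =>
    refine ⟨‖u₀‖ ^ 2, by positivity, fun z t hz ht _ => ENNReal.ofReal_le_ofReal ?_⟩
    rw [← sq_abs]
    exact pow_le_pow_left₀ (abs_nonneg _) (abs_detSolution_le u₀ hz ht) 2
  | succ n =>
    obtain ⟨ε, hε1, hε⟩ := ((hlim.eventually (gt_mem_nhds (one_pos))).and
      self_mem_nhdsWithin).exists
    have hε0 : 0 < ε := hε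
    have hF := symmIntegral_nonneg hf hε0.le
    set θ := 1 * symmIntegral f ε / 2 with hθ
    have hθ0 : 0 ≤ θ := by positivity
    have hθ1 : θ < 1 := by linarith
    set lam := 1 * f ε / (1 - θ) with hlam
    have hlam0 : 0 ≤ lam := div_nonneg (by linarith [hf.nonneg ε]) (by linarith)
    refine ⟨max (‖u₀‖ ^ 2 * (1 / 2 * (2 * θ / (1 - θ)) + (Real.exp (lam * T) - 1) / (1 - θ))) 0,
      le_max_right _ _, fun z t hz ht htT => ?_⟩
    have h := sum_chaosBound_le u₀ hf hanti hε0 zero_le_one hθ hθ1 hlam (n + 1) hz ht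
    have h1 := (Finset.single_le_sum (f := fun n => ENNReal.ofReal 1 ^ (n + 1) *
      chaosBound u₀ f (n + 1) z t) (fun _ _ => zero_le) (Finset.self_mem_range_succ n)).trans h
    rw [ENNReal.ofReal_one, one_pow, one_mul] at h1
    refine h1.trans (ENNReal.ofReal_le_ofReal (le_trans ?_ (le_max_left _ _)))
    have h2 := kimuraU_le_half (y := z / t) (by positivity)
    have h3 : Real.exp (lam * t) ≤ Real.exp (lam * T) :=
      Real.exp_le_exp.2 (mul_le_mul_of_nonneg_left htT hlam0)
    have h4 : 0 < 1 - θ := by linarith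
    gcongr

/-- The quadratic form `∑ cᵢ cⱼ mᵢⱼ(t)ⁿ / n!` in terms of the accumulated covariances `mᵢⱼ`. -/
noncomputable def powerForm (f γ : ℝ → ℝ) {ι : Type*} [Fintype ι] (H : ι → ℝ × ℝ → ℝ) (n : ℕ)
    (c : ι → ℝ) (t : ℝ) : ℝ :=
  ∑ i, ∑ j, c i * c j * (sliceIntegral f γ (H i) (H j) t ^ n / n.factorial)

variable {ι : Type*} [Fintype ι] {H : ι → ℝ × ℝ → ℝ}

theorem hasDerivAt_sliceIntegral (hf : LocallyIntegrable f) (hγ : LocallyIntegrable γ)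
    {g : ℝ × ℝ → ℝ} (hg : Continuous g) (hgs : HasCompactSupport g) (hc : Continuous h)
    (hs : HasCompactSupport h) (t : ℝ) :
    HasDerivAt (sliceIntegral f γ g h) (sliceForm f γ g h t) t :=
  ((continuous_sliceForm hf hγ hg hgs hc hs).integral_hasStrictDerivAt 0 t).hasDerivAt

/-- The derivative of the power form of order `n + 1` is the form with weights of order `n`. -/
theorem hasDerivAt_powerForm (hf : LocallyIntegrable f) (hγ : LocallyIntegrable γ)
    (hc : ∀ i, Continuous (H i)) (hs : ∀ i, HasCompactSupport (H i)) (n : ℕ) (c : ι → ℝ) (t : ℝ) :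
    HasDerivAt (powerForm f γ H (n + 1) c)
      (∑ i, ∑ j, c i * c j * (sliceIntegral f γ (H i) (H j) t ^ n / n.factorial) *
        sliceForm f γ (H i) (H j) t) t := by
  unfold powerForm
  refine HasDerivAt.fun_sum fun i _ => HasDerivAt.fun_sum fun j _ => ?_
  have h1 := (((hasDerivAt_sliceIntegral hf hγ (hc i) (hs i) (hc j) (hs j) t).pow
    (n + 1)).div_const ((n + 1).factorial : ℝ)).const_mul (c i * c j)
  refine h1.congr_deriv ?_
  have h2 : (n.factorial : ℝ) ≠ 0 := by exact_mod_cast n.factorial_ne_zero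
  rw [Nat.factorial_succ, Nat.add_sub_cancel]
  push_cast
  field_simp

theorem sliceForm_posSemidef (hf : IsCovarianceKernel f) (hγ : LocallyIntegrable γ)
    (hc : ∀ i, Continuous (H i)) (hs : ∀ i, HasCompactSupport (H i)) (t : ℝ) :
    (Matrix.of fun i j => sliceForm f γ (H i) (H j) t).PosSemidef := by
  refine Matrix.posSemidef_of_sum_nonneg (fun i j => sliceForm_comm hf t) fun c => ?_
  simp only [Matrix.of_apply]
  rw [← sliceForm_linComb hf.locallyIntegrable hγ hc hs c]
  exact sliceForm_self_nonneg hf hγ (continuous_linComb hc c) (hasCompactSupport_linComb hs c) t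

/-- By the Schur product theorem. -/
theorem powerWeights_posSemidef (hf : IsCovarianceKernel f) (hγ : LocallyIntegrable γ)
    (hc : ∀ i, Continuous (H i)) (hs : ∀ i, HasCompactSupport (H i)) (n : ℕ) (c : ι → ℝ) {t : ℝ}
    (ht : 0 ≤ t) : (Matrix.of fun i j =>
      c i * c j * (sliceIntegral f γ (H i) (H j) t ^ n / n.factorial)).PosSemidef := by
  have h := ((sliceIntegral_posSemidef hf hγ hc hs ht).entry_pow n)
  refine Matrix.posSemidef_of_sum_nonneg (fun i j => ?_) fun d => ?_
  · simp only [Matrix.of_apply]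
    rw [sliceIntegral_comm hf, mul_comm (c i)]
  · have h1 := h.sum_nonneg fun i => d i * c i
    have h2 : (0 : ℝ) < n.factorial := by exact_mod_cast n.factorial_pos
    have h3 := div_nonneg h1 h2.le
    refine h3.trans_eq ?_
    rw [Finset.sum_div]
    refine Finset.sum_congr rfl fun i _ => ?_
    rw [Finset.sum_div]
    refine Finset.sum_congr rfl fun j _ => ?_
    simp only [Matrix.of_apply]
    ring

theorem lintegral_sqrt_mul_sqrt_le {X : Type*} [MeasurableSpace X] {μ : Measure X} {a b : X → ℝ≥0∞}
    (ha : Measurable a) (hb : Measurable b) :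
    ∫⁻ x, a x ^ (1 / 2 : ℝ) * b x ^ (1 / 2 : ℝ) ∂μ ≤
      (∫⁻ x, a x ∂μ) ^ (1 / 2 : ℝ) * (∫⁻ x, b x ∂μ) ^ (1 / 2 : ℝ) := by
  have h := ENNReal.lintegral_mul_le_Lp_mul_Lq μ Real.HolderConjugate.two_two
    (f := fun x => a x ^ (1 / 2 : ℝ)) (g := fun x => b x ^ (1 / 2 : ℝ))
    (ha.pow_const _).aemeasurable (hb.pow_const _).aemeasurable
  have h2 : ∀ x : ℝ≥0∞, (x ^ (1 / 2 : ℝ)) ^ (2 : ℝ) = x := fun x => by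
    rw [← ENNReal.rpow_mul]; norm_num
  simp only [h2] at h
  exact h

theorem ofReal_sqrt {x : ℝ} (hx : 0 ≤ x) : ENNReal.ofReal √x = ENNReal.ofReal x ^ (1 / 2 : ℝ) := by
  rw [Real.sqrt_eq_rpow, ENNReal.ofReal_rpow_of_nonneg hx (by norm_num)]

/-- The induction step for the bound of the pairings: the bound for the `n`-th pairings is used at
each point `p` with the coefficients `cᵢ h̃ᵢ(p)`. -/
theorem lintegral_chaosPairing_le (hf : IsCovarianceKernel f) (hγ : LocallyIntegrable γ)
    (hc : ∀ i, Continuous (H i)) (hs : ∀ i, HasCompactSupport (H i)) {n : ℕ}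
    (hA : ∀ z t, 0 < z → 0 < t → chaosBound u₀ f n z t < ∞)
    (hA' : ∀ z t, 0 < z → 0 < t → chaosBound u₀ f (n + 1) z t < ∞)
    (ih : ∀ (c : ι → ℝ) (z t : ℝ), 0 < z → 0 < t →
      (∑ i, c i * chaosPairing u₀ f γ (H i) n z t) ^ 2 ≤
        (chaosBound u₀ f n z t).toReal * powerForm f γ H n c t) (c : ι → ℝ) {z t : ℝ} (hz : 0 < z)
    (ht : 0 < t) :
    ∫⁻ p, ENNReal.ofReal (duhamel z t p * |∑ i, c i * (chaosPairing u₀ f γ (H i) n p.1 p.2 *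
        potential f γ (H i) p)|) ≤
      chaosBound u₀ f (n + 1) z t ^ (1 / 2 : ℝ) *
        ENNReal.ofReal (powerForm f γ H (n + 1) c t) ^ (1 / 2 : ℝ) := by
  have hf' := hf.locallyIntegrable
  -- `S` is the time derivative of the power form of order `n + 1`.
  let a : ℝ → ℝ → ℝ := fun τ w => duhamel z t (w, τ) * √(chaosBound u₀ f n w τ).toReal
  let S : ℝ → ℝ := fun τ => ∑ i, ∑ j,
    c i * c j * (sliceIntegral f γ (H i) (H j) τ ^ n / n.factorial) * sliceForm f γ (H i) (H j) τ
  let e : ℝ → ℝ≥0∞ := fun τ => energy f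
      (fun w => ENNReal.ofReal (duhamel z t (w, τ)) * chaosBound u₀ f n w τ ^ (1 / 2 : ℝ))
      (fun w => ENNReal.ofReal (duhamel z t (w, τ)) * chaosBound u₀ f n w τ ^ (1 / 2 : ℝ))
  have mA := chaosBound_measurable u₀ hf' n
  have ha : ∀ τ, Measurable (a τ) := fun τ =>
    ((duhamel_measurable' z t).comp (f := fun w => (w, τ)) (by fun_prop)).mul
      (mA.comp (f := fun w => (w, τ)) (by fun_prop)).ennreal_toReal.sqrt
  have ha0 : ∀ τ w, 0 ≤ a τ w := fun τ w => mul_nonneg (duhamel_nonneg _ _ _) (Real.sqrt_nonneg _)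
  have hae : ∀ τ w, ENNReal.ofReal (a τ w) =
      ENNReal.ofReal (duhamel z t (w, τ)) * chaosBound u₀ f n w τ ^ (1 / 2 : ℝ) := fun τ w => by
    by_cases h : 0 < w ∧ τ ∈ Ioo 0 t
    · simp only [a]
      rw [ENNReal.ofReal_mul (duhamel_nonneg _ _ _), ofReal_sqrt ENNReal.toReal_nonneg,
        ENNReal.ofReal_toReal (hA w τ h.1 h.2.1).ne]
    · simp only [a, duhamel_eq_zero (p := (w, τ)) h, zero_mul, ENNReal.ofReal_zero]
  have hem : Measurable e := by
    have h1 : Measurable fun q : ℝ × ℝ => ENNReal.ofReal (duhamel z t (q.2, q.1)) *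
          chaosBound u₀ f n q.2 q.1 ^ (1 / 2 : ℝ) :=
      ((duhamel_measurable' z t).comp measurable_swap).ennreal_ofReal.mul
        ((mA.comp measurable_swap).pow_const _)
    let b : ℝ → ℝ → ℝ≥0∞ := fun τ w =>
      ENNReal.ofReal (duhamel z t (w, τ)) * chaosBound u₀ f n w τ ^ (1 / 2 : ℝ)
    have h2 : Measurable fun x => energy f (b x) (b x) := energy_measurable hf' h1 h1
    exact h2
  have heA : ∫⁻ τ, e τ = chaosBound u₀ f (n + 1) z t := rfl
  have hefin : ∀ᵐ τ, e τ < ∞ := ae_lt_top hem (heA ▸ (hA' z t hz ht).ne)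
  have hderiv := hasDerivAt_powerForm hf' hγ hc hs n c
  have hScont : Continuous S := by
    refine continuous_finsetSum _ fun i _ => continuous_finsetSum _ fun j _ => ?_
    have h1 : Continuous (sliceIntegral f γ (H i) (H j)) := continuous_iff_continuousAt.2 fun τ =>
      (hasDerivAt_sliceIntegral hf' hγ (hc i) (hs i) (hc j) (hs j) τ).continuousAt
    have h2 := continuous_sliceForm hf' hγ (hc i) (hs i) (hc j) (hs j)
    fun_prop
  have hS0 : ∀ τ, 0 ≤ τ → 0 ≤ S τ := fun τ hτ => by
    have := ((powerWeights_posSemidef hf hγ hc hs n c hτ).hadamard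
      (sliceForm_posSemidef hf hγ hc hs τ)).sum_nonneg fun _ => 1
    simpa [S] using this
  have hSint : ∫⁻ τ, (Ioo 0 t).indicator (fun τ => ENNReal.ofReal (S τ)) τ =
      ENNReal.ofReal (powerForm f γ H (n + 1) c t) := by
    rw [lintegral_indicator measurableSet_Ioo, ← ofReal_integral_eq_lintegral_ofReal]
    · congr 1
      rw [← integral_Ioc_eq_integral_Ioo, ← intervalIntegral.integral_of_le ht.le,
        intervalIntegral.integral_eq_sub_of_hasDerivAt (fun τ _ => hderiv τ)
          (hScont.intervalIntegrable _ _)]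
      simp [powerForm, sliceIntegral]
    · exact (hScont.integrableOn_Icc (a := 0) (b := t)).mono_set Ioo_subset_Icc_self
    · exact (ae_restrict_iff' measurableSet_Ioo).2 (ae_of_all _ fun τ hτ => hS0 τ hτ.1.le)
  -- At fixed time, the inductive bound is inserted and the vector-valued Cauchy–Schwarz
  -- inequality is applied with the weights `cᵢ cⱼ mᵢⱼ(τ)ⁿ / n!`.
  have hinner : ∀ᵐ τ, ∫⁻ w, ENNReal.ofReal (duhamel z t (w, τ) *
      |∑ i, c i * (chaosPairing u₀ f γ (H i) n w τ * potential f γ (H i) (w, τ))|) ≤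
      e τ ^ (1 / 2 : ℝ) *
        ((Ioo 0 t).indicator (fun τ => ENNReal.ofReal (S τ)) τ) ^ (1 / 2 : ℝ) := by
    filter_upwards [hefin] with τ hτfin
    by_cases hτ : τ ∈ Ioo 0 t
    · have hee : e τ = energy f (fun w => ENNReal.ofReal (a τ w))
          (fun w => ENNReal.ofReal (a τ w)) := by simp only [hae]; rfl
      rw [indicator_of_mem hτ, ← ofReal_sqrt (hS0 τ hτ.1.le), hee]
      refine le_trans ?_ (lintegral_mul_sqrt_le hf.isPDKernel
        (powerWeights_posSemidef hf hγ hc hs n c hτ.1.le)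
        (fun i => continuous_timeAverage hγ (hc i) (hs i) τ)
        (fun i => hasCompactSupport_timeAverage (hs i) τ) (ha τ) (ha0 τ) (hee ▸ hτfin.ne))
      refine lintegral_mono fun w => ENNReal.ofReal_le_ofReal ?_
      by_cases hw : 0 < w
      · simp only [a]
        rw [mul_assoc]
        refine mul_le_mul_of_nonneg_left ?_ (duhamel_nonneg _ _ _)
        rw [← Real.sqrt_mul ENNReal.toReal_nonneg]
        refine Real.abs_le_sqrt ?_
        have h1 := ih (fun i => c i * potential f γ (H i) (w, τ)) w τ hw hτ.1
        refine le_trans (le_of_eq ?_) (h1.trans (le_of_eq ?_))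
        · congr 1
          exact Finset.sum_congr rfl fun i _ => by ring
        · congr 1
          unfold powerForm
          refine Finset.sum_congr rfl fun i _ => Finset.sum_congr rfl fun j _ => ?_
          have e1 := potential_eq hf' hγ (hc i) (hs i) (w, τ)
          have e2 := potential_eq hf' hγ (hc j) (hs j) (w, τ)
          simp only [Matrix.of_apply] at e1 e2 ⊢
          rw [← e1, ← e2]
          ring
      · rw [duhamel_eq_zero (p := (w, τ)) fun h => hw h.1, zero_mul]
        exact mul_nonneg (ha0 _ _) (Real.sqrt_nonneg _)
    · have h0 : ∀ w, duhamel z t (w, τ) = 0 := fun w =>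
        duhamel_eq_zero (p := (w, τ)) fun h => hτ h.2
      simp [h0]
  have hmeas : Measurable fun p : ℝ × ℝ => ENNReal.ofReal (duhamel z t p *
      |∑ i, c i * (chaosPairing u₀ f γ (H i) n p.1 p.2 * potential f γ (H i) p)|) := by
    refine ((duhamel_measurable' z t).mul (Measurable.abs ?_)).ennreal_ofReal
    exact Finset.measurable_fun_sum _ fun i _ => measurable_const.mul
      ((chaosPairing_measurable u₀ hf' hγ (hc i) (hs i) n).mul
        (continuous_potential hf' hγ (hc i) (hs i)).measurable)
  rw [Measure.volume_eq_prod, lintegral_prod_symm' _ hmeas]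
  refine (lintegral_mono_ae hinner).trans ?_
  refine (lintegral_sqrt_mul_sqrt_le hem
    (hScont.measurable.ennreal_ofReal.indicator measurableSet_Ioo)).trans_eq ?_
  rw [heA, hSint]

theorem powerForm_nonneg (hf : IsCovarianceKernel f) (hγ : LocallyIntegrable γ)
    (hc : ∀ i, Continuous (H i)) (hs : ∀ i, HasCompactSupport (H i)) (n : ℕ) (c : ι → ℝ) {t : ℝ}
    (ht : 0 ≤ t) : 0 ≤ powerForm f γ H n c t := by
  have := (powerWeights_posSemidef hf hγ hc hs n c ht).sum_nonneg fun _ => 1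
  simpa [powerForm] using this

theorem integrable_of_lintegral_le {X : Type*} [MeasurableSpace X] {μ : Measure X} {g : X → ℝ}
    (hg : AEStronglyMeasurable g μ) (h : ∫⁻ x, ENNReal.ofReal |g x| ∂μ < ∞) : Integrable g μ := by
  refine ⟨hg, ?_⟩
  unfold HasFiniteIntegral
  simpa only [Real.enorm_eq_ofReal_abs] using h

/-- Joint bounds for the pairings `φₙ(hᵢ; z, t)`, together with the integrability of the integrand
of `φₙ₊₁`. -/
theorem sum_chaosPairing_sq_le_powerForm (hf : IsCovarianceKernel f) (hγ : LocallyIntegrable γ)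
    (hA : ∀ n z t, 0 < z → 0 < t → chaosBound u₀ f n z t < ∞) (n : ℕ) :
    (∀ (ι : Type) [Fintype ι] (H : ι → ℝ × ℝ → ℝ), (∀ i, Continuous (H i)) →
      (∀ i, HasCompactSupport (H i)) → ∀ (c : ι → ℝ) (z t : ℝ), 0 < z → 0 < t →
      (∑ i, c i * chaosPairing u₀ f γ (H i) n z t) ^ 2 ≤
        (chaosBound u₀ f n z t).toReal * powerForm f γ H n c t) ∧
    ∀ (h : ℝ × ℝ → ℝ), Continuous h → HasCompactSupport h → ∀ z t, 0 < z → 0 < t →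
      Integrable fun p =>
        duhamel z t p * (chaosPairing u₀ f γ h n p.1 p.2 * potential f γ h p) := by
  have hf' := hf.locallyIntegrable
  -- Integrability is the case of a single function in the bound for the integrals of the moduli.
  have hint : ∀ n, (∀ (ι : Type) [Fintype ι] (H : ι → ℝ × ℝ → ℝ), (∀ i, Continuous (H i)) →
      (∀ i, HasCompactSupport (H i)) → ∀ (c : ι → ℝ) (z t : ℝ), 0 < z → 0 < t →
      (∑ i, c i * chaosPairing u₀ f γ (H i) n z t) ^ 2 ≤
        (chaosBound u₀ f n z t).toReal * powerForm f γ H n c t) →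
      ∀ (h : ℝ × ℝ → ℝ), Continuous h → HasCompactSupport h → ∀ z t, 0 < z → 0 < t →
      Integrable fun p =>
        duhamel z t p * (chaosPairing u₀ f γ h n p.1 p.2 * potential f γ h p) := by
    intro n hn h hc hs z t hz ht
    refine integrable_of_lintegral_le ((duhamel_measurable' z t).mul
      ((chaosPairing_measurable u₀ hf' hγ hc hs n).mul
        (continuous_potential hf' hγ hc hs).measurable)).aestronglyMeasurable ?_
    have h1 := lintegral_chaosPairing_le u₀ hf hγ (H := fun _ : Unit => h) (fun _ => hc)
      (fun _ => hs) (hA n) (hA (n + 1)) (hn Unit _ (fun _ => hc) (fun _ => hs)) (fun _ => 1) hz ht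
    simp only [Finset.univ_unique, Finset.sum_const, Finset.card_singleton, one_smul, one_mul] at h1
    refine lt_of_le_of_lt (le_of_eq ?_) (h1.trans_lt ?_)
    · refine lintegral_congr fun p => ?_
      rw [abs_mul, abs_of_nonneg (duhamel_nonneg z t p)]
    · exact ENNReal.mul_lt_top (ENNReal.rpow_lt_top_of_nonneg (by norm_num) (hA _ z t hz ht).ne)
        (ENNReal.rpow_lt_top_of_nonneg (by norm_num) ENNReal.ofReal_ne_top)
  induction n with
  | zero =>
    refine (fun hn => ⟨hn, hint 0 hn⟩) ?_
    intro ι _ H hc hs c z t hz ht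
    refine le_of_eq ?_
    have e1 : (chaosBound u₀ f 0 z t).toReal = detSolution u₀ z t ^ 2 :=
      ENNReal.toReal_ofReal (sq_nonneg _)
    have e2 : powerForm f γ H 0 c t = (∑ i, c i) ^ 2 := by
      simp only [powerForm, pow_zero, Nat.factorial_zero, Nat.cast_one, div_one, mul_one, sq,
        Finset.sum_mul_sum]
    have e3 : ∑ i, c i * chaosPairing u₀ f γ (H i) 0 z t = (∑ i, c i) * detSolution u₀ z t := by
      rw [Finset.sum_mul]; rfl
    rw [e1, e2, e3]; ring
  | succ n ih =>
    refine (fun hn => ⟨hn, hint (n + 1) hn⟩) ?_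
    intro ι _ H hc hs c z t hz ht
    have h1 := lintegral_chaosPairing_le u₀ hf hγ hc hs (hA n) (hA (n + 1)) (ih.1 ι H hc hs) c hz ht
    have hi := fun i => ih.2 (H i) (hc i) (hs i) z t hz ht
    have e : ∑ i, c i * chaosPairing u₀ f γ (H i) (n + 1) z t =
        ∫ p, duhamel z t p * ∑ i, c i * (chaosPairing u₀ f γ (H i) n p.1 p.2 *
          potential f γ (H i) p) := by
      simp only [chaosPairing, ← integral_const_mul]
      rw [← integral_finsetSum _ fun i _ => (hi i).const_mul (c i)]
      refine integral_congr_ae (ae_of_all _ fun p => ?_)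
      dsimp only
      rw [Finset.mul_sum]
      exact Finset.sum_congr rfl fun i _ => by ring
    have hQ := powerForm_nonneg hf hγ hc hs (n + 1) c ht.le
    have h2 : ENNReal.ofReal |∑ i, c i * chaosPairing u₀ f γ (H i) (n + 1) z t| ≤
        ENNReal.ofReal √((chaosBound u₀ f (n + 1) z t).toReal * powerForm f γ H (n + 1) c t) := by
      rw [← Real.enorm_eq_ofReal_abs, e]
      refine (enorm_integral_le_lintegral_enorm _).trans ((le_of_eq ?_).trans (h1.trans_eq ?_))
      · refine lintegral_congr fun p => ?_
        rw [Real.enorm_eq_ofReal_abs, abs_mul, abs_of_nonneg (duhamel_nonneg z t p)]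
      · rw [ofReal_sqrt (mul_nonneg ENNReal.toReal_nonneg hQ),
          ENNReal.ofReal_mul ENNReal.toReal_nonneg, ENNReal.ofReal_toReal (hA _ z t hz ht).ne,
          ENNReal.mul_rpow_of_nonneg _ _ (by norm_num)]
    have h3 := (ENNReal.ofReal_le_ofReal_iff (Real.sqrt_nonneg _)).1 h2
    have h4 := pow_le_pow_left₀ (abs_nonneg _) h3 2
    rwa [sq_abs, Real.sq_sqrt (mul_nonneg ENNReal.toReal_nonneg hQ)] at h4

/-- The key bound: the pairings of the `n`-th chaos component with tensor powers are controlled by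
the Gram matrix in the `n`-th symmetric power of `H`. This makes the functional with these
pairings bounded, with norm given by `chaosBound`. -/
theorem sum_chaosPairing_sq_le (hf : IsCovarianceKernel f) (hγ : IsCovarianceKernel γ)
    (hA : ∀ n z t, 0 < z → 0 < t → chaosBound u₀ f n z t < ∞) (n : ℕ)
    {ι : Type} [Fintype ι] {H : ι → ℝ × ℝ → ℝ} (hc : ∀ i, Continuous (H i))
    (hs : ∀ i, HasCompactSupport (H i)) (c : ι → ℝ) {z t : ℝ} (hz : 0 < z) (ht : 0 < t) :
    (∑ i, c i * chaosPairing u₀ f γ (H i) n z t) ^ 2 ≤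
      symmIntegral γ t ^ n * (chaosBound u₀ f n z t).toReal *
        ((∑ i, ∑ j, c i * c j * bilin (tensorKernel f γ) (H i) (H j) ^ n) / n.factorial) := by
  refine ((sum_chaosPairing_sq_le_powerForm u₀ hf hγ.locallyIntegrable hA n).1 ι H hc hs c z t hz
    ht).trans ?_
  have h1 := sum_sliceIntegral_pow_le hf hγ hc hs ht.le n c
  have h2 : (0 : ℝ) < n.factorial := by exact_mod_cast n.factorial_pos
  have h3 : powerForm f γ H n c t =
      (∑ i, ∑ j, c i * c j * sliceIntegral f γ (H i) (H j) t ^ n) / n.factorial := by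
    unfold powerForm
    rw [Finset.sum_div]
    refine Finset.sum_congr rfl fun i _ => ?_
    rw [Finset.sum_div]
    exact Finset.sum_congr rfl fun j _ => by ring
  rw [h3]
  calc _ ≤ (chaosBound u₀ f n z t).toReal * ((symmIntegral γ t ^ n *
        ∑ i, ∑ j, c i * c j * bilin (tensorKernel f γ) (H i) (H j) ^ n) / n.factorial) := by
        gcongr
    _ = _ := by ring

end Pairing

/-! ### The isonormal Gaussian process -/

section Gaussian

variable {Ω : Type*} [MeasurableSpace Ω] {P : Measure Ω} [IsProbabilityMeasure P]
  {K : NoiseKernel} {W : K.H → Ω → ℝ}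

theorem Lp_inner_toLp {u v : Ω → ℝ} (hu : MemLp u 2 P) (hv : MemLp v 2 P) :
    inner ℝ (hu.toLp u) (hv.toLp v) = ∫ ω, u ω * v ω ∂P := by
  rw [L2.inner_def]
  refine integral_congr_ae ?_
  filter_upwards [hu.coeFn_toLp, hv.coeFn_toLp] with ω h1 h2
  rw [h1, h2, real_inner_comm]
  rfl

theorem Lp_inner_eq (u v : Lp ℝ 2 P) : inner ℝ u v = ∫ ω, u ω * v ω ∂P := by
  rw [L2.inner_def]
  refine integral_congr_ae (ae_of_all _ fun ω => ?_)
  dsimp only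
  rw [real_inner_comm]
  rfl

namespace IsIsonormal

theorem memLp_top (hW : IsIsonormal K P W) (h : K.H) {p : ℝ≥0∞} (hp : p ≠ ∞) : MemLp (W h) p P :=
  (hW.gaussian.hasGaussianLaw_eval h).memLp hp

theorem memLp (hW : IsIsonormal K P W) (h : K.H) : MemLp (W h) 2 P :=
  hW.memLp_top h (by norm_num)

theorem inner_toLp (hW : IsIsonormal K P W) (h g : K.H) :
    inner ℝ ((hW.memLp h).toLp (W h)) ((hW.memLp g).toLp (W g)) = inner ℝ h g := by
  rw [Lp_inner_toLp, hW.covariance]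

/-- The isometry `h ↦ W(h)` from `H` to `L²(Ω)`. -/
noncomputable def lin (hW : IsIsonormal K P W) : K.H →ₗᵢ[ℝ] Lp ℝ 2 P where
  toFun h := (hW.memLp h).toLp (W h)
  map_add' x y := by
    rw [← sub_eq_zero, ← inner_self_eq_zero (𝕜 := ℝ)]
    simp only [inner_sub_left, inner_sub_right, inner_add_left, inner_add_right, hW.inner_toLp,
      real_inner_comm]
    ring
  map_smul' c x := by
    rw [← sub_eq_zero, ← inner_self_eq_zero (𝕜 := ℝ)]
    simp only [inner_sub_left, inner_sub_right, real_inner_smul_left, real_inner_smul_right,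
      hW.inner_toLp, RingHom.id_apply]
    ring
  norm_map' x := by
    have h := hW.inner_toLp x x
    rw [real_inner_self_eq_norm_sq, real_inner_self_eq_norm_sq] at h
    exact (sq_eq_sq₀ (norm_nonneg _) (norm_nonneg _)).1 h

theorem coeFn_lin (hW : IsIsonormal K P W) (h : K.H) : hW.lin h =ᵐ[P] W h :=
  (hW.memLp h).coeFn_toLp

theorem add_ae (hW : IsIsonormal K P W) (h g : K.H) : W (h + g) =ᵐ[P] fun ω => W h ω + W g ω := by
  have e : hW.lin (h + g) = hW.lin h + hW.lin g := map_add _ _ _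
  filter_upwards [hW.coeFn_lin (h + g), hW.coeFn_lin h, hW.coeFn_lin g,
    Lp.coeFn_add (hW.lin h) (hW.lin g)] with ω h1 h2 h3 h4
  rw [← h1, e, h4, Pi.add_apply, h2, h3]

theorem sub_ae (hW : IsIsonormal K P W) (h g : K.H) : W (h - g) =ᵐ[P] fun ω => W h ω - W g ω := by
  have e : hW.lin (h - g) = hW.lin h - hW.lin g := map_sub _ _ _
  filter_upwards [hW.coeFn_lin (h - g), hW.coeFn_lin h, hW.coeFn_lin g,
    Lp.coeFn_sub (hW.lin h) (hW.lin g)] with ω h1 h2 h3 h4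
  rw [← h1, e, h4, Pi.sub_apply, h2, h3]

theorem smul_ae (hW : IsIsonormal K P W) (c : ℝ) (h : K.H) :
    W (c • h) =ᵐ[P] fun ω => c * W h ω := by
  have e : hW.lin (c • h) = c • hW.lin h := map_smul _ _ _
  filter_upwards [hW.coeFn_lin (c • h), hW.coeFn_lin h, Lp.coeFn_smul c (hW.lin h)] with ω h1 h2 h3
  rw [← h1, e, h3, Pi.smul_apply, h2, smul_eq_mul]

theorem sum_ae (hW : IsIsonormal K P W) {ι : Type*} (s : Finset ι) (c : ι → ℝ) (h : ι → K.H) :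
    W (∑ i ∈ s, c i • h i) =ᵐ[P] fun ω => ∑ i ∈ s, c i * W (h i) ω := by
  classical
  induction s using Finset.induction_on with
  | empty =>
    have e := hW.smul_ae 0 0
    filter_upwards [e] with ω h1
    simpa using h1
  | insert i s hi ih =>
    simp only [Finset.sum_insert hi]
    filter_upwards [hW.add_ae (c i • h i) (∑ i ∈ s, c i • h i), hW.smul_ae (c i) (h i), ih]
      with ω h1 h2 h3
    rw [h1, h2, h3]

theorem map_eq (hW : IsIsonormal K P W) (h : K.H) :
    P.map (W h) = ProbabilityTheory.gaussianReal 0 (‖h‖ ^ 2).toNNReal := by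
  rw [(hW.gaussian.hasGaussianLaw_eval h).map_eq_gaussianReal, hW.mean,
    ProbabilityTheory.variance_of_integral_eq_zero (hW.measurable h).aemeasurable (hW.mean h)]
  congr 2
  rw [← real_inner_self_eq_norm_sq, ← hW.covariance]
  exact integral_congr_ae (ae_of_all _ fun ω => by simp [sq])

theorem integral_cexp (hW : IsIsonormal K P W) (h : K.H) :
    ∫ ω, Complex.exp (W h ω * Complex.I) ∂P = Real.exp (-(‖h‖ ^ 2 / 2)) := by
  have h1 := ProbabilityTheory.charFun_gaussianReal (μ := 0) (v := (‖h‖ ^ 2).toNNReal) 1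
  rw [← hW.map_eq h, charFun_apply_real, integral_map (hW.measurable h).aemeasurable
    (by fun_prop)] at h1
  simp only [Complex.ofReal_one, one_mul, Complex.ofReal_zero, zero_mul, one_pow, mul_one,
    zero_sub] at h1
  rw [h1]
  push_cast
  have e : (((‖h‖ ^ 2).toNNReal : ℝ) : ℂ) = (‖h‖ : ℂ) ^ 2 := by
    rw [← Complex.ofReal_pow, Complex.ofReal_inj, Real.coe_toNNReal _ (by positivity)]
  rw [e]

theorem integrable_of_bound {u : Ω → ℝ} (hu : Measurable u) {C : ℝ} (hC : ∀ ω, |u ω| ≤ C) :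
    Integrable u P :=
  Integrable.of_bound hu.aestronglyMeasurable C (ae_of_all _ hC)

theorem integral_cos (hW : IsIsonormal K P W) (h : K.H) (a : ℝ) :
    ∫ ω, Real.cos (W h ω + a) ∂P = Real.exp (-(‖h‖ ^ 2 / 2)) * Real.cos a := by
  have hm := hW.measurable h
  have hi : Integrable (fun ω => Complex.exp (W h ω * Complex.I)) P :=
    Integrable.of_bound (by fun_prop) 1 (ae_of_all _ fun ω => by
      rw [Complex.norm_exp_ofReal_mul_I])
  have h1 := hW.integral_cexp h
  have h2 : ∫ ω, Complex.exp ((W h ω + a : ℝ) * Complex.I) ∂P =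
      Real.exp (-(‖h‖ ^ 2 / 2)) * Complex.exp (a * Complex.I) := by
    rw [← h1, ← integral_mul_const]
    refine integral_congr_ae (ae_of_all _ fun ω => ?_)
    dsimp only
    rw [← Complex.exp_add]
    push_cast
    ring_nf
  have hi2 : Integrable (fun ω => Complex.exp ((W h ω + a : ℝ) * Complex.I)) P :=
    Integrable.of_bound (by fun_prop) 1 (ae_of_all _ fun ω => by
      rw [Complex.norm_exp_ofReal_mul_I])
  have h3 := congrArg Complex.re h2
  have h4 := integral_re hi2
  simp only [RCLike.re_to_complex, Complex.exp_ofReal_mul_I_re] at h4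
  rw [h4, h3, Complex.re_ofReal_mul, Complex.exp_ofReal_mul_I_re]

/-- The random variable `exp(‖h‖² / 2) cos(W(h) + a)`; for `a = 0` and `a = -π / 2` these are the
real and imaginary parts of the exponential `exp(i W(h) + ‖h‖² / 2)`. -/
noncomputable def _root_.wave (W : K.H → Ω → ℝ) (h : K.H) (a : ℝ) (ω : Ω) : ℝ :=
  Real.exp (‖h‖ ^ 2 / 2) * Real.cos (W h ω + a)

theorem wave_measurable (hW : IsIsonormal K P W) (h : K.H) (a : ℝ) : Measurable (wave W h a) := by
  have := hW.measurable h
  unfold wave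
  fun_prop

theorem _root_.abs_wave_le (W : K.H → Ω → ℝ) (h : K.H) (a : ℝ) (ω : Ω) :
    |wave W h a ω| ≤ Real.exp (‖h‖ ^ 2 / 2) := by
  unfold wave
  rw [abs_mul, abs_of_pos (Real.exp_pos _)]
  exact mul_le_of_le_one_right (Real.exp_pos _).le (Real.abs_cos_le_one _)

theorem memLp_wave (hW : IsIsonormal K P W) (h : K.H) (a : ℝ) : MemLp (wave W h a) 2 P :=
  MemLp.of_bound (hW.wave_measurable h a).aestronglyMeasurable _ (ae_of_all _ (abs_wave_le W h a))

/-- `wave W h a` as an element of `L²(Ω)`. -/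
noncomputable def waveLp (hW : IsIsonormal K P W) (h : K.H) (a : ℝ) : Lp ℝ 2 P :=
  (hW.memLp_wave h a).toLp _

theorem integral_wave_mul_wave (hW : IsIsonormal K P W) (h g : K.H) (a b : ℝ) :
    ∫ ω, wave W h a ω * wave W g b ω ∂P =
      (Real.exp (inner ℝ h g) * Real.cos (a - b) + Real.exp (-inner ℝ h g) * Real.cos (a + b)) /
        2 := by
  have e : ∀ᵐ ω ∂P, wave W h a ω * wave W g b ω =
      Real.exp (‖h‖ ^ 2 / 2) * Real.exp (‖g‖ ^ 2 / 2) / 2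
      * (Real.cos (W (h - g) ω + (a - b)) + Real.cos (W (h + g) ω + (a + b))) := by
    filter_upwards [hW.add_ae h g, hW.sub_ae h g] with ω h1 h2
    rw [h1, h2]
    unfold wave
    have e1 : W h ω - W g ω + (a - b) = (W h ω + a) - (W g ω + b) := by ring
    have e2 : W h ω + W g ω + (a + b) = (W h ω + a) + (W g ω + b) := by ring
    rw [e1, e2, Real.cos_sub, Real.cos_add (W h ω + a) (W g ω + b)]
    ring
  have hm1 := hW.measurable (h - g)
  have hm2 := hW.measurable (h + g)
  rw [integral_congr_ae e, integral_const_mul, integral_add, hW.integral_cos, hW.integral_cos]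
  · have e1 : Real.exp (-(‖h - g‖ ^ 2 / 2)) =
        Real.exp (-(‖h‖ ^ 2 / 2)) * Real.exp (-(‖g‖ ^ 2 / 2)) * Real.exp (inner ℝ h g) := by
      rw [← Real.exp_add, ← Real.exp_add, norm_sub_sq_real]
      congr 1; ring
    have e2 : Real.exp (-(‖h + g‖ ^ 2 / 2)) =
        Real.exp (-(‖h‖ ^ 2 / 2)) * Real.exp (-(‖g‖ ^ 2 / 2)) * Real.exp (-inner ℝ h g) := by
      rw [← Real.exp_add, ← Real.exp_add, norm_add_sq_real]
      congr 1; ring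
    have e3 : Real.exp (‖h‖ ^ 2 / 2) * Real.exp (-(‖h‖ ^ 2 / 2)) = 1 := by
      rw [← Real.exp_add]; simp
    have e4 : Real.exp (‖g‖ ^ 2 / 2) * Real.exp (-(‖g‖ ^ 2 / 2)) = 1 := by
      rw [← Real.exp_add]; simp
    rw [e1, e2]
    linear_combination ((Real.exp (inner ℝ h g) * Real.cos (a - b) +
      Real.exp (-inner ℝ h g) * Real.cos (a + b)) / 2) *
      (Real.exp (‖g‖ ^ 2 / 2) * Real.exp (-(‖g‖ ^ 2 / 2)) * e3 + e4)
  · exact integrable_of_bound (by fun_prop) fun ω => Real.abs_cos_le_one _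
  · exact integrable_of_bound (by fun_prop) fun ω => Real.abs_cos_le_one _

/-- The chaos expansion of the inner product of two trigonometric exponentials. -/
theorem hasSum_inner_waveLp (hW : IsIsonormal K P W) (h g : K.H) (a b : ℝ) :
    HasSum (fun n : ℕ => Real.cos (a + n * (Real.pi / 2)) * Real.cos (b + n * (Real.pi / 2)) *
      (inner ℝ h g ^ n / n.factorial)) (inner ℝ (hW.waveLp h a) (hW.waveLp g b)) := by
  have h0 : inner ℝ (hW.waveLp h a) (hW.waveLp g b) =
      (Real.exp (inner ℝ h g) * Real.cos (a - b) + Real.exp (-inner ℝ h g) * Real.cos (a + b)) /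
        2 := by
    rw [waveLp, waveLp, Lp_inner_toLp, hW.integral_wave_mul_wave]
  rw [h0]
  have s1 := NormedSpace.expSeries_div_hasSum_exp (inner ℝ h g)
  have s2 := NormedSpace.expSeries_div_hasSum_exp (-inner ℝ h g)
  rw [← Real.exp_eq_exp_ℝ] at s1 s2
  have s3 := ((s1.mul_right (Real.cos (a - b))).add (s2.mul_right (Real.cos (a + b)))).div_const 2
  refine s3.congr_fun fun n => ?_
  have e : Real.cos (a + n * (Real.pi / 2)) * Real.cos (b + n * (Real.pi / 2)) =
      (Real.cos (a - b) + (-1) ^ n * Real.cos (a + b)) / 2 := by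
    have e1 : a - b = (a + n * (Real.pi / 2)) - (b + n * (Real.pi / 2)) := by ring
    have e2 : (-1) ^ n * Real.cos (a + b) =
        Real.cos ((a + n * (Real.pi / 2)) + (b + n * (Real.pi / 2))) := by
      rw [← Real.cos_add_nat_mul_pi]
      congr 1; ring
    rw [e1, e2, Real.cos_sub, Real.cos_add (a + n * (Real.pi / 2)) (b + n * (Real.pi / 2))]
    ring
  rw [e, neg_pow]
  ring

end IsIsonormal

end Gaussian

/-! ### Totality of the trigonometric functions of the noise -/

section Total

variable {Ω : Type*} [MeasurableSpace Ω] {P : Measure Ω} [IsProbabilityMeasure P]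
  {K : NoiseKernel} {W : K.H → Ω → ℝ}

/-- Riesz representation for a functional which is prescribed on a family of vectors. -/
theorem exists_inner_eq_of_sq_le {E A : Type*} [NormedAddCommGroup E] [InnerProductSpace ℝ E]
    [CompleteSpace E] (x : A → E) (ℓ : A → ℝ) {C : ℝ} (hC : 0 ≤ C)
    (h : ∀ c : A →₀ ℝ, (c.sum fun a r => r * ℓ a) ^ 2 ≤ C * ‖c.sum fun a r => r • x a‖ ^ 2) :
    ∃ J : E, (∀ a, inner ℝ J (x a) = ℓ a) ∧ ‖J‖ ^ 2 ≤ C := by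
  let T := Finsupp.linearCombination ℝ x
  let L := Finsupp.linearCombination ℝ ℓ
  have hTL : ∀ c, (L c) ^ 2 ≤ C * ‖T c‖ ^ 2 := fun c => h c
  -- The bound makes the functional well defined on the range of `T`; it is given there by any
  -- linear section, and extended by the Hahn–Banach theorem.
  obtain ⟨g, hg⟩ := T.rangeRestrict.exists_rightInverse_of_surjective T.range_rangeRestrict
  have hTg : ∀ y, T (g y) = y.1 := fun y => by
    have := LinearMap.congr_fun hg y
    exact congrArg Subtype.val this
  have hb : ∀ y, ‖(L ∘ₗ g) y‖ ≤ √C * ‖y‖ := fun y => by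
    have h1 := hTL (g y)
    rw [hTg] at h1
    rw [LinearMap.comp_apply, Real.norm_eq_abs]
    refine (Real.abs_le_sqrt h1).trans_eq ?_
    rw [Real.sqrt_mul hC, Real.sqrt_sq (norm_nonneg _)]
    rfl
  obtain ⟨φ, hφ1, hφ2⟩ := exists_extension_norm_eq (LinearMap.range T)
    ((L ∘ₗ g).mkContinuous (√C) hb)
  refine ⟨(InnerProductSpace.toDual ℝ E).symm φ, fun a => ?_, ?_⟩
  · rw [InnerProductSpace.toDual_symm_apply]
    have hx : T (Finsupp.single a 1) = x a := by simp [T]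
    have h1 := hφ1 ⟨x a, Finsupp.single a 1, hx⟩
    rw [h1]
    change L (g _) = _
    have h2 : L (Finsupp.single a 1) = ℓ a := by simp [L]
    rw [← h2, ← sub_eq_zero, ← map_sub]
    have h3 := hTL (g ⟨x a, Finsupp.single a 1, hx⟩ - Finsupp.single a 1)
    rw [map_sub T, hTg, hx, sub_self, norm_zero] at h3
    refine pow_eq_zero_iff (two_ne_zero) |>.1 (le_antisymm (h3.trans_eq ?_) (sq_nonneg _))
    ring
  · have h1 := LinearMap.mkContinuous_norm_le (L ∘ₗ g) (Real.sqrt_nonneg C) hb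
    rw [← hφ2] at h1
    rw [LinearIsometryEquiv.norm_map]
    exact (pow_le_pow_left₀ (norm_nonneg _) h1 2).trans_eq (Real.sq_sqrt hC)

theorem integral_abs_mul_abs_le {u v : Ω → ℝ} (hu : MemLp u 2 P) (hv : MemLp v 2 P) :
    ∫ ω, |u ω| * |v ω| ∂P ≤ ‖hu.toLp u‖ * ‖hv.toLp v‖ := by
  have e : ∀ {w : Ω → ℝ} (hw : MemLp w 2 P), ‖hw.abs.toLp |w|‖ = ‖hw.toLp w‖ := fun {w} hw => by
    rw [Lp.norm_toLp, Lp.norm_toLp]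
    exact congrArg _ (eLpNorm_norm w)
  rw [← e hu, ← e hv]
  exact (Lp_inner_toLp hu.abs hv.abs).symm.trans_le
    (real_inner_le_norm (hu.abs.toLp |u|) (hv.abs.toLp |v|))

theorem abs_cos_sub_cos_le (x y : ℝ) : |Real.cos x - Real.cos y| ≤ |x - y| := by
  have h := Convex.norm_image_sub_le_of_norm_deriv_le (f := Real.cos) (C := 1) (s := univ)
    (fun x _ => Real.differentiable_cos x) (fun x _ => by
      rw [Real.deriv_cos, norm_neg]; exact Real.abs_sin_le_one x) convex_univ
    (mem_univ y) (mem_univ x)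
  simpa using h

namespace IsIsonormal

theorem integrable_smul_of_norm_le_one {Z : Ω → ℝ} (hZ : Integrable Z P) {F : Ω → ℂ}
    (hF : Measurable F) (hb : ∀ ω, ‖F ω‖ ≤ 1) : Integrable (fun ω => Z ω • F ω) P := by
  refine Integrable.mono hZ (hZ.1.smul hF.aestronglyMeasurable) (ae_of_all _ fun ω => ?_)
  rw [norm_smul]
  exact mul_le_of_le_one_right (norm_nonneg _) (hb ω)

theorem integral_withDensity_sub {Z : Ω → ℝ} (hZ : Integrable Z P) {F : Ω → ℂ} (hF : Measurable F)
    (hb : ∀ ω, ‖F ω‖ ≤ 1) :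
    ∫ ω, F ω ∂(P.withDensity fun ω => ENNReal.ofReal (Z ω)) -
      ∫ ω, F ω ∂(P.withDensity fun ω => ENNReal.ofReal (-Z ω)) = ∫ ω, Z ω • F ω ∂P := by
  have hn : Integrable (fun ω => -Z ω) P := hZ.neg
  have e : ∀ Z : Ω → ℝ, Integrable Z P → Integrable (fun ω => (ENNReal.ofReal (Z ω)).toReal) P :=
    fun Z hZ => by
      refine hZ.mono hZ.1.aemeasurable.ennreal_ofReal.ennreal_toReal.aestronglyMeasurable
        (ae_of_all _ fun ω => ?_)
      rw [ENNReal.toReal_ofReal', Real.norm_eq_abs, Real.norm_eq_abs,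
        abs_of_nonneg (le_max_right _ _)]
      exact max_le (le_abs_self _) (abs_nonneg _)
  rw [integral_withDensity_eq_integral_toReal_smul₀ hZ.1.aemeasurable.ennreal_ofReal
      (ae_of_all _ fun _ => ENNReal.ofReal_lt_top),
    integral_withDensity_eq_integral_toReal_smul₀ hn.1.aemeasurable.ennreal_ofReal
      (ae_of_all _ fun _ => ENNReal.ofReal_lt_top), ← integral_sub
      (integrable_smul_of_norm_le_one (e _ hZ) hF hb)
      (integrable_smul_of_norm_le_one (e _ hn) hF hb)]
  refine integral_congr_ae (ae_of_all _ fun ω => ?_)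
  dsimp only
  rw [← sub_smul]
  congr 1
  rw [ENNReal.toReal_ofReal', ENNReal.toReal_ofReal']
  exact max_zero_sub_eq_self (Z ω)

/-- The random variables `cos(W(h) + a)` are total: the positive and the negative part of a
density orthogonal to all of them define measures under which `W` has the same
finite-dimensional characteristic functions. -/
theorem ae_eq_zero_of_integral_mul_cos (hW : IsIsonormal K P W) {Z : Ω → ℝ} (hZ : Integrable Z P)
    (h0 : ∀ h a, ∫ ω, Z ω * Real.cos (W h ω + a) ∂P = 0) : Z =ᵐ[P] 0 := by
  let μp := P.withDensity fun ω => ENNReal.ofReal (Z ω)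
  let μm := P.withDensity fun ω => ENNReal.ofReal (-Z ω)
  have hp : IsFiniteMeasure μp := isFiniteMeasure_withDensity_ofReal hZ.2
  have hm : IsFiniteMeasure μm := isFiniteMeasure_withDensity_ofReal hZ.neg.2
  have hexp : ∀ h, ∫ ω, Complex.exp (W h ω * Complex.I) ∂μp =
      ∫ ω, Complex.exp (W h ω * Complex.I) ∂μm := fun h => by
    have hmeas := hW.measurable h
    have hb : ∀ ω, ‖Complex.exp (W h ω * Complex.I)‖ ≤ 1 := fun ω => by
      rw [Complex.norm_exp_ofReal_mul_I]
    rw [← sub_eq_zero, integral_withDensity_sub hZ (by fun_prop) hb]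
    have hi : Integrable (fun ω => Z ω • Complex.exp (W h ω * Complex.I)) P :=
      integrable_smul_of_norm_le_one hZ (by fun_prop) hb
    apply Complex.ext
    · have h4 := integral_re hi
      simp only [RCLike.re_to_complex, Complex.real_smul, Complex.re_ofReal_mul,
        Complex.exp_ofReal_mul_I_re] at h4
      simp only [Complex.real_smul]
      rw [← h4, Complex.zero_re]
      simpa using h0 h 0
    · have h4 := integral_im hi
      simp only [RCLike.im_to_complex, Complex.real_smul, Complex.im_ofReal_mul,
        Complex.exp_ofReal_mul_I_im] at h4
      simp only [Complex.real_smul]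
      rw [← h4, Complex.zero_im]
      have := h0 h (-(Real.pi / 2))
      simpa only [← sub_eq_add_neg, Real.cos_sub_pi_div_two] using this
  let Φ : Ω → K.H → ℝ := fun ω h => W h ω
  have hΦ : Measurable Φ := measurable_pi_lambda _ hW.measurable
  classical
  have hchar : ∀ (I : Finset K.H) (μ : Measure Ω), μ ≪ P → IsFiniteMeasure μ →
      ∀ L : StrongDual ℝ (I → ℝ), charFunDual ((μ.map Φ).map I.restrict) L =
        ∫ ω, Complex.exp (W (∑ i : I, L (Pi.single i 1) • (i : K.H)) ω * Complex.I) ∂μ := by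
    intro I μ hμ _ L
    rw [Measure.map_map (by fun_prop) hΦ, charFunDual_apply, integral_map
      ((Measurable.comp (by fun_prop) hΦ).aemeasurable) (by fun_prop)]
    refine integral_congr_ae ?_
    filter_upwards [hμ.ae_le (hW.sum_ae Finset.univ (fun i : I => L (Pi.single i 1))
      fun i => (i : K.H))] with ω hω
    rw [hω]
    congr 3
    have e : (I.restrict ∘ Φ) ω = ∑ i : I, W i ω • (Pi.single i 1 : I → ℝ) := by
      ext j
      simp [Φ, Finset.sum_apply, Pi.single_apply]
    rw [e, map_sum]
    refine Finset.sum_congr rfl fun i _ => ?_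
    rw [map_smul, smul_eq_mul, mul_comm]
  have hmarg : ∀ I : Finset K.H,
      (μp.map Φ).map I.restrict = (μm.map Φ).map I.restrict := fun I => by
    refine Measure.ext_of_charFunDual (funext fun L => ?_)
    rw [hchar I μp (withDensity_absolutelyContinuous _ _) hp,
      hchar I μm (withDensity_absolutelyContinuous _ _) hm, hexp]
  -- Finite measures on the product space with the same finite-dimensional marginals are equal,
  -- and the events depend only on the process up to null sets.
  have hmap : μp.map Φ = μm.map Φ :=
    IsProjectiveLimit.unique (P := fun I : Finset K.H => (μm.map Φ).map I.restrict) hmarg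
      fun I => rfl
  refine hZ.ae_eq_zero_of_forall_setIntegral_eq_zero fun s hs _ => ?_
  obtain ⟨s', hs', hss⟩ := hW.generates s hs
  rw [setIntegral_congr_set hss]
  have hcomap : (⨆ h, MeasurableSpace.comap (W h) inferInstance) =
      MeasurableSpace.comap Φ MeasurableSpace.pi := by
    simp only [MeasurableSpace.pi, MeasurableSpace.comap_iSup, MeasurableSpace.comap_comp]
    rfl
  rw [hcomap] at hs'
  obtain ⟨T, hT, rfl⟩ := hs'
  have h1 : μp (Φ ⁻¹' T) = μm (Φ ⁻¹' T) := by
    rw [← Measure.map_apply hΦ hT, hmap, Measure.map_apply hΦ hT]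
  rw [integral_eq_lintegral_pos_part_sub_lintegral_neg_part hZ.integrableOn,
    ← withDensity_apply _ (hΦ hT), ← withDensity_apply _ (hΦ hT)]
  exact sub_eq_zero.2 (congrArg _ h1)

/-- `h ↦ E[Z cos(W(h) + a)]` is Lipschitz on `H`. -/
theorem continuous_integral_mul_cos (hW : IsIsonormal K P W) {Z : Ω → ℝ} (hZ : MemLp Z 2 P)
    (a : ℝ) : Continuous fun h => ∫ ω, Z ω * Real.cos (W h ω + a) ∂P := by
  have hi : ∀ h, Integrable (fun ω => Z ω * Real.cos (W h ω + a)) P := fun h => by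
    have := hW.measurable h
    exact (hZ.integrable (by norm_num)).mul_bdd (c := 1) (by fun_prop)
      (ae_of_all _ fun ω => Real.abs_cos_le_one _)
  refine (LipschitzWith.of_dist_le_mul (K := ‖hZ.toLp Z‖₊) fun h g => ?_).continuous
  rw [Real.dist_eq, ← integral_sub (hi h) (hi g)]
  calc |∫ ω, (Z ω * Real.cos (W h ω + a) - Z ω * Real.cos (W g ω + a)) ∂P|
      ≤ ∫ ω, |Z ω| * |W (h - g) ω| ∂P := by
        have hi' : Integrable (fun ω => |Z ω| * |W (h - g) ω|) P :=
          hZ.abs.integrable_mul (hW.memLp (h - g)).abs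
        rw [← Real.norm_eq_abs]
        refine norm_integral_le_of_norm_le hi' ?_
        filter_upwards [hW.sub_ae h g] with ω h1
        rw [h1, ← mul_sub, norm_mul, Real.norm_eq_abs, Real.norm_eq_abs]
        refine mul_le_mul_of_nonneg_left ?_ (abs_nonneg _)
        have := abs_cos_sub_cos_le (W h ω + a) (W g ω + a)
        simpa using this
    _ ≤ ‖hZ.toLp Z‖ * ‖(hW.memLp (h - g)).toLp _‖ := integral_abs_mul_abs_le hZ _
    _ = ‖hZ.toLp Z‖₊ * dist h g := by
        rw [dist_eq_norm, ← hW.lin.norm_map (h - g)]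
        rfl

/-- The random variables `cos(W(h) + a)` with `h` a test function are total in `L²(Ω)`. -/
theorem ae_eq_zero_of_test (hW : IsIsonormal K P W) {Z : Ω → ℝ} (hZ : MemLp Z 2 P)
    (h0 : ∀ (φ : 𝓓(openQuadrant, ℝ)) (a : ℝ),
      ∫ ω, Z ω * Real.cos (W (K.toH φ) ω + a) ∂P = 0) : Z =ᵐ[P] 0 := by
  refine hW.ae_eq_zero_of_integral_mul_cos (hZ.integrable (by norm_num)) fun h a => ?_
  have := K.denseRange_toH.equalizer (hW.continuous_integral_mul_cos hZ a) continuous_const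
    (funext fun φ => h0 φ a)
  exact congrFun this h

theorem inner_waveLp (hW : IsIsonormal K P W) (J : Lp ℝ 2 P) (h : K.H) (a : ℝ) :
    inner ℝ J (hW.waveLp h a) = ∫ ω, J ω * wave W h a ω ∂P := by
  rw [Lp_inner_eq]
  refine integral_congr_ae ?_
  filter_upwards [(hW.memLp_wave h a).coeFn_toLp] with ω h1
  rw [waveLp, h1]

theorem eq_of_inner_waveLp (hW : IsIsonormal K P W) {J J' : Lp ℝ 2 P}
    (h : ∀ (φ : 𝓓(openQuadrant, ℝ)) (a : ℝ),
      inner ℝ J (hW.waveLp (K.toH φ) a) = inner ℝ J' (hW.waveLp (K.toH φ) a)) : J = J' := by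
  rw [← sub_eq_zero]
  refine Lp.ext ?_
  refine (hW.ae_eq_zero_of_test (Lp.memLp (J - J')) fun φ a => ?_).trans (Lp.coeFn_zero _ _ _).symm
  have h1 := h φ a
  rw [← sub_eq_zero, ← inner_sub_left, hW.inner_waveLp] at h1
  have e : ∀ ω, (J - J' : Lp ℝ 2 P) ω * wave W (K.toH φ) a ω = Real.exp (‖K.toH φ‖ ^ 2 / 2) *
      ((J - J' : Lp ℝ 2 P) ω * Real.cos (W (K.toH φ) ω + a)) := fun ω => by
    unfold wave; ring
  rw [integral_congr_ae (ae_of_all _ e), integral_const_mul] at h1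
  exact (mul_eq_zero.1 h1).resolve_left (Real.exp_pos _).ne'

end IsIsonormal

end Total

/-! ### Separability and weak measurability -/

section Pettis

/-- A map into a separable space is measurable if its distances to fixed points are: open sets are
countable unions of balls. -/
theorem measurable_of_measurable_dist {X E : Type*} [MeasurableSpace X] [PseudoMetricSpace E]
    [TopologicalSpace.SeparableSpace E] [MeasurableSpace E] [BorelSpace E] {J : X → E}
    (h : ∀ y, Measurable fun p => dist (J p) y) : Measurable J := by
  rcases isEmpty_or_nonempty E with he | hne
  · intro s _
    convert MeasurableSet.empty
    ext p
    exact he.elim (J p)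
  refine measurable_of_isOpen fun U hU => ?_
  let d := TopologicalSpace.denseSeq E
  have e : J ⁻¹' U = ⋃ (n : ℕ) (q : ℚ) (_ : Metric.ball (d n) q ⊆ U),
      (fun p => dist (J p) (d n)) ⁻¹' Iio (q : ℝ) := by
    ext p
    simp only [mem_preimage, mem_iUnion, mem_Iio, exists_prop]
    refine ⟨fun hp => ?_, fun ⟨n, q, h1, h2⟩ => h1 h2⟩
    obtain ⟨ε, hε, hb⟩ := Metric.isOpen_iff.1 hU _ hp
    obtain ⟨n, hn⟩ := (TopologicalSpace.denseRange_denseSeq E).exists_dist_lt (J p)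
      (half_pos hε)
    obtain ⟨q, hq1, hq2⟩ := exists_rat_btwn hn
    refine ⟨n, q, fun y hy => hb ?_, hq1⟩
    rw [Metric.mem_ball] at hy ⊢
    have := dist_triangle y (d n) (J p)
    rw [dist_comm (d n)] at this
    linarith
  rw [e]
  exact MeasurableSet.iUnion fun n => MeasurableSet.iUnion fun q => MeasurableSet.iUnion fun _ =>
    h (d n) measurableSet_Iio

variable {E : Type*} [NormedAddCommGroup E] [InnerProductSpace ℝ E]
  [TopologicalSpace.SeparableSpace E]

/-- A closed ball in a separable Hilbert space is a countable intersection of half-spaces. -/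
theorem norm_le_iff_denseSeq (v : E) (r : ℝ) (hr : 0 ≤ r) :
    ‖v‖ ≤ r ↔ ∀ n, inner ℝ v (TopologicalSpace.denseSeq E n) ≤
      r * ‖TopologicalSpace.denseSeq E n‖ := by
  refine ⟨fun h n => (real_inner_le_norm _ _).trans
    (mul_le_mul_of_nonneg_right h (norm_nonneg _)), fun h => ?_⟩
  have h1 : ∀ y, inner ℝ v y ≤ r * ‖y‖ := fun y => by
    have hc : IsClosed {y : E | inner ℝ v y ≤ r * ‖y‖} :=
      isClosed_le (continuous_const.inner continuous_id) (continuous_const.mul continuous_norm)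
    have := hc.closure_subset_iff.2 (range_subset_iff.2 h)
    rw [(TopologicalSpace.denseRange_denseSeq E).closure_range] at this
    exact this (mem_univ y)
  have h2 := h1 v
  rw [real_inner_self_eq_norm_sq, sq] at h2
  rcases (norm_nonneg v).eq_or_lt with h3 | h3
  · rw [← h3]; exact hr
  · exact le_of_mul_le_mul_right h2 h3

/-- Weakly measurable functions with values in a separable Hilbert space are strongly
measurable. -/
theorem stronglyMeasurable_of_measurable_inner {X : Type*} [MeasurableSpace X] {J : X → E}
    (h : ∀ y, Measurable fun p => (inner ℝ (J p) y : ℝ)) : StronglyMeasurable J := by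
  borelize E
  have : SecondCountableTopology E := UniformSpace.secondCountable_of_separable E
  refine Measurable.stronglyMeasurable ?_
  refine measurable_of_measurable_dist fun y => measurable_of_Iic fun r => ?_
  by_cases hr : 0 ≤ r
  · have e : (fun p => dist (J p) y) ⁻¹' Iic r = ⋂ n, {p |
        inner ℝ (J p) (TopologicalSpace.denseSeq E n) - inner ℝ y (TopologicalSpace.denseSeq E n) ≤
          r * ‖TopologicalSpace.denseSeq E n‖} := by
      ext p
      simp only [mem_preimage, mem_Iic, mem_iInter, mem_ofPred_eq, ← inner_sub_left]
      rw [dist_eq_norm, norm_le_iff_denseSeq _ _ hr]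
    rw [e]
    exact MeasurableSet.iInter fun n => measurableSet_le ((h _).sub_const _) measurable_const
  · have e : (fun p => dist (J p) y) ⁻¹' Iic r = ∅ := by
      ext p
      simp only [mem_preimage, mem_Iic, mem_empty_iff_false, iff_false, not_le]
      exact (not_le.1 hr).trans_le dist_nonneg
    rw [e]
    exact MeasurableSet.empty

theorem measurable_inner_of_dense {X : Type*} [MeasurableSpace X] {J : X → E} {T : Set E}
    (hT : Dense (Submodule.span ℝ T : Set E))
    (h : ∀ y ∈ T, Measurable fun p => (inner ℝ (J p) y : ℝ)) (y : E) :
    Measurable fun p => (inner ℝ (J p) y : ℝ) := by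
  have hspan : ∀ y ∈ Submodule.span ℝ T, Measurable fun p => (inner ℝ (J p) y : ℝ) := by
    intro y hy
    induction hy using Submodule.span_induction with
    | mem y hy => exact h y hy
    | zero => simp
    | add x y _ _ hx hy => simp only [inner_add_right]; exact hx.add hy
    | smul c x _ hx => simpa only [real_inner_smul_right] using hx.const_mul c
  obtain ⟨u, hu1, hu2⟩ := mem_closure_iff_seq_limit.1 (hT y)
  refine measurable_of_tendsto_metrizable (fun n => hspan (u n) (hu1 n)) ?_
  rw [tendsto_pi_nhds]
  exact fun p => tendsto_const_nhds.inner hu2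

end Pettis

section Separable

namespace NoiseKernel

variable (K : NoiseKernel)

theorem bilin_test_integrable (φ ψ : 𝓓(openQuadrant, ℝ)) :
    Integrable fun p : (ℝ × ℝ) × (ℝ × ℝ) =>
      tensorKernel K.f K.γ (p.1 - p.2) * φ p.1 * ψ p.2 :=
  bilin_integrable_of_continuous
    (tensorKernel_locallyIntegrable K.hf.locallyIntegrable K.hγ.locallyIntegrable)
    φ.continuous φ.hasCompactSupport ψ.continuous ψ.hasCompactSupport

theorem inner_toH_eq_bilin (φ ψ : 𝓓(openQuadrant, ℝ)) :
    inner ℝ (K.toH φ) (K.toH ψ) = bilin (tensorKernel K.f K.γ) φ ψ := by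
  rw [K.inner_toH, covForm_testFunction, integral_tensorKernel]

theorem norm_toH_sub_sq (φ ψ : 𝓓(openQuadrant, ℝ)) :
    ‖K.toH φ - K.toH ψ‖ ^ 2 =
      bilin (tensorKernel K.f K.γ) (fun p => φ p - ψ p) (fun p => φ p - ψ p) := by
  have h := bilin_linComb (k := tensorKernel K.f K.γ) (ι := Fin 2)
    (G := fun i => (![φ, ψ] i : 𝓓(openQuadrant, ℝ))) (fun i j => K.bilin_test_integrable _ _)
    ![1, -1]
  simp only [Fin.sum_univ_two, Matrix.cons_val_zero, Matrix.cons_val_one, one_mul, neg_mul,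
    mul_neg, ← sub_eq_add_neg] at h
  rw [h, norm_sub_sq_real, ← real_inner_self_eq_norm_sq, ← real_inner_self_eq_norm_sq,
    K.inner_toH_eq_bilin, K.inner_toH_eq_bilin, K.inner_toH_eq_bilin,
    bilin_swap (isPDKernel_tensorKernel K.hf K.hγ) ψ φ]
  ring

/-- Domination by the indicator of a ball. -/
theorem bilin_self_le_of_bound {M C : ℝ} {g : ℝ × ℝ → ℝ} (hC : ∀ p, ‖p‖ ≤ M → |g p| ≤ C)
    (hM : ∀ p, g p ≠ 0 → ‖p‖ ≤ M) :
    bilin (tensorKernel K.f K.γ) g g ≤ C ^ 2 * bilin (tensorKernel K.f K.γ)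
      ((Metric.closedBall 0 M).indicator fun _ => 1)
      ((Metric.closedBall 0 M).indicator fun _ => 1) := by
  have hK := isPDKernel_tensorKernel K.hf K.hγ
  have hm : Measurable ((Metric.closedBall (0 : ℝ × ℝ) M).indicator fun _ => (1 : ℝ)) :=
    measurable_const.indicator measurableSet_closedBall
  have hb : ∀ p, |(Metric.closedBall (0 : ℝ × ℝ) M).indicator (fun _ => (1 : ℝ)) p| ≤ 1 :=
    fun p => by
      by_cases hp : p ∈ Metric.closedBall (0 : ℝ × ℝ) M
      · rw [indicator_of_mem hp, abs_one]
      · rw [indicator_of_notMem hp, abs_zero]; exact zero_le_one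
  have hs : ∀ p, (Metric.closedBall (0 : ℝ × ℝ) M).indicator (fun _ => (1 : ℝ)) p ≠ 0 →
      ‖p‖ ≤ M := fun p hp => mem_closedBall_zero_iff.1 (mem_of_indicator_ne_zero hp)
  have hi := bilin_integrable_of_bounded hK.locallyIntegrable hm hm hb hb hs hs
  unfold bilin
  rw [← integral_const_mul]
  refine (le_abs_self _).trans ?_
  rw [← Real.norm_eq_abs]
  refine norm_integral_le_of_norm_le (hi.const_mul _) (ae_of_all _ fun p => ?_)
  rw [Real.norm_eq_abs, abs_mul, abs_mul, abs_of_nonneg (hK.nonneg _)]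
  have h0 := hK.nonneg (p.1 - p.2)
  by_cases h1 : ‖p.1‖ ≤ M
  · by_cases h2 : ‖p.2‖ ≤ M
    · rw [indicator_of_mem (mem_closedBall_zero_iff.2 h1),
        indicator_of_mem (mem_closedBall_zero_iff.2 h2)]
      have a1 := hC _ h1
      have a2 := hC _ h2
      have a3 := (abs_nonneg _).trans a1
      calc _ ≤ tensorKernel K.f K.γ (p.1 - p.2) * C * C := by gcongr
        _ = _ := by ring
    · have : g p.2 = 0 := by
        by_contra h; exact h2 (hM _ h)
      rw [this, indicator_of_notMem fun h => h2 (mem_closedBall_zero_iff.1 h)]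
      simp
  · have : g p.1 = 0 := by
      by_contra h; exact h1 (hM _ h)
    rw [this, indicator_of_notMem fun h => h1 (mem_closedBall_zero_iff.1 h)]
    simp

/-- Test functions with support in the ball of radius `M`. -/
def BoundedTest (M : ℕ) : Type := {φ : 𝓓(openQuadrant, ℝ) // ∀ p, φ p ≠ 0 → ‖p‖ ≤ M}

/-- The uniform topology on test functions with support in a fixed ball. -/
noncomputable instance (M : ℕ) : TopologicalSpace (BoundedTest M) :=
  TopologicalSpace.induced (fun φ => (⟨φ.1, φ.1.continuous⟩ : C(ℝ × ℝ, ℝ))) inferInstance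

/-- The uniform topology is second countable, and the map to `H` is continuous for it. -/
theorem isSeparable_boundedTest (M : ℕ) :
    TopologicalSpace.IsSeparable (range fun φ : BoundedTest M => K.toH φ.1) := by
  have : SecondCountableTopology (BoundedTest M) :=
    TopologicalSpace.secondCountableTopology_induced _ _ _
  refine TopologicalSpace.isSeparable_range (continuous_iff_continuousAt.2 fun φ => ?_)
  have hι : Tendsto (fun ψ : BoundedTest M => (⟨ψ.1, ψ.1.continuous⟩ : C(ℝ × ℝ, ℝ))) (𝓝 φ)
      (𝓝 ⟨φ.1, φ.1.continuous⟩) := continuous_induced_dom.continuousAt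
  rw [ContinuousMap.tendsto_iff_forall_isCompact_tendstoUniformlyOn] at hι
  have hu := hι _ (isCompact_closedBall (0 : ℝ × ℝ) M)
  rw [Metric.tendstoUniformlyOn_iff] at hu
  set B := bilin (tensorKernel K.f K.γ) ((Metric.closedBall 0 (M : ℝ)).indicator fun _ => 1)
      ((Metric.closedBall 0 (M : ℝ)).indicator fun _ => 1) with hB
  -- `B` is the squared norm in `H` of the indicator of the ball; uniform convergence in the ball is
  -- convergence in `H`.
  rw [ContinuousAt, Metric.tendsto_nhds]
  intro ε hε
  filter_upwards [hu (ε / (|B| + 1)) (by positivity)] with ψ hψ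
  have h1 : ‖K.toH ψ.1 - K.toH φ.1‖ ^ 2 ≤ (ε / (|B| + 1)) ^ 2 * B := by
    rw [K.norm_toH_sub_sq]
    refine K.bilin_self_le_of_bound (fun p hp => ?_) fun p hp => ?_
    · have := hψ p (mem_closedBall_zero_iff.2 hp)
      rw [dist_comm, Real.dist_eq] at this
      exact this.le
    · by_cases h : ψ.1 p = 0
      · refine φ.2 p fun h' => hp ?_
        rw [h, h', sub_zero]
      · exact ψ.2 p h
  rw [dist_eq_norm]
  refine lt_of_pow_lt_pow_left₀ 2 hε.le (h1.trans_lt ?_)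
  have h2 : B ≤ |B| := le_abs_self B
  have h3 := abs_nonneg B
  rw [div_pow, div_mul_eq_mul_div, div_lt_iff₀ (by positivity)]
  have : 0 < ε ^ 2 := by positivity
  have h4 : B < (|B| + 1) ^ 2 := by nlinarith
  exact mul_lt_mul_of_pos_left h4 this

instance : TopologicalSpace.SeparableSpace K.H := by
  rw [← TopologicalSpace.isSeparable_univ_iff, ← K.denseRange_toH.closure_range]
  refine TopologicalSpace.IsSeparable.closure ?_
  refine (TopologicalSpace.IsSeparable.iUnion fun M : ℕ => K.isSeparable_boundedTest M).mono ?_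
  rintro _ ⟨φ, rfl⟩
  obtain ⟨M, hM⟩ := φ.hasCompactSupport.isCompact.isBounded.exists_norm_le
  obtain ⟨N, hN⟩ := exists_nat_ge M
  exact mem_iUnion.2 ⟨N, ⟨φ, fun p hp => (hM p (subset_tsupport _ hp)).trans hN⟩, rfl⟩

end NoiseKernel

end Separable

/-! ### The chaos components as elements of `L²(Ω)` -/

section Chaos

variable {Ω : Type*} [MeasurableSpace Ω] {P : Measure Ω} [IsProbabilityMeasure P]
  {K : NoiseKernel} {W : K.H → Ω → ℝ}

theorem continuous_of_continuous_inner {X E : Type*} [TopologicalSpace X] [NormedAddCommGroup E]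
    [InnerProductSpace ℝ E] {x : X → E}
    (h : Continuous fun p : X × X => (inner ℝ (x p.1) (x p.2) : ℝ)) : Continuous x := by
  refine continuous_iff_continuousAt.2 fun q => ?_
  rw [ContinuousAt, tendsto_iff_norm_sub_tendsto_zero]
  have h1 : Continuous fun p : X => (inner ℝ (x p) (x p) : ℝ) - 2 * inner ℝ (x p) (x q) +
      inner ℝ (x q) (x q) := by
    have a1 : Continuous fun p : X => (inner ℝ (x p) (x p) : ℝ) :=
      h.comp (f := fun p => (p, p)) (by fun_prop)
    have a2 : Continuous fun p : X => (inner ℝ (x p) (x q) : ℝ) :=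
      h.comp (f := fun p => (p, q)) (by fun_prop)
    exact (a1.sub (a2.const_mul 2)).add continuous_const
  have h2 : Tendsto (fun p => ‖x p - x q‖ ^ 2) (𝓝 q) (𝓝 0) := by
    have := h1.tendsto q
    refine (this.congr fun p => ?_).trans_eq ?_
    · rw [norm_sub_sq_real, real_inner_self_eq_norm_sq, real_inner_self_eq_norm_sq]
    · congr 1; ring
  have h3 := h2.sqrt
  simpa [Real.sqrt_sq (norm_nonneg _)] using h3

namespace IsIsonormal

theorem continuous_waveLp (hW : IsIsonormal K P W) :
    Continuous fun q : K.H × ℝ => hW.waveLp q.1 q.2 := by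
  refine continuous_of_continuous_inner ?_
  have e : ∀ p : (K.H × ℝ) × (K.H × ℝ),
      inner ℝ (hW.waveLp p.1.1 p.1.2) (hW.waveLp p.2.1 p.2.2) =
      (Real.exp (inner ℝ p.1.1 p.2.1) * Real.cos (p.1.2 - p.2.2) +
        Real.exp (-inner ℝ p.1.1 p.2.1) * Real.cos (p.1.2 + p.2.2)) / 2 := fun p => by
    rw [waveLp, waveLp, Lp_inner_toLp, hW.integral_wave_mul_wave]
  simp only [e]
  have h1 : Continuous fun p : (K.H × ℝ) × (K.H × ℝ) => (inner ℝ p.1.1 p.2.1 : ℝ) :=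
    (continuous_fst.fst).inner (continuous_snd.fst)
  fun_prop

theorem dense_span_waveLp (hW : IsIsonormal K P W) :
    Dense (Submodule.span ℝ (range fun q : 𝓓(openQuadrant, ℝ) × ℝ =>
      hW.waveLp (K.toH q.1) q.2) : Set (Lp ℝ 2 P)) := by
  rw [Submodule.dense_iff_topologicalClosure_eq_top, Submodule.topologicalClosure_eq_top_iff,
    Submodule.eq_bot_iff]
  intro J hJ
  refine hW.eq_of_inner_waveLp fun φ a => ?_
  rw [inner_zero_left, real_inner_comm]
  exact (Submodule.mem_orthogonal _ _).1 hJ _ (Submodule.subset_span ⟨(φ, a), rfl⟩)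

theorem separableSpace_Lp (hW : IsIsonormal K P W) :
    TopologicalSpace.SeparableSpace (Lp ℝ 2 P) := by
  rw [← TopologicalSpace.isSeparable_univ_iff, ← hW.dense_span_waveLp.closure_eq]
  refine TopologicalSpace.IsSeparable.closure (TopologicalSpace.IsSeparable.span ?_)
  refine (TopologicalSpace.isSeparable_range hW.continuous_waveLp).mono ?_
  rintro _ ⟨q, rfl⟩
  exact ⟨(K.toH q.1, q.2), rfl⟩

theorem stronglyMeasurable_of_inner_waveLp (hW : IsIsonormal K P W) {X : Type*} [MeasurableSpace X]
    {J : X → Lp ℝ 2 P}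
    (h : ∀ (φ : 𝓓(openQuadrant, ℝ)) (a : ℝ),
      Measurable fun p => (inner ℝ (J p) (hW.waveLp (K.toH φ) a) : ℝ)) :
    StronglyMeasurable J := by
  have := hW.separableSpace_Lp
  refine stronglyMeasurable_of_measurable_inner (measurable_inner_of_dense hW.dense_span_waveLp ?_)
  rintro _ ⟨q, rfl⟩
  exact h q.1 q.2

end IsIsonormal

/-- A measurable family of elements of `L²(Ω)` has a jointly measurable version. -/
theorem exists_measurable_version [TopologicalSpace.SeparableSpace (Lp ℝ 2 P)] {X : Type*}
    [MeasurableSpace X] {J : X → Lp ℝ 2 P} (hJ : StronglyMeasurable J) :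
    ∃ v : X → Ω → ℝ, Measurable (fun q : X × Ω => v q.1 q.2) ∧ ∀ p, v p =ᵐ[P] J p := by
  let d := TopologicalSpace.denseSeq (Lp ℝ 2 P)
  have hex : ∀ (n : ℕ) (p : X), ∃ k, dist (J p) (d k) < (1 / 2) ^ n := fun n p =>
    (TopologicalSpace.denseRange_denseSeq (Lp ℝ 2 P)).exists_dist_lt (J p) (by positivity)
  classical
  -- Approximation within `2⁻ⁿ` by the first suitable element of a dense sequence; the
  -- approximations take countably many values, and they converge almost surely since the squared
  -- distances are summable.
  let k : ℕ → X → ℕ := fun n p => Nat.find (hex n p)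
  have hk : ∀ n, Measurable (k n) := fun n =>
    measurable_find (hex n) fun m => measurableSet_lt
      (hJ.dist stronglyMeasurable_const).measurable measurable_const
  have hd : ∀ m, Measurable (d m : Ω → ℝ) := fun m => (Lp.stronglyMeasurable (d m)).measurable
  let V : ℕ → X × Ω → ℝ := fun n q => d (k n q.1) q.2
  have hV : ∀ n, Measurable (V n) := fun n => by
    have h1 : Measurable fun q : ℕ × Ω => (d q.1 : Ω → ℝ) q.2 :=
      measurable_from_prod_countable_right fun m => hd m
    exact h1.comp (((hk n).comp measurable_fst).prodMk measurable_snd)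
  refine ⟨fun p ω => limsup (fun n => V n (p, ω)) atTop, Measurable.limsup hV, fun p => ?_⟩
  have hdist : ∀ n, dist (J p) (d (k n p)) < (1 / 2) ^ n := fun n => Nat.find_spec (hex n p)
  have hsq : ∀ n, ∫⁻ ω, ‖d (k n p) ω - J p ω‖ₑ ^ 2 ∂P ≤ ENNReal.ofReal ((1 / 4) ^ n) := fun n => by
    have h1 : ‖d (k n p) - J p‖ ^ 2 ≤ (1 / 4) ^ n := by
      rw [← dist_eq_norm, dist_comm]
      refine (pow_le_pow_left₀ dist_nonneg (hdist n).le 2).trans_eq ?_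
      rw [← pow_mul, mul_comm, pow_mul]; norm_num
    have h2 : ENNReal.ofReal (‖d (k n p) - J p‖ ^ 2) =
        ∫⁻ ω, ‖(d (k n p) - J p : Lp ℝ 2 P) ω‖ₑ ^ 2 ∂P := by
      rw [← real_inner_self_eq_norm_sq, Lp_inner_eq, ofReal_integral_eq_lintegral_ofReal]
      · refine lintegral_congr fun ω => ?_
        rw [← sq, Real.enorm_eq_ofReal_abs, ← ENNReal.ofReal_pow (abs_nonneg _), sq_abs]
      · exact (Lp.memLp _).integrable_mul (Lp.memLp _)
      · exact ae_of_all _ fun ω => mul_self_nonneg _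
    calc _ = ∫⁻ ω, ‖(d (k n p) - J p : Lp ℝ 2 P) ω‖ₑ ^ 2 ∂P := by
          refine lintegral_congr_ae ?_
          filter_upwards [Lp.coeFn_sub (d (k n p)) (J p)] with ω hω
          rw [hω, Pi.sub_apply]
      _ ≤ _ := h2 ▸ ENNReal.ofReal_le_ofReal h1
  have hfin : ∫⁻ ω, ∑' n, ‖d (k n p) ω - J p ω‖ₑ ^ 2 ∂P ≠ ∞ := by
    have hm : ∀ n, AEMeasurable (fun ω => ‖d (k n p) ω - J p ω‖ₑ ^ 2) P := fun n =>
      (((hd _).sub (Lp.stronglyMeasurable (J p)).measurable).enorm.pow_const 2).aemeasurable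
    rw [lintegral_tsum hm]
    refine ne_top_of_le_ne_top ?_ (ENNReal.tsum_le_tsum hsq)
    rw [← ENNReal.ofReal_tsum_of_nonneg (fun n => by positivity)
      (summable_geometric_of_lt_one (by norm_num) (by norm_num))]
    exact ENNReal.ofReal_ne_top
  have hmeas : AEMeasurable (fun ω => ∑' n, ‖d (k n p) ω - J p ω‖ₑ ^ 2) P :=
    AEMeasurable.tsum fun n =>
      (((hd _).sub (Lp.stronglyMeasurable (J p)).measurable).enorm.pow_const 2).aemeasurable
  filter_upwards [ae_lt_top' hmeas hfin] with ω hω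
  have h1 := ENNReal.tendsto_atTop_zero_of_tsum_ne_top hω.ne
  have h2 : Tendsto (fun n => d (k n p) ω) atTop (𝓝 (J p ω)) := by
    rw [tendsto_iff_edist_tendsto_0]
    have h3 := (ENNReal.continuous_rpow_const (y := 1 / 2)).tendsto 0 |>.comp h1
    rw [ENNReal.zero_rpow_of_pos (by norm_num)] at h3
    refine h3.congr fun n => ?_
    rw [Function.comp_apply, ← ENNReal.rpow_natCast, ← ENNReal.rpow_mul, edist_eq_enorm_sub]
    norm_num
  exact h2.limsup_eq

/-- By the Schur product theorem. -/
theorem gram_entry_pow_nonneg {E : Type*} [NormedAddCommGroup E] [InnerProductSpace ℝ E]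
    {ι : Type*} [Fintype ι] (x : ι → E) (n : ℕ) (c : ι → ℝ) :
    0 ≤ ∑ i, ∑ j, c i * c j * (inner ℝ (x i) (x j) : ℝ) ^ n := by
  have h : (Matrix.of fun i j => (inner ℝ (x i) (x j) : ℝ)).PosSemidef := by
    refine Matrix.posSemidef_of_sum_nonneg (fun i j => real_inner_comm _ _) fun c => ?_
    have := real_inner_self_nonneg (x := ∑ i, c i • x i)
    simp only [sum_inner, inner_sum, real_inner_smul_left, real_inner_smul_right] at this
    refine this.trans_eq (Finset.sum_congr rfl fun i _ => Finset.sum_congr rfl fun j _ => ?_)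
    rw [Matrix.of_apply, real_inner_comm]
    ring
  simpa only [Matrix.of_apply] using (h.entry_pow n).sum_nonneg c

variable (u₀ : BoundedContinuousFunction (Ioi (0 : ℝ)) ℝ)

/-- Existence of the partial sums of the chaos expansion, by the Riesz representation theorem. -/
theorem exists_chaosSum (hW : IsIsonormal K P W)
    (hA : ∀ n z t, 0 < z → 0 < t → chaosBound u₀ K.f n z t < ∞) (s : Finset ℕ) {z t : ℝ}
    (hz : 0 < z) (ht : 0 < t) :
    ∃ S : Lp ℝ 2 P, (∀ (φ : 𝓓(openQuadrant, ℝ)) (a : ℝ), inner ℝ S (hW.waveLp (K.toH φ) a) =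
      ∑ n ∈ s, chaosPairing u₀ K.f K.γ φ n z t * Real.cos (a + n * (Real.pi / 2))) ∧
      ‖S‖ ^ 2 ≤ ∑ n ∈ s, symmIntegral K.γ t ^ n * (chaosBound u₀ K.f n z t).toReal := by
  have hΓ := symmIntegral_nonneg K.hγ ht.le
  have hB : ∀ n, 0 ≤ symmIntegral K.γ t ^ n * (chaosBound u₀ K.f n z t).toReal := fun n =>
    mul_nonneg (pow_nonneg hΓ n) ENNReal.toReal_nonneg
  obtain ⟨S, h1, h2⟩ := exists_inner_eq_of_sq_le
    (fun q : 𝓓(openQuadrant, ℝ) × ℝ => hW.waveLp (K.toH q.1) q.2)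
    (fun q => ∑ n ∈ s, chaosPairing u₀ K.f K.γ q.1 n z t * Real.cos (q.2 + n * (Real.pi / 2)))
    (Finset.sum_nonneg fun n _ => hB n) fun c => by
    let ι := c.support
    -- `b n` is the contribution of the `n`-th chaos to the functional at the linear combination
    -- `c`, and `q n` the squared norm of its `n`-th chaos component. The claim follows from
    -- `(b n)² ≤ Bₙ q n` by the Cauchy–Schwarz inequality in `n`.
    let b : ℕ → ℝ := fun n => ∑ i : ι, c i * Real.cos (i.1.2 + n * (Real.pi / 2)) *
      chaosPairing u₀ K.f K.γ i.1.1 n z t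
    let q : ℕ → ℝ := fun n => (∑ i : ι, ∑ j : ι, (c i * Real.cos (i.1.2 + n * (Real.pi / 2))) *
      (c j * Real.cos (j.1.2 + n * (Real.pi / 2))) *
      (inner ℝ (K.toH i.1.1) (K.toH j.1.1) : ℝ) ^ n) / n.factorial
    have hq0 : ∀ n, 0 ≤ q n := fun n =>
      div_nonneg (gram_entry_pow_nonneg (fun i : ι => K.toH i.1.1) n _) (by positivity)
    have hb : ∀ n, b n ^ 2 ≤
        symmIntegral K.γ t ^ n * (chaosBound u₀ K.f n z t).toReal * q n := fun n => by
      have := sum_chaosPairing_sq_le u₀ K.hf K.hγ hA n (ι := ι) (H := fun i => i.1.1)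
        (fun i => i.1.1.continuous) (fun i => i.1.1.hasCompactSupport)
        (fun i => c i * Real.cos (i.1.2 + n * (Real.pi / 2))) hz ht
      simpa only [q, K.inner_toH_eq_bilin] using this
    have hsum : HasSum q (‖c.sum fun a r => r • hW.waveLp (K.toH a.1) a.2‖ ^ 2) := by
      have h1 : HasSum (fun n : ℕ => ∑ i : ι, ∑ j : ι, c i * c j *
          (Real.cos (i.1.2 + n * (Real.pi / 2)) * Real.cos (j.1.2 + n * (Real.pi / 2)) *
            ((inner ℝ (K.toH i.1.1) (K.toH j.1.1) : ℝ) ^ n / n.factorial)))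
          (∑ i : ι, ∑ j : ι, c i * c j *
            inner ℝ (hW.waveLp (K.toH i.1.1) i.1.2) (hW.waveLp (K.toH j.1.1) j.1.2)) :=
        hasSum_sum fun i _ => hasSum_sum fun j _ => (hW.hasSum_inner_waveLp _ _ _ _).mul_left _
      have e1 : ‖c.sum fun a r => r • hW.waveLp (K.toH a.1) a.2‖ ^ 2 = ∑ i : ι, ∑ j : ι, c i * c j *
            inner ℝ (hW.waveLp (K.toH i.1.1) i.1.2) (hW.waveLp (K.toH j.1.1) j.1.2) := by
        rw [← real_inner_self_eq_norm_sq, Finsupp.sum, ← Finset.sum_coe_sort]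
        simp only [sum_inner, inner_sum, real_inner_smul_left, real_inner_smul_right]
        refine Finset.sum_congr rfl fun i _ => Finset.sum_congr rfl fun j _ => ?_
        rw [real_inner_comm]
        ring
      rw [e1]
      refine h1.congr_fun fun n => ?_
      simp only [q]
      rw [Finset.sum_div]
      refine Finset.sum_congr rfl fun i _ => ?_
      rw [Finset.sum_div]
      exact Finset.sum_congr rfl fun j _ => by ring
    have e2 : (c.sum fun a r => r * ∑ n ∈ s, chaosPairing u₀ K.f K.γ a.1 n z t *
        Real.cos (a.2 + n * (Real.pi / 2))) = ∑ n ∈ s, b n := by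
      rw [Finsupp.sum, ← Finset.sum_coe_sort]
      simp only [Finset.mul_sum, b]
      rw [Finset.sum_comm]
      exact Finset.sum_congr rfl fun n _ => Finset.sum_congr rfl fun i _ => by ring
    rw [e2]
    have h3 : |∑ n ∈ s, b n| ≤ √(∑ n ∈ s, symmIntegral K.γ t ^ n *
        (chaosBound u₀ K.f n z t).toReal) * √(∑ n ∈ s, q n) := by
      refine le_trans ?_ (Real.sum_sqrt_mul_sqrt_le s hB hq0)
      refine (Finset.abs_sum_le_sum_abs _ _).trans (Finset.sum_le_sum fun n _ => ?_)
      rw [← Real.sqrt_mul (hB n)]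
      exact Real.abs_le_sqrt (hb n)
    have h4 := pow_le_pow_left₀ (abs_nonneg _) h3 2
    rw [sq_abs, mul_pow, Real.sq_sqrt (Finset.sum_nonneg fun n _ => hB n),
      Real.sq_sqrt (Finset.sum_nonneg fun n _ => hq0 n)] at h4
    refine h4.trans (mul_le_mul_of_nonneg_left ?_ (Finset.sum_nonneg fun n _ => hB n))
    exact sum_le_hasSum s (fun n _ => hq0 n) hsum
  exact ⟨S, fun φ a => h1 (φ, a), h2⟩

/-- The chaos components: `J n z t` is characterised by its pairings with the exponentials. -/
theorem exists_chaos (hW : IsIsonormal K P W)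
    (hA : ∀ n z t, 0 < z → 0 < t → chaosBound u₀ K.f n z t < ∞) :
    ∃ J : ℕ → ℝ → ℝ → Lp ℝ 2 P,
      (∀ n z t, 0 < z → 0 < t → ∀ (φ : 𝓓(openQuadrant, ℝ)) (a : ℝ),
        inner ℝ (J n z t) (hW.waveLp (K.toH φ) a) =
          chaosPairing u₀ K.f K.γ φ n z t * Real.cos (a + n * (Real.pi / 2))) ∧
      (∀ (s : Finset ℕ) z t, 0 < z → 0 < t → ‖∑ n ∈ s, J n z t‖ ^ 2 ≤
        ∑ n ∈ s, symmIntegral K.γ t ^ n * (chaosBound u₀ K.f n z t).toReal) ∧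
      ∀ n z t, ¬ (0 < z ∧ 0 < t) → J n z t = 0 := by
  choose S hS1 hS2 using fun (n : ℕ) (z t : ℝ) (h : 0 < z ∧ 0 < t) =>
    exists_chaosSum (P := P) u₀ hW hA {n} h.1 h.2
  classical
  let J : ℕ → ℝ → ℝ → Lp ℝ 2 P := fun n z t => if h : 0 < z ∧ 0 < t then S n z t h else 0
  have hJ : ∀ n z t, 0 < z → 0 < t → ∀ (φ : 𝓓(openQuadrant, ℝ)) (a : ℝ),
        inner ℝ (J n z t) (hW.waveLp (K.toH φ) a) =
          chaosPairing u₀ K.f K.γ φ n z t * Real.cos (a + n * (Real.pi / 2)) :=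
    fun n z t hz ht φ a => by
      have h : 0 < z ∧ 0 < t := ⟨hz, ht⟩
      simp only [J, h, and_self, dif_pos]
      rw [hS1, Finset.sum_singleton]
  refine ⟨J, hJ, fun s z t hz ht => ?_, fun n z t h => dif_neg h⟩
  obtain ⟨S', h1, h2⟩ := exists_chaosSum (P := P) u₀ hW hA s hz ht
  have e : ∑ n ∈ s, J n z t = S' := hW.eq_of_inner_waveLp fun φ a => by
    rw [sum_inner, h1]
    exact Finset.sum_congr rfl fun n _ => hJ n z t hz ht φ a
  rwa [e]

theorem stronglyMeasurable_chaos (hW : IsIsonormal K P W) {J : ℕ → ℝ → ℝ → Lp ℝ 2 P}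
    (hJ : ∀ n z t, 0 < z → 0 < t → ∀ (φ : 𝓓(openQuadrant, ℝ)) (a : ℝ),
        inner ℝ (J n z t) (hW.waveLp (K.toH φ) a) =
          chaosPairing u₀ K.f K.γ φ n z t * Real.cos (a + n * (Real.pi / 2)))
    (hJ0 : ∀ n z t, ¬ (0 < z ∧ 0 < t) → J n z t = 0) (n : ℕ) :
    StronglyMeasurable fun p : ℝ × ℝ => J n p.1 p.2 := by
  refine hW.stronglyMeasurable_of_inner_waveLp fun φ a => ?_
  have e : (fun p : ℝ × ℝ => inner ℝ (J n p.1 p.2) (hW.waveLp (K.toH φ) a)) =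
      quadrant.indicator fun p => chaosPairing u₀ K.f K.γ φ n p.1 p.2 *
        Real.cos (a + n * (Real.pi / 2)) := by
    ext p
    by_cases hp : p ∈ quadrant
    · rw [indicator_of_mem hp, hJ n p.1 p.2 hp.1 hp.2]
    · rw [indicator_of_notMem hp, hJ0 n p.1 p.2 hp, inner_zero_left]
  rw [e]
  exact ((chaosPairing_measurable u₀ K.hf.locallyIntegrable K.hγ.locallyIntegrable φ.continuous
    φ.hasCompactSupport n).mul_const _).indicator (measurableSet_Ioi.prod measurableSet_Ioi)

end Chaos

/-! ### Divergences are determined by the trigonometric functions of the noise -/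

section Divergence

variable {Ω : Type*} [MeasurableSpace Ω] {P : Measure Ω} [IsProbabilityMeasure P]
  {K : NoiseKernel} {W : K.H → Ω → ℝ}

open scoped FourierTransform in
/-- Fourier inversion under an expectation. -/
theorem integral_smul_schwartz {E : Type*} [NormedAddCommGroup E] [InnerProductSpace ℝ E]
    [FiniteDimensional ℝ E] [MeasurableSpace E] [BorelSpace E] {Y : Ω → ℝ} (hY : Integrable Y P)
    {x : Ω → E} (hx : Measurable x) (G : SchwartzMap E ℂ) :
    ∫ ω, (Y ω : ℂ) * G (x ω) ∂P =
      ∫ ξ, 𝓕 G ξ * ∫ ω, (Y ω : ℂ) *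
        Complex.exp (↑(2 * Real.pi * inner ℝ ξ (x ω)) * Complex.I) ∂P := by
  have h1 : ∀ y, G y = ∫ ξ, Complex.exp (↑(2 * Real.pi * inner ℝ ξ y) * Complex.I) * 𝓕 G ξ := by
    intro y
    have e : G y = (𝓕⁻ (𝓕 G)) y := by rw [FourierTransform.fourierInv_fourier_eq]
    rw [e, SchwartzMap.fourierInv_coe, Real.fourierInv_eq']
    rfl
  simp_rw [h1, ← integral_const_mul]
  rw [integral_integral_swap]
  · refine integral_congr_ae (ae_of_all _ fun ξ => integral_congr_ae (ae_of_all _ fun ω => ?_))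
    dsimp only
    ring
  · have hi : Integrable (fun p : Ω × E => (Y p.1 : ℂ) * 𝓕 G p.2) (P.prod volume) :=
      hY.ofReal.mul_prod (𝓕 G).integrable
    have hm : Measurable fun p : Ω × E =>
        Complex.exp (↑(2 * Real.pi * inner ℝ p.2 (x p.1)) * Complex.I) := by
      have : Measurable fun p : Ω × E => (inner ℝ p.2 (x p.1) : ℝ) :=
        measurable_snd.inner (hx.comp measurable_fst)
      fun_prop
    have := hi.mul_bdd (c := 1) hm.aestronglyMeasurable
      (ae_of_all _ fun p => by rw [Complex.norm_exp_ofReal_mul_I])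
    refine this.congr (ae_of_all _ fun p => ?_)
    simp only [Function.uncurry]
    ring

namespace IsIsonormal

theorem memLp_inner_Lp (V : Lp K.H 2 P) (h : K.H) : MemLp (fun ω => (inner ℝ h (V ω) : ℝ)) 2 P :=
  (Lp.memLp V).const_inner h

/-- The test identity of a divergence extends from test functions to all of `H`. -/
theorem integral_cos_of_test (hW : IsIsonormal K P W) {Z : Ω → ℝ} (hZ : MemLp Z 2 P)
    (V : Lp K.H 2 P)
    (hcos : ∀ (φ : 𝓓(openQuadrant, ℝ)) (a : ℝ), ∫ ω, Z ω * Real.cos (W (K.toH φ) ω + a) ∂P =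
      ∫ ω, inner ℝ (K.toH φ) (V ω) * Real.cos (W (K.toH φ) ω + (a + Real.pi / 2)) ∂P)
    (h : K.H) (a : ℝ) : ∫ ω, Z ω * Real.cos (W h ω + a) ∂P =
      ∫ ω, inner ℝ h (V ω) * Real.cos (W h ω + (a + Real.pi / 2)) ∂P := by
  have hi : ∀ g h, Integrable (fun ω => inner ℝ g (V ω) *
      Real.cos (W h ω + (a + Real.pi / 2))) P := fun g h => by
    have := hW.measurable h
    exact ((memLp_inner_Lp V g).integrable (by norm_num)).mul_bdd (c := 1) (by fun_prop)
      (ae_of_all _ fun ω => Real.abs_cos_le_one _)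
  have hc : Continuous fun h => ∫ ω, inner ℝ h (V ω) * Real.cos (W h ω + (a + Real.pi / 2)) ∂P := by
    rw [continuous_iff_continuousAt]
    intro h₀
    have hV : Integrable (fun ω => ‖V ω‖) P := ((Lp.memLp V).integrable (by norm_num)).norm
    have hb : ∀ g h : K.H, |∫ ω, inner ℝ g (V ω) * Real.cos (W h ω + (a + Real.pi / 2)) ∂P| ≤
        ‖g‖ * ∫ ω, ‖V ω‖ ∂P := fun g h => by
      rw [← Real.norm_eq_abs, ← integral_const_mul]
      refine norm_integral_le_of_norm_le (hV.const_mul _) (ae_of_all _ fun ω => ?_)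
      rw [norm_mul]
      refine (mul_le_of_le_one_right (norm_nonneg _) (Real.abs_cos_le_one _)).trans ?_
      exact norm_inner_le_norm _ _
    have h1 : Tendsto (fun h => ∫ ω, inner ℝ (h - h₀) (V ω) *
        Real.cos (W h ω + (a + Real.pi / 2)) ∂P) (𝓝 h₀) (𝓝 0) := by
      refine squeeze_zero_norm (fun h => hb (h - h₀) h) ?_
      have : Continuous fun h : K.H => ‖h - h₀‖ * ∫ ω, ‖V ω‖ ∂P := by fun_prop
      simpa using this.tendsto h₀
    have h2 := (hW.continuous_integral_mul_cos (memLp_inner_Lp V h₀) (a + Real.pi / 2)).tendsto h₀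
    have h3 := h1.add h2
    rw [zero_add] at h3
    refine h3.congr fun h => ?_
    rw [← integral_add (hi _ _) (hi _ _)]
    refine integral_congr_ae (ae_of_all _ fun ω => ?_)
    dsimp only
    rw [inner_sub_left]
    ring
  refine congrFun (Continuous.ext_on K.denseRange_toH (hW.continuous_integral_mul_cos hZ a) hc ?_) h
  rintro _ ⟨φ, rfl⟩
  exact hcos φ a

/-- The complex exponential form of the test identity. -/
theorem integral_cexp_of_cos (hW : IsIsonormal K P W) {Z : Ω → ℝ} (hZ : Integrable Z P)
    {Y : Ω → ℝ} (hY : Integrable Y P) (h : K.H)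
    (hcos : ∀ a : ℝ, ∫ ω, Z ω * Real.cos (W h ω + a) ∂P =
      ∫ ω, Y ω * Real.cos (W h ω + (a + Real.pi / 2)) ∂P) :
    ∫ ω, (Z ω : ℂ) * Complex.exp (W h ω * Complex.I) ∂P =
      Complex.I * ∫ ω, (Y ω : ℂ) * Complex.exp (W h ω * Complex.I) ∂P := by
  have hm := hW.measurable h
  have key : ∀ {X : Ω → ℝ}, Integrable X P →
      ∫ ω, (X ω : ℂ) * Complex.exp (W h ω * Complex.I) ∂P =
        (∫ ω, X ω * Real.cos (W h ω) ∂P : ℝ) +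
          (∫ ω, X ω * Real.sin (W h ω) ∂P : ℝ) * Complex.I := by
    intro X hX
    have i1 : Integrable (fun ω => X ω * Real.cos (W h ω)) P :=
      hX.mul_bdd (c := 1) (by fun_prop) (ae_of_all _ fun ω => Real.abs_cos_le_one _)
    have i2 : Integrable (fun ω => X ω * Real.sin (W h ω)) P :=
      hX.mul_bdd (c := 1) (by fun_prop) (ae_of_all _ fun ω => Real.abs_sin_le_one _)
    rw [← integral_complex_ofReal, ← integral_complex_ofReal, ← integral_mul_const,
      ← integral_add i1.ofReal (i2.ofReal.mul_const _)]
    refine integral_congr_ae (ae_of_all _ fun ω => ?_)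
    dsimp only
    rw [Complex.exp_mul_I, ← Complex.ofReal_cos, ← Complex.ofReal_sin]
    push_cast
    ring
  rw [key hZ, key hY]
  have h0 := hcos 0
  have h1 := hcos (-(Real.pi / 2))
  simp only [add_zero, zero_add, neg_add_cancel, Real.cos_add_pi_div_two] at h0 h1
  simp only [← sub_eq_add_neg, Real.cos_sub_pi_div_two] at h1
  rw [h0, h1]
  simp only [mul_neg, integral_neg]
  push_cast
  linear_combination (-(∫ ω, Y ω * Real.sin (W h ω) ∂P : ℝ) : ℂ) * Complex.I_sq

open scoped FourierTransform LineDeriv in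
/-- Gaussian integration by parts for Schwartz functions of the noise, by Fourier inversion. -/
theorem integral_schwartz (hW : IsIsonormal K P W) {Z : Ω → ℝ} (hZ : MemLp Z 2 P)
    (V : Lp K.H 2 P)
    (hcos : ∀ (h : K.H) (a : ℝ), ∫ ω, Z ω * Real.cos (W h ω + a) ∂P =
      ∫ ω, inner ℝ h (V ω) * Real.cos (W h ω + (a + Real.pi / 2)) ∂P)
    {N : ℕ} (h : Fin N → K.H) (G : SchwartzMap (EuclideanSpace ℝ (Fin N)) ℂ) :
    ∫ ω, (Z ω : ℂ) * G (WithLp.toLp 2 fun i => W (h i) ω) ∂P =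
      ∑ j, ∫ ω, ((inner ℝ (h j) (V ω) : ℝ) : ℂ) *
        (fderiv ℝ G (WithLp.toLp 2 fun i => W (h i) ω) (EuclideanSpace.single j 1)) ∂P := by
  set x : Ω → EuclideanSpace ℝ (Fin N) := fun ω => WithLp.toLp 2 fun i => W (h i) ω with hx_def
  have hx : Measurable x := by
    have : Measurable fun ω => (fun i => W (h i) ω) :=
      measurable_pi_lambda _ fun i => hW.measurable _
    exact (WithLp.measurable_toLp 2 _).comp this
  have hZi : Integrable Z P := hZ.integrable (by norm_num)
  have hVi : ∀ g, Integrable (fun ω => (inner ℝ g (V ω) : ℝ)) P := fun g =>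
    (memLp_inner_Lp V g).integrable (by norm_num)
  -- Under the Fourier transform, the partial derivatives of `G` become multiplications by
  -- `2πi ξⱼ`, and at each frequency the claim is the exponential form of the test identity.
  let D : Fin N → SchwartzMap (EuclideanSpace ℝ (Fin N)) ℂ := fun j =>
    ∂_{EuclideanSpace.single j (1 : ℝ)} G
  have hd : ∀ j, ∫ ω, ((inner ℝ (h j) (V ω) : ℝ) : ℂ) * (fderiv ℝ G (x ω)
      (EuclideanSpace.single j 1)) ∂P = ∫ ξ, 𝓕 (D j) ξ *
      ∫ ω, ((inner ℝ (h j) (V ω) : ℝ) : ℂ) *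
        Complex.exp (↑(2 * Real.pi * inner ℝ ξ (x ω)) * Complex.I) ∂P := fun j =>
    integral_smul_schwartz (hVi (h j)) hx (D j)
  have hF : ∀ j ξ, 𝓕 (D j) ξ =
      2 * Real.pi * Complex.I * (ξ j * 𝓕 G ξ) := by
    intro j ξ
    have ht : (inner ℝ · (EuclideanSpace.single j (1 : ℝ)) :
      EuclideanSpace ℝ (Fin N) → ℝ).HasTemperateGrowth := by fun_prop
    rw [show D j = ∂_{EuclideanSpace.single j (1 : ℝ)} G from rfl,
      SchwartzMap.fourier_lineDerivOp_eq, _root_.smul_apply,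
      SchwartzMap.smulLeftCLM_apply_apply ht]
    simp [EuclideanSpace.inner_single_right]
  refine (integral_smul_schwartz hZi hx G).trans ?_
  refine Eq.trans ?_ (Finset.sum_congr rfl fun j _ => (hd j).symm)
  have hE : ∀ ξ : EuclideanSpace ℝ (Fin N), ∫ ω, (Z ω : ℂ) *
      Complex.exp (↑(2 * Real.pi * inner ℝ ξ (x ω)) * Complex.I) ∂P =
      ∑ j, 2 * Real.pi * Complex.I * ξ j * ∫ ω, ((inner ℝ (h j) (V ω) : ℝ) : ℂ) *
        Complex.exp (↑(2 * Real.pi * inner ℝ ξ (x ω)) * Complex.I) ∂P := by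
    intro ξ
    have hsum : W (∑ j, (2 * Real.pi * ξ j) • h j) =ᵐ[P]
        fun ω => 2 * Real.pi * inner ℝ ξ (x ω) := by
      filter_upwards [hW.sum_ae Finset.univ (fun j => 2 * Real.pi * ξ j) h] with ω h1
      rw [h1, PiLp.inner_apply, Finset.mul_sum]
      refine Finset.sum_congr rfl fun j _ => ?_
      simp [x]
      ring
    have h1 := hW.integral_cexp_of_cos hZi (hVi (∑ j, (2 * Real.pi * ξ j) • h j)) _ (hcos _)
    have h2 : ∀ Y : Ω → ℂ, ∫ ω, Y ω * Complex.exp (W (∑ j, (2 * Real.pi * ξ j) • h j) ω *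
        Complex.I) ∂P = ∫ ω, Y ω * Complex.exp (↑(2 * Real.pi * inner ℝ ξ (x ω)) * Complex.I) ∂P :=
      fun Y => integral_congr_ae (by filter_upwards [hsum] with ω h3; rw [h3])
    rw [h2, h2] at h1
    rw [h1]
    have h4 : ∀ ω, (((inner ℝ (∑ j, (2 * Real.pi * ξ j) • h j) (V ω) : ℝ) : ℂ) *
        Complex.exp (↑(2 * Real.pi * inner ℝ ξ (x ω)) * Complex.I)) =
        ∑ j, (2 * Real.pi * ξ j : ℂ) * (((inner ℝ (h j) (V ω) : ℝ) : ℂ) *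
        Complex.exp (↑(2 * Real.pi * inner ℝ ξ (x ω)) * Complex.I)) := by
      intro ω
      rw [sum_inner, Complex.ofReal_sum, Finset.sum_mul]
      refine Finset.sum_congr rfl fun j _ => ?_
      rw [real_inner_smul_left]
      push_cast
      ring
    simp_rw [h4]
    rw [integral_finsetSum, Finset.mul_sum]
    · refine Finset.sum_congr rfl fun j _ => ?_
      rw [integral_const_mul]
      ring
    · intro j _
      refine Integrable.const_mul ?_ _
      have hm : Measurable fun ω => (inner ℝ ξ (x ω) : ℝ) := measurable_const.inner hx
      exact (hVi (h j)).ofReal.mul_bdd (c := 1) (by fun_prop)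
        (ae_of_all _ fun ω => by rw [Complex.norm_exp_ofReal_mul_I])
  rw [← integral_finsetSum]
  · refine integral_congr_ae (ae_of_all _ fun ξ => ?_)
    dsimp only
    rw [hE, Finset.mul_sum]
    refine Finset.sum_congr rfl fun j _ => ?_
    rw [hF]
    ring
  · intro j _
    have hm : StronglyMeasurable fun ξ : EuclideanSpace ℝ (Fin N) =>
        ∫ ω, ((inner ℝ (h j) (V ω) : ℝ) : ℂ) *
        Complex.exp (↑(2 * Real.pi * inner ℝ ξ (x ω)) * Complex.I) ∂P := by
      have h1 : Measurable fun p : EuclideanSpace ℝ (Fin N) × Ω => (inner ℝ p.1 (x p.2) : ℝ) :=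
        measurable_fst.inner (hx.comp measurable_snd)
      have h2 : StronglyMeasurable fun p : EuclideanSpace ℝ (Fin N) × Ω =>
          (inner ℝ (h j) (V p.2) : ℝ) :=
        (stronglyMeasurable_const.inner (Lp.stronglyMeasurable V)).comp_measurable measurable_snd
      have h3 := h2.measurable
      refine StronglyMeasurable.integral_prod_right' (f := fun p : EuclideanSpace ℝ (Fin N) × Ω =>
        ((inner ℝ (h j) (V p.2) : ℝ) : ℂ) *
        Complex.exp (↑(2 * Real.pi * inner ℝ p.1 (x p.2)) * Complex.I)) ?_
      exact Measurable.stronglyMeasurable (by fun_prop)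
    refine (𝓕 (D j)).integrable.mul_bdd
      (c := ∫ ω, ‖(inner ℝ (h j) (V ω) : ℝ)‖ ∂P) hm.aestronglyMeasurable (ae_of_all _ fun ξ => ?_)
    refine norm_integral_le_of_norm_le (hVi (h j)).norm (ae_of_all _ fun ω => ?_)
    rw [norm_mul, Complex.norm_exp_ofReal_mul_I, mul_one, Complex.norm_real]

theorem measurable_pi (hW : IsIsonormal K P W) {N : ℕ} (h : Fin N → K.H) :
    Measurable fun ω (i : Fin N) => W (h i) ω :=
  measurable_pi_lambda _ fun _ => hW.measurable _

/-- A function of polynomial growth of finitely many noise variables is square integrable. -/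
theorem memLp_of_growth (hW : IsIsonormal K P W) {N : ℕ} (h : Fin N → K.H)
    {G : (Fin N → ℝ) → ℝ} (hG : Continuous G) {k : ℕ} {C : ℝ}
    (hk : ∀ x, ‖G x‖ ≤ C * (1 + ‖x‖) ^ k) : MemLp (fun ω => G fun i => W (h i) ω) 2 P := by
  have hS : MemLp (fun ω => 1 + ∑ i, ‖W (h i) ω‖) (2 * k) P := by
    have hq : (2 * k : ℝ≥0∞) ≠ ∞ := ENNReal.mul_ne_top (by simp) (by simp)
    have h1 : MemLp (fun ω => ∑ i, ‖W (h i) ω‖) (2 * k) P :=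
      memLp_finsetSum Finset.univ (f := fun i ω => ‖W (h i) ω‖) fun i _ =>
        (hW.memLp_top (h i) hq).norm
    exact (memLp_const (1 : ℝ)).add h1
  have hSk : MemLp (fun ω => ‖1 + ∑ i, ‖W (h i) ω‖‖ ^ k) 2 P := by
    rcases Nat.eq_zero_or_pos k with rfl | hk0
    · simpa using memLp_const (1 : ℝ)
    · have h1 := hS.norm_rpow_div k
      have e : (2 : ℝ≥0∞) * k / k = 2 := by
        rw [ENNReal.mul_div_cancel_right (by simpa using hk0.ne') (by simp)]
      rw [e] at h1
      simpa using h1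
  refine MemLp.of_le (hSk.const_mul C)
    (hG.measurable.comp (hW.measurable_pi h)).aestronglyMeasurable (ae_of_all _ fun ω => ?_)
  have hC : 0 ≤ C := by
    have := (norm_nonneg _).trans (hk 0)
    simpa using this
  refine (hk _).trans ?_
  rw [norm_mul, Real.norm_of_nonneg hC, norm_pow, norm_norm, Real.norm_eq_abs (1 + _),
    abs_of_nonneg (by positivity)]
  gcongr
  refine (pi_norm_le_iff_of_nonneg (by positivity)).2 fun i => ?_
  exact Finset.single_le_sum (f := fun i => ‖W (h i) ω‖) (fun i _ => norm_nonneg _)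
    (Finset.mem_univ i)

theorem memLp_pow (hW : IsIsonormal K P W) (h : K.H) (k : ℕ) :
    MemLp (fun ω => W h ω ^ k) 2 P :=
  hW.memLp_of_growth (N := 1) (fun _ => h) (G := fun x => x 0 ^ k) (k := k) (C := 1)
    (by fun_prop) fun x => by
      rw [norm_pow, one_mul]
      have := norm_le_pi_norm x 0
      gcongr
      linarith

/-- Gaussian integration by parts for smooth compactly supported functions of the noise. -/
theorem integral_compactSupport (hW : IsIsonormal K P W) {Z : Ω → ℝ} (hZ : MemLp Z 2 P)
    (V : Lp K.H 2 P)
    (hcos : ∀ (h : K.H) (a : ℝ), ∫ ω, Z ω * Real.cos (W h ω + a) ∂P =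
      ∫ ω, inner ℝ h (V ω) * Real.cos (W h ω + (a + Real.pi / 2)) ∂P)
    {N : ℕ} (h : Fin N → K.H) {F : (Fin N → ℝ) → ℝ} (hF : ContDiff ℝ (⊤ : ℕ∞) F)
    (hFs : HasCompactSupport F) :
    ∫ ω, Z ω * F (fun i => W (h i) ω) ∂P =
      ∑ j, ∫ ω, inner ℝ (h j) (V ω) * fderiv ℝ F (fun i => W (h i) ω) (Pi.single j 1) ∂P := by
  set e := EuclideanSpace.equiv (Fin N) ℝ with he
  have hg2 : ContDiff ℝ (⊤ : ℕ∞) fun x => ((F (e x) : ℝ) : ℂ) :=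
    Complex.ofRealCLM.contDiff.comp (hF.comp e.contDiff)
  have hg1 : HasCompactSupport fun x => ((F (e x) : ℝ) : ℂ) :=
    (hFs.comp_homeomorph e.toHomeomorph).comp_left (g := fun r : ℝ => (r : ℂ)) rfl
  have hd : ∀ x v, fderiv ℝ (fun x => ((F (e x) : ℝ) : ℂ)) x v = (fderiv ℝ F (e x) (e v) : ℝ) := by
    intro x v
    have h1 : HasFDerivAt F (fderiv ℝ F (e x)) (e x) :=
      (hF.differentiable (by simp)).differentiableAt.hasFDerivAt
    have h2 := (Complex.ofRealCLM.hasFDerivAt.comp (e x) h1).comp x e.hasFDerivAt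
    have h3 : HasFDerivAt (fun x => ((F (e x) : ℝ) : ℂ)) _ x := h2
    rw [h3.fderiv]
    rfl
  have key := hW.integral_schwartz hZ V hcos h (hg1.toSchwartzMap hg2)
  have e1 : ∫ ω, (Z ω : ℂ) * (hg1.toSchwartzMap hg2) (WithLp.toLp 2 fun i => W (h i) ω) ∂P =
      (∫ ω, Z ω * F (fun i => W (h i) ω) ∂P : ℝ) := by
    rw [← integral_complex_ofReal]
    refine integral_congr_ae (ae_of_all _ fun ω => ?_)
    dsimp only
    rw [Complex.ofReal_mul]
    rfl
  have e2 : ∀ j, ∫ ω, ((inner ℝ (h j) (V ω) : ℝ) : ℂ) * (fderiv ℝ (hg1.toSchwartzMap hg2)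
      (WithLp.toLp 2 fun i => W (h i) ω) (EuclideanSpace.single j 1)) ∂P =
      (∫ ω, inner ℝ (h j) (V ω) * fderiv ℝ F (fun i => W (h i) ω) (Pi.single j 1) ∂P : ℝ) := by
    intro j
    rw [← integral_complex_ofReal]
    refine integral_congr_ae (ae_of_all _ fun ω => ?_)
    dsimp only
    rw [Complex.ofReal_mul]
    congr 1
    refine (hd _ _).trans ?_
    congr 2
  rw [e1, Finset.sum_congr rfl fun j _ => e2 j, ← Complex.ofReal_sum] at key
  exact Complex.ofReal_injective key

/-- Gaussian integration by parts for smooth functions of polynomial growth, by cutting off. -/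
theorem integral_temperate (hW : IsIsonormal K P W) {Z : Ω → ℝ} (hZ : MemLp Z 2 P)
    (V : Lp K.H 2 P)
    (hcos : ∀ (h : K.H) (a : ℝ), ∫ ω, Z ω * Real.cos (W h ω + a) ∂P =
      ∫ ω, inner ℝ h (V ω) * Real.cos (W h ω + (a + Real.pi / 2)) ∂P)
    {N : ℕ} (h : Fin N → K.H) {F : (Fin N → ℝ) → ℝ} (hF : F.HasTemperateGrowth) :
    (∫ ω, Z ω * F (fun i => W (h i) ω) ∂P =
      ∑ j, ∫ ω, inner ℝ (h j) (V ω) * fderiv ℝ F (fun i => W (h i) ω) (Pi.single j 1) ∂P) ∧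
    ∀ j, Integrable (fun ω => inner ℝ (h j) (V ω) *
      fderiv ℝ F (fun i => W (h i) ω) (Pi.single j 1)) P := by
  obtain ⟨k0, C0, hC0⟩ := hF.2 0
  obtain ⟨k1, C1, hC1⟩ := hF.2 1
  simp only [norm_iteratedFDeriv_zero] at hC0
  simp only [norm_iteratedFDeriv_one] at hC1
  have hFc := hF.1.continuous
  have hFd : Differentiable ℝ F := hF.1.differentiable (by simp)
  have hF'c : Continuous (fderiv ℝ F) := hF.1.continuous_fderiv (by simp)
  have hpj : ∀ j : Fin N, ‖(Pi.single j (1 : ℝ) : Fin N → ℝ)‖ ≤ 1 := fun j => by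
    rw [Pi.norm_single, norm_one]
  have hL0 := hW.memLp_of_growth h hFc hC0
  have hL1 : ∀ j, MemLp (fun ω => fderiv ℝ F (fun i => W (h i) ω) (Pi.single j 1)) 2 P := fun j =>
    hW.memLp_of_growth h (G := fun x => fderiv ℝ F x (Pi.single j 1)) (by fun_prop) fun x =>
      ((fderiv ℝ F x).le_of_opNorm_le_of_le (hC1 x) (hpj j)).trans_eq (mul_one _)
  refine ⟨?_, fun j => (memLp_inner_Lp V (h j)).integrable_mul (hL1 j)⟩
  -- The cut-offs `χ(x / (n + 1))` tend to one, and their gradients are bounded by `D / (n + 1)`.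
  let χ : ContDiffBump (0 : Fin N → ℝ) := ⟨1, 2, one_pos, one_lt_two⟩
  have hχd : Differentiable ℝ χ := χ.contDiff.differentiable (n := (⊤ : ℕ∞)) (by simp)
  have hχ'c : Continuous (fderiv ℝ χ) := (χ.contDiff (n := (⊤ : ℕ∞))).continuous_fderiv (by simp)
  obtain ⟨D, hD⟩ := hχ'c.bounded_above_of_compact_support (χ.hasCompactSupport.fderiv ℝ)
  set c : ℕ → ℝ := fun n => ((n : ℝ) + 1)⁻¹ with hc
  have hc0 : ∀ n, 0 < c n := fun n => by positivity
  have hc1 : ∀ n, c n ≤ 1 := fun n => inv_le_one_of_one_le₀ (by simp)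
  have hct : Tendsto c atTop (𝓝 0) := tendsto_inv_atTop_zero.comp
    (tendsto_atTop_add_const_right _ _ tendsto_natCast_atTop_atTop)
  have hFn : ∀ n x, HasFDerivAt (fun x => χ (c n • x) * F x)
      (χ (c n • x) • fderiv ℝ F x + F x • c n • fderiv ℝ χ (c n • x)) x := by
    intro n x
    have h1 : HasFDerivAt (fun x : Fin N → ℝ => c n • x)
        (c n • ContinuousLinearMap.id ℝ (Fin N → ℝ)) x := (hasFDerivAt_id x).const_smul (c n)
    have h2 := (hχd (c n • x)).hasFDerivAt.comp x h1
    have h3 := h2.mul (hFd x).hasFDerivAt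
    refine h3.congr_fderiv ?_
    ext v
    simp
  have hcut : ∀ n, ∫ ω, Z ω * (χ (c n • fun i => W (h i) ω) * F (fun i => W (h i) ω)) ∂P =
      ∑ j, ∫ ω, inner ℝ (h j) (V ω) * (χ (c n • fun i => W (h i) ω) *
        fderiv ℝ F (fun i => W (h i) ω) (Pi.single j 1) +
        F (fun i => W (h i) ω) *
          (c n * fderiv ℝ χ (c n • fun i => W (h i) ω) (Pi.single j 1))) ∂P := by
    intro n
    have hsm : ContDiff ℝ (⊤ : ℕ∞) fun x => χ (c n • x) * F x :=
      (χ.contDiff.comp (contDiff_const_smul (c n))).mul hF.1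
    have hcs : HasCompactSupport fun x => χ (c n • x) * F x :=
      (χ.hasCompactSupport.comp_smul (hc0 n).ne').mul_right
    have := hW.integral_compactSupport hZ V hcos h hsm hcs
    simpa only [(hFn n _).fderiv, _root_.add_apply, _root_.smul_apply, smul_eq_mul] using this
  have hχ1 : ∀ n x, |χ (c n • x)| ≤ 1 := fun n x => by
    rw [abs_of_nonneg χ.nonneg]; exact χ.le_one
  have hlimc : ∀ x : Fin N → ℝ, Tendsto (fun n => c n • x) atTop (𝓝 0) := fun x => by
    simpa using hct.smul_const x
  have hlim1 : ∀ x, Tendsto (fun n => χ (c n • x)) atTop (𝓝 1) := fun x => by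
    have h1 := (hχd.continuous.tendsto 0).comp (hlimc x)
    have h2 : χ 0 = 1 := χ.one_of_mem_closedBall (by simp [χ])
    rw [h2] at h1
    exact h1
  have hmW := hW.measurable_pi h
  have hmχ : ∀ n, Measurable fun ω => χ (c n • fun i => W (h i) ω) := fun n =>
    hχd.continuous.measurable.comp (hmW.const_smul (c n))
  have L := tendsto_integral_of_dominated_convergence (μ := P)
    (F := fun n ω => Z ω * (χ (c n • fun i => W (h i) ω) * F (fun i => W (h i) ω)))
    (f := fun ω => Z ω * F (fun i => W (h i) ω))
    (fun ω => ‖Z ω * F (fun i => W (h i) ω)‖)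
    (fun n => hZ.1.mul ((hmχ n).mul (hFc.measurable.comp hmW)).aestronglyMeasurable)
    (hZ.integrable_mul hL0).norm
    (fun n => ae_of_all _ fun ω => by
      rw [mul_left_comm, norm_mul]
      exact mul_le_of_le_one_left (norm_nonneg _) (hχ1 n _))
    (ae_of_all _ fun ω => by
      have := ((hlim1 fun i => W (h i) ω).mul_const (F fun i => W (h i) ω)).const_mul (Z ω)
      simpa using this)
  have R : Tendsto (fun n => ∑ j, ∫ ω, inner ℝ (h j) (V ω) * (χ (c n • fun i => W (h i) ω) *
        fderiv ℝ F (fun i => W (h i) ω) (Pi.single j 1) +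
        F (fun i => W (h i) ω) * (c n * fderiv ℝ χ (c n • fun i => W (h i) ω) (Pi.single j 1))) ∂P)
      atTop (𝓝 (∑ j, ∫ ω, inner ℝ (h j) (V ω) *
        fderiv ℝ F (fun i => W (h i) ω) (Pi.single j 1) ∂P)) := by
    refine tendsto_finsetSum _ fun j _ => ?_
    have hD1 : ∀ x, |fderiv ℝ χ x (Pi.single j 1)| ≤ D := fun x =>
      ((fderiv ℝ χ x).le_of_opNorm_le_of_le (hD x) (hpj j)).trans_eq (mul_one _)
    refine tendsto_integral_of_dominated_convergence
      (fun ω => ‖inner ℝ (h j) (V ω) * fderiv ℝ F (fun i => W (h i) ω) (Pi.single j 1)‖ +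
        D * ‖inner ℝ (h j) (V ω) * F (fun i => W (h i) ω)‖) (fun n => ?_) ?_ (fun n => ?_) ?_
    · refine (memLp_inner_Lp V (h j)).1.mul (Measurable.aestronglyMeasurable ?_)
      have m1 : Measurable fun ω => fderiv ℝ F (fun i => W (h i) ω) (Pi.single j 1) :=
        (show Continuous fun x => fderiv ℝ F x (Pi.single j 1) by fun_prop).measurable.comp hmW
      have m2 : Measurable fun ω => fderiv ℝ χ (c n • fun i => W (h i) ω) (Pi.single j 1) :=
        (show Continuous fun x => fderiv ℝ χ (c n • x) (Pi.single j 1) by fun_prop).measurable.comp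
          hmW
      exact ((hmχ n).mul m1).add ((hFc.measurable.comp hmW).mul (m2.const_mul _))
    · exact ((memLp_inner_Lp V (h j)).integrable_mul (hL1 j)).norm.add
        (((memLp_inner_Lp V (h j)).integrable_mul hL0).norm.const_mul D)
    · refine ae_of_all _ fun ω => ?_
      rw [mul_add]
      refine (norm_add_le _ _).trans (add_le_add ?_ ?_)
      · rw [mul_left_comm, norm_mul]
        exact mul_le_of_le_one_left (norm_nonneg _) (hχ1 n _)
      · rw [← mul_assoc, norm_mul, mul_comm]
        refine mul_le_mul_of_nonneg_right ?_ (norm_nonneg _)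
        rw [norm_mul, Real.norm_of_nonneg (hc0 n).le]
        exact (mul_le_of_le_one_left (norm_nonneg _) (hc1 n)).trans (hD1 _)
    · refine ae_of_all _ fun ω => ?_
      have t1 := (hlim1 fun i => W (h i) ω).mul_const
        (fderiv ℝ F (fun i => W (h i) ω) (Pi.single j 1))
      have t2 : Tendsto (fun n => fderiv ℝ χ (c n • fun i => W (h i) ω) (Pi.single j 1)) atTop
          (𝓝 (fderiv ℝ χ 0 (Pi.single j 1))) :=
        ((show Continuous fun x => fderiv ℝ χ x (Pi.single j 1) by fun_prop).tendsto 0).comp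
          (hlimc _)
      have t3 := (t1.add ((hct.mul t2).const_mul (F fun i => W (h i) ω))).const_mul
        (inner ℝ (h j) (V ω))
      simpa using t3
  exact tendsto_nhds_unique L (R.congr fun n => (hcut n).symm)

/-- A pair `(V, Z)` which satisfies the divergence identity against `cos(W(h) + a)` for all test
functions `h` satisfies it on the whole domain of the Malliavin derivative. -/
theorem isDivergence_of_cos (hW : IsIsonormal K P W) {Z : Ω → ℝ} (hZ : MemLp Z 2 P)
    (V : Lp K.H 2 P)
    (hcos : ∀ (φ : 𝓓(openQuadrant, ℝ)) (a : ℝ), ∫ ω, Z ω * Real.cos (W (K.toH φ) ω + a) ∂P =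
      ∫ ω, inner ℝ (K.toH φ) (V ω) * Real.cos (W (K.toH φ) ω + (a + Real.pi / 2)) ∂P) :
    IsDivergence K P W V Z := by
  refine ⟨hZ, fun XU hXU => ?_⟩
  have hcl : IsClosed {XU : Lp ℝ 2 P × Lp K.H 2 P |
      (inner ℝ (hZ.toLp Z) XU.1 : ℝ) = inner ℝ XU.2 V} :=
    isClosed_eq (by fun_prop) (by fun_prop)
  have hsub : smoothMalliavinGraph K P W ⊆
      {XU : Lp ℝ 2 P × Lp K.H 2 P | (inner ℝ (hZ.toLp Z) XU.1 : ℝ) = inner ℝ XU.2 V} := by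
    rintro ⟨X, U⟩ ⟨N, F, h, hF, hX, hU⟩
    obtain ⟨k1, k2⟩ := hW.integral_temperate hZ V (hW.integral_cos_of_test hZ V hcos) h hF
    simp only [mem_ofPred_eq]
    rw [Lp_inner_eq, L2.inner_def]
    have e1 : ∫ ω, (hZ.toLp Z) ω * X ω ∂P = ∫ ω, Z ω * F (fun i => W (h i) ω) ∂P :=
      integral_congr_ae (by filter_upwards [hZ.coeFn_toLp, hX] with ω h1 h2; rw [h1, h2])
    rw [e1, k1, ← integral_finsetSum _ fun j _ => k2 j]
    refine integral_congr_ae ?_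
    filter_upwards [hU] with ω h1
    rw [h1, sum_inner]
    refine Finset.sum_congr rfl fun j _ => ?_
    rw [real_inner_smul_left]
    ring
  have hmem := closure_minimal hsub hcl hXU
  simp only [mem_ofPred_eq] at hmem
  rw [Lp_inner_eq, L2.inner_def] at hmem
  rw [← hmem]
  exact integral_congr_ae (by filter_upwards [hZ.coeFn_toLp] with ω h1; rw [h1])

end IsIsonormal

end Divergence

/-! ### The Duhamel kernel as an element of `H` -/

/-- The space-time energy as a time integral of spatial energies. -/
theorem energy_tensorKernel {f γ : ℝ → ℝ} (hf : IsCovarianceKernel f) (hγ : LocallyIntegrable γ)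
    {a b : ℝ × ℝ → ℝ≥0∞} (ha : Measurable a) (hb : Measurable b) :
    energy (tensorKernel f γ) a b = ∫⁻ r : ℝ × ℝ, ENNReal.ofReal (γ (r.1 - r.2)) *
      energy f (fun w => a (w, r.1)) (fun w => b (w, r.2)) := by
  have h1 : energy (tensorKernel f γ) a b = ∫⁻ p : (ℝ × ℝ) × (ℝ × ℝ),
      ENNReal.ofReal (γ (p.2.1 - p.2.2)) * (ENNReal.ofReal (f (p.1.1 - p.1.2)) *
        a (p.1.1, p.2.1) * b (p.1.2, p.2.2)) := by
    unfold energy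
    rw [← measurePreserving_middleSwap.lintegral_comp_emb middleSwap.measurableEmbedding]
    refine lintegral_congr fun p => ?_
    simp only [middleSwap_apply, tensorKernel, Prod.fst_sub, Prod.snd_sub]
    rw [ENNReal.ofReal_mul (hf.nonneg _)]
    ring
  have hγm := aemeasurable_ofReal_comp_sub hγ
  have hfm := aemeasurable_ofReal_comp_sub hf.locallyIntegrable
  rw [h1, Measure.volume_eq_prod, lintegral_prod_symm]
  · refine lintegral_congr fun r => ?_
    simp only [mul_assoc]
    rw [lintegral_const_mul' _ _ ENNReal.ofReal_ne_top]
    simp only [energy, mul_assoc]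
  · have m1 : AEMeasurable (fun p : (ℝ × ℝ) × (ℝ × ℝ) => ENNReal.ofReal (γ (p.2.1 - p.2.2)))
        (volume.prod volume) := hγm.comp_quasiMeasurePreserving Measure.quasiMeasurePreserving_snd
    have m2 : AEMeasurable (fun p : (ℝ × ℝ) × (ℝ × ℝ) => ENNReal.ofReal (f (p.1.1 - p.1.2)))
        (volume.prod volume) := hfm.comp_quasiMeasurePreserving Measure.quasiMeasurePreserving_fst
    have m3 : Measurable fun p : (ℝ × ℝ) × (ℝ × ℝ) => a (p.1.1, p.2.1) := ha.comp (by fun_prop)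
    have m4 : Measurable fun p : (ℝ × ℝ) × (ℝ × ℝ) => b (p.1.2, p.2.2) := hb.comp (by fun_prop)
    exact m1.mul ((m2.mul m3.aemeasurable).mul m4.aemeasurable)

/-- The Duhamel kernel has finite energy, so that it defines an element of `H`. -/
theorem energy_duhamel_lt_top {f γ : ℝ → ℝ} (hf : IsCovarianceKernel f)
    (hγ : IsCovarianceKernel γ) (hanti : AntitoneOn f (Ioi 0)) {z t : ℝ} (hz : 0 < z)
    (ht : 0 < t) :
    energy (tensorKernel f γ) (fun p => ENNReal.ofReal (duhamel z t p))
      (fun p => ENNReal.ofReal (duhamel z t p)) < ∞ := by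
  have mq : Measurable fun p : ℝ × ℝ => ENNReal.ofReal (duhamel z t p) :=
    (duhamel_measurable' z t).ennreal_ofReal
  have mq' : ∀ τ, Measurable fun w => ENNReal.ofReal (duhamel z t (w, τ)) := fun τ =>
    mq.comp (f := fun w => (w, τ)) (by fun_prop)
  set e : ℝ → ℝ≥0∞ := fun τ => energy f (fun w => ENNReal.ofReal (duhamel z t (w, τ)))
    (fun w => ENNReal.ofReal (duhamel z t (w, τ))) with he
  have mqs : Measurable fun q : ℝ × ℝ => ENNReal.ofReal (duhamel z t (q.2, q.1)) :=
    mq.comp measurable_swap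
  have me : Measurable e := energy_measurable (X := ℝ) hf.locallyIntegrable
    (a := fun τ w => ENNReal.ofReal (duhamel z t (w, τ)))
    (b := fun τ w => ENNReal.ofReal (duhamel z t (w, τ))) mqs mqs
  have e0 : ∀ τ, τ ∉ Ioo 0 t → e τ = 0 := fun τ hτ => by
    simp [he, energy, duhamel_eq_zero (z := z) (t := t) (p := (_, τ)) fun h => hτ h.2]
  set φ : ℝ → ℝ≥0∞ := (Ioo (-t) t).indicator fun x => ENNReal.ofReal (γ x) with hφ
  have hφm : AEMeasurable φ :=
    (hγ.locallyIntegrable.aestronglyMeasurable.aemeasurable.ennreal_ofReal).indicator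
      measurableSet_Ioo
  have h2 : ∀ x : ℝ≥0∞, (x ^ (1 / 2 : ℝ)) ^ 2 = x := fun x => by
    rw [← ENNReal.rpow_natCast, ← ENNReal.rpow_mul]; norm_num
  -- The Cauchy–Schwarz inequality in space and the Young inequality in time.
  have hle : energy (tensorKernel f γ) (fun p => ENNReal.ofReal (duhamel z t p))
      (fun p => ENNReal.ofReal (duhamel z t p)) ≤
      ENNReal.ofReal (symmIntegral γ t) * ∫⁻ τ, e τ := by
    rw [energy_tensorKernel hf hγ.locallyIntegrable mq mq]
    calc ∫⁻ r : ℝ × ℝ, ENNReal.ofReal (γ (r.1 - r.2)) *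
          energy f (fun w => ENNReal.ofReal (duhamel z t (w, r.1)))
            (fun w => ENNReal.ofReal (duhamel z t (w, r.2)))
        ≤ ∫⁻ r : ℝ × ℝ, φ (r.1 - r.2) * e r.1 ^ (1 / 2 : ℝ) * e r.2 ^ (1 / 2 : ℝ) := by
          refine lintegral_mono fun r => ?_
          have hcs := energy_le_sqrt hf.isPDKernel (mq' r.1) (mq' r.2)
          change _ ≤ e r.1 ^ (1 / 2 : ℝ) * e r.2 ^ (1 / 2 : ℝ) at hcs
          by_cases h1 : r.1 ∈ Ioo 0 t
          · by_cases h3 : r.2 ∈ Ioo 0 t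
            · have h4 : r.1 - r.2 ∈ Ioo (-t) t :=
                ⟨by linarith [h1.1, h3.2], by linarith [h1.2, h3.1]⟩
              simp only [hφ, indicator_of_mem h4]
              rw [mul_assoc]
              gcongr
            · rw [e0 _ h3, ENNReal.zero_rpow_of_pos (by norm_num), mul_zero] at hcs
              rw [le_zero_iff.1 hcs, mul_zero]
              exact zero_le
          · rw [e0 _ h1, ENNReal.zero_rpow_of_pos (by norm_num), zero_mul] at hcs
            rw [le_zero_iff.1 hcs, mul_zero]
            exact zero_le
      _ ≤ (∫⁻ x, φ x) * (((∫⁻ x, (e x ^ (1 / 2 : ℝ)) ^ 2) + ∫⁻ x, (e x ^ (1 / 2 : ℝ)) ^ 2) / 2) :=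
          lintegral_young hφm (me.pow_const _) (me.pow_const _)
      _ = ENNReal.ofReal (symmIntegral γ t) * ∫⁻ τ, e τ := by
          simp only [h2]
          rw [ENNReal.add_div, ENNReal.add_halves, hφ, lintegral_indicator measurableSet_Ioo,
            lintegral_symmIntegral hγ ht.le]
  -- The split at distance `ε = 1` into a near and a far part.
  have hE : ∫⁻ τ, e τ ≤ ENNReal.ofReal (symmIntegral f 1) * ENNReal.ofReal (kimuraU (z / t)) +
      ENNReal.ofReal (f 1) * ENNReal.ofReal t := by
    have h : ∀ τ, e τ ≤ ENNReal.ofReal (symmIntegral f 1) *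
        (∫⁻ w, ENNReal.ofReal (duhamel z t (w, τ)) ^ 2) +
        ENNReal.ofReal (f 1) * (Ioo 0 t).indicator 1 τ := fun τ => by
      refine (energy_le_near_far hf hanti one_pos (mq' τ) (mq' τ)).trans ?_
      rw [ENNReal.add_div, ENNReal.add_halves]
      gcongr
      refine (mul_le_mul' (lintegral_duhamel_le hz τ) (lintegral_duhamel_le hz τ)).trans ?_
      by_cases hτ : τ ∈ Ioo 0 t <;> simp [hτ]
    refine (lintegral_mono h).trans ?_
    have m1 : Measurable fun τ => ∫⁻ w, ENNReal.ofReal (duhamel z t (w, τ)) ^ 2 :=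
      (mqs.pow_const 2).lintegral_prod_right'
    rw [lintegral_add_left (m1.const_mul _), lintegral_const_mul' _ _ ENNReal.ofReal_ne_top,
      lintegral_const_mul' _ _ ENNReal.ofReal_ne_top, lintegral_indicator_one measurableSet_Ioo,
      Real.volume_Ioo, sub_zero]
    gcongr
    exact lintegral_duhamel_sq_le hz ht
  refine hle.trans_lt (ENNReal.mul_lt_top ENNReal.ofReal_lt_top (hE.trans_lt ?_))
  exact ENNReal.add_lt_top.2 ⟨ENNReal.mul_lt_top ENNReal.ofReal_lt_top ENNReal.ofReal_lt_top,
    ENNReal.mul_lt_top ENNReal.ofReal_lt_top ENNReal.ofReal_lt_top⟩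

theorem integrable_duhamel_mul_potential {f γ : ℝ → ℝ} (hf : IsCovarianceKernel f)
    (hγ : IsCovarianceKernel γ) (hanti : AntitoneOn f (Ioi 0)) {z t : ℝ} (hz : 0 < z)
    (ht : 0 < t) {h : ℝ × ℝ → ℝ} (hc : Continuous h) (hs : HasCompactSupport h) :
    Integrable fun p => duhamel z t p * potential f γ h p := by
  have hk := isPDKernel_tensorKernel hf hγ
  have h1 : Integrable fun p : (ℝ × ℝ) × (ℝ × ℝ) =>
      tensorKernel f γ (p.1 - p.2) * duhamel z t p.1 * duhamel z t p.2 := by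
    rw [bilin_integrable_iff hk (duhamel_measurable' z t) (duhamel_measurable' z t)]
    simp only [Real.enorm_of_nonneg (duhamel_nonneg _ _ _)]
    exact energy_duhamel_lt_top hf hγ hanti hz ht
  exact integrable_mul_kernel_integral (bilin_integrable_cross hk (duhamel_measurable' z t)
    hc.measurable h1 (bilin_integrable_of_continuous hk.locallyIntegrable hc hs hc hs))

/-! ### Random fields as random elements of `H` -/

section Field

variable {Ω : Type*} [MeasurableSpace Ω] {P : Measure Ω} [IsProbabilityMeasure P]
  {K : NoiseKernel} {W : K.H → Ω → ℝ}

/-- The covariance kernel of the noise on `ℝ²`. -/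
noncomputable abbrev NoiseKernel.kernel (K : NoiseKernel) : ℝ × ℝ → ℝ := tensorKernel K.f K.γ

theorem NoiseKernel.isPDKernel (K : NoiseKernel) : IsPDKernel K.kernel :=
  isPDKernel_tensorKernel K.hf K.hγ

theorem covForm_eq_bilin {f γ : ℝ → ℝ} {g h : ℝ × ℝ → ℝ} (hg : ∀ p ∉ quadrant, g p = 0)
    (hh : ∀ p ∉ quadrant, h p = 0) : covForm f γ g h = bilin (tensorKernel f γ) g h := by
  rw [integral_tensorKernel]
  unfold covForm
  refine setIntegral_eq_integral_of_forall_compl_eq_zero fun p hp => ?_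
  by_cases h1 : (p.1.1, p.2.1) ∈ quadrant
  · have h2 : (p.1.2, p.2.2) ∉ quadrant := fun h2 => hp ⟨⟨h1.1, h2.1⟩, ⟨h1.2, h2.2⟩⟩
    rw [hh _ h2, mul_zero]
  · rw [hg _ h1, mul_zero, zero_mul]

/-- The element of `H` defined by a function of finite energy. -/
theorem exists_element {g : ℝ × ℝ → ℝ} (hg : Measurable g)
    (hfin : energy K.kernel (fun p => ‖g p‖ₑ) (fun p => ‖g p‖ₑ) < ∞) :
    ∃ V : K.H, (∀ φ : 𝓓(openQuadrant, ℝ), inner ℝ V (K.toH φ) = bilin K.kernel g φ) ∧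
      ‖V‖ ^ 2 ≤ (energy K.kernel (fun p => ‖g p‖ₑ) (fun p => ‖g p‖ₑ)).toReal := by
  have hgg := (bilin_integrable_iff K.isPDKernel hg hg).2 hfin
  have hgφ : ∀ φ : 𝓓(openQuadrant, ℝ), Integrable fun p : (ℝ × ℝ) × (ℝ × ℝ) =>
      K.kernel (p.1 - p.2) * g p.1 * φ p.2 := fun φ =>
    bilin_integrable_cross K.isPDKernel hg φ.continuous.measurable hgg
      (K.bilin_test_integrable φ φ)
  have hle : bilin K.kernel g g ≤ (energy K.kernel (fun p => ‖g p‖ₑ) (fun p => ‖g p‖ₑ)).toReal := by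
    rw [energy_eq_lintegral_enorm K.isPDKernel, ← integral_norm_eq_lintegral_enorm hgg.1]
    refine (le_abs_self _).trans ?_
    rw [← Real.norm_eq_abs]
    exact norm_integral_le_integral_norm _
  obtain ⟨V, h1, h2⟩ := exists_inner_eq_of_sq_le (E := K.H) K.toH (fun φ => bilin K.kernel g φ)
    (bilin_nonneg K.isPDKernel hg hgg) fun c => by
      have e1 : (c.sum fun a r => r * bilin K.kernel g a) =
          bilin K.kernel g fun p => ∑ i : c.support, c i * (i : 𝓓(openQuadrant, ℝ)) p := by
        unfold bilin Finsupp.sum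
        rw [← Finset.sum_coe_sort]
        simp only [Finset.mul_sum]
        rw [integral_finsetSum]
        · refine Finset.sum_congr rfl fun i _ => ?_
          rw [← integral_const_mul]
          exact integral_congr_ae (ae_of_all _ fun p => by dsimp only; ring)
        · intro i _
          refine ((hgφ i).const_mul (c i)).congr (ae_of_all _ fun p => ?_)
          dsimp only
          ring
      have e2 : ‖c.sum fun a r => r • K.toH a‖ ^ 2 = bilin K.kernel
          (fun p => ∑ i : c.support, c i * (i : 𝓓(openQuadrant, ℝ)) p)
          (fun p => ∑ i : c.support, c i * (i : 𝓓(openQuadrant, ℝ)) p) := by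
        rw [bilin_linComb (G := fun (i : c.support) => ((i : 𝓓(openQuadrant, ℝ)) : ℝ × ℝ → ℝ))
          (fun i j => K.bilin_test_integrable _ _), ← real_inner_self_eq_norm_sq, Finsupp.sum,
          ← Finset.sum_coe_sort, sum_inner]
        refine Finset.sum_congr rfl fun i _ => ?_
        rw [inner_sum]
        refine Finset.sum_congr rfl fun j _ => ?_
        rw [real_inner_smul_left, real_inner_smul_right, K.inner_toH_eq_bilin]
        ring
      rw [e1, e2]
      refine bilin_sq_le K.isPDKernel hg ?_ hgg ?_
      · exact (continuous_linComb (fun i : c.support => (i : 𝓓(openQuadrant, ℝ)).continuous)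
          _).measurable
      · exact bilin_linComb_integrable
          (G := fun (i : c.support) => ((i : 𝓓(openQuadrant, ℝ)) : ℝ × ℝ → ℝ))
          (fun i j => K.bilin_test_integrable _ _) _
  exact ⟨V, h1, h2.trans hle⟩

theorem aestronglyMeasurable_covariance (K : NoiseKernel) :
    AEStronglyMeasurable (fun p : (ℝ × ℝ) × (ℝ × ℝ) => K.f (p.1.1 - p.1.2) * K.γ (p.2.1 - p.2.2))
      volume := by
  have h1 := aestronglyMeasurable_comp_sub K.hf.locallyIntegrable
  have h2 := aestronglyMeasurable_comp_sub K.hγ.locallyIntegrable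
  exact (h1.comp_quasiMeasurePreserving Measure.quasiMeasurePreserving_fst).mul
    (h2.comp_quasiMeasurePreserving Measure.quasiMeasurePreserving_snd)

/-- For a field supported in the quadrant, square integrability in the sense of `IsFieldElement`
is finiteness of the expected energy. -/
theorem field_integrable_iff {g : ℝ × ℝ → Ω → ℝ}
    (hg : Measurable fun q : (ℝ × ℝ) × Ω => g q.1 q.2) (h0 : ∀ p ∉ quadrant, ∀ ω, g p ω = 0) :
    Integrable (fun p : ((ℝ × ℝ) × (ℝ × ℝ)) × Ω =>
      K.f (p.1.1.1 - p.1.1.2) * K.γ (p.1.2.1 - p.1.2.2) * g (p.1.1.1, p.1.2.1) p.2 *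
        g (p.1.1.2, p.1.2.2) p.2)
      ((volume.restrict (quadrant ×ˢ quadrant)).prod P) ↔
    ∫⁻ ω, energy K.kernel (fun p => ‖g p ω‖ₑ) (fun p => ‖g p ω‖ₑ) ∂P < ∞ := by
  have hm : AEStronglyMeasurable (fun p : ((ℝ × ℝ) × (ℝ × ℝ)) × Ω =>
      K.f (p.1.1.1 - p.1.1.2) * K.γ (p.1.2.1 - p.1.2.2) * g (p.1.1.1, p.1.2.1) p.2 *
        g (p.1.1.2, p.1.2.2) p.2) (volume.prod P) := by
    have h1 := (aestronglyMeasurable_covariance K).comp_quasiMeasurePreserving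
      (Measure.quasiMeasurePreserving_fst (μ := (volume : Measure ((ℝ × ℝ) × (ℝ × ℝ)))) (ν := P))
    have h2 : Measurable fun p : ((ℝ × ℝ) × (ℝ × ℝ)) × Ω => g (p.1.1.1, p.1.2.1) p.2 :=
      hg.comp (f := fun p : ((ℝ × ℝ) × (ℝ × ℝ)) × Ω => ((p.1.1.1, p.1.2.1), p.2)) (by fun_prop)
    have h3 : Measurable fun p : ((ℝ × ℝ) × (ℝ × ℝ)) × Ω => g (p.1.1.2, p.1.2.2) p.2 :=
      hg.comp (f := fun p : ((ℝ × ℝ) × (ℝ × ℝ)) × Ω => ((p.1.1.2, p.1.2.2), p.2)) (by fun_prop)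
    exact (h1.mul h2.aestronglyMeasurable).mul h3.aestronglyMeasurable
  have hqm : MeasurableSet (quadrant ×ˢ quadrant) :=
    (measurableSet_Ioi.prod measurableSet_Ioi).prod (measurableSet_Ioi.prod measurableSet_Ioi)
  have e : (volume.restrict (quadrant ×ˢ quadrant)).prod P =
      (volume.prod P).restrict ((quadrant ×ˢ quadrant) ×ˢ univ) :=
    Measure.restrict_prod_eq_prod_univ _
  have hsupp : (Function.support fun p : ((ℝ × ℝ) × (ℝ × ℝ)) × Ω =>
      K.f (p.1.1.1 - p.1.1.2) * K.γ (p.1.2.1 - p.1.2.2) * g (p.1.1.1, p.1.2.1) p.2 *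
        g (p.1.1.2, p.1.2.2) p.2) ⊆ (quadrant ×ˢ quadrant) ×ˢ univ := fun p hp => by
    have h1 : (p.1.1.1, p.1.2.1) ∈ quadrant := by
      by_contra h
      exact hp (by simp [h0 _ h])
    have h2 : (p.1.1.2, p.1.2.2) ∈ quadrant := by
      by_contra h
      exact hp (by simp [h0 _ h])
    exact ⟨⟨⟨h1.1, h2.1⟩, ⟨h1.2, h2.2⟩⟩, mem_univ _⟩
  rw [e]
  change IntegrableOn _ _ _ ↔ _
  rw [integrableOn_iff_integrable_of_support_subset hsupp]
  have key : ∫⁻ p, ‖K.f (p.1.1.1 - p.1.1.2) * K.γ (p.1.2.1 - p.1.2.2) * g (p.1.1.1, p.1.2.1) p.2 *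
        g (p.1.1.2, p.1.2.2) p.2‖ₑ ∂((volume : Measure ((ℝ × ℝ) × (ℝ × ℝ))).prod P) =
      ∫⁻ ω, energy K.kernel (fun p => ‖g p ω‖ₑ) (fun p => ‖g p ω‖ₑ) ∂P := by
    rw [lintegral_prod_symm _ hm.enorm]
    refine lintegral_congr fun ω => ?_
    rw [energy_eq_lintegral_enorm K.isPDKernel (fun p => g p ω),
      ← measurePreserving_middleSwap.lintegral_comp_emb middleSwap.measurableEmbedding]
    rfl
  rw [← key]
  exact ⟨fun h => h.2, fun h => ⟨hm, h⟩⟩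

/-- Random fields of finite expected energy are random elements of `H`. -/
theorem exists_isFieldElement {g : ℝ × ℝ → Ω → ℝ}
    (hg : Measurable fun q : (ℝ × ℝ) × Ω => g q.1 q.2) (h0 : ∀ p ∉ quadrant, ∀ ω, g p ω = 0)
    (hfin : ∫⁻ ω, energy K.kernel (fun p => ‖g p ω‖ₑ) (fun p => ‖g p ω‖ₑ) ∂P < ∞) :
    ∃ V : Lp K.H 2 P, IsFieldElement K P (fun w τ ω => g (w, τ) ω) V := by
  classical
  have hgω : ∀ ω, Measurable fun p => g p ω := fun ω =>
    hg.comp (f := fun p : ℝ × ℝ => (p, ω)) (by fun_prop)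
  have hg' : Measurable fun q : Ω × (ℝ × ℝ) => ‖g q.2 q.1‖ₑ := (hg.comp measurable_swap).enorm
  have hEm : Measurable fun ω => energy K.kernel (fun p => ‖g p ω‖ₑ) (fun p => ‖g p ω‖ₑ) :=
    energy_measurable K.isPDKernel.locallyIntegrable (a := fun ω p => ‖g p ω‖ₑ)
      (b := fun ω p => ‖g p ω‖ₑ) hg' hg'
  have hex : ∀ ω, ∃ V : K.H,
      (energy K.kernel (fun p => ‖g p ω‖ₑ) (fun p => ‖g p ω‖ₑ) < ∞ →
        ∀ φ : 𝓓(openQuadrant, ℝ), inner ℝ V (K.toH φ) = bilin K.kernel (fun p => g p ω) φ) ∧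
      (¬ energy K.kernel (fun p => ‖g p ω‖ₑ) (fun p => ‖g p ω‖ₑ) < ∞ → V = 0) ∧
      ‖V‖ ^ 2 ≤ (energy K.kernel (fun p => ‖g p ω‖ₑ) (fun p => ‖g p ω‖ₑ)).toReal := fun ω => by
    by_cases h : energy K.kernel (fun p => ‖g p ω‖ₑ) (fun p => ‖g p ω‖ₑ) < ∞
    · obtain ⟨V, h1, h2⟩ := exists_element (hgω ω) h
      exact ⟨V, fun _ => h1, fun h' => absurd h h', h2⟩
    · exact ⟨0, fun h' => absurd h' h, fun _ => rfl, by simp⟩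
  -- Weak measurability in `ω` of the elements given by the Riesz theorem is measurability of
  -- their inner products with test functions; it is strong by separability of `H`.
  choose V hV1 hV2 hV3 using hex
  have hbm : ∀ φ : 𝓓(openQuadrant, ℝ), Measurable fun ω => bilin K.kernel (fun p => g p ω) φ := by
    intro φ
    have hκ := aestronglyMeasurable_comp_sub K.isPDKernel.locallyIntegrable
    have e : ∀ ω, bilin K.kernel (fun p => g p ω) φ =
        ∫ p : (ℝ × ℝ) × (ℝ × ℝ), hκ.mk _ p * g p.1 ω * φ p.2 := fun ω =>
      integral_congr_ae (by filter_upwards [hκ.ae_eq_mk] with p hp; rw [hp])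
    simp only [e]
    refine (StronglyMeasurable.integral_prod_right' (f := fun q : Ω × ((ℝ × ℝ) × (ℝ × ℝ)) =>
      hκ.mk _ q.2 * g q.2.1 q.1 * φ q.2.2) ?_).measurable
    have m1 : Measurable fun q : Ω × ((ℝ × ℝ) × (ℝ × ℝ)) => g q.2.1 q.1 :=
      hg.comp (f := fun q : Ω × ((ℝ × ℝ) × (ℝ × ℝ)) => (q.2.1, q.1)) (by fun_prop)
    have m2 : Measurable fun q : Ω × ((ℝ × ℝ) × (ℝ × ℝ)) => φ q.2.2 :=
      φ.continuous.measurable.comp (by fun_prop)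
    exact (((hκ.stronglyMeasurable_mk.measurable.comp measurable_snd).mul m1).mul
      m2).stronglyMeasurable
  have hVm : StronglyMeasurable V := by
    refine stronglyMeasurable_of_measurable_inner fun y => measurable_inner_of_dense
      (T := range K.toH) (K.denseRange_toH.mono Submodule.subset_span) ?_ y
    rintro _ ⟨φ, rfl⟩
    have hS : MeasurableSet {ω | energy K.kernel (fun p => ‖g p ω‖ₑ) (fun p => ‖g p ω‖ₑ) < ∞} :=
      hEm measurableSet_Iio
    convert! (hbm φ).indicator hS using 1
    funext ω
    by_cases h : energy K.kernel (fun p => ‖g p ω‖ₑ) (fun p => ‖g p ω‖ₑ) < ∞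
    · rw [indicator_of_mem (show ω ∈ _ from h), hV1 ω h]
    · rw [indicator_of_notMem (show ω ∉ _ from h), hV2 ω h, inner_zero_left]
  have hVL : MemLp V 2 P := by
    rw [memLp_two_iff_integrable_sq_norm hVm.aestronglyMeasurable]
    refine (integrable_toReal_of_lintegral_ne_top hEm.aemeasurable hfin.ne).mono'
      (hVm.norm.pow 2).aestronglyMeasurable (ae_of_all _ fun ω => ?_)
    rw [Real.norm_of_nonneg (by positivity)]
    exact hV3 ω
  refine ⟨hVL.toLp V, ?_, (field_integrable_iff hg h0).2 hfin, ?_⟩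
  · exact hg.aestronglyMeasurable
  · filter_upwards [hVL.coeFn_toLp, ae_lt_top hEm hfin.ne] with ω h1 h2 φ
    rw [h1, hV1 ω h2, covForm_eq_bilin (fun p hp => h0 p hp ω)
      fun p hp => testFunction_eq_zero φ hp]

/-- The inner product of a field with a test function, tested against a random variable. -/
theorem integral_bilin_mul {g : ℝ × ℝ → Ω → ℝ}
    (hg : Measurable fun q : (ℝ × ℝ) × Ω => g q.1 q.2)
    (hfin : ∫⁻ ω, energy K.kernel (fun p => ‖g p ω‖ₑ) (fun p => ‖g p ω‖ₑ) ∂P < ∞)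
    (φ : 𝓓(openQuadrant, ℝ)) {X : Ω → ℝ} (hX : Measurable X) (hX2 : MemLp X 2 P) :
    ∫ ω, bilin K.kernel (fun p => g p ω) φ * X ω ∂P =
      ∫ p, (∫ ω, g p ω * X ω ∂P) * potential K.f K.γ φ p := by
  have hgω : ∀ ω, Measurable fun p => g p ω := fun ω =>
    hg.comp (f := fun p : ℝ × ℝ => (p, ω)) (by fun_prop)
  have hg' : Measurable fun q : Ω × (ℝ × ℝ) => ‖g q.2 q.1‖ₑ := (hg.comp measurable_swap).enorm
  have hEm : Measurable fun ω => energy K.kernel (fun p => ‖g p ω‖ₑ) (fun p => ‖g p ω‖ₑ) :=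
    energy_measurable K.isPDKernel.locallyIntegrable (a := fun ω p => ‖g p ω‖ₑ)
      (b := fun ω p => ‖g p ω‖ₑ) hg' hg'
  have hφm := φ.continuous.measurable
  have hφφ := (bilin_integrable_iff K.isPDKernel hφm hφm).1 (K.bilin_test_integrable φ φ)
  have hpot : Continuous (potential K.f K.γ φ) := continuous_potential K.hf.locallyIntegrable
    K.hγ.locallyIntegrable φ.continuous φ.hasCompactSupport
  have hpm := hpot.measurable
  have hκm := aemeasurable_ofReal_comp_sub K.isPDKernel.locallyIntegrable
  have hX' : Measurable fun ω => ‖X ω‖ₑ := hX.enorm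
  have hHm : Measurable fun q : Ω × (ℝ × ℝ) => g q.2 q.1 * potential K.f K.γ φ q.2 * X q.1 := by
    have : Measurable fun q : Ω × (ℝ × ℝ) => g q.2 q.1 := hg.comp measurable_swap
    fun_prop
  -- The potential of a test function is dominated by the energy pairing, and the expectation is
  -- then estimated with the Cauchy–Schwarz inequality.
  have hb : ∀ ω, ∫⁻ p, ‖g p ω‖ₑ * ‖potential K.f K.γ φ p‖ₑ ≤
      energy K.kernel (fun p => ‖g p ω‖ₑ) (fun p => ‖φ p‖ₑ) := fun ω => by
    have e : energy K.kernel (fun p => ‖g p ω‖ₑ) (fun p => ‖φ p‖ₑ) =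
        ∫⁻ p, ∫⁻ q, ENNReal.ofReal (K.kernel (p - q)) * ‖g p ω‖ₑ * ‖φ q‖ₑ := by
      unfold energy
      rw [Measure.volume_eq_prod (ℝ × ℝ) (ℝ × ℝ)]
      exact lintegral_prod _ ((hκm.mul ((hgω ω).comp measurable_fst).enorm.aemeasurable).mul
        (hφm.comp measurable_snd).enorm.aemeasurable)
    rw [e]
    refine lintegral_mono fun p => ?_
    have h1 : ‖potential K.f K.γ φ p‖ₑ ≤ ∫⁻ q, ENNReal.ofReal (K.kernel (p - q)) * ‖φ q‖ₑ := by
      refine (enorm_integral_le_lintegral_enorm _).trans_eq (lintegral_congr fun q => ?_)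
      rw [enorm_mul, Real.enorm_of_nonneg (K.isPDKernel.nonneg _)]
    refine (mul_le_mul_right h1 _).trans_eq ?_
    rw [← lintegral_const_mul' _ _ enorm_ne_top]
    exact lintegral_congr fun q => by ring
  have hH : Integrable (fun q : Ω × (ℝ × ℝ) => g q.2 q.1 * potential K.f K.γ φ q.2 * X q.1)
      (P.prod volume) := by
    refine ⟨hHm.aestronglyMeasurable, ?_⟩
    change ∫⁻ q, _ ∂_ < ∞
    rw [lintegral_prod _ hHm.enorm.aemeasurable]
    calc ∫⁻ ω, (∫⁻ p, ‖g p ω * potential K.f K.γ φ p * X ω‖ₑ) ∂P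
        ≤ ∫⁻ ω, energy K.kernel (fun p => ‖φ p‖ₑ) (fun p => ‖φ p‖ₑ) ^ (1 / 2 : ℝ) *
          (energy K.kernel (fun p => ‖g p ω‖ₑ) (fun p => ‖g p ω‖ₑ) ^ (1 / 2 : ℝ) *
            (‖X ω‖ₑ ^ 2) ^ (1 / 2 : ℝ)) ∂P := by
          refine lintegral_mono fun ω => ?_
          have e : (‖X ω‖ₑ ^ 2) ^ (1 / 2 : ℝ) = ‖X ω‖ₑ := by
            rw [← ENNReal.rpow_natCast, ← ENNReal.rpow_mul]; norm_num
          simp only [enorm_mul]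
          rw [lintegral_mul_const' _ _ enorm_ne_top, e, ← mul_assoc]
          refine mul_le_mul_left ((hb ω).trans ?_) _
          refine (energy_le_sqrt K.isPDKernel (hgω ω).enorm hφm.enorm).trans_eq (mul_comm _ _)
      _ ≤ energy K.kernel (fun p => ‖φ p‖ₑ) (fun p => ‖φ p‖ₑ) ^ (1 / 2 : ℝ) *
          ((∫⁻ ω, energy K.kernel (fun p => ‖g p ω‖ₑ) (fun p => ‖g p ω‖ₑ) ∂P) ^ (1 / 2 : ℝ) *
            (∫⁻ ω, ‖X ω‖ₑ ^ 2 ∂P) ^ (1 / 2 : ℝ)) := by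
          rw [lintegral_const_mul' _ _ (ENNReal.rpow_ne_top_of_nonneg (by norm_num) hφφ.ne)]
          refine mul_le_mul_right (lintegral_sqrt_mul_sqrt_le hEm (hX'.pow_const 2)) _
      _ < ∞ := by
          have hX3 : ∫⁻ ω, ‖X ω‖ₑ ^ 2 ∂P < ∞ := by
            have := hX2.integrable_sq.2
            change ∫⁻ ω, _ ∂P < ∞ at this
            simpa only [enorm_pow] using this
          have hh : ∀ {x : ℝ≥0∞}, x < ∞ → x ^ (1 / 2 : ℝ) < ∞ := fun h =>
            ENNReal.rpow_lt_top_of_nonneg (by norm_num) h.ne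
          exact ENNReal.mul_lt_top (hh hφφ) (ENNReal.mul_lt_top (hh hfin) (hh hX3))
  have hae : ∀ᵐ ω ∂P, bilin K.kernel (fun p => g p ω) φ * X ω =
      ∫ p, g p ω * potential K.f K.γ φ p * X ω := by
    filter_upwards [ae_lt_top hEm hfin.ne] with ω h1
    rw [bilin_eq_integral (bilin_integrable_cross K.isPDKernel (hgω ω) hφm
      ((bilin_integrable_iff K.isPDKernel (hgω ω) (hgω ω)).2 h1) (K.bilin_test_integrable φ φ)),
      ← integral_mul_const]
    rfl
  rw [integral_congr_ae hae, integral_integral_swap (f := fun ω p =>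
    g p ω * potential K.f K.γ φ p * X ω) hH]
  refine integral_congr_ae (ae_of_all _ fun p => ?_)
  dsimp only
  rw [← integral_mul_const]
  exact integral_congr_ae (ae_of_all _ fun ω => by dsimp only; ring)

end Field

/-! ### Skorohod integrals against the Duhamel kernel -/

section Skorohod

variable {Ω : Type*} [MeasurableSpace Ω] {P : Measure Ω} [IsProbabilityMeasure P]
  {K : NoiseKernel} {W : K.H → Ω → ℝ}

theorem measurableSet_quadrant : MeasurableSet quadrant := measurableSet_Ioi.prod measurableSet_Ioi

/-- Only the values of a field on the quadrant matter. -/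
theorem IsFieldElement.congr {v v' : ℝ → ℝ → Ω → ℝ} {V : Lp K.H 2 P}
    (hv : IsFieldElement K P v V) (h : ∀ w τ, 0 < w → 0 < τ → v w τ = v' w τ) :
    IsFieldElement K P v' V where
  measurable := by
    refine hv.measurable.congr ?_
    have h1 : ∀ᵐ p ∂(volume.restrict quadrant : Measure (ℝ × ℝ)), p ∈ quadrant :=
      ae_restrict_mem measurableSet_quadrant
    filter_upwards [Measure.quasiMeasurePreserving_fst.ae h1] with p hp
    rw [h _ _ hp.1 hp.2]
  integrable := by
    refine hv.integrable.congr ?_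
    have h1 : ∀ᵐ p ∂(volume.restrict (quadrant ×ˢ quadrant) : Measure ((ℝ × ℝ) × (ℝ × ℝ))),
        p ∈ quadrant ×ˢ quadrant :=
      ae_restrict_mem (measurableSet_quadrant.prod measurableSet_quadrant)
    filter_upwards [Measure.quasiMeasurePreserving_fst.ae h1] with p hp
    rw [h _ _ hp.1.1 hp.2.1, h _ _ hp.1.2 hp.2.2]
  inner_eq := by
    filter_upwards [hv.inner_eq] with ω hω φ
    rw [hω]
    refine setIntegral_congr_fun (measurableSet_quadrant.prod measurableSet_quadrant) fun p hp => ?_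
    dsimp only
    rw [h _ _ hp.1.1 hp.2.1]

theorem IsSkorohodIntegral.congr {v v' : ℝ → ℝ → Ω → ℝ} {Y : Ω → ℝ}
    (hv : IsSkorohodIntegral K P W v Y) (h : ∀ w τ, 0 < w → 0 < τ → v w τ = v' w τ) :
    IsSkorohodIntegral K P W v' Y := by
  obtain ⟨V, h1, h2⟩ := hv
  exact ⟨V, h1.congr h, h2⟩

theorem IsDivergence.congr {V : Lp K.H 2 P} {Y Y' : Ω → ℝ} (h : IsDivergence K P W V Y)
    (hY : Y =ᵐ[P] Y') : IsDivergence K P W V Y' :=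
  ⟨(memLp_congr_ae hY).1 h.1, fun XU hXU => by
    rw [← h.2 XU hXU]
    exact integral_congr_ae (by filter_upwards [hY] with ω h1; rw [h1])⟩

theorem duhamel_eq_zero_of_notMem (z t : ℝ) : ∀ p ∉ quadrant, duhamel z t p = 0 := fun _ hp =>
  duhamel_eq_zero fun h => hp ⟨h.1, h.2.1⟩

theorem indicator_kimuraKernel_eq {z t w τ : ℝ} (hw : 0 < w) (y : ℝ → ℝ) :
    (Ioo 0 t).indicator (fun τ' => kimuraKernel z w (t - τ') * y τ') τ =
      duhamel z t (w, τ) * y τ := by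
  by_cases h : τ ∈ Ioo 0 t
  · rw [indicator_of_mem h, duhamel_eq hw h]
  · rw [indicator_of_notMem h, duhamel_eq_zero fun h' => h h'.2, zero_mul]

theorem lintegral_enorm_sq_Lp (Y : Lp ℝ 2 P) :
    ∫⁻ ω, ‖Y ω‖ₑ ^ 2 ∂P = ENNReal.ofReal (‖Y‖ ^ 2) := by
  rw [← real_inner_self_eq_norm_sq, Lp_inner_eq, ofReal_integral_eq_lintegral_ofReal]
  · refine lintegral_congr fun ω => ?_
    rw [← sq, ← sq_abs, ENNReal.ofReal_pow (abs_nonneg _), ← Real.enorm_eq_ofReal_abs]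
  · exact ((Lp.memLp Y).integrable_sq).congr (ae_of_all _ fun ω => sq _)
  · exact ae_of_all _ fun ω => mul_self_nonneg _

/-- The field `q y`, with `q` the Duhamel kernel and `y` bounded in `L²`, has finite energy. -/
theorem lintegral_energy_duhamel_mul_lt_top (hanti : AntitoneOn K.f (Ioi 0)) {z t : ℝ} (hz : 0 < z)
    (ht : 0 < t) {Y : ℝ × ℝ → Lp ℝ 2 P} {y : ℝ × ℝ → Ω → ℝ}
    (hy : Measurable fun q : (ℝ × ℝ) × Ω => y q.1 q.2) (hyY : ∀ p, y p =ᵐ[P] Y p) {C : ℝ}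
    (hC : ∀ p : ℝ × ℝ, 0 < p.1 → p.2 ∈ Ioo 0 t → ‖Y p‖ ^ 2 ≤ C) :
    ∫⁻ ω, energy K.kernel (fun p => ‖duhamel z t p * y p ω‖ₑ)
      (fun p => ‖duhamel z t p * y p ω‖ₑ) ∂P < ∞ := by
  have hκm := aemeasurable_ofReal_comp_sub K.isPDKernel.locallyIntegrable
  have hdm := duhamel_measurable' z t
  have hym1 : Measurable fun q : Ω × ((ℝ × ℝ) × (ℝ × ℝ)) => y q.2.1 q.1 :=
    hy.comp (f := fun q : Ω × ((ℝ × ℝ) × (ℝ × ℝ)) => (q.2.1, q.1)) (by fun_prop)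
  have hym2 : Measurable fun q : Ω × ((ℝ × ℝ) × (ℝ × ℝ)) => y q.2.2 q.1 :=
    hy.comp (f := fun q : Ω × ((ℝ × ℝ) × (ℝ × ℝ)) => (q.2.2, q.1)) (by fun_prop)
  have hy2 : ∀ p : ℝ × ℝ, 0 < p.1 → p.2 ∈ Ioo 0 t → ∫⁻ ω, ‖y p ω‖ₑ ^ 2 ∂P ≤ ENNReal.ofReal C := by
    intro p h1 h2
    have e : ∫⁻ ω, ‖y p ω‖ₑ ^ 2 ∂P = ∫⁻ ω, ‖Y p ω‖ₑ ^ 2 ∂P :=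
      lintegral_congr_ae (by filter_upwards [hyY p] with ω h; rw [h])
    rw [e, lintegral_enorm_sq_Lp]
    exact ENNReal.ofReal_le_ofReal (hC p h1 h2)
  have hyp : ∀ p, Measurable fun ω => ‖y p ω‖ₑ := fun p =>
    (hy.comp (f := fun ω => (p, ω)) (by fun_prop)).enorm
  unfold energy
  rw [lintegral_lintegral_swap]
  · refine lt_of_le_of_lt (lintegral_mono (g := fun p : (ℝ × ℝ) × (ℝ × ℝ) =>
      (ENNReal.ofReal C + ENNReal.ofReal C) * (ENNReal.ofReal (K.kernel (p.1 - p.2)) *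
        ENNReal.ofReal (duhamel z t p.1) * ENNReal.ofReal (duhamel z t p.2))) fun p => ?_) ?_
    · have e : ∀ ω, ENNReal.ofReal (K.kernel (p.1 - p.2)) * ‖duhamel z t p.1 * y p.1 ω‖ₑ *
          ‖duhamel z t p.2 * y p.2 ω‖ₑ = (ENNReal.ofReal (K.kernel (p.1 - p.2)) *
          ENNReal.ofReal (duhamel z t p.1) * ENNReal.ofReal (duhamel z t p.2)) *
          (‖y p.1 ω‖ₑ * ‖y p.2 ω‖ₑ) := fun ω => by
        rw [enorm_mul, enorm_mul, Real.enorm_of_nonneg (duhamel_nonneg _ _ _),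
          Real.enorm_of_nonneg (duhamel_nonneg _ _ _)]
        ring
      simp only [e]
      rw [lintegral_const_mul' _ _ (by finiteness), mul_comm]
      by_cases h1 : 0 < p.1.1 ∧ p.1.2 ∈ Ioo 0 t
      · by_cases h2 : 0 < p.2.1 ∧ p.2.2 ∈ Ioo 0 t
        · refine mul_le_mul_left ?_ _
          calc ∫⁻ ω, ‖y p.1 ω‖ₑ * ‖y p.2 ω‖ₑ ∂P
              ≤ ∫⁻ ω, (‖y p.1 ω‖ₑ ^ 2 + ‖y p.2 ω‖ₑ ^ 2) ∂P := by
                refine lintegral_mono fun ω => ?_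
                rcases le_total ‖y p.1 ω‖ₑ ‖y p.2 ω‖ₑ with h | h
                · refine le_add_of_le_right ?_
                  rw [sq]
                  gcongr
                · refine le_add_of_le_left ?_
                  rw [sq]
                  gcongr
            _ ≤ _ := by
                rw [lintegral_add_left ((hyp _).pow_const 2)]
                exact add_le_add (hy2 _ h1.1 h1.2) (hy2 _ h2.1 h2.2)
        · simp [duhamel_eq_zero h2]
      · simp [duhamel_eq_zero h1]
    · rw [lintegral_const_mul' _ _ (by finiteness)]
      exact ENNReal.mul_lt_top (by finiteness) (energy_duhamel_lt_top K.hf K.hγ hanti hz ht)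
  · have m0 : AEMeasurable (fun q : Ω × ((ℝ × ℝ) × (ℝ × ℝ)) =>
        ENNReal.ofReal (K.kernel (q.2.1 - q.2.2))) (P.prod volume) :=
      hκm.comp_quasiMeasurePreserving Measure.quasiMeasurePreserving_snd
    have m1 : Measurable fun q : Ω × ((ℝ × ℝ) × (ℝ × ℝ)) => duhamel z t q.2.1 :=
      hdm.comp (by fun_prop)
    have m2 : Measurable fun q : Ω × ((ℝ × ℝ) × (ℝ × ℝ)) => duhamel z t q.2.2 :=
      hdm.comp (by fun_prop)
    exact (m0.mul (m1.mul hym1).enorm.aemeasurable).mul (m2.mul hym2).enorm.aemeasurable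

/-- The Skorohod integral of `q y`, with `q` the Duhamel kernel, is characterised by its pairings
with the trigonometric functions of the noise. -/
theorem isSkorohodIntegral_duhamel (hW : IsIsonormal K P W) (hanti : AntitoneOn K.f (Ioi 0))
    {z t : ℝ} (hz : 0 < z) (ht : 0 < t) {Y : ℝ × ℝ → Lp ℝ 2 P} {y : ℝ × ℝ → Ω → ℝ}
    (hy : Measurable fun q : (ℝ × ℝ) × Ω => y q.1 q.2) (hyY : ∀ p, y p =ᵐ[P] Y p) {C : ℝ}
    (hC : ∀ p : ℝ × ℝ, 0 < p.1 → p.2 ∈ Ioo 0 t → ‖Y p‖ ^ 2 ≤ C) {Z : Lp ℝ 2 P}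
    (hZ : ∀ (φ : 𝓓(openQuadrant, ℝ)) (a : ℝ), inner ℝ Z (hW.waveLp (K.toH φ) a) =
      ∫ p, duhamel z t p * (potential K.f K.γ φ p *
        inner ℝ (Y p) (hW.waveLp (K.toH φ) (a + Real.pi / 2)))) :
    IsSkorohodIntegral K P W (fun w τ ω => duhamel z t (w, τ) * y (w, τ) ω) Z := by
  have hg : Measurable fun q : (ℝ × ℝ) × Ω => duhamel z t q.1 * y q.1 q.2 :=
    ((duhamel_measurable' z t).comp measurable_fst).mul hy
  have hg0 : ∀ p ∉ quadrant, ∀ ω, duhamel z t p * y p ω = 0 := fun p hp ω => by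
    rw [duhamel_eq_zero_of_notMem z t p hp, zero_mul]
  have hfin := lintegral_energy_duhamel_mul_lt_top hanti hz ht hy hyY hC
  obtain ⟨V, hV⟩ := exists_isFieldElement (g := fun p ω => duhamel z t p * y p ω) hg hg0 hfin
  refine ⟨V, hV, hW.isDivergence_of_cos (Lp.memLp Z) V fun φ a => ?_⟩
  have h1 : ∫ ω, inner ℝ (K.toH φ) (V ω) * wave W (K.toH φ) (a + Real.pi / 2) ω ∂P =
      ∫ ω, bilin K.kernel (fun p => duhamel z t p * y p ω) φ *
        wave W (K.toH φ) (a + Real.pi / 2) ω ∂P := by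
    refine integral_congr_ae ?_
    filter_upwards [hV.inner_eq] with ω h
    rw [real_inner_comm, h, covForm_eq_bilin (fun p hp => hg0 p hp ω)
      fun p hp => testFunction_eq_zero φ hp]
  rw [integral_bilin_mul (g := fun p ω => duhamel z t p * y p ω) hg hfin φ
    (hW.wave_measurable _ _) (hW.memLp_wave _ _)] at h1
  have h2 := hZ φ a
  rw [hW.inner_waveLp] at h2
  have h3 : ∫ ω, Z ω * wave W (K.toH φ) a ω ∂P =
      ∫ ω, inner ℝ (K.toH φ) (V ω) * wave W (K.toH φ) (a + Real.pi / 2) ω ∂P := by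
    rw [h1, h2]
    refine integral_congr_ae (ae_of_all _ fun p => ?_)
    dsimp only
    have e : ∫ ω, duhamel z t p * y p ω * wave W (K.toH φ) (a + Real.pi / 2) ω ∂P =
        duhamel z t p * inner ℝ (Y p) (hW.waveLp (K.toH φ) (a + Real.pi / 2)) := by
      rw [hW.inner_waveLp, ← integral_const_mul]
      refine integral_congr_ae ?_
      filter_upwards [hyY p] with ω h
      rw [h]
      ring
    rw [e]
    ring
  have e1 : ∀ (X : Ω → ℝ) b, ∫ ω, X ω * wave W (K.toH φ) b ω ∂P =
      Real.exp (‖K.toH φ‖ ^ 2 / 2) * ∫ ω, X ω * Real.cos (W (K.toH φ) ω + b) ∂P := fun X b => by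
    rw [← integral_const_mul]
    exact integral_congr_ae (ae_of_all _ fun ω => by unfold wave; ring)
  rw [e1, e1] at h3
  exact mul_left_cancel₀ (Real.exp_pos _).ne' h3

/-- The divergence identity against powers of a Gaussian variable. -/
theorem integral_mul_pow (hW : IsIsonormal K P W) {g : ℝ × ℝ → Ω → ℝ}
    (hg : Measurable fun q : (ℝ × ℝ) × Ω => g q.1 q.2) (h0 : ∀ p ∉ quadrant, ∀ ω, g p ω = 0)
    {Y : Ω → ℝ} (hY : IsSkorohodIntegral K P W (fun w τ ω => g (w, τ) ω) Y)
    (φ : 𝓓(openQuadrant, ℝ)) (n : ℕ) :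
    ∫ ω, Y ω * W (K.toH φ) ω ^ n ∂P =
      n * ∫ p, (∫ ω, g p ω * W (K.toH φ) ω ^ (n - 1) ∂P) * potential K.f K.γ φ p := by
  obtain ⟨V, hV, hYV⟩ := hY
  have hfin := (field_integrable_iff hg h0).1 hV.integrable
  have hp := hW.memLp_pow (K.toH φ)
  have hU : MemLp (fun ω => (n * W (K.toH φ) ω ^ (n - 1)) • K.toH φ) 2 P :=
    (ContinuousLinearMap.toSpanSingleton ℝ (K.toH φ)).comp_memLp' ((hp (n - 1)).const_mul (n : ℝ))
  -- The pair `(W(φ)ⁿ, n W(φ)ⁿ⁻¹ φ)` is in the graph of the Malliavin derivative.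
  have hmem : ((hp n).toLp _, hU.toLp _) ∈ malliavinGraph K P W := by
    refine subset_closure ⟨1, fun x => x 0 ^ n, fun _ => K.toH φ, ?_, ?_, ?_⟩
    · have h1 : (fun x : Fin 1 → ℝ => x 0).HasTemperateGrowth :=
        (ContinuousLinearMap.proj (R := ℝ) (φ := fun _ : Fin 1 => ℝ) 0).hasTemperateGrowth
      exact h1.pow n
    · exact (hp n).coeFn_toLp
    · filter_upwards [hU.coeFn_toLp] with ω h1
      have h2 : HasFDerivAt (fun x : Fin 1 → ℝ => x 0 ^ n) ((n * W (K.toH φ) ω ^ (n - 1)) •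
          ContinuousLinearMap.proj (R := ℝ) (φ := fun _ : Fin 1 => ℝ) 0)
          (fun _ => W (K.toH φ) ω) := by
        have := (ContinuousLinearMap.proj (R := ℝ) (φ := fun _ : Fin 1 => ℝ) 0).hasFDerivAt
          (x := fun _ => W (K.toH φ) ω)
        exact (this.pow n).congr_fderiv (by simp [nsmul_eq_mul])
      rw [h1]
      simp [h2.fderiv]
  have h1 := hYV.2 _ hmem
  have e1 : ∫ ω, Y ω * (hp n).toLp _ ω ∂P = ∫ ω, Y ω * W (K.toH φ) ω ^ n ∂P :=
    integral_congr_ae (by filter_upwards [(hp n).coeFn_toLp] with ω h; rw [h])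
  have e2 : ∫ ω, (inner ℝ (hU.toLp _ ω) (V ω) : ℝ) ∂P =
      n * ∫ ω, bilin K.kernel (fun p => g p ω) φ * W (K.toH φ) ω ^ (n - 1) ∂P := by
    rw [← integral_const_mul]
    refine integral_congr_ae ?_
    filter_upwards [hU.coeFn_toLp, hV.inner_eq] with ω h1 h2
    rw [h1, real_inner_smul_left, real_inner_comm, h2, covForm_eq_bilin (fun p hp => h0 p hp ω)
      fun p hp => testFunction_eq_zero φ hp]
    ring
  rw [e1, e2, integral_bilin_mul hg hfin φ ((hW.measurable _).pow_const _) (hp _)] at h1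
  exact h1

end Skorohod

/-! ### The chaos components as multiple integrals -/

section Multiple

variable {Ω : Type*} [MeasurableSpace Ω] {P : Measure Ω} [IsProbabilityMeasure P]
  {K : NoiseKernel} {W : K.H → Ω → ℝ}

namespace IsIsonormal

theorem memLp_exp_abs (hW : IsIsonormal K P W) (h : K.H) :
    MemLp (fun ω => Real.exp |W h ω|) 2 P := by
  have hm := hW.measurable h
  have hi : ∀ c : ℝ, Integrable (fun ω => Real.exp (c * W h ω)) P := fun c => by
    have h1 := ProbabilityTheory.integrable_exp_mul_gaussianReal
      (μ := 0) (v := (‖h‖ ^ 2).toNNReal) c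
    rw [← hW.map_eq h, integrable_map_measure (by fun_prop) hm.aemeasurable] at h1
    exact h1
  rw [memLp_two_iff_integrable_sq (by fun_prop)]
  refine ((hi 2).add (hi (-2))).mono' (by fun_prop) (ae_of_all _ fun ω => ?_)
  rw [Real.norm_of_nonneg (by positivity), ← Real.exp_nat_mul, Pi.add_apply]
  have p1 := Real.exp_pos (2 * W h ω)
  have p2 := Real.exp_pos (-2 * W h ω)
  rcases abs_choice (W h ω) with h1 | h1 <;> rw [h1]
  · push_cast
    linarith
  · rw [show ((2 : ℕ) : ℝ) * -W h ω = -2 * W h ω by push_cast; ring]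
    linarith

/-- Polynomials in the noise are total in `L²(Ω)`. -/
theorem ae_eq_zero_of_integral_mul_pow (hW : IsIsonormal K P W) {Z : Ω → ℝ} (hZ : MemLp Z 2 P)
    (h0 : ∀ (φ : 𝓓(openQuadrant, ℝ)) (n : ℕ), ∫ ω, Z ω * W (K.toH φ) ω ^ n ∂P = 0) :
    Z =ᵐ[P] 0 := by
  refine hW.ae_eq_zero_of_test hZ fun φ a => ?_
  have hm := hW.measurable (K.toH φ)
  set X := W (K.toH φ) with hX
  have hZX : ∀ n : ℕ, Integrable (fun ω => Z ω * X ω ^ n) P := fun n =>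
    hZ.integrable_mul (hW.memLp_pow (K.toH φ) n)
  have hsum : ∀ N : ℕ, ∫ ω, (Z ω : ℂ) * ∑ n ∈ Finset.range N,
      (X ω * Complex.I) ^ n / n.factorial ∂P = 0 := by
    intro N
    have e : ∀ ω, (Z ω : ℂ) * ∑ n ∈ Finset.range N, (X ω * Complex.I) ^ n / n.factorial =
        ∑ n ∈ Finset.range N,
          (Complex.I ^ n / n.factorial) * ((Z ω * X ω ^ n : ℝ) : ℂ) := fun ω => by
      rw [Finset.mul_sum]
      refine Finset.sum_congr rfl fun n _ => ?_
      push_cast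
      ring
    simp only [e]
    rw [integral_finsetSum _ fun n _ => (hZX n).ofReal.const_mul _]
    refine Finset.sum_eq_zero fun n _ => ?_
    rw [integral_const_mul, integral_complex_ofReal, h0, Complex.ofReal_zero, mul_zero]
  have hZm : AEStronglyMeasurable (fun ω => (Z ω : ℂ)) P :=
    Complex.continuous_ofReal.comp_aestronglyMeasurable hZ.1
  -- The exponential series of `iW(φ)` is dominated by `exp |W(φ)|`, which is square integrable.
  have hlim := tendsto_integral_of_dominated_convergence (μ := P)
    (F := fun N ω => (Z ω : ℂ) * ∑ n ∈ Finset.range N, (X ω * Complex.I) ^ n / n.factorial)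
    (f := fun ω => (Z ω : ℂ) * Complex.exp (X ω * Complex.I))
    (fun ω => ‖Z ω‖ * Real.exp |X ω|) (fun N => hZm.mul (by fun_prop))
    (hZ.norm.integrable_mul (hW.memLp_exp_abs (K.toH φ)))
    (fun N => ae_of_all _ fun ω => by
      rw [norm_mul, Complex.norm_real]
      refine mul_le_mul_of_nonneg_left ((norm_sum_le _ _).trans ?_) (norm_nonneg _)
      refine le_trans (Finset.sum_le_sum fun n _ => ?_)
        (Real.sum_le_exp_of_nonneg (abs_nonneg (X ω)) N)
      simp)
    (ae_of_all _ fun ω => by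
      have h1 := NormedSpace.expSeries_div_hasSum_exp (X ω * Complex.I)
      rw [← Complex.exp_eq_exp_ℂ] at h1
      exact h1.tendsto_sum_nat.const_mul _)
  simp only [hsum] at hlim
  have hz : ∫ ω, (Z ω : ℂ) * Complex.exp (X ω * Complex.I) ∂P = 0 :=
    tendsto_nhds_unique hlim tendsto_const_nhds
  have hi : Integrable (fun ω => Complex.exp (a * Complex.I) *
      ((Z ω : ℂ) * Complex.exp (X ω * Complex.I))) P :=
    Integrable.const_mul ((hZ.integrable (by norm_num)).ofReal.mul_bdd (c := 1) (by fun_prop)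
      (ae_of_all _ fun ω => by rw [Complex.norm_exp_ofReal_mul_I])) _
  have h1 := integral_re hi
  rw [integral_const_mul, hz, mul_zero] at h1
  refine Eq.trans (integral_congr_ae (ae_of_all _ fun ω => ?_)) (h1.trans Complex.zero_re)
  dsimp only
  have e : Complex.exp (a * Complex.I) * ((Z ω : ℂ) * Complex.exp (X ω * Complex.I)) =
      (Z ω : ℂ) * Complex.exp ((X ω + a : ℝ) * Complex.I) := by
    push_cast
    rw [add_mul, Complex.exp_add]
    ring
  rw [e, RCLike.re_to_complex, Complex.re_ofReal_mul, Complex.exp_ofReal_mul_I_re]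

end IsIsonormal

variable (u₀ : BoundedContinuousFunction (Ioi (0 : ℝ)) ℝ)

theorem IsSkorohodIntegral.congr_right {v : ℝ → ℝ → Ω → ℝ} {Y Y' : Ω → ℝ}
    (hv : IsSkorohodIntegral K P W v Y) (h : Y =ᵐ[P] Y') : IsSkorohodIntegral K P W v Y' := by
  obtain ⟨V, h1, h2⟩ := hv
  exact ⟨V, h1, h2.congr h⟩

theorem symmIntegral_mono {k : ℝ → ℝ} (hk : IsCovarianceKernel k) {a b : ℝ} (ha : 0 ≤ a)
    (hab : a ≤ b) : symmIntegral k a ≤ symmIntegral k b := by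
  refine intervalIntegral.integral_mono_interval (by linarith) (by linarith) hab
    (ae_of_all _ fun x => hk.nonneg x) ?_
  exact intervalIntegrable_iff.2
    ((hk.locallyIntegrable.integrableOn_isCompact isCompact_uIcc).mono_set uIoc_subset_uIcc)

theorem inner_constL_waveLp (hW : IsIsonormal K P W) (c : ℝ) (h : K.H) (a : ℝ) :
    inner ℝ (Lp.constL 2 P ℝ c) (hW.waveLp h a) = c * Real.cos a := by
  rw [hW.inner_waveLp]
  have e : ∫ ω, (Lp.constL 2 P ℝ c : Lp ℝ 2 P) ω * wave W h a ω ∂P =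
      ∫ ω, (c * Real.exp (‖h‖ ^ 2 / 2)) * Real.cos (W h ω + a) ∂P := by
    refine integral_congr_ae ?_
    filter_upwards [Lp.coeFn_const (p := 2) (μ := P) c] with ω h1
    rw [show (Lp.constL 2 P ℝ c : Lp ℝ 2 P) = Lp.const 2 P c from rfl, h1]
    unfold wave
    simp only [Function.const_apply]
    ring
  rw [e, integral_const_mul, hW.integral_cos, ← mul_assoc, mul_assoc c, ← Real.exp_add]
  simp

/-- A family of elements of `L²(Ω)` represents the chaos components if its pairings with the
trigonometric functions of the noise are the chaos pairings. -/
structure IsChaos (hW : IsIsonormal K P W) (J : ℕ → ℝ → ℝ → Lp ℝ 2 P) : Prop where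
  inner_eq : ∀ n z t, 0 < z → 0 < t → ∀ (φ : 𝓓(openQuadrant, ℝ)) (a : ℝ),
    inner ℝ (J n z t) (hW.waveLp (K.toH φ) a) =
      chaosPairing u₀ K.f K.γ φ n z t * Real.cos (a + n * (Real.pi / 2))
  norm_sum_sq_le : ∀ (s : Finset ℕ) z t, 0 < z → 0 < t → ‖∑ n ∈ s, J n z t‖ ^ 2 ≤
    ∑ n ∈ s, symmIntegral K.γ t ^ n * (chaosBound u₀ K.f n z t).toReal
  eq_zero : ∀ n z t, ¬ (0 < z ∧ 0 < t) → J n z t = 0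

namespace IsChaos

variable {u₀} {hW : IsIsonormal K P W} {J : ℕ → ℝ → ℝ → Lp ℝ 2 P}

theorem zero_eq (hJ : IsChaos u₀ hW J) {z t : ℝ} (hz : 0 < z) (ht : 0 < t) :
    J 0 z t = Lp.constL 2 P ℝ (detSolution u₀ z t) := by
  refine hW.eq_of_inner_waveLp fun φ a => ?_
  rw [hJ.inner_eq 0 z t hz ht, inner_constL_waveLp]
  simp [chaosPairing]

/-- The Duhamel recursion between consecutive chaos components, in weak form. -/
theorem inner_succ (hJ : IsChaos u₀ hW J) (n : ℕ) {z t : ℝ} (hz : 0 < z) (ht : 0 < t)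
    (φ : 𝓓(openQuadrant, ℝ)) (a : ℝ) :
    inner ℝ (J (n + 1) z t) (hW.waveLp (K.toH φ) a) =
      ∫ p, duhamel z t p * (potential K.f K.γ φ p *
        inner ℝ (J n p.1 p.2) (hW.waveLp (K.toH φ) (a + Real.pi / 2))) := by
  rw [hJ.inner_eq (n + 1) z t hz ht, chaosPairing, ← integral_mul_const]
  refine integral_congr_ae (ae_of_all _ fun p => ?_)
  dsimp only
  by_cases hp : 0 < p.1 ∧ p.2 ∈ Ioo 0 t
  · rw [hJ.inner_eq n _ _ hp.1 hp.2.1,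
      show a + Real.pi / 2 + n * (Real.pi / 2) = a + (n + 1 : ℕ) * (Real.pi / 2) by push_cast; ring]
    ring
  · rw [duhamel_eq_zero hp]
    ring

theorem norm_sq_le (hJ : IsChaos u₀ hW J) (n : ℕ) {z t : ℝ} (hz : 0 < z) (ht : 0 < t) :
    ‖J n z t‖ ^ 2 ≤ symmIntegral K.γ t ^ n * (chaosBound u₀ K.f n z t).toReal := by
  simpa using hJ.norm_sum_sq_le {n} z t hz ht

theorem exists_norm_sq_le (hJ : IsChaos u₀ hW J) (hanti : AntitoneOn K.f (Ioi 0))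
    (hlim : Tendsto (fun ε => symmIntegral K.f ε) (𝓝[>] 0) (𝓝 0)) (n : ℕ) (t : ℝ) :
    ∃ C, ∀ p : ℝ × ℝ, 0 < p.1 → p.2 ∈ Ioo 0 t → ‖J n p.1 p.2‖ ^ 2 ≤ C := by
  obtain ⟨C, hC0, hC⟩ := exists_chaosBound_le u₀ K.hf hanti hlim n t
  refine ⟨symmIntegral K.γ t ^ n * C, fun p h1 h2 => (hJ.norm_sq_le n h1 h2.1).trans ?_⟩
  have h3 := symmIntegral_nonneg K.hγ h2.1.le
  have h4 := symmIntegral_mono K.hγ h2.1.le h2.2.le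
  have h6 := h3.trans h4
  have h5 := ENNReal.toReal_mono ENNReal.ofReal_ne_top (hC p.1 p.2 h1 h2.1 h2.2.le)
  rw [ENNReal.toReal_ofReal hC0] at h5
  gcongr

theorem exists_version (hJ : IsChaos u₀ hW J) (n : ℕ) : ∃ y : ℝ × ℝ → Ω → ℝ,
    Measurable (fun q : (ℝ × ℝ) × Ω => y q.1 q.2) ∧ ∀ p, y p =ᵐ[P] J n p.1 p.2 := by
  have := hW.separableSpace_Lp
  exact exists_measurable_version (stronglyMeasurable_chaos u₀ hW hJ.inner_eq hJ.eq_zero n)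

/-- The chaos components are the multiple Skorohod integrals of the kernels. The factor `c` makes
the induction work, as the integrand of the last integral is a multiple of a chaos component. -/
theorem isMultipleIntegral (hJ : IsChaos u₀ hW J) (hanti : AntitoneOn K.f (Ioi 0))
    (hlim : Tendsto (fun ε => symmIntegral K.f ε) (𝓝[>] 0) (𝓝 0)) (n : ℕ) :
    ∀ {z t : ℝ}, 0 < z → 0 < t → ∀ (c : ℝ) (Y : Ω → ℝ), Y =ᵐ[P] (fun ω => c * J n z t ω) →
      IsMultipleIntegral K P W n (fun p => c * chaosKernel u₀ n p z t) Y := by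
  induction n with
  | zero =>
    intro z t hz ht c Y hY
    refine hY.trans ?_
    rw [hJ.zero_eq hz ht]
    filter_upwards [Lp.coeFn_const (p := 2) (μ := P) (detSolution u₀ z t)] with ω h1
    rw [show (Lp.constL 2 P ℝ (detSolution u₀ z t) : Lp ℝ 2 P) = Lp.const 2 P (detSolution u₀ z t)
      from rfl, h1]
    rfl
  | succ n ih =>
    intro z t hz ht c Y hY
    obtain ⟨C, hC⟩ := hJ.exists_norm_sq_le hanti hlim n t
    obtain ⟨y, hy, hyJ⟩ := hJ.exists_version n
    refine ⟨fun w τ ω => duhamel z t (w, τ) * (c * y (w, τ) ω), ?_, ?_⟩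
    · filter_upwards [ae_restrict_mem measurableSet_quadrant] with p hp
      have hk : (fun x => c * chaosKernel u₀ (n + 1) (Fin.snoc (α := fun _ => ℝ × ℝ) x p) z t) =
          fun x => (c * duhamel z t p) * chaosKernel u₀ n x p.1 p.2 := by
        funext x
        have e := indicator_kimuraKernel_eq (z := z) (t := t) (τ := p.2) hp.1 (fun _ => 1)
        simp only [mul_one] at e
        rw [chaosKernel]
        simp only [Fin.snoc_last, Fin.snoc_castSucc]
        rw [e]
        ring
      rw [hk]
      refine ih hp.1 hp.2 _ _ ?_
      filter_upwards [hyJ p] with ω h1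
      rw [h1]
      ring
    · refine (isSkorohodIntegral_duhamel hW hanti hz ht (Y := fun p => c • J n p.1 p.2)
        (y := fun p ω => c * y p ω) (hy.const_mul c) (fun p => ?_) (C := c ^ 2 * C)
        (fun p h1 h2 => ?_) (Z := c • J (n + 1) z t) fun φ a => ?_).congr_right ?_
      · filter_upwards [hyJ p, Lp.coeFn_smul c (J n p.1 p.2)] with ω h1 h2
        rw [h2, h1]
        rfl
      · rw [norm_smul, mul_pow, Real.norm_eq_abs, sq_abs]
        exact mul_le_mul_of_nonneg_left (hC p h1 h2) (sq_nonneg _)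
      · rw [real_inner_smul_left, hJ.inner_succ n hz ht, ← integral_const_mul]
        refine integral_congr_ae (ae_of_all _ fun p => ?_)
        dsimp only
        rw [real_inner_smul_left]
        ring
      · filter_upwards [hY, Lp.coeFn_smul c (J (n + 1) z t)] with ω h1 h2
        rw [h1, h2]
        rfl

end IsChaos

end Multiple

/-! ### Convergence of the chaos series and the second moment bound -/

/-- By monotonicity; in particular `f(ε) = 0` when `F_ε = 0`. -/
theorem mul_le_symmIntegral {f : ℝ → ℝ} (hf : IsCovarianceKernel f)
    (hanti : AntitoneOn f (Ioi 0)) {ε : ℝ} (hε : 0 < ε) : ε * f ε ≤ symmIntegral f ε := by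
  have hi : ∀ a b : ℝ, IntervalIntegrable f volume a b := fun a b => intervalIntegrable_iff.2
    ((hf.locallyIntegrable.integrableOn_isCompact isCompact_uIcc).mono_set uIoc_subset_uIcc)
  have h1 : ∫ x in (0 : ℝ)..ε, f ε ≤ ∫ x in (0 : ℝ)..ε, f x :=
    intervalIntegral.integral_mono_on_of_le_Ioo hε.le (by simp) (hi _ _) fun x hx =>
      hanti hx.1 (mem_Ioi.2 hε) hx.2.le
  have h2 : 0 ≤ ∫ x in (-ε)..0, f x :=
    intervalIntegral.integral_nonneg (by linarith) fun x _ => hf.nonneg x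
  rw [intervalIntegral.integral_const, sub_zero, smul_eq_mul] at h1
  have h3 := intervalIntegral.integral_add_adjacent_intervals (hi (-ε) 0) (hi 0 ε)
  change _ = symmIntegral f ε at h3
  linarith

theorem exists_mul_symmIntegral_lt {f : ℝ → ℝ}
    (hlim : Tendsto (fun ε => symmIntegral f ε) (𝓝[>] 0) (𝓝 0)) (G : ℝ) :
    ∃ ε₀ > 0, ∀ ε ∈ Ioo 0 ε₀, G * symmIntegral f ε < 1 / 2 := by
  have h1 := hlim.const_mul G
  rw [mul_zero] at h1
  have h2 := h1.eventually_lt_const (show (0 : ℝ) < 1 / 2 by norm_num)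
  obtain ⟨ε₀, h3, h4⟩ := mem_nhdsGT_iff_exists_Ioo_subset.1 h2
  exact ⟨ε₀, h3, fun ε hε => h4 hε⟩

/-- The bound given by the supersolution, with `λ = G f(ε) / (1 - θ)` and `θ = G F / 2 = y²`, is
stronger than the closed form with `√2 - √(G F) = √2 (1 - y)`. -/
theorem supersolution_le {G F φ t θ : ℝ} (hG : 0 ≤ G) (hF : 0 ≤ F) (hφ : 0 ≤ φ) (ht : 0 < t)
    (hFφ : F = 0 → φ = 0) (hGF : G * F < 1 / 2) (hθ : θ = G * F / 2) :
    (Real.exp (G * φ / (1 - θ) * t) - 1) / (1 - θ) ≤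
      √2 * G * φ * t / (√2 - √(G * F)) *
        Real.exp (2 * φ * t * √(G * F) / (F * (√2 - √(G * F)))) := by
  have h2 : 0 < √2 := by positivity
  obtain ⟨y, hy⟩ : ∃ y, y = √θ := ⟨_, rfl⟩
  have hy0 : 0 ≤ y := hy ▸ Real.sqrt_nonneg _
  have hθ0 : 0 ≤ θ := by rw [hθ]; positivity
  have hyθ : y ^ 2 = θ := by rw [hy, Real.sq_sqrt hθ0]
  have hy1 : y ≤ 1 / 2 := by nlinarith
  have hGFy : √(G * F) = √2 * y := by
    rw [hy, ← Real.sqrt_mul (by norm_num)]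
    congr 1
    linarith
  have hx0 : 0 ≤ G * φ * t := by positivity
  rw [hGFy]
  -- If `G φ t = 0`, the left side vanishes and the right side is non-negative; this covers `F = 0`.
  rcases eq_or_lt_of_le hx0 with hx | hx
  · have e : G * φ / (1 - θ) * t = 0 := by
      rw [div_mul_eq_mul_div, ← hx, zero_div]
    rw [e, Real.exp_zero, sub_self, zero_div]
    have : 0 ≤ √2 - √2 * y := by nlinarith
    positivity
  have hG' : 0 < G := by
    rcases eq_or_lt_of_le hG with h | h
    · rw [← h] at hx; simp at hx
    · exact h
  have hφ' : 0 < φ := by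
    rcases eq_or_lt_of_le hφ with h | h
    · rw [← h] at hx; simp at hx
    · exact h
  have hF' : 0 < F := lt_of_le_of_ne hF fun h => hφ'.ne' (hFφ h.symm)
  have hy' : 0 < y := by
    rw [hy, Real.sqrt_pos, hθ]
    positivity
  have hFy : F = 2 * y ^ 2 / G := by
    rw [hyθ, hθ]
    field_simp
  obtain ⟨x, hxdef⟩ : ∃ x, x = G * φ * t := ⟨_, rfl⟩
  rw [← hxdef] at hx0 hx
  have e1 : G * φ / (1 - θ) * t = x / (1 - y ^ 2) := by rw [hyθ, hxdef]; ring
  have e2 : √2 * G * φ * t / (√2 - √2 * y) = x / (1 - y) := by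
    rw [hxdef, show √2 - √2 * y = √2 * (1 - y) by ring,
      show √2 * G * φ * t = √2 * (G * φ * t) by ring, mul_div_mul_left _ _ h2.ne']
  have hy3 : 0 < 1 - y := by linarith
  have e3 : 2 * φ * t * (√2 * y) / (F * (√2 - √2 * y)) = x / (y * (1 - y)) := by
    rw [hxdef, hFy, show √2 - √2 * y = √2 * (1 - y) by ring]
    field_simp
  have hy4 : 0 < 1 - y ^ 2 := by nlinarith
  rw [e1, e2, e3, ← hyθ]
  have ha : 0 ≤ x / (1 - y ^ 2) := by positivity
  -- `e^s - 1 ≤ s e^s`, from `1 - s ≤ e^{-s}`.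
  have hexp : Real.exp (x / (1 - y ^ 2)) - 1 ≤ x / (1 - y ^ 2) * Real.exp (x / (1 - y ^ 2)) := by
    have h3 := Real.add_one_le_exp (-(x / (1 - y ^ 2)))
    have h4 : Real.exp (x / (1 - y ^ 2)) * Real.exp (-(x / (1 - y ^ 2))) = 1 := by
      rw [← Real.exp_add]; simp
    nlinarith [Real.exp_pos (x / (1 - y ^ 2))]
  calc (Real.exp (x / (1 - y ^ 2)) - 1) / (1 - y ^ 2)
      ≤ x / (1 - y ^ 2) * Real.exp (x / (1 - y ^ 2)) / (1 - y ^ 2) := by gcongr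
    _ = x / (1 - y ^ 2) ^ 2 * Real.exp (x / (1 - y ^ 2)) := by field_simp
    _ ≤ x / (1 - y) * Real.exp (x / (y * (1 - y))) := by
        -- `1 - y ≤ (1 - y²)²` and `y (1 - y) ≤ 1 - y²` hold because `y ≤ 1/2`.
        gcongr x / ?_ * Real.exp (x / ?_)
        · have h5 : 0 ≤ y * (1 - y - y ^ 2) := mul_nonneg hy0 (by nlinarith)
          nlinarith
        · nlinarith

section Series

variable {Ω : Type*} [MeasurableSpace Ω] {P : Measure Ω} [IsProbabilityMeasure P]
  {K : NoiseKernel} {W : K.H → Ω → ℝ} {u₀ : BoundedContinuousFunction (Ioi (0 : ℝ)) ℝ}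

theorem sum_chaosBound_toReal_le {f : ℝ → ℝ} (hf : IsCovarianceKernel f)
    (hanti : AntitoneOn f (Ioi 0)) {ε : ℝ} (hε : 0 < ε) {G θ : ℝ} (hG : 0 ≤ G)
    (hθ : θ = G * symmIntegral f ε / 2) (hθ1 : θ < 1) (N : ℕ) {z t : ℝ} (hz : 0 < z) (ht : 0 < t) :
    ∑ n ∈ Finset.range N, G ^ n * (chaosBound u₀ f n z t).toReal ≤ detSolution u₀ z t ^ 2 +
      ‖u₀‖ ^ 2 * (kimuraU (z / t) * (2 * θ / (1 - θ)) +
        (Real.exp (G * f ε / (1 - θ) * t) - 1) / (1 - θ)) := by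
  have h1 := sum_chaosBound_le u₀ hf hanti hε hG hθ hθ1 rfl N hz ht
  have h2 := ENNReal.toReal_mono ENNReal.ofReal_ne_top h1
  have hθ0 : 0 ≤ θ := by
    rw [hθ]
    have := symmIntegral_nonneg hf hε.le
    positivity
  have h3 : 0 ≤ ‖u₀‖ ^ 2 * (kimuraU (z / t) * (2 * θ / (1 - θ)) +
      (Real.exp (G * f ε / (1 - θ) * t) - 1) / (1 - θ)) := by
    have hU := kimuraU_nonneg (y := z / t) (by positivity)
    have hθ2 : 0 < 1 - θ := by linarith
    have hfε := hf.nonneg ε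
    have : 0 ≤ Real.exp (G * f ε / (1 - θ) * t) - 1 := by
      rw [sub_nonneg]
      exact Real.one_le_exp (by positivity)
    positivity
  rw [ENNReal.toReal_ofReal h3, ENNReal.toReal_sum] at h2
  · refine (Finset.sum_le_sum_of_subset_of_nonneg (Finset.range_mono (Nat.le_succ N))
      fun n _ _ => by positivity).trans ?_
    rw [Finset.sum_range_succ', add_comm]
    refine add_le_add ?_ ?_
    · simp only [chaosBound, pow_zero, one_mul]
      rw [ENNReal.toReal_ofReal (sq_nonneg _)]
    · refine le_trans (le_of_eq (Finset.sum_congr rfl fun n _ => ?_)) h2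
      rw [ENNReal.toReal_mul, ENNReal.toReal_pow, ENNReal.toReal_ofReal hG]
  · intro n hn
    exact ((Finset.single_le_sum (f := fun n => ENNReal.ofReal G ^ (n + 1) *
      chaosBound u₀ f (n + 1) z t) (fun _ _ => zero_le) hn).trans_lt
        (h1.trans_lt ENNReal.ofReal_lt_top)).ne

/-- Bounds for the partial sums of the variances which are uniform on `(0, ∞) × (0, T]`. -/
theorem exists_sum_chaosBound_le {f : ℝ → ℝ} (hf : IsCovarianceKernel f)
    (hanti : AntitoneOn f (Ioi 0))
    (hlim : Tendsto (fun ε => symmIntegral f ε) (𝓝[>] 0) (𝓝 0)) {G : ℝ} (hG : 0 ≤ G) (T : ℝ) :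
    ∃ B, ∀ z t, 0 < z → 0 < t → t ≤ T → ∀ N,
      ∑ n ∈ Finset.range N, G ^ n * (chaosBound u₀ f n z t).toReal ≤ B := by
  obtain ⟨ε₀, h1, h2⟩ := exists_mul_symmIntegral_lt hlim G
  have hε : (0 : ℝ) < ε₀ / 2 := by linarith
  have hθ1 := h2 (ε₀ / 2) ⟨hε, by linarith⟩
  set θ := G * symmIntegral f (ε₀ / 2) / 2 with hθ
  have hθ0 : 0 ≤ θ := by
    have := symmIntegral_nonneg hf hε.le
    positivity
  have hθ2 : 0 < 1 - θ := by linarith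
  have hfε := hf.nonneg (ε₀ / 2)
  refine ⟨‖u₀‖ ^ 2 + ‖u₀‖ ^ 2 * (1 / 2 * (2 * θ / (1 - θ)) +
    (Real.exp (G * f (ε₀ / 2) / (1 - θ) * T) - 1) / (1 - θ)), fun z t hz ht htT N => ?_⟩
  refine (sum_chaosBound_toReal_le hf hanti hε hG hθ (by linarith) N hz ht).trans ?_
  have hU := kimuraU_le_half (y := z / t) (by positivity)
  have hd := sq_le_sq' (abs_le.1 (abs_detSolution_le u₀ hz ht)).1
    (abs_le.1 (abs_detSolution_le u₀ hz ht)).2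
  gcongr

namespace IsChaos

variable {hW : IsIsonormal K P W} {J : ℕ → ℝ → ℝ → Lp ℝ 2 P}

theorem summable (hJ : IsChaos u₀ hW J) (hanti : AntitoneOn K.f (Ioi 0))
    (hlim : Tendsto (fun ε => symmIntegral K.f ε) (𝓝[>] 0) (𝓝 0)) (z t : ℝ) :
    Summable fun n => J n z t := by
  by_cases h : 0 < z ∧ 0 < t
  swap
  · simpa only [hJ.eq_zero _ z t h] using summable_zero
  obtain ⟨hz, ht⟩ := h
  have hΓ := symmIntegral_nonneg K.hγ ht.le
  obtain ⟨B, hB⟩ := exists_sum_chaosBound_le (u₀ := u₀) K.hf hanti hlim hΓ t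
  have hs : Summable fun n => symmIntegral K.γ t ^ n * (chaosBound u₀ K.f n z t).toReal :=
    summable_of_sum_range_le (fun n => by positivity) (hB z t hz ht le_rfl)
  rw [summable_iff_vanishing_norm] at hs ⊢
  intro ε hε
  obtain ⟨s, h1⟩ := hs (ε ^ 2) (by positivity)
  refine ⟨s, fun r hr => ?_⟩
  have h2 := (le_abs_self _).trans_lt (h1 r hr)
  exact lt_of_pow_lt_pow_left₀ 2 hε.le ((hJ.norm_sum_sq_le r z t hz ht).trans_lt h2)

theorem norm_tsum_sq_le (hJ : IsChaos u₀ hW J) (hanti : AntitoneOn K.f (Ioi 0))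
    (hlim : Tendsto (fun ε => symmIntegral K.f ε) (𝓝[>] 0) (𝓝 0)) {z t : ℝ} (hz : 0 < z)
    (ht : 0 < t) {B : ℝ} (hB : ∀ N, ∑ n ∈ Finset.range N,
      symmIntegral K.γ t ^ n * (chaosBound u₀ K.f n z t).toReal ≤ B) :
    ‖∑' n, J n z t‖ ^ 2 ≤ B :=
  le_of_tendsto ((hJ.summable hanti hlim z t).hasSum.tendsto_sum_nat.norm.pow 2)
    (Eventually.of_forall fun N => (hJ.norm_sum_sq_le _ z t hz ht).trans (hB N))

theorem exists_norm_sum_sq_le (hJ : IsChaos u₀ hW J) (hanti : AntitoneOn K.f (Ioi 0))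
    (hlim : Tendsto (fun ε => symmIntegral K.f ε) (𝓝[>] 0) (𝓝 0)) {t : ℝ} (ht : 0 < t) :
    ∃ B, ∀ p : ℝ × ℝ, 0 < p.1 → p.2 ∈ Ioo 0 t →
      (∀ N, ‖∑ n ∈ Finset.range N, J n p.1 p.2‖ ^ 2 ≤ B) ∧ ‖∑' n, J n p.1 p.2‖ ^ 2 ≤ B := by
  have hΓ := symmIntegral_nonneg K.hγ ht.le
  obtain ⟨B, hB⟩ := exists_sum_chaosBound_le (u₀ := u₀) K.hf hanti hlim hΓ t
  refine ⟨B, fun p h1 h2 => ?_⟩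
  have h3 : ∀ N, ∑ n ∈ Finset.range N,
      symmIntegral K.γ p.2 ^ n * (chaosBound u₀ K.f n p.1 p.2).toReal ≤ B := fun N => by
    refine le_trans (Finset.sum_le_sum fun n _ => ?_) (hB p.1 p.2 h1 h2.1 h2.2.le N)
    have h3 := symmIntegral_nonneg K.hγ h2.1.le
    have h4 := symmIntegral_mono K.hγ h2.1.le h2.2.le
    gcongr
  exact ⟨fun N => (hJ.norm_sum_sq_le _ _ _ h1 h2.1).trans (h3 N),
    hJ.norm_tsum_sq_le hanti hlim h1 h2.1 h3⟩

/-- The second moment bound for the chaos series. -/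
theorem norm_tsum_sq_le_closed (hJ : IsChaos u₀ hW J) (hanti : AntitoneOn K.f (Ioi 0))
    (hlim : Tendsto (fun ε => symmIntegral K.f ε) (𝓝[>] 0) (𝓝 0)) {z t ε : ℝ} (hz : 0 < z)
    (ht : 0 < t) (hε : 0 < ε) (hGF : symmIntegral K.γ t * symmIntegral K.f ε < 1 / 2) :
    ‖∑' n, J n z t‖ ^ 2 ≤ detSolution u₀ z t ^ 2 + ‖u₀‖ ^ 2 *
      (kimuraU (z / t) * (2 * symmIntegral K.γ t * symmIntegral K.f ε /
          (2 - symmIntegral K.γ t * symmIntegral K.f ε)) +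
        √2 * symmIntegral K.γ t * K.f ε * t /
            (√2 - √(symmIntegral K.γ t * symmIntegral K.f ε)) *
          Real.exp (2 * K.f ε * t * √(symmIntegral K.γ t * symmIntegral K.f ε) /
            (symmIntegral K.f ε *
              (√2 - √(symmIntegral K.γ t * symmIntegral K.f ε))))) := by
  have hΓ := symmIntegral_nonneg K.hγ ht.le
  have hF := symmIntegral_nonneg K.hf hε.le
  have hfε := K.hf.nonneg ε
  have hFφ : symmIntegral K.f ε = 0 → K.f ε = 0 := fun h => by
    have := mul_le_symmIntegral K.hf hanti hε
    rw [h] at this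
    nlinarith
  set θ := symmIntegral K.γ t * symmIntegral K.f ε / 2 with hθ
  refine hJ.norm_tsum_sq_le hanti hlim hz ht fun N =>
    (sum_chaosBound_toReal_le K.hf hanti hε hΓ hθ (by linarith) N hz ht).trans ?_
  have hsup := supersolution_le hΓ hF hfε ht hFφ hGF hθ
  have e : 2 * θ / (1 - θ) = 2 * symmIntegral K.γ t * symmIntegral K.f ε /
      (2 - symmIntegral K.γ t * symmIntegral K.f ε) := by
    rw [hθ, div_eq_div_iff (by linarith) (by linarith)]
    ring
  rw [e]
  gcongr

end IsChaos

end Series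

/-! ### The mild solution -/

section Mild

variable {Ω : Type*} [MeasurableSpace Ω] {P : Measure Ω} [IsProbabilityMeasure P]
  {K : NoiseKernel} {W : K.H → Ω → ℝ} {u₀ : BoundedContinuousFunction (Ioi (0 : ℝ)) ℝ}

/-- The chaos series, extended by the initial condition to `t = 0` and by zero to `z = 0`. -/
noncomputable def chaosSolution (u₀ : BoundedContinuousFunction (Ioi (0 : ℝ)) ℝ)
    (J : ℕ → ℝ → ℝ → Lp ℝ 2 P) (z t : ℝ) : Lp ℝ 2 P :=
  ∑' n, J n z t + Lp.constL 2 P ℝ (if t ≤ 0 then extendZero u₀ z else 0)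

namespace IsChaos

variable {hW : IsIsonormal K P W} {J : ℕ → ℝ → ℝ → Lp ℝ 2 P}

theorem chaosSolution_eq (J : ℕ → ℝ → ℝ → Lp ℝ 2 P) {z t : ℝ} (ht : 0 < t) :
    chaosSolution u₀ J z t = ∑' n, J n z t := by
  unfold chaosSolution
  rw [if_neg (not_le.2 ht), map_zero, add_zero]

theorem stronglyMeasurable_chaosSolution (hJ : IsChaos u₀ hW J) (hanti : AntitoneOn K.f (Ioi 0))
    (hlim : Tendsto (fun ε => symmIntegral K.f ε) (𝓝[>] 0) (𝓝 0)) :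
    StronglyMeasurable fun p : ℝ × ℝ => chaosSolution u₀ J p.1 p.2 := by
  have h1 : StronglyMeasurable fun p : ℝ × ℝ => ∑' n, J n p.1 p.2 := by
    refine stronglyMeasurable_of_tendsto atTop
      (f := fun N (p : ℝ × ℝ) => ∑ n ∈ Finset.range N, J n p.1 p.2) (fun N => ?_) ?_
    · exact Finset.stronglyMeasurable_fun_sum _ fun n _ =>
        stronglyMeasurable_chaos u₀ hW hJ.inner_eq hJ.eq_zero n
    · rw [tendsto_pi_nhds]
      exact fun p => (hJ.summable hanti hlim p.1 p.2).hasSum.tendsto_sum_nat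
  refine h1.add ((Lp.constL 2 P ℝ).continuous.comp_stronglyMeasurable
    (Measurable.stronglyMeasurable ?_))
  exact Measurable.ite (measurableSet_le measurable_snd measurable_const)
    ((extendZero_measurable u₀).comp measurable_fst) measurable_const

/-- The chaos series satisfies the mild equation, in weak form. -/
theorem inner_chaosSolution (hJ : IsChaos u₀ hW J) (hanti : AntitoneOn K.f (Ioi 0))
    (hlim : Tendsto (fun ε => symmIntegral K.f ε) (𝓝[>] 0) (𝓝 0)) {z t : ℝ} (hz : 0 < z)
    (ht : 0 < t) (φ : 𝓓(openQuadrant, ℝ)) (a : ℝ) :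
    inner ℝ (chaosSolution u₀ J z t - Lp.constL 2 P ℝ (detSolution u₀ z t))
      (hW.waveLp (K.toH φ) a) =
    ∫ p, duhamel z t p * (potential K.f K.γ φ p *
      inner ℝ (chaosSolution u₀ J p.1 p.2) (hW.waveLp (K.toH φ) (a + Real.pi / 2))) := by
  -- The recursion between consecutive components is summed, and the limit is taken by dominated
  -- convergence.
  obtain ⟨B, hB⟩ := hJ.exists_norm_sum_sq_le hanti hlim ht
  set X := hW.waveLp (K.toH φ) (a + Real.pi / 2) with hX
  have hpot : Continuous (potential K.f K.γ φ) := continuous_potential K.hf.locallyIntegrable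
    K.hγ.locallyIntegrable φ.continuous φ.hasCompactSupport
  have hdp := integrable_duhamel_mul_potential K.hf K.hγ hanti hz ht φ.continuous
    φ.hasCompactSupport
  have hbound : ∀ {S : ℝ × ℝ → Lp ℝ 2 P} {B : ℝ},
      (∀ p : ℝ × ℝ, 0 < p.1 → p.2 ∈ Ioo 0 t → ‖S p‖ ^ 2 ≤ B) → ∀ p : ℝ × ℝ,
      ‖duhamel z t p * (potential K.f K.γ φ p * inner ℝ (S p) X)‖ ≤
        ‖duhamel z t p * potential K.f K.γ φ p‖ * (√B * ‖X‖) := fun {S B} hS p => by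
    by_cases hp : 0 < p.1 ∧ p.2 ∈ Ioo 0 t
    · rw [← mul_assoc, norm_mul]
      refine mul_le_mul_of_nonneg_left ((norm_inner_le_norm _ _).trans ?_) (norm_nonneg _)
      gcongr
      exact Real.le_sqrt_of_sq_le (hS p hp.1 hp.2)
    · simp [duhamel_eq_zero hp]
  have hJm : ∀ n, Measurable fun p : ℝ × ℝ => (inner ℝ (J n p.1 p.2) X : ℝ) := fun n =>
    ((stronglyMeasurable_chaos u₀ hW hJ.inner_eq hJ.eq_zero n).inner
      stronglyMeasurable_const).measurable
  have hint : ∀ n, Integrable fun p => duhamel z t p * (potential K.f K.γ φ p *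
      inner ℝ (J n p.1 p.2) X) := fun n => by
    obtain ⟨C, hC⟩ := hJ.exists_norm_sq_le hanti hlim n t
    refine (hdp.norm.mul_const (√C * ‖X‖)).mono' ?_ (ae_of_all _ (hbound hC))
    exact ((duhamel_measurable' z t).mul (hpot.measurable.mul (hJm n))).aestronglyMeasurable
  have hpart : ∀ N, inner ℝ (∑ n ∈ Finset.range N, J (n + 1) z t) (hW.waveLp (K.toH φ) a) =
      ∫ p, duhamel z t p * (potential K.f K.γ φ p *
        inner ℝ (∑ n ∈ Finset.range N, J n p.1 p.2) X) := fun N => by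
    simp only [sum_inner, Finset.mul_sum]
    rw [integral_finsetSum _ fun n _ => hint n]
    exact Finset.sum_congr rfl fun n _ => hJ.inner_succ n hz ht φ a
  have hsum := hJ.summable hanti hlim
  have h1 : chaosSolution u₀ J z t - Lp.constL 2 P ℝ (detSolution u₀ z t) =
      ∑' n, J (n + 1) z t := by
    rw [chaosSolution_eq J ht, (hsum z t).tsum_eq_zero_add, hJ.zero_eq hz ht, add_sub_cancel_left]
  have hL : Tendsto (fun N => inner ℝ (∑ n ∈ Finset.range N, J (n + 1) z t)
      (hW.waveLp (K.toH φ) a)) atTop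
      (𝓝 (inner ℝ (∑' n, J (n + 1) z t) (hW.waveLp (K.toH φ) a))) :=
    (((summable_nat_add_iff 1).2 (hsum z t)).hasSum.tendsto_sum_nat).inner tendsto_const_nhds
  have hR := tendsto_integral_of_dominated_convergence (μ := volume)
    (F := fun N p => duhamel z t p * (potential K.f K.γ φ p *
        inner ℝ (∑ n ∈ Finset.range N, J n p.1 p.2) X))
    (f := fun p => duhamel z t p * (potential K.f K.γ φ p *
      inner ℝ (chaosSolution u₀ J p.1 p.2) X))
    (fun p => ‖duhamel z t p * potential K.f K.γ φ p‖ * (√B * ‖X‖))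
    (fun N => by
      have : Measurable fun p : ℝ × ℝ => (inner ℝ (∑ n ∈ Finset.range N, J n p.1 p.2) X : ℝ) := by
        simp only [sum_inner]
        exact Finset.measurable_fun_sum _ fun n _ => hJm n
      exact ((duhamel_measurable' z t).mul (hpot.measurable.mul this)).aestronglyMeasurable)
    (hdp.norm.mul_const _)
    (fun N => ae_of_all _ (hbound fun p h1 h2 => (hB p h1 h2).1 N))
    (ae_of_all _ fun p => by
      by_cases hp : 0 < p.1 ∧ p.2 ∈ Ioo 0 t
      · rw [chaosSolution_eq J hp.2.1]
        exact (((hsum p.1 p.2).hasSum.tendsto_sum_nat.inner tendsto_const_nhds).const_mul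
          _).const_mul _
      · simp only [duhamel_eq_zero hp, zero_mul]
        exact tendsto_const_nhds)
  rw [h1]
  exact tendsto_nhds_unique (hL.congr hpart) hR

theorem isMildSolution (hJ : IsChaos u₀ hW J) (hanti : AntitoneOn K.f (Ioi 0))
    (hlim : Tendsto (fun ε => symmIntegral K.f ε) (𝓝[>] 0) (𝓝 0)) :
    IsMildSolution K P W u₀ fun z t => chaosSolution u₀ J z t := by
  have := hW.separableSpace_Lp
  obtain ⟨y, hy, hyu⟩ :=
    exists_measurable_version (hJ.stronglyMeasurable_chaosSolution hanti hlim)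
  have hzero : ∀ z t, ¬ (0 < z ∧ 0 < t) → ∑' n, J n z t = 0 := fun z t h => by
    simp only [hJ.eq_zero _ z t h, tsum_zero]
  refine ⟨fun z t _ _ => Lp.memLp _, fun z => ?_, fun t ht => ?_, fun z t ω => y (z, t) ω, hy,
    fun z t _ _ => hyu (z, t), fun z t hz ht => ?_⟩
  · have e : chaosSolution u₀ J z 0 = Lp.const 2 P (u₀ z) := by
      unfold chaosSolution
      rw [hzero z 0 (by simp), zero_add, if_pos le_rfl]
      have : extendZero u₀ z = u₀ z := dif_pos z.2
      rw [this]
      rfl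
    beta_reduce
    rw [e]
    exact Lp.coeFn_const 2 P (u₀ z)
  · have e : chaosSolution u₀ J 0 t = 0 := by
      rw [chaosSolution_eq J ht, hzero 0 t (by simp)]
    beta_reduce
    rw [e]
    exact Lp.coeFn_zero _ _ _
  · obtain ⟨B, hB⟩ := hJ.exists_norm_sum_sq_le hanti hlim ht
    refine ⟨_, (isSkorohodIntegral_duhamel hW hanti hz ht hy hyu (C := B) (fun p h1 h2 => ?_)
      (hJ.inner_chaosSolution hanti hlim hz ht)).congr fun w τ hw _ => ?_, ?_⟩
    · rw [chaosSolution_eq J h2.1]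
      exact (hB p h1 h2).2
    · funext ω
      exact (indicator_kimuraKernel_eq hw fun τ' => y (w, τ') ω).symm
    · filter_upwards [Lp.coeFn_sub (chaosSolution u₀ J z t) (Lp.constL 2 P ℝ (detSolution u₀ z t)),
        Lp.coeFn_const 2 P (detSolution u₀ z t)] with ω h1 h2
      rw [h1, Pi.sub_apply, show (Lp.constL 2 P ℝ (detSolution u₀ z t) : Lp ℝ 2 P) =
        Lp.const 2 P (detSolution u₀ z t) from rfl, h2, Function.const_apply]
      ring

end IsChaos

/-- The moments `E[v(z, t) W(φ)ⁿ]` of a mild solution are determined recursively in `n`. -/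
theorem IsMildSolution.integral_mul_pow_eq (hW : IsIsonormal K P W) {u v : ℝ → ℝ → Ω → ℝ}
    (hu : IsMildSolution K P W u₀ u) (hv : IsMildSolution K P W u₀ v) (φ : 𝓓(openQuadrant, ℝ))
    (n : ℕ) : ∀ {z t : ℝ}, 0 < z → 0 < t →
      ∫ ω, v z t ω * W (K.toH φ) ω ^ n ∂P = ∫ ω, u z t ω * W (K.toH φ) ω ^ n ∂P := by
  -- The mild equation, tested against the power `n` of the noise, involves only the power `n - 1`
  -- under the integral.
  have key : ∀ {v : ℝ → ℝ → Ω → ℝ}, IsMildSolution K P W u₀ v → ∀ (n : ℕ) {z t : ℝ}, 0 < z → 0 < t →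
      ∫ ω, v z t ω * W (K.toH φ) ω ^ n ∂P = detSolution u₀ z t * ∫ ω, W (K.toH φ) ω ^ n ∂P +
        n * ∫ p, duhamel z t p * (∫ ω, v p.1 p.2 ω * W (K.toH φ) ω ^ (n - 1) ∂P) *
          potential K.f K.γ φ p := by
    rintro v ⟨-, -, -, y, hy, hyv, hI⟩ n z t hz ht
    obtain ⟨I, hI1, hI2⟩ := hI z t hz ht
    have hg : Measurable fun q : (ℝ × ℝ) × Ω => duhamel z t q.1 * y q.1.1 q.1.2 q.2 :=
      ((duhamel_measurable' z t).comp measurable_fst).mul hy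
    have hg0 : ∀ p ∉ quadrant, ∀ ω, duhamel z t p * y p.1 p.2 ω = 0 := fun p hp ω => by
      rw [duhamel_eq_zero_of_notMem z t p hp, zero_mul]
    have hI3 : IsSkorohodIntegral K P W (fun w τ ω => duhamel z t (w, τ) * y w τ ω) I :=
      hI1.congr fun w τ hw _ => by
        funext ω
        exact indicator_kimuraKernel_eq hw fun τ' => y w τ' ω
    have h1 := integral_mul_pow hW (g := fun p ω => duhamel z t p * y p.1 p.2 ω) hg hg0 hI3 φ n
    have hIL : MemLp I 2 P := by
      obtain ⟨V, -, h⟩ := hI3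
      exact h.1
    have h2 : ∫ ω, v z t ω * W (K.toH φ) ω ^ n ∂P = ∫ ω, (detSolution u₀ z t * W (K.toH φ) ω ^ n +
        I ω * W (K.toH φ) ω ^ n) ∂P := by
      refine integral_congr_ae ?_
      filter_upwards [hI2] with ω h
      rw [h, add_mul]
    have i1 : Integrable (fun ω => I ω * W (K.toH φ) ω ^ n) P :=
      hIL.integrable_mul (hW.memLp_pow _ n)
    rw [h2, integral_add (((hW.memLp_pow _ n).integrable (by norm_num)).const_mul _) i1,
      integral_const_mul, h1]
    congr 2
    refine integral_congr_ae (ae_of_all _ fun p => ?_)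
    dsimp only
    congr 1
    by_cases hp : 0 < p.1 ∧ p.2 ∈ Ioo 0 t
    · rw [← integral_const_mul]
      refine integral_congr_ae ?_
      filter_upwards [hyv p.1 p.2 hp.1.le hp.2.1.le] with ω h
      rw [h, mul_assoc]
    · simp [duhamel_eq_zero hp]
  induction n with
  | zero =>
    intro z t hz ht
    rw [key hv 0 hz ht, key hu 0 hz ht]
    simp
  | succ n ih =>
    intro z t hz ht
    rw [key hv (n + 1) hz ht, key hu (n + 1) hz ht]
    congr 2
    refine integral_congr_ae (ae_of_all _ fun p => ?_)
    dsimp only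
    by_cases hp : 0 < p.1 ∧ p.2 ∈ Ioo 0 t
    · rw [Nat.add_sub_cancel, ih hp.1 hp.2.1]
    · simp [duhamel_eq_zero hp]

/-- Mild solutions are unique: their differences are orthogonal to all polynomials in the noise. -/
theorem IsMildSolution.ae_eq (hW : IsIsonormal K P W) {u v : ℝ → ℝ → Ω → ℝ}
    (hu : IsMildSolution K P W u₀ u) (hv : IsMildSolution K P W u₀ v) {z t : ℝ} (hz : 0 ≤ z)
    (ht : 0 ≤ t) (h : 0 < z ∨ 0 < t) : v z t =ᵐ[P] u z t := by
  rcases eq_or_lt_of_le hz with rfl | hz'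
  · have ht' : 0 < t := h.resolve_left (lt_irrefl _)
    exact (hv.2.2.1 t ht').trans (hu.2.2.1 t ht').symm
  rcases eq_or_lt_of_le ht with rfl | ht'
  · exact (hv.2.1 ⟨z, hz'⟩).trans (hu.2.1 ⟨z, hz'⟩).symm
  have hvL := hv.1 z t hz ht
  have huL := hu.1 z t hz ht
  have h0 := hW.ae_eq_zero_of_integral_mul_pow (hvL.sub huL) fun φ n => by
    have e : ∀ ω, (v z t - u z t) ω * W (K.toH φ) ω ^ n =
        v z t ω * W (K.toH φ) ω ^ n - u z t ω * W (K.toH φ) ω ^ n := fun ω => by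
      rw [Pi.sub_apply, sub_mul]
    simp only [e]
    have i1 : Integrable (fun ω => v z t ω * W (K.toH φ) ω ^ n) P :=
      hvL.integrable_mul (hW.memLp_pow _ n)
    have i2 : Integrable (fun ω => u z t ω * W (K.toH φ) ω ^ n) P :=
      huL.integrable_mul (hW.memLp_pow _ n)
    rw [integral_sub i1 i2, hu.integral_mul_pow_eq hW hv φ n hz' ht', sub_self]
  filter_upwards [h0] with ω h1
  exact sub_eq_zero.1 h1

end Mild

theorem mainTheorem2 {Ω : Type*} [MeasurableSpace Ω] (P : Measure Ω) [IsProbabilityMeasure P]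
    (K : NoiseKernel) (hf_anti : AntitoneOn K.f (Ioi 0))
    (hf_lim : Tendsto (fun ε => symmIntegral K.f ε) (𝓝[>] 0) (𝓝 0))
    (W : K.H → Ω → ℝ) (hW : IsIsonormal K P W)
    (u₀ : BoundedContinuousFunction (Ioi (0 : ℝ)) ℝ) :
    ∃ (J : ℕ → ℝ → ℝ → Lp ℝ 2 P) (u : ℝ → ℝ → Lp ℝ 2 P),
      (∀ n z t, 0 < z → 0 < t →
        IsMultipleIntegral K P W n (fun p => chaosKernel u₀ n p z t) (J n z t)) ∧
      (∀ z t, 0 < z → 0 < t → HasSum (fun n => J n z t) (u z t)) ∧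
      (∀ t, 0 < t → ∃ ε₀ > 0, ∀ ε ∈ Ioo 0 ε₀, ∀ z, 0 < z →
        ∫ ω, (u z t ω) ^ 2 ∂P ≤ detSolution u₀ z t ^ 2 + ‖u₀‖ ^ 2 *
          (kimuraU (z / t) * (2 * symmIntegral K.γ t * symmIntegral K.f ε /
              (2 - symmIntegral K.γ t * symmIntegral K.f ε)) +
            √2 * symmIntegral K.γ t * K.f ε * t /
                (√2 - √(symmIntegral K.γ t * symmIntegral K.f ε)) *
              Real.exp (2 * K.f ε * t * √(symmIntegral K.γ t * symmIntegral K.f ε) /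
                (symmIntegral K.f ε *
                  (√2 - √(symmIntegral K.γ t * symmIntegral K.f ε)))))) ∧
      IsMildSolution K P W u₀ (fun z t => u z t) ∧
      ∀ v : ℝ → ℝ → Ω → ℝ, IsMildSolution K P W u₀ v →
        ∀ z t, 0 ≤ z → 0 ≤ t → 0 < z ∨ 0 < t → v z t =ᵐ[P] u z t := by
  obtain ⟨J, h1, h2, h3⟩ := exists_chaos u₀ hW fun n z t hz ht => by
    obtain ⟨C, -, hC⟩ := exists_chaosBound_le u₀ K.hf hf_anti hf_lim n t
    exact (hC z t hz ht le_rfl).trans_lt ENNReal.ofReal_lt_top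
  have hJ : IsChaos u₀ hW J := ⟨h1, h2, h3⟩
  have hu := hJ.isMildSolution hf_anti hf_lim
  refine ⟨J, chaosSolution u₀ J, fun n z t hz ht => ?_, fun z t _ ht => ?_, fun t ht => ?_, hu,
    fun v hv z t hz ht h => hu.ae_eq hW hv hz ht h⟩
  · have := hJ.isMultipleIntegral hf_anti hf_lim n hz ht 1 (J n z t) (by simp)
    simpa only [one_mul] using this
  · rw [IsChaos.chaosSolution_eq J ht]
    exact (hJ.summable hf_anti hf_lim z t).hasSum
  · obtain ⟨ε₀, hε₀, hlt⟩ := exists_mul_symmIntegral_lt hf_lim (symmIntegral K.γ t)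
    refine ⟨ε₀, hε₀, fun ε hε z hz => ?_⟩
    have e : ∫ ω, (chaosSolution u₀ J z t ω) ^ 2 ∂P = ‖∑' n, J n z t‖ ^ 2 := by
      rw [← IsChaos.chaosSolution_eq (u₀ := u₀) J ht, ← real_inner_self_eq_norm_sq, Lp_inner_eq]
      simp only [sq]
    rw [e]
    exact hJ.norm_tsum_sq_le_closed hf_anti hf_lim hz ht hε.1 (hlt ε hε)
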